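/- Let $Y$ be a real random variable with distribution function $F_Y$, and put $\bar F_Y=1-F_Y$, $U_Y(v)=\inf\{y: F_Y(y)\ge 1-1/v\}$ for $v>1$. Let $\xi>-\tfrac12$, $\rho\le 0$, and assume the second-order condition: there are a measurable, eventually positive function $a$ and a function $A$, eventually of constant sign with $A(t)\to0$, such that for all $x>0$ $$\lim_{t\to\infty}\frac{1}{A(t)}\left(\frac{U_Y(tx)-U_Y(t)}{a(t)}-\frac{x^{\xi}-1}{\xi}\right)=\int_1^x s^{\xi-1}\int_1^s u^{\rho-1}\,du\,ds$$ ($(x^\xi-1)/\xi$ is read as $\log x$ if $\xi=0$). Let $k=k_n\to\infty$ with $k/n\to0$ and $\sqrt{k}\,A(n/k)\to\lambda$ for some $\lambda\in\mathbb R$. Let $T=T_n$ be truncation points with $F_Y(T)>0$ and odds $D_T=\bar F_Y(T)/F_Y(T)$, and suppose that $nD_T\to0$ (light truncation). For each $n$ let $X_1,\dots,X_n$ (a triangular array) be i.i.d. with distribution function $F_T(x)=\min\{F_Y(x)/F_Y(T),1\}$ (the law of $Y$ given $Y\le T$), with order statistics $X_{1,n}\le\dots\le X_{n,n}$, and put $E_{j,k}=X_{n-j+1,n}-X_{n-k,n}$,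 $1\le j\le k$. The pseudo-likelihood equations for $(\hat\xi_k,\hat\tau_k)$ are $$\frac1{k-1}\sum_{j=2}^k\log(1+\hat\tau_kE_{j,k})+\frac{(1+\hat\tau_kE_{1,k})^{-1/\hat\xi_k}\log(1+\hat\tau_kE_{1,k})}{1-(1+\hat\tau_kE_{1,k})^{-1/\hat\xi_k}}=\hat\xi_k,$$ $$\frac1{k-1}\sum_{j=2}^k\frac1{1+\hat\tau_kE_{j,k}}=\frac1{1+\hat\xi_k}\,\frac{1-(1+\hat\tau_kE_{1,k})^{-1-1/\hat\xi_k}}{1-(1+\hat\tau_kE_{1,k})^{-1/\hat\xi_k}},$$ under the restrictions $\hat\sigma_k=\hat\xi_k/\hat\tau_k>0$ and $1+\hat\tau_kE_{j,k}>0$ for $1\le j\le k$. By pseudo maximum likelihood estimators we mean a consistent root of these equations: measurable functions $(\hat\xi_k,\hat\tau_k)$ of the sample that satisfy the equations and the restrictions with probability tending to one and for which $\hat\xi_k\to\xi$ and $\hat\sigma_k/a(n/k)\to1$ in probability. Then such estimators exist, and for every choice of them the truncation test statistic $$T_{k,n}=k\,(1+\hat\tau_kE_{1,k})^{-1/\hat\xi_k}$$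 is asymptotically standard exponential: $T_{k,n}=_d E\,(1+o_p(1))$ with $E$ a standard exponential random variable. -/

import Mathlib

open MeasureTheory ProbabilityTheory Filter Topology

namespace TruncPOT

noncomputable section

/-! The parent distribution. The law of `Y` is a probability measure `μ` on `ℝ`; its distribution
function is `ProbabilityTheory.cdf μ`. -/

/-- Quantile function `Q_Y(p) = inf {y : F_Y(y) ≥ p}` (used for `0 < p < 1`). -/
def quantile (μ : Measure ℝ) (p : ℝ) : ℝ := sInf {y : ℝ | p ≤ cdf μ y}

/-- Tail quantile function `U_Y(v) = Q_Y(1 - 1/v)` (used for `v > 1`). -/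
def tailQuantile (μ : Measure ℝ) (v : ℝ) : ℝ := quantile μ (1 - 1 / v)

/-- The odds `D_T = (1 - F_Y(T)) / F_Y(T)` of the truncated probability mass. -/
def truncOdds (μ : Measure ℝ) (T : ℝ) : ℝ := (1 - cdf μ T) / cdf μ T

/-- The right truncated law: the conditional law of `Y` given `Y ≤ T`, whose distribution
function is `min (F_Y(x) / F_Y(T)) 1`. -/
def truncLaw (μ : Measure ℝ) (T : ℝ) : Measure ℝ := cond μ (Set.Iic T)

/-- `(x ^ ξ - 1) / ξ`, read as `log x` for `ξ = 0`. -/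
def kFun (ξ x : ℝ) : ℝ := if ξ = 0 then Real.log x else (x ^ ξ - 1) / ξ

/-- `Ψ_{ξ,ρ}(x) = ∫_1^x s^{ξ-1} ∫_1^s u^{ρ-1} du ds`. -/
def Psi (ξ ρ x : ℝ) : ℝ := ∫ s in (1 : ℝ)..x, s ^ (ξ - 1) * ∫ u in (1 : ℝ)..s, u ^ (ρ - 1)

/-- The second-order condition on a tail quantile function `U`, with first-order function `a`
(positive) and second-order function `A` (of constant sign and tending to `0`). -/
structure SecondOrder (U a A : ℝ → ℝ) (ξ ρ : ℝ) : Prop where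
  measurable_a : Measurable a
  pos_a : ∀ᶠ t in atTop, 0 < a t
  sign_A : (∀ᶠ t in atTop, 0 < A t) ∨ (∀ᶠ t in atTop, A t < 0)
  tendsto_A : Tendsto A atTop (𝓝 0)
  limit : ∀ x : ℝ, 0 < x →
    Tendsto (fun t => ((U (t * x) - U t) / a t - kFun ξ x) / A t) atTop (𝓝 (Psi ξ ρ x))

/-! Statistics of a sample `x` of size `n`. -/

/-- The order statistic `X_{i,n}`: the `i`-th smallest value, `1 ≤ i ≤ n` (junk value `0` for
other `i`). -/
def orderStat {n : ℕ} (x : Fin n → ℝ) (i : ℕ) : ℝ :=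
  if h : 1 ≤ i ∧ i ≤ n then x (Tuple.sort x ⟨i - 1, by omega⟩) else 0

/-- The exceedances `E_{j,k} = X_{n-j+1,n} - X_{n-k,n}`, `1 ≤ j ≤ k < n`. -/
def exceed {n : ℕ} (x : Fin n → ℝ) (k j : ℕ) : ℝ :=
  orderStat x (n - j + 1) - orderStat x (n - k)

/-- `(ξ, τ)` solves the pseudo-likelihood equations of the truncated generalized Pareto model for
the exceedances over `X_{n-k,n}`, within the model restrictions `ξ / τ > 0` and
`1 + τ E_{j,k} > 0`. -/
structure IsLikelihoodRoot {n : ℕ} (x : Fin n → ℝ) (k : ℕ) (ξ τ : ℝ) : Prop where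
  scale_pos : 0 < ξ / τ
  arg_pos : ∀ j ∈ Finset.Icc 1 k, 0 < 1 + τ * exceed x k j
  eq_xi :
    1 / ((k : ℝ) - 1) * ∑ j ∈ Finset.Icc 2 k, Real.log (1 + τ * exceed x k j)
      + (1 + τ * exceed x k 1) ^ (-1 / ξ) * Real.log (1 + τ * exceed x k 1)
          / (1 - (1 + τ * exceed x k 1) ^ (-1 / ξ)) = ξ
  eq_tau :
    1 / ((k : ℝ) - 1) * ∑ j ∈ Finset.Icc 2 k, 1 / (1 + τ * exceed x k j)
      = 1 / (1 + ξ) * ((1 - (1 + τ * exceed x k 1) ^ (-1 - 1 / ξ))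
          / (1 - (1 + τ * exceed x k 1) ^ (-1 / ξ)))

/-- The truncation test statistic `k (1 + τ E_{1,k})^{-1/ξ}`. -/
def testStat {n : ℕ} (x : Fin n → ℝ) (k : ℕ) (ξ τ : ℝ) : ℝ :=
  (k : ℝ) * (1 + τ * exceed x k 1) ^ (-1 / ξ)

/-! Asymptotics along a sequence of probability spaces. -/

/-- `Z_n = o_p(1)` under `P n`. -/
def SmallInProb {Ω : ℕ → Type*} [∀ n, MeasurableSpace (Ω n)] (P : ∀ n, Measure (Ω n))
    (Z : ∀ n, Ω n → ℝ) : Prop :=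
  ∀ ε : ℝ, 0 < ε → Tendsto (fun n => P n {ω | ε ≤ |Z n ω|}) atTop (𝓝 0)

/-- `Z_n =_d E (1 + o_p(1))` with `E` standard exponential: for each `n` there is a random pair
`(E, R_n)` with joint law `ν n` such that `E` is standard exponential, `Z_n` has the law of
`E (1 + R_n)`, and `R_n = o_p(1)`. -/
def EqInLawExpOneAddSmall {Ω : ℕ → Type*} [∀ n, MeasurableSpace (Ω n)] (P : ∀ n, Measure (Ω n))
    (Z : ∀ n, Ω n → ℝ) : Prop :=
  ∃ ν : ℕ → Measure (ℝ × ℝ),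
    (∀ n, IsProbabilityMeasure (ν n)) ∧
    (∀ n, (ν n).map Prod.fst = expMeasure 1) ∧
    (∀ n, (P n).map (Z n) = (ν n).map (fun q => q.1 * (1 + q.2))) ∧
    SmallInProb ν (fun _ q => q.2)

/-- The statistics `(ξh n, τh n)`, evaluated on the samples `X n`, are pseudo maximum likelihood
estimators in the usual asymptotic sense: measurable functions of the sample that solve the
pseudo-likelihood equations with probability tending to one and form a consistent root, that is
`ξh → ξ` and `(ξh / τh) / a(n/k) → 1` in probability. -/
structure IsPseudoMLE {Ω : ℕ → Type*} [∀ n, MeasurableSpace (Ω n)] (P : ∀ n, Measure (Ω n))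
    (X : ∀ n, Ω n → Fin n → ℝ) (k : ℕ → ℕ) (a : ℝ → ℝ) (ξ : ℝ)
    (ξh τh : ∀ n, (Fin n → ℝ) → ℝ) : Prop where
  measurable_xi : ∀ n, Measurable (ξh n)
  measurable_tau : ∀ n, Measurable (τh n)
  root : Tendsto
    (fun n => P n {ω | IsLikelihoodRoot (X n ω) (k n) (ξh n (X n ω)) (τh n (X n ω))}) atTop (𝓝 1)
  consistent_xi : SmallInProb P (fun n ω => ξh n (X n ω) - ξ)
  consistent_sigma : SmallInProb P
    (fun n ω => ξh n (X n ω) / τh n (X n ω) / a ((n : ℝ) / (k n : ℝ)) - 1)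

end

end TruncPOT

/-! In law the sample is the quantile transform of `n` independent uniform variables, each conditioned
on being at least `1 - F_Y(T)`. The density of the conditioned law is at most `(1 + D_T) ^ n`, which
tends to one if `n D_T → 0` (`truncUnifPi_le`). So whatever holds with probability tending to one for
unconditioned uniform variables also holds under truncation (`inProb_mono`), limits of probabilities
are the same (`tendsto_real_of_le`), and it suffices to treat the sample without truncation.
Convergence in probability is convergence along the filter `inProb`, so that the analysis is carried
out for sequences, or rather families along an arbitrary filter.

*The exceedances.* Uniform order statistics stay close to their means (`uniformTail_unifPi`). By the
second-order condition, `U_Y (t x) - U_Y t` is close to a multiple of `kFun ξ x` with an error bounded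
in `t` and `x` jointly (`SecondOrder.exists_bound`), and at `t = n / k` that error has order
`k ^ (-1/2)`. Therefore the exceedances divided by `a (n / k)` are `kFun ξ (k / y j)`, where the
positions `y j` are a small perturbation of `n` times the uniform order statistics (`TailArray`,
`tailArray_qSample`). Everything the likelihood equations need is contained in the inequalities of
`TailArray`, and no limit theorem for empirical processes enters.

*The limit law.* Put `θ = τ a(n/k)`, `σ = ξ_k / θ` and write the fractional power
`(1 + τ E₁) ^ (-1/ξ_k)` as `exp (-level)`. Without the terms that contain it, the two equations say
`profile θ = 1`. Since `profile - 1` has a double zero at `θ = 0`, `(profile θ - 1) / θ ^ 2` is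
expanded; it is linear in `θ - ξ` with a slope bounded away from zero, up to errors of order almost
`k ^ (-1/2)` (`profile_expansion`). Here `ξ > -1/2` is needed. At a consistent root the level tends to
infinity, `θ - ξ` is small up to a term exponentially small in the level (`abs_sub_le_of_root`), and
feeding this back gives a polynomial rate (`exists_rate_of_abs_sub_le`). With the rate, the level is
`log (k / y 1) + o(1)` (`TailArray.tendsto_level_sub`), so the test statistic is `y 1 (1 + o(1))`,
that is, `n` times the smallest uniform variable up to a factor tending to one, which is asymptotically
exponential.

*Existence.* For given `θ` the first equation determines `σ`, and the second one becomes
`rootFun θ = 0` with a continuous `rootFun`. On the box `|θ - ξ| ≤ k ^ (-c)`, with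
`max (-ξ) 0 < c < 1/2`, the linear part dominates at the end points, so there is a sign change
(`TailArray.root_box`) and a zero that depends measurably on the sample (`exists_measurable_zero`).
It solves the original equations unless `θ = 0`, which has to be excluded if `ξ = 0`. Given the
threshold and the maximum, `rootFun 0 = 0` is a relation between the first two empirical moments of
the exceedances. Moving a single observation within an intermediate window breaks it
(`exists_degenerateSample_update_injective`), there are of order `k` observations in the window, and
the second-order condition makes the atoms there small (`SecondOrder.exists_atom_le`). Double counting
shows that the relation has probability tending to zero (`pi_degenerateSample_le`,
`eventually_rootFun_zero_ne`). -/


namespace TruncPOT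

open Real
open Finset (Icc mem_Icc)
open Set (Ioc Ioo Iic uIcc Ioi Ici)
open Function (update)
open ENNReal (ofReal)

noncomputable section

/-! ### The generalized Pareto profile and its second-order correction -/

lemma kFun_one (ξ : ℝ) : kFun ξ 1 = 0 := by unfold kFun; split_ifs <;> simp

lemma kFun_mul (ξ : ℝ) {x y : ℝ} (hx : 0 < x) (hy : 0 < y) :
    kFun ξ (x * y) = kFun ξ x + x ^ ξ * kFun ξ y := by
  unfold kFun
  split_ifs with h
  · subst h; rw [log_mul hx.ne' hy.ne']; simp
  · rw [mul_rpow hx.le hy.le]; field_simp; ring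

lemma hasDerivAt_kFun (ξ : ℝ) {x : ℝ} (hx : 0 < x) : HasDerivAt (kFun ξ) (x ^ (ξ - 1)) x := by
  unfold kFun
  by_cases h : ξ = 0
  · subst h; simpa [rpow_neg_one] using hasDerivAt_log hx.ne'
  · simp only [h, if_false]
    have := ((hasDerivAt_rpow_const (p := ξ) (Or.inl hx.ne')).sub_const 1).div_const ξ
    rwa [mul_div_cancel_left₀ _ h] at this

lemma continuousOn_kFun (ξ : ℝ) : ContinuousOn (kFun ξ) (Ioi 0) :=
  fun _ hx => (hasDerivAt_kFun ξ hx).continuousAt.continuousWithinAt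

lemma kFun_strictMonoOn (ξ : ℝ) : StrictMonoOn (kFun ξ) (Ioi 0) := by
  apply strictMonoOn_of_deriv_pos (convex_Ioi 0) (continuousOn_kFun ξ)
  intro x hx
  rw [interior_Ioi] at hx
  rw [(hasDerivAt_kFun ξ hx).deriv]
  exact rpow_pos_of_pos hx _

lemma kFun_eq_integral (ξ : ℝ) {x : ℝ} (hx : 0 < x) :
    ∫ s in (1 : ℝ)..x, s ^ (ξ - 1) = kFun ξ x := by
  have hpos : ∀ s ∈ uIcc 1 x, 0 < s := fun s hs => (lt_min one_pos hx).trans_le hs.1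
  rw [intervalIntegral.integral_eq_sub_of_hasDerivAt
    (fun s hs => hasDerivAt_kFun ξ (hpos s hs)), kFun_one, sub_zero]
  apply ContinuousOn.intervalIntegrable
  exact fun s hs => (continuousAt_rpow_const _ _ (Or.inl (hpos s hs).ne')).continuousWithinAt

lemma kFun_nonneg (ξ : ℝ) {x : ℝ} (hx : 1 ≤ x) : 0 ≤ kFun ξ x := by
  have := (kFun_strictMonoOn ξ).monotoneOn (Set.mem_Ioi.2 one_pos)
    (Set.mem_Ioi.2 (one_pos.trans_le hx)) hx
  rwa [kFun_one] at this

lemma kFun_mono_exponent {ξ γ x : ℝ} (h : ξ ≤ γ) (hx : 1 ≤ x) : kFun ξ x ≤ kFun γ x := by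
  rw [← kFun_eq_integral ξ (by linarith), ← kFun_eq_integral γ (by linarith)]
  have hc : ∀ p : ℝ, IntervalIntegrable (fun s : ℝ => s ^ (p - 1)) volume 1 x := by
    intro p
    apply ContinuousOn.intervalIntegrable
    intro s hs
    rw [Set.uIcc_of_le hx] at hs
    exact (continuousAt_rpow_const _ _ (Or.inl (by linarith [hs.1]))).continuousWithinAt
  apply intervalIntegral.integral_mono_on hx (hc _) (hc _)
  intro s hs
  exact rpow_le_rpow_of_exponent_le hs.1 (by linarith)

lemma kFun_le_rpow {ξ γ x : ℝ} (h : ξ ≤ γ) (hγ : 0 < γ) (hx : 1 ≤ x) : kFun ξ x ≤ x ^ γ / γ := by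
  refine (kFun_mono_exponent h hx).trans ?_
  unfold kFun
  rw [if_neg hγ.ne']
  gcongr; linarith

lemma continuousOn_Psi_integrand (ξ ρ : ℝ) :
    ContinuousOn (fun s : ℝ => s ^ (ξ - 1) * kFun ρ s) (Ioi 0) := by
  refine ContinuousOn.mul ?_ (continuousOn_kFun ρ)
  exact fun s hs => (continuousAt_rpow_const _ _ (Or.inl (ne_of_gt hs))).continuousWithinAt

lemma Psi_eq (ξ ρ : ℝ) {x : ℝ} (hx : 0 < x) :
    Psi ξ ρ x = ∫ s in (1 : ℝ)..x, s ^ (ξ - 1) * kFun ρ s := by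
  unfold Psi
  apply intervalIntegral.integral_congr
  intro s hs
  have : 0 < s := (lt_min one_pos hx).trans_le hs.1
  simp only [kFun_eq_integral ρ this]

lemma intervalIntegrable_Psi_integrand (ξ ρ : ℝ) {x y : ℝ} (hx : 0 < x) (hy : 0 < y) :
    IntervalIntegrable (fun s : ℝ => s ^ (ξ - 1) * kFun ρ s) volume x y := by
  apply ((continuousOn_Psi_integrand ξ ρ).mono ?_).intervalIntegrable
  exact fun s hs => (lt_min hx hy).trans_le hs.1

lemma hasDerivAt_Psi (ξ ρ : ℝ) {x : ℝ} (hx : 0 < x) :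
    HasDerivAt (Psi ξ ρ) (x ^ (ξ - 1) * kFun ρ x) x := by
  have h1 : HasDerivAt (fun y => ∫ s in (1 : ℝ)..y, s ^ (ξ - 1) * kFun ρ s)
      (x ^ (ξ - 1) * kFun ρ x) x := by
    apply intervalIntegral.integral_hasDerivAt_right
      (intervalIntegrable_Psi_integrand ξ ρ one_pos hx)
    · exact (continuousOn_Psi_integrand ξ ρ).stronglyMeasurableAtFilter isOpen_Ioi x hx
    · exact (continuousOn_Psi_integrand ξ ρ).continuousAt (Ioi_mem_nhds hx)
  refine h1.congr_of_eventuallyEq ?_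
  filter_upwards [Ioi_mem_nhds hx] with y hy
  exact Psi_eq ξ ρ hy

lemma continuousOn_Psi (ξ ρ : ℝ) : ContinuousOn (Psi ξ ρ) (Ioi 0) :=
  fun _ hx => (hasDerivAt_Psi ξ ρ hx).continuousAt.continuousWithinAt

/-- The cocycle identity satisfied by the second-order limit function. -/
lemma Psi_mul (ξ ρ : ℝ) {x y : ℝ} (hx : 0 < x) (hy : 0 < y) :
    Psi ξ ρ (x * y) = Psi ξ ρ x + x ^ ξ * kFun ρ x * kFun ξ y + x ^ (ξ + ρ) * Psi ξ ρ y := by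
  have hxy := mul_pos hx hy
  have hpos : ∀ s ∈ uIcc 1 y, 0 < s := fun s hs => (lt_min one_pos hy).trans_le hs.1
  rw [Psi_eq ξ ρ hxy, Psi_eq ξ ρ hx, Psi_eq ξ ρ hy, ← kFun_eq_integral ξ hy]
  rw [← intervalIntegral.integral_add_adjacent_intervals
    (intervalIntegrable_Psi_integrand ξ ρ one_pos hx)
    (intervalIntegrable_Psi_integrand ξ ρ hx hxy), add_assoc]
  congr 1
  have := intervalIntegral.smul_integral_comp_mul_left (a := 1) (b := y)
    (fun s : ℝ => s ^ (ξ - 1) * kFun ρ s) x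
  rw [mul_one] at this
  rw [← this, smul_eq_mul, ← intervalIntegral.integral_const_mul,
    ← intervalIntegral.integral_const_mul, ← intervalIntegral.integral_const_mul,
    ← intervalIntegral.integral_add]
  · apply intervalIntegral.integral_congr
    intro s hs
    have hs := hpos s hs
    simp only
    rw [kFun_mul ρ hx hs, mul_rpow hx.le hs.le, rpow_sub_one hx.ne', rpow_add hx]; field_simp
  · apply IntervalIntegrable.const_mul
    apply ContinuousOn.intervalIntegrable
    exact fun s hs => (continuousAt_rpow_const _ _ (Or.inl (hpos s hs).ne')).continuousWithinAt
  · exact (intervalIntegrable_Psi_integrand ξ ρ one_pos hy).const_mul _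

/-- Increments of the second-order limit are increments of `kFun ξ` weighted by values of
`kFun ρ`; this bounds them from above and below. -/
lemma Psi_sub_bounds (ξ ρ : ℝ) {x y : ℝ} (hx : 0 < x) (hxy : x ≤ y) :
    kFun ρ x * (kFun ξ y - kFun ξ x) ≤ Psi ξ ρ y - Psi ξ ρ x ∧
      Psi ξ ρ y - Psi ξ ρ x ≤ kFun ρ y * (kFun ξ y - kFun ξ x) := by
  have hsub : Set.Icc x y ⊆ Ioi 0 := fun s hs => hx.trans_le hs.1
  have key : ∀ c : ℝ, ∀ s ∈ Set.Icc x y, HasDerivAt (fun s => Psi ξ ρ s - c * kFun ξ s)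
      (s ^ (ξ - 1) * (kFun ρ s - c)) s := by
    intro c s hs
    exact ((hasDerivAt_Psi ξ ρ (hsub hs)).sub
      ((hasDerivAt_kFun ξ (hsub hs)).const_mul c)).congr_deriv (by ring)
  constructor
  · have hm : MonotoneOn (fun s => Psi ξ ρ s - kFun ρ x * kFun ξ s) (Set.Icc x y) := by
      apply monotoneOn_of_deriv_nonneg (convex_Icc x y)
      · exact fun s hs => (key _ s hs).continuousAt.continuousWithinAt
      · exact fun s hs => (key _ s (interior_subset hs)).differentiableAt.differentiableWithinAt
      · intro s hs
        have hs := interior_subset hs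
        rw [(key _ s hs).deriv]
        refine mul_nonneg (rpow_nonneg (hsub hs).le _) (sub_nonneg.2 ?_)
        exact (kFun_strictMonoOn ρ).monotoneOn hx (hsub hs) hs.1
    have := hm ⟨le_rfl, hxy⟩ ⟨hxy, le_rfl⟩ hxy
    simp only at this; linarith
  · have hm : AntitoneOn (fun s => Psi ξ ρ s - kFun ρ y * kFun ξ s) (Set.Icc x y) := by
      apply antitoneOn_of_deriv_nonpos (convex_Icc x y)
      · exact fun s hs => (key _ s hs).continuousAt.continuousWithinAt
      · exact fun s hs => (key _ s (interior_subset hs)).differentiableAt.differentiableWithinAt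
      · intro s hs
        have hs := interior_subset hs
        rw [(key _ s hs).deriv]
        refine mul_nonpos_of_nonneg_of_nonpos (rpow_nonneg (hsub hs).le _) (sub_nonpos.2 ?_)
        exact (kFun_strictMonoOn ρ).monotoneOn (hsub hs) (hx.trans_le hxy) hs.2
    have := hm ⟨le_rfl, hxy⟩ ⟨hxy, le_rfl⟩ hxy
    simp only at this; linarith

/-! ### A joint bound from the second-order condition -/

/-- The normalized error in the first-order approximation of `U (t x) - U t`. -/
def soErr (U a A : ℝ → ℝ) (ξ t x : ℝ) : ℝ :=
  ((U (t * x) - U t) / a t - kFun ξ x) / A t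

/-- The cocycle identity behind the second-order condition: changing the base point from `t` to
`t x` changes the error by a multiple of `kFun ξ` and a rescaling. -/
lemma soErr_mul {U a A : ℝ → ℝ} {ξ t x y : ℝ} (hx : 0 < x) (hy : 0 < y)
    (ha' : a (t * x) ≠ 0) (hA : A t ≠ 0) (hA' : A (t * x) ≠ 0) :
    soErr U a A ξ t (x * y) = soErr U a A ξ t x
      + (a (t * x) / a t - x ^ ξ) / A t * kFun ξ y
      + a (t * x) / a t * (A (t * x) / A t) * soErr U a A ξ (t * x) y := by
  unfold soErr
  rw [kFun_mul ξ hx hy, ← mul_assoc]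
  by_cases ha : a t = 0
  · simp only [ha, div_zero]; field_simp; ring
  · field_simp; ring

lemma exists_mem_Icc_notMem_of_volume_lt {T₁ T₂ : Set ℝ} (h₁ : volume T₁ ≤ ofReal (1 / 8))
    (h₂ : volume T₂ ≤ ofReal (1 / 8)) {x : ℝ} (hx : x ∈ Set.Icc (1 / 2 : ℝ) 2) (p : ℝ) :
    ∃ y ∈ Set.Icc p (p + 1), x * y ∉ T₁ ∧ y ∉ T₂ := by
  by_contra! h
  have hsub : Set.Icc p (p + 1) ⊆ ((x * ·) ⁻¹' T₁) ∪ T₂ := by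
    intro y hy
    by_cases h1 : x * y ∈ T₁
    · exact Or.inl h1
    · exact Or.inr (h y hy h1)
  have hx0 : 0 < x := by linarith [hx.1]
  have h3 : volume ((x * ·) ⁻¹' T₁) ≤ ofReal (1 / 4) := by
    rw [volume_preimage_mul_left hx0.ne']
    calc ofReal |x⁻¹| * volume T₁
        ≤ ofReal 2 * ofReal (1 / 8) := by
          gcongr
          rw [abs_of_pos (inv_pos.2 hx0), inv_le_comm₀ hx0 two_pos]
          simpa using hx.1
      _ = ofReal (1 / 4) := by rw [← ENNReal.ofReal_mul (by norm_num)]; norm_num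
  have h4 : volume (Set.Icc p (p + 1)) ≤ ofReal (1 / 4) + ofReal (1 / 8) :=
    (measure_mono hsub).trans ((measure_union_le _ _).trans (add_le_add h3 h₂))
  rw [volume_Icc, ← ENNReal.ofReal_add (by norm_num) (by norm_num),
    ENNReal.ofReal_le_ofReal_iff (by norm_num)] at h4
  norm_num at h4

/-- A linear elimination: if a cocycle relation holds at four points at which all the other terms
are bounded and two of the slopes are separated, then its constant term is bounded. -/
lemma abs_le_of_cocycle {F κ q M c d v₁ v₂ v₃ v₄ K₁ K₂ K₃ K₄ g₁ g₂ g₃ g₄ B : ℝ}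
    (h₁ : v₁ = F + κ * K₁ + q * g₁) (h₂ : v₂ = F + κ * K₂ + q * g₂)
    (h₃ : v₃ = F + κ * K₃ + q * g₃) (h₄ : v₄ = F + κ * K₄ + q * g₄)
    (hv₁ : |v₁| ≤ M) (hv₂ : |v₂| ≤ M) (hv₃ : |v₃| ≤ M) (hv₄ : |v₄| ≤ M)
    (hg₁ : |g₁| ≤ M) (hg₂ : |g₂| ≤ M)
    (hd : 0 < d) (hc : 0 < c) (hK₁₂ : d ≤ K₂ - K₁) (hK₃₄ : d ≤ K₄ - K₃)
    (hK₁ : |K₁| ≤ B)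
    (hs : c ≤ (g₄ - g₃) / (K₄ - K₃) - (g₂ - g₁) / (K₂ - K₁)) :
    |F| ≤ M + (2 * M / d + 4 * M / d / c * (2 * M / d)) * B + 4 * M / d / c * M := by
  have hM : 0 ≤ M := (abs_nonneg _).trans hv₁
  have hΔ₁ : 0 < K₂ - K₁ := hd.trans_le hK₁₂
  have hΔ₂ : 0 < K₄ - K₃ := hd.trans_le hK₃₄
  have quot : ∀ {z w e : ℝ}, |z| ≤ M → |w| ≤ M → d ≤ e → |(z - w) / e| ≤ 2 * M / d := by
    intro z w e hz hw he
    rw [abs_div, abs_of_pos (hd.trans_le he)]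
    apply div_le_div₀ (by positivity) _ hd he
    calc |z - w| ≤ |z| + |w| := abs_sub _ _
      _ ≤ 2 * M := by linarith
  have e1 : (v₂ - v₁) / (K₂ - K₁) = κ + q * ((g₂ - g₁) / (K₂ - K₁)) := by
    rw [div_eq_iff hΔ₁.ne', add_mul, mul_assoc, div_mul_cancel₀ _ hΔ₁.ne', h₁, h₂]; ring
  have e2 : (v₄ - v₃) / (K₄ - K₃) = κ + q * ((g₄ - g₃) / (K₄ - K₃)) := by
    rw [div_eq_iff hΔ₂.ne', add_mul, mul_assoc, div_mul_cancel₀ _ hΔ₂.ne', h₃, h₄]; ring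
  set P₁ := (g₂ - g₁) / (K₂ - K₁)
  set P₂ := (g₄ - g₃) / (K₄ - K₃)
  have hD₁ := quot hv₂ hv₁ hK₁₂
  have hD₂ := quot hv₄ hv₃ hK₃₄
  have hP₁ : |P₁| ≤ 2 * M / d := quot hg₂ hg₁ hK₁₂
  have hq : |q| ≤ 4 * M / d / c := by
    rw [le_div_iff₀ hc]
    calc |q| * c ≤ |q| * |P₂ - P₁| := by gcongr; exact hs.trans (le_abs_self _)
      _ = |(v₄ - v₃) / (K₄ - K₃) - (v₂ - v₁) / (K₂ - K₁)| := by
          rw [← abs_mul, e1, e2, add_sub_add_left_eq_sub, ← mul_sub]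
      _ ≤ 2 * M / d + 2 * M / d := (abs_sub _ _).trans (add_le_add hD₂ hD₁)
      _ = 4 * M / d := by ring
  have hκ : |κ| ≤ 2 * M / d + 4 * M / d / c * (2 * M / d) := by
    have : κ = (v₂ - v₁) / (K₂ - K₁) - q * P₁ := by rw [e1]; ring
    rw [this]
    refine (abs_sub _ _).trans (add_le_add hD₁ ?_)
    rw [abs_mul]
    exact mul_le_mul hq hP₁ (abs_nonneg _) (by positivity)
  have : F = v₁ - κ * K₁ - q * g₁ := by rw [h₁]; ring
  rw [this]
  refine (abs_sub _ _).trans (add_le_add ((abs_sub _ _).trans (add_le_add hv₁ ?_)) ?_)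
  · rw [abs_mul]; exact mul_le_mul hκ hK₁ (abs_nonneg _) (by positivity)
  · rw [abs_mul]; exact mul_le_mul hq hg₁ (abs_nonneg _) (by positivity)

/-- Egorov's theorem for the second-order error along a sequence of base points. -/
lemma exists_uniform_off_small_set {U a A : ℝ → ℝ} {ξ ρ : ℝ} (hU : Measurable U)
    (hlim : ∀ x : ℝ, 0 < x → Tendsto (fun t => soErr U a A ξ t x) atTop (𝓝 (Psi ξ ρ x)))
    {ε : ℝ} (hεpos : 0 < ε) {s : ℕ → ℝ} (hs : Tendsto s atTop atTop) :
    ∃ T ⊆ Set.Icc (1 / 2 : ℝ) 32, volume T ≤ ofReal (1 / 8) ∧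
      ∀ᶠ n in atTop, ∀ z ∈ Set.Icc (1 / 2 : ℝ) 32, z ∉ T →
        |soErr U a A ξ (s n) z - Psi ξ ρ z| < ε := by
  have hmeas : ∀ s, Measurable (fun z => soErr U a A ξ s z) := by
    intro s
    have hk : Measurable (kFun ξ) := by unfold kFun; split_ifs <;> fun_prop
    have : Measurable fun z => U (s * z) := hU.comp (measurable_const_mul s)
    unfold soErr
    exact (((this.sub_const _).div_const _).sub hk).div_const _
  set G : ℝ → ℝ := (Ioi 0).piecewise (Psi ξ ρ) (fun _ => 0)
  have hGm : StronglyMeasurable G := ((continuousOn_Psi ξ ρ).measurable_piecewise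
    continuousOn_const measurableSet_Ioi).stronglyMeasurable
  have hGe : ∀ z, 0 < z → G z = Psi ξ ρ z := fun z hz => Set.piecewise_eq_of_mem _ _ _ hz
  obtain ⟨T, hT, -, hTv, hTu⟩ := tendstoUniformlyOn_of_ae_tendsto
    (f := fun n z => soErr U a A ξ (s n) z) (g := G) (μ := volume)
    (s := Set.Icc (1 / 2 : ℝ) 32)
    (fun n => (hmeas (s n)).stronglyMeasurable) hGm measurableSet_Icc (by simp)
    (Eventually.of_forall fun z hz => by
      have hz0 : 0 < z := lt_of_lt_of_le (by norm_num) hz.1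
      rw [hGe z hz0]
      exact (hlim z hz0).comp hs) (show (0 : ℝ) < 1 / 8 by norm_num)
  refine ⟨T, hT, hTv, ?_⟩
  have := Metric.tendstoUniformlyOn_iff.1 hTu ε hεpos
  filter_upwards [this] with n hn z hz hzT
  have := hn z ⟨hz, hzT⟩
  rwa [hGe z (lt_of_lt_of_le (by norm_num) hz.1), dist_comm, dist_eq] at this

set_option maxHeartbeats 1000000 in
/-- Local boundedness of the second-order error, uniformly in large `t`. Along a hypothetical
sequence of violations `(t_n, x_n)`, Egorov's theorem makes the error at the base points `t_n`
and `t_n x_n` uniformly close to its limit off small sets; the cocycle identity at four points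
avoiding these sets then bounds the error at `(t_n, x_n)`. -/
lemma exists_bound_soErr {U a A : ℝ → ℝ} {ξ ρ : ℝ} (hU : Measurable U)
    (ha : ∀ᶠ t in atTop, a t ≠ 0) (hA : ∀ᶠ t in atTop, A t ≠ 0)
    (hlim : ∀ x : ℝ, 0 < x → Tendsto (fun t => soErr U a A ξ t x) atTop (𝓝 (Psi ξ ρ x))) :
    ∃ M t₀ : ℝ, ∀ t ≥ t₀, ∀ x ∈ Set.Icc (1 / 2 : ℝ) 2, |soErr U a A ξ t x| ≤ M := by
  by_contra! hcon
  choose t ht x hx hbig using fun n : ℕ => hcon n n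
  have htop : Tendsto t atTop atTop := tendsto_atTop_mono ht tendsto_natCast_atTop_atTop
  have htxtop : Tendsto (fun n => t n * x n) atTop atTop := by
    refine tendsto_atTop_mono' atTop ?_ (htop.atTop_div_const (two_pos))
    filter_upwards [htop.eventually_ge_atTop 0] with n hn
    nlinarith [(hx n).1]
  obtain ⟨M₀, hM₀⟩ : ∃ M₀ : ℝ, ∀ z ∈ Set.Icc (1 / 2 : ℝ) 32, |Psi ξ ρ z| ≤ M₀ := by
    have := isCompact_Icc.exists_bound_of_continuousOn (s := Set.Icc (1 / 2 : ℝ) 32)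
      ((continuousOn_Psi ξ ρ).mono fun z hz => lt_of_lt_of_le (by norm_num) hz.1)
    simpa [norm_eq_abs] using this
  have hmono := kFun_strictMonoOn ξ
  have h23 : 0 < kFun ξ 3 - kFun ξ 2 := sub_pos.2 (hmono (by norm_num) (by norm_num) (by norm_num))
  have h67 : 0 < kFun ξ 7 - kFun ξ 6 := sub_pos.2 (hmono (by norm_num) (by norm_num) (by norm_num))
  have h45 : 0 < kFun ρ 5 - kFun ρ 4 :=
    sub_pos.2 (kFun_strictMonoOn ρ (by norm_num) (by norm_num) (by norm_num))
  set d := min (kFun ξ 3 - kFun ξ 2) (kFun ξ 7 - kFun ξ 6)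
  have hdpos : 0 < d := lt_min h23 h67
  set c := (kFun ρ 5 - kFun ρ 4) / 2 with hc
  have hcpos : 0 < c := by positivity
  set ε := min 1 (c * d / 4)
  have hεpos : 0 < ε := by positivity
  have egor := fun s hs => exists_uniform_off_small_set (A := A) (a := a) hU hlim hεpos (s := s) hs
  obtain ⟨T₁, -, hT₁v, hT₁⟩ := egor t htop
  obtain ⟨T₂, -, hT₂v, hT₂⟩ := egor _ htxtop
  set M := M₀ + 1
  obtain ⟨B, hB⟩ : ∃ B : ℝ, ∀ z ∈ Set.Icc (1 : ℝ) 2, |kFun ξ z| ≤ B := by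
    have := isCompact_Icc.exists_bound_of_continuousOn (s := Set.Icc (1 : ℝ) 2)
      ((continuousOn_kFun ξ).mono fun z hz => lt_of_lt_of_le (by norm_num) hz.1)
    simpa [norm_eq_abs] using this
  obtain ⟨n, hn₁, hn₂, hat, hAt, hAtx, hnB⟩ := (hT₁.and <| hT₂.and <|
    (htxtop.eventually ha).and <| (htop.eventually hA).and <| (htxtop.eventually hA).and <|
    tendsto_natCast_atTop_atTop.eventually_ge_atTop
      (M + (2 * M / d + 4 * M / d / c * (2 * M / d)) * B + 4 * M / d / c * M)).exists
  have hxpos : 0 < x n := lt_of_lt_of_le (by norm_num) (hx n).1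
  have pick := fun p : ℝ => exists_mem_Icc_notMem_of_volume_lt hT₁v hT₂v (hx n) p
  obtain ⟨y₁, hy₁, hxy₁, hyT₁⟩ := pick 1
  obtain ⟨y₂, hy₂, hxy₂, hyT₂⟩ := pick 3
  obtain ⟨y₃, hy₃, hxy₃, hyT₃⟩ := pick 5
  obtain ⟨y₄, hy₄, hxy₄, hyT₄⟩ := pick 7
  norm_num at hy₁ hy₂ hy₃ hy₄
  have bv : ∀ y, 1 ≤ y → y ≤ 8 → x n * y ∉ T₁ → |soErr U a A ξ (t n) (x n * y)| ≤ M := by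
    intro y h1 h8 hT
    have hm : x n * y ∈ Set.Icc (1 / 2 : ℝ) 32 := ⟨by nlinarith [(hx n).1], by nlinarith [(hx n).2]⟩
    have e1 := hn₁ _ hm hT
    have e2 := hM₀ _ hm
    have e3 : ε ≤ 1 := min_le_left _ _
    rw [abs_lt] at e1; rw [abs_le] at e2 ⊢
    constructor <;> linarith
  have bg : ∀ y, 1 ≤ y → y ≤ 8 → y ∉ T₂ →
      |soErr U a A ξ (t n * x n) y - Psi ξ ρ y| < ε := fun y h1 h8 hT =>
    hn₂ y ⟨by linarith, by linarith⟩ hT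
  have bg' : ∀ y, 1 ≤ y → y ≤ 8 → y ∉ T₂ → |soErr U a A ξ (t n * x n) y| ≤ M := by
    intro y h1 h8 hT
    have e1 := bg y h1 h8 hT
    have e2 := hM₀ y ⟨by linarith, by linarith⟩
    have e3 : ε ≤ 1 := min_le_left _ _
    rw [abs_lt] at e1; rw [abs_le] at e2 ⊢
    constructor <;> linarith
  have hcoc := fun (y : ℝ) (hy : 0 < y) =>
    soErr_mul (U := U) (ξ := ξ) hxpos hy hat hAt hAtx
  have hK₁₂ : d ≤ kFun ξ y₂ - kFun ξ y₁ := by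
    have e1 := hmono.monotoneOn (a := y₁) (b := 2) (by simp; linarith) (by norm_num) hy₁.2
    have e2 := hmono.monotoneOn (a := 3) (b := y₂) (by norm_num) (by simp; linarith) hy₂.1
    have := min_le_left (kFun ξ 3 - kFun ξ 2) (kFun ξ 7 - kFun ξ 6); linarith
  have hK₃₄ : d ≤ kFun ξ y₄ - kFun ξ y₃ := by
    have e1 := hmono.monotoneOn (a := y₃) (b := 6) (by simp; linarith) (by norm_num) hy₃.2
    have e2 := hmono.monotoneOn (a := 7) (b := y₄) (by norm_num) (by simp; linarith) hy₄.1
    have := min_le_right (kFun ξ 3 - kFun ξ 2) (kFun ξ 7 - kFun ξ 6); linarith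
  have hs : c ≤ (soErr U a A ξ (t n * x n) y₄ - soErr U a A ξ (t n * x n) y₃)
        / (kFun ξ y₄ - kFun ξ y₃)
      - (soErr U a A ξ (t n * x n) y₂ - soErr U a A ξ (t n * x n) y₁)
        / (kFun ξ y₂ - kFun ξ y₁) := by
    have hΔ₁ := hdpos.trans_le hK₁₂
    have hΔ₂ := hdpos.trans_le hK₃₄
    have p1 := (Psi_sub_bounds ξ ρ (x := y₁) (y := y₂) (by linarith) (by linarith)).2
    have p2 := (Psi_sub_bounds ξ ρ (x := y₃) (y := y₄) (by linarith) (by linarith)).1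
    have r1 := (kFun_strictMonoOn ρ).monotoneOn (a := y₂) (b := 4) (by simp; linarith)
      (by norm_num) hy₂.2
    have r2 := (kFun_strictMonoOn ρ).monotoneOn (a := 5) (b := y₃) (by norm_num)
      (by simp; linarith) hy₃.1
    have a1 := abs_lt.1 (bg y₁ (by linarith) (by linarith) hyT₁)
    have a2 := abs_lt.1 (bg y₂ (by linarith) (by linarith) hyT₂)
    have a3 := abs_lt.1 (bg y₃ (by linarith) (by linarith) hyT₃)
    have a4 := abs_lt.1 (bg y₄ (by linarith) (by linarith) hyT₄)
    have hεle : 2 * ε ≤ c / 2 * d := by have := min_le_right 1 (c * d / 4); linarith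
    have q1 : (soErr U a A ξ (t n * x n) y₂ - soErr U a A ξ (t n * x n) y₁)
        / (kFun ξ y₂ - kFun ξ y₁) ≤ kFun ρ 4 + c / 2 := by rw [div_le_iff₀ hΔ₁]; nlinarith
    have q2 : kFun ρ 5 - c / 2 ≤
        (soErr U a A ξ (t n * x n) y₄ - soErr U a A ξ (t n * x n) y₃)
        / (kFun ξ y₄ - kFun ξ y₃) := by rw [le_div_iff₀ hΔ₂]; nlinarith
    linarith
  have hfin := abs_le_of_cocycle (hcoc y₁ (by linarith)) (hcoc y₂ (by linarith))
    (hcoc y₃ (by linarith)) (hcoc y₄ (by linarith))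
    (bv y₁ (by linarith) (by linarith) hxy₁) (bv y₂ (by linarith) (by linarith) hxy₂)
    (bv y₃ (by linarith) (by linarith) hxy₃) (bv y₄ (by linarith) (by linarith) hxy₄)
    (bg' y₁ (by linarith) (by linarith) hyT₁) (bg' y₂ (by linarith) (by linarith) hyT₂)
    hdpos hcpos hK₁₂ hK₃₄ (hB y₁ ⟨hy₁.1, hy₁.2⟩) hs
  linarith [hbig n]

/-- The factors of the cocycle identity at `x = 2` converge; only the boundedness of the additive
one and the limit of the multiplicative one are needed. -/
lemma tendsto_cocycle_factors {U a A : ℝ → ℝ} {ξ ρ : ℝ}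
    (ha : ∀ᶠ t in atTop, a t ≠ 0) (hA : ∀ᶠ t in atTop, A t ≠ 0)
    (hlim : ∀ x : ℝ, 0 < x → Tendsto (fun t => soErr U a A ξ t x) atTop (𝓝 (Psi ξ ρ x))) :
    Tendsto (fun t => (a (t * 2) / a t - 2 ^ ξ) / A t) atTop (𝓝 (2 ^ ξ * kFun ρ 2)) ∧
    Tendsto (fun t => a (t * 2) / a t * (A (t * 2) / A t)) atTop (𝓝 (2 ^ (ξ + ρ))) := by
  have h2 : Tendsto (fun t : ℝ => t * 2) atTop atTop := tendsto_id.atTop_mul_const two_pos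
  set D : ℝ → ℝ → ℝ := fun y t => soErr U a A ξ t (2 * y) - soErr U a A ξ t 2
  set g : ℝ → ℝ → ℝ := fun y t => soErr U a A ξ (t * 2) y
  have hD : ∀ y, 0 < y → Tendsto (D y) atTop
      (𝓝 (2 ^ ξ * kFun ρ 2 * kFun ξ y + 2 ^ (ξ + ρ) * Psi ξ ρ y)) := by
    intro y hy
    have := (hlim (2 * y) (by positivity)).sub (hlim 2 two_pos)
    rw [Psi_mul ξ ρ two_pos hy] at this
    convert this using 2; ring
  have hg : ∀ y, 0 < y → Tendsto (g y) atTop (𝓝 (Psi ξ ρ y)) := fun y hy => (hlim y hy).comp h2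
  have hdet : kFun ξ 2 * Psi ξ ρ 4 - kFun ξ 4 * Psi ξ ρ 2 ≠ 0 := by
    have e1 := Psi_sub_bounds ξ ρ (x := 1) (y := 2) one_pos (by norm_num)
    have e2 := Psi_sub_bounds ξ ρ (x := 3) (y := 4) (by norm_num) (by norm_num)
    have e3 := Psi_sub_bounds ξ ρ (x := 2) (y := 3) (by norm_num) (by norm_num)
    have P1 : Psi ξ ρ 1 = 0 := by rw [Psi_eq ξ ρ one_pos]; simp
    rw [P1, kFun_one ξ, kFun_one ρ] at e1
    have r := kFun_strictMonoOn ρ (a := 2) (b := 3) (by norm_num) (by norm_num) (by norm_num)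
    have k1 := kFun_strictMonoOn ξ (a := 1) (b := 2) (by norm_num) (by norm_num) (by norm_num)
    have k2 := kFun_strictMonoOn ξ (a := 2) (b := 3) (by norm_num) (by norm_num) (by norm_num)
    have k3 := kFun_strictMonoOn ξ (a := 3) (b := 4) (by norm_num) (by norm_num) (by norm_num)
    rw [kFun_one] at k1
    have l1 : kFun ρ 2 * (kFun ξ 4 - kFun ξ 2) < Psi ξ ρ 4 - Psi ξ ρ 2 := by nlinarith
    have : 0 < kFun ξ 2 * (Psi ξ ρ 4 - Psi ξ ρ 2) - (kFun ξ 4 - kFun ξ 2) * Psi ξ ρ 2 := by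
      nlinarith
    linarith
  have hdett := ((hg 4 (by norm_num)).const_mul (kFun ξ 2)).sub
    ((hg 2 (by norm_num)).const_mul (kFun ξ 4))
  have hne : ∀ᶠ t in atTop, kFun ξ 2 * g 4 t - kFun ξ 4 * g 2 t ≠ 0 := hdett.eventually_ne hdet
  have hcoc : ∀ᶠ t in atTop, ∀ y, 0 < y → D y t = (a (t * 2) / a t - 2 ^ ξ) / A t * kFun ξ y
      + a (t * 2) / a t * (A (t * 2) / A t) * g y t := by
    filter_upwards [h2.eventually ha, hA, h2.eventually hA] with t h1 h2 h3 y hy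
    simp only [D, g]
    rw [soErr_mul two_pos hy h1 h2 h3]; ring
  constructor
  · have hl := (((hD 2 two_pos).mul (hg 4 (by norm_num))).sub
      ((hD 4 (by norm_num)).mul (hg 2 two_pos))).div hdett hdet
    refine (hl.congr' ?_).trans (le_of_eq ?_)
    · filter_upwards [hne, hcoc] with t h1 h2
      simp only [Pi.div_apply]
      rw [h2 2 two_pos, h2 4 (by norm_num), div_eq_iff h1]; ring
    · congr 1; rw [div_eq_iff hdet]; ring
  · have hl := (((hD 4 (by norm_num)).mul_const (kFun ξ 2)).sub
      ((hD 2 two_pos).mul_const (kFun ξ 4))).div hdett hdet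
    refine (hl.congr' ?_).trans (le_of_eq ?_)
    · filter_upwards [hne, hcoc] with t h1 h2
      simp only [Pi.div_apply]
      rw [h2 2 two_pos, h2 4 (by norm_num), div_eq_iff h1]; ring
    · congr 1; rw [div_eq_iff hdet]; ring

/-- A Potter-type bound: the first-order approximation of `U` holds with error `O(A t)`, uniformly
for `x` bounded away from zero up to a factor growing slightly faster than `kFun ξ x`. -/
lemma exists_potter_bound {U a A : ℝ → ℝ} {ξ ρ δ : ℝ} (hρ : ρ ≤ 0) (hδ : 0 < δ)
    (hU : Measurable U) (ha : ∀ᶠ t in atTop, a t ≠ 0) (hA : ∀ᶠ t in atTop, A t ≠ 0)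
    (hlim : ∀ x : ℝ, 0 < x → Tendsto (fun t => soErr U a A ξ t x) atTop (𝓝 (Psi ξ ρ x))) :
    ∃ C t₀ : ℝ, ∀ t ≥ t₀, ∀ x ≥ (1 / 2 : ℝ),
      |soErr U a A ξ t x| ≤ C * x ^ (max ξ 0 + δ) := by
  obtain ⟨M, t₁, hM⟩ := exists_bound_soErr hU ha hA hlim
  obtain ⟨hκ, hq⟩ := tendsto_cocycle_factors ha hA hlim
  set γ := max ξ 0 + δ
  have hγ0 : 0 < γ := by have := le_max_right ξ 0; linarith
  have hqlt : (2 : ℝ) ^ (ξ + ρ) < 2 ^ (γ - δ / 2) := by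
    apply rpow_lt_rpow_of_exponent_lt one_lt_two
    have := le_max_left ξ 0; linarith
  have hq0 : (-2 ^ (γ - δ / 2) : ℝ) < 2 ^ (ξ + ρ) := by
    have := rpow_pos_of_pos two_pos (ξ + ρ)
    have := rpow_pos_of_pos two_pos (γ - δ / 2); linarith
  set B := |(2 : ℝ) ^ ξ * kFun ρ 2| + 1
  have hevκ : ∀ᶠ t in atTop, |(a (t * 2) / a t - 2 ^ ξ) / A t| ≤ B := by
    filter_upwards [hκ.abs.eventually_lt_const (lt_add_one _)] with t ht using ht.le
  have h2 : Tendsto (fun t : ℝ => t * 2) atTop atTop := tendsto_id.atTop_mul_const two_pos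
  obtain ⟨t₂, ht₂⟩ := eventually_atTop.1 (hevκ.and <| (hq.eventually_lt_const hqlt).and <|
    (hq.eventually_const_lt hq0).and <| (h2.eventually ha).and <| hA.and (h2.eventually hA))
  set t₀ := max (max t₁ t₂) 0
  have hM0 : 0 ≤ M := (abs_nonneg _).trans (hM t₁ le_rfl 1 (by norm_num))
  have hB0 : 0 ≤ B := by positivity
  have hpow : (2 : ℝ) ^ (γ - δ / 2) < 2 ^ γ := rpow_lt_rpow_of_exponent_lt one_lt_two (by linarith)
  set C₁ := (M + B / γ) / (2 ^ γ - 2 ^ (γ - δ / 2))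
  have hC₁0 : 0 ≤ C₁ := div_nonneg (by positivity) (by linarith)
  set C := max C₁ (M * 2 ^ γ)
  have hCrec : M + B / γ + 2 ^ (γ - δ / 2) * C ≤ C * 2 ^ γ := by
    have : M + B / γ ≤ C * (2 ^ γ - 2 ^ (γ - δ / 2)) := by
      rw [← div_le_iff₀ (by linarith)]; exact le_max_left _ _
    linarith
  refine ⟨C, t₀, ?_⟩
  have key : ∀ m : ℕ, ∀ t ≥ t₀, ∀ x ∈ Set.Icc (1 / 2 : ℝ) (2 ^ (m + 1)),
      |soErr U a A ξ t x| ≤ C * x ^ γ := by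
    have base : ∀ t ≥ t₀, ∀ x ∈ Set.Icc (1 / 2 : ℝ) 2,
        |soErr U a A ξ t x| ≤ C * x ^ γ := by
      intro t ht x hx
      refine (hM t ((le_max_left _ _).trans ((le_max_left _ _).trans ht)) x hx).trans ?_
      have h1 : (1 : ℝ) ≤ 2 ^ γ * x ^ γ := by
        rw [← mul_rpow (by norm_num) (by linarith [hx.1])]
        exact one_le_rpow (by linarith [hx.1]) hγ0.le
      have hxg : 0 ≤ x ^ γ := rpow_nonneg (by linarith [hx.1]) _
      calc M ≤ M * (2 ^ γ * x ^ γ) := by nlinarith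
        _ = (M * 2 ^ γ) * x ^ γ := by ring
        _ ≤ C * x ^ γ := by gcongr; exact le_max_right _ _
    intro m
    induction m with
    | zero => intro t ht x hx; exact base t ht x (by simpa using hx)
    | succ m ih =>
      intro t ht x hx
      by_cases hx2 : x ≤ 2
      · exact base t ht x ⟨hx.1, hx2⟩
      push Not at hx2
      obtain ⟨b1, b2, b3, b4, b5, b6⟩ :=
        ht₂ t ((le_max_right _ _).trans ((le_max_left _ _).trans ht))
      have htpos : 0 ≤ t := (le_max_right _ _).trans ht
      set z := x / 2 with hz
      have hxz : x = 2 * z := by rw [hz]; ring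
      have hz1 : 1 ≤ z := by rw [hz]; linarith
      have hzm : z ≤ 2 ^ (m + 1) := by
        have := hx.2; rw [hz, div_le_iff₀ two_pos]; rw [pow_succ] at this; linarith
      have i1 := ih (t * 2) (ht.le.trans (by linarith) : t₀ ≤ t * 2) z ⟨by linarith, hzm⟩
      have i2 := hM t ((le_max_left _ _).trans ((le_max_left _ _).trans ht)) 2 (by norm_num)
      have hzγ : 1 ≤ z ^ γ := one_le_rpow hz1 hγ0.le
      have i3 : |kFun ξ z| ≤ z ^ γ / γ := by
        rw [abs_of_nonneg (kFun_nonneg ξ hz1)]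
        exact kFun_le_rpow (by have := le_max_left ξ 0; linarith) hγ0 hz1
      rw [hxz, soErr_mul two_pos (by linarith) b4 b5 b6]
      have hqabs : |a (t * 2) / a t * (A (t * 2) / A t)| ≤ 2 ^ (γ - δ / 2) :=
        abs_le.2 ⟨b3.le, b2.le⟩
      calc _ ≤ M + B * (z ^ γ / γ) + 2 ^ (γ - δ / 2) * (C * z ^ γ) := by
            refine (abs_add_three _ _ _).trans (add_le_add (add_le_add i2 ?_) ?_)
            · rw [abs_mul]; exact mul_le_mul b1 i3 (abs_nonneg _) hB0
            · rw [abs_mul]; exact mul_le_mul hqabs i1 (abs_nonneg _) (by positivity)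
        _ ≤ (M + B / γ + 2 ^ (γ - δ / 2) * C) * z ^ γ := by
            have e : B * (z ^ γ / γ) = B / γ * z ^ γ := by ring
            nlinarith
        _ ≤ C * 2 ^ γ * z ^ γ := by gcongr
        _ = C * (2 * z) ^ γ := by rw [mul_rpow (by norm_num) (by linarith)]; ring
  intro t ht x hx
  obtain ⟨m, hm⟩ := pow_unbounded_of_one_lt x one_lt_two
  exact key m t ht x ⟨hx, hm.le.trans (pow_le_pow_right₀ one_le_two (by omega))⟩

/-! ### Quantiles -/

/-- The Galois connection between the quantile function and the distribution function. -/
lemma quantile_le_iff (μ : Measure ℝ) [IsProbabilityMeasure μ] {p : ℝ} (h0 : 0 < p) (h1 : p < 1)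
    (y : ℝ) : quantile μ p ≤ y ↔ p ≤ cdf μ y := by
  have hne : {y : ℝ | p ≤ cdf μ y}.Nonempty := by
    obtain ⟨y, hy⟩ := ((tendsto_cdf_atTop μ).eventually_const_lt h1).exists; exact ⟨y, hy.le⟩
  have hbdd : BddBelow {y : ℝ | p ≤ cdf μ y} := by
    obtain ⟨z, hz⟩ := ((tendsto_cdf_atBot μ).eventually_lt_const h0).exists
    refine ⟨z, fun y hy => ?_⟩
    by_contra! hlt
    exact absurd (monotone_cdf μ hlt.le) (by have : p ≤ cdf μ y := hy; linarith)
  constructor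
  · intro h
    have hall : ∀ z > y, p ≤ cdf μ z := by
      intro z hz
      obtain ⟨w, hw, hwz⟩ := exists_lt_of_csInf_lt hne (lt_of_le_of_lt h hz)
      exact le_trans hw (monotone_cdf μ hwz.le)
    have hcont : Tendsto (cdf μ) (𝓝[>] y) (𝓝 (cdf μ y)) :=
      ((cdf μ).right_continuous y).mono_left (nhdsWithin_mono _ Set.Ioi_subset_Ici_self)
    exact ge_of_tendsto hcont (eventually_nhdsWithin_of_forall hall)
  · intro h; exact csInf_le hbdd h

lemma quantile_mono (μ : Measure ℝ) [IsProbabilityMeasure μ] {p q : ℝ} (h0 : 0 < p)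
    (hpq : p ≤ q) (h1 : q < 1) : quantile μ p ≤ quantile μ q := by
  rw [quantile_le_iff μ h0 (hpq.trans_lt h1)]
  exact hpq.trans ((quantile_le_iff μ (h0.trans_le hpq) h1 _).1 le_rfl)

lemma tailQuantile_mono (μ : Measure ℝ) [IsProbabilityMeasure μ] {u v : ℝ} (hu : 1 < u)
    (huv : u ≤ v) : tailQuantile μ u ≤ tailQuantile μ v := by
  have hu0 : 0 < u := by linarith
  have hv0 : 0 < v := by linarith
  apply quantile_mono
  · rw [sub_pos, div_lt_one hu0]; exact hu
  · have := one_div_le_one_div_of_le hu0 huv; linarith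
  · have := one_div_pos.2 hv0; linarith

/-- The second-order condition gives first-order approximation of the tail quantile function with
error `O(A t)`, up to a factor growing slightly faster than `kFun ξ x`. -/
lemma SecondOrder.exists_bound {μ : Measure ℝ} [IsProbabilityMeasure μ] {a A : ℝ → ℝ} {ξ ρ δ : ℝ}
    (hU : SecondOrder (tailQuantile μ) a A ξ ρ) (hρ : ρ ≤ 0) (hδ : 0 < δ) :
    ∃ C t₀ : ℝ, ∀ t ≥ t₀, ∀ x ≥ (1 / 2 : ℝ),
      |(tailQuantile μ (t * x) - tailQuantile μ t) / a t - kFun ξ x|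
        ≤ C * |A t| * x ^ (max ξ 0 + δ) := by
  -- `U` is replaced by a monotone, hence measurable, function that agrees with it far out
  set V : ℝ → ℝ := fun v => tailQuantile μ (max v 2) with hV
  have hVm : Measurable V := by
    apply Monotone.measurable
    intro u v huv
    exact tailQuantile_mono μ (lt_of_lt_of_le one_lt_two (le_max_right _ _))
      (max_le_max_right _ huv)
  have hA : ∀ᶠ t in atTop, A t ≠ 0 := by
    rcases hU.sign_A with h | h
    · exact h.mono fun t ht => ht.ne'
    · exact h.mono fun t ht => ht.ne
  have hVe : ∀ x : ℝ, 0 < x → ∀ᶠ t in atTop,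
      soErr V a A ξ t x = ((tailQuantile μ (t * x) - tailQuantile μ t) / a t - kFun ξ x)
        / A t := by
    intro x hx
    filter_upwards [eventually_ge_atTop 2, eventually_ge_atTop (2 / x)] with t h1 h2
    have h3 : 2 ≤ t * x := by rwa [← div_le_iff₀ hx]
    simp only [soErr, hV, max_eq_left h1, max_eq_left h3]
  obtain ⟨C, t₀, h⟩ := exists_potter_bound (U := V) hρ hδ hVm (hU.pos_a.mono fun t ht => ht.ne') hA
    (fun x hx => (hU.limit x hx).congr' ((hVe x hx).mono fun t ht => ht.symm))
  obtain ⟨t₁, ht₁⟩ := eventually_atTop.1 hA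
  refine ⟨C, max (max t₀ t₁) 4, fun t ht x hx => ?_⟩
  have h4 : 4 ≤ t := (le_max_right _ _).trans ht
  have hAt : 0 < |A t| := abs_pos.2 (ht₁ t ((le_max_right _ _).trans ((le_max_left _ _).trans ht)))
  have := h t ((le_max_left _ _).trans ((le_max_left _ _).trans ht)) x hx
  rw [soErr, abs_div, div_le_iff₀ hAt, hV] at this
  simp only at this
  rw [max_eq_left (by linarith : (2 : ℝ) ≤ t), max_eq_left (by nlinarith : 2 ≤ t * x)] at this
  linarith

/-- The uniform distribution on the unit interval. -/
def unif : Measure ℝ := volume.restrict (Ioo 0 1)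

instance : IsProbabilityMeasure unif := ⟨by simp [unif]⟩

lemma ae_unif : ∀ᵐ v ∂unif, v ∈ Ioo (0 : ℝ) 1 := ae_restrict_mem measurableSet_Ioo

lemma measurable_quantile_one_sub (μ : Measure ℝ) [IsProbabilityMeasure μ] :
    AEMeasurable (fun v => quantile μ (1 - v)) unif := by
  apply aemeasurable_restrict_of_antitoneOn measurableSet_Ioo
  intro u hu v hv huv
  exact quantile_mono μ (by linarith [hv.2]) (by linarith) (by linarith [hu.1])

/-- The quantile transform of a uniform variable. -/
lemma map_quantile_unif (μ : Measure ℝ) [IsProbabilityMeasure μ] :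
    unif.map (fun v => quantile μ (1 - v)) = μ := by
  have hm := measurable_quantile_one_sub μ
  apply Measure.ext_of_Iic
  intro y
  rw [Measure.map_apply_of_aemeasurable hm measurableSet_Iic, unif,
    Measure.restrict_apply' measurableSet_Ioo]
  have hset : (fun v => quantile μ (1 - v)) ⁻¹' Iic y ∩ Ioo 0 1
      = Ici (1 - cdf μ y) ∩ Ioo 0 1 := by
    ext v
    simp only [Set.mem_inter_iff, Set.mem_preimage, Set.mem_Iic, Set.mem_Ici, Set.mem_Ioo]
    refine and_congr_left fun hv => ?_
    rw [quantile_le_iff μ (by linarith) (by linarith)]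
    constructor <;> intro h <;> linarith
  have h1 := cdf_le_one μ y
  have e : (Ici (1 - cdf μ y) ∩ Ioo 0 1 : Set ℝ) =ᵐ[volume] Set.Icc (1 - cdf μ y) 1 := by
    have : (Ioo 0 1 : Set ℝ) =ᵐ[volume] Set.Icc 0 1 := Ioo_ae_eq_Icc
    have e2 : (Ici (1 - cdf μ y) ∩ Set.Icc 0 1 : Set ℝ) = Set.Icc (1 - cdf μ y) 1 := by
      ext v
      simp only [Set.mem_inter_iff, Set.mem_Ici, Set.mem_Icc]
      constructor
      · rintro ⟨a, b, c⟩; exact ⟨a, c⟩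
      · rintro ⟨a, c⟩; exact ⟨a, by linarith, c⟩
    exact e2 ▸ ae_eq_set_inter (ae_eq_refl _) this
  rw [hset, measure_congr e, volume_Icc, sub_sub_cancel, ofReal_cdf]

/-! ### Arrays with uniform-like tails -/

/-- Average of `c 2, …, c k`. -/
def avg (k : ℕ) (c : ℕ → ℝ) : ℝ := 1 / ((k : ℝ) - 1) * ∑ j ∈ Icc 2 k, c j

/-- An array of positive numbers `y i 1 ≤ … ≤ y i k`, `k = k i`, that behaves along the filter `F`
like `n` times the smallest `k` order statistics of `n` uniform variables: `y i j` is close to `j`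
with a relative error of order `j ^ (-1/2)`, up to factors that are subpolynomial in `k`, and its
first two members do not come too close. -/
structure TailArray {ι : Type*} (F : Filter ι) (k : ι → ℕ) (y : ι → ℕ → ℝ) : Prop where
  tendsto_k : Tendsto k F atTop
  mono : ∀ᶠ i in F, ∀ j ∈ Icc 1 (k i), ∀ l ∈ Icc 1 (k i), j ≤ l → y i j ≤ y i l
  le_k : ∀ᶠ i in F, ∀ j ∈ Icc 1 (k i), y i j ≤ k i
  lower : ∀ ε > (0 : ℝ), ∀ᶠ i in F, ∀ j ∈ Icc 1 (k i), (k i : ℝ) ^ (-ε) * j ≤ y i j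
  upper : ∀ ε > (0 : ℝ), ∀ᶠ i in F, ∀ j ∈ Icc 1 (k i), y i j ≤ (k i : ℝ) ^ ε * j
  gap : ∀ ε > (0 : ℝ), ∀ᶠ i in F, (1 + (k i : ℝ) ^ (-ε)) * y i 1 ≤ y i 2
  near : ∀ ε > (0 : ℝ), ∀ᶠ i in F, ∀ j ∈ Icc 1 (k i),
    |log (y i j / j)| ≤ (k i : ℝ) ^ ε * (j : ℝ) ^ (-1 / 2 : ℝ)

section Powers

variable {ι : Type*} {F : Filter ι} {k : ι → ℕ}

local notation:max "K[" i "]" => (k i : ℝ)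

lemma tendsto_rpow_neg_of_tendsto (hk : Tendsto k F atTop) {b : ℝ} (hb : b < 0) :
    Tendsto (fun i => K[i] ^ b) F (𝓝 0) := by
  have := (tendsto_rpow_neg_atTop (neg_pos.2 hb)).comp (tendsto_natCast_atTop_atTop.comp hk)
  simpa [Function.comp_def] using this

lemma eventually_mul_rpow_le (hk : Tendsto k F atTop) {a b : ℝ} (hab : a < b) (C : ℝ) :
    ∀ᶠ i in F, C * K[i] ^ a ≤ K[i] ^ b := by
  have h1 := (tendsto_rpow_neg_of_tendsto hk (sub_neg.2 hab)).const_mul C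
  rw [mul_zero] at h1
  filter_upwards [h1.eventually_le_const one_pos, hk.eventually_ge_atTop 1] with i h2 h3
  have hk0 : (0 : ℝ) < k i := mod_cast h3
  have hb : K[i] ^ a = K[i] ^ (a - b) * K[i] ^ b := by rw [← rpow_add hk0]; ring_nf
  rw [hb, ← mul_assoc]
  have := rpow_pos_of_pos hk0 b; nlinarith

lemma eventually_le_rpow (hk : Tendsto k F atTop) {b : ℝ} (hb : 0 < b) (C : ℝ) :
    ∀ᶠ i in F, C ≤ K[i] ^ b := by
  filter_upwards [eventually_mul_rpow_le hk hb C] with i hi; simpa using hi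

lemma eventually_log_le_rpow (hk : Tendsto k F atTop) {b : ℝ} (hb : 0 < b) (C : ℝ) :
    ∀ᶠ i in F, C * log (k i) ≤ K[i] ^ b := by
  have h := (isLittleO_log_rpow_atTop hb).bound (show 0 < 1 / (|C| + 1) by positivity)
  have hk' : Tendsto (fun i => K[i]) F atTop := tendsto_natCast_atTop_atTop.comp hk
  filter_upwards [hk'.eventually h, hk.eventually_ge_atTop 1] with i h1 h2
  have hk1 : (1 : ℝ) ≤ k i := mod_cast h2
  have hl := log_nonneg hk1
  rw [norm_of_nonneg hl, norm_of_nonneg (rpow_nonneg (by linarith) _),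
    div_mul_eq_mul_div, one_mul, le_div_iff₀ (by positivity)] at h1
  calc C * log (k i) ≤ log (k i) * (|C| + 1) := by nlinarith [le_abs_self C]
    _ ≤ _ := h1

end Powers

namespace TailArray

variable {ι : Type*} {F : Filter ι} {k : ι → ℕ} {y : ι → ℕ → ℝ}

lemma eventually_le_k (h : TailArray F k y) (m : ℕ) : ∀ᶠ i in F, m ≤ k i :=
  h.tendsto_k.eventually_ge_atTop m

lemma eventually_natCast_le (h : TailArray F k y) (m : ℕ) : ∀ᶠ i in F, (m : ℝ) ≤ k i :=
  (h.eventually_le_k m).mono fun _ hi => mod_cast hi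

lemma one_le_k (h : TailArray F k y) : ∀ᶠ i in F, (1 : ℝ) ≤ k i := by
  simpa using h.eventually_natCast_le 1

lemma k_pos (h : TailArray F k y) : ∀ᶠ i in F, (0 : ℝ) < k i :=
  h.one_le_k.mono fun _ hi => one_pos.trans_le hi

lemma tendsto_rpow_neg (h : TailArray F k y) {b : ℝ} (hb : b < 0) :
    Tendsto (fun i => (k i : ℝ) ^ b) F (𝓝 0) := tendsto_rpow_neg_of_tendsto h.tendsto_k hb

lemma mul_rpow_le (h : TailArray F k y) {a b : ℝ} (hab : a < b) (C : ℝ) :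
    ∀ᶠ i in F, C * (k i : ℝ) ^ a ≤ (k i : ℝ) ^ b := eventually_mul_rpow_le h.tendsto_k hab C

lemma log_le_rpow (h : TailArray F k y) {b : ℝ} (hb : 0 < b) (C : ℝ) :
    ∀ᶠ i in F, C * log (k i) ≤ (k i : ℝ) ^ b := eventually_log_le_rpow h.tendsto_k hb C

lemma tendsto_of_abs_sub_le (h : TailArray F k y) {θ : ι → ℝ} {ξ c : ℝ} (hc : 0 < c)
    (hθ : ∀ᶠ i in F, |θ i - ξ| ≤ (k i : ℝ) ^ (-c)) : Tendsto θ F (𝓝 ξ) := by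
  rw [tendsto_iff_norm_sub_tendsto_zero]
  exact squeeze_zero' (Eventually.of_forall fun i => norm_nonneg _) hθ
    (h.tendsto_rpow_neg (neg_lt_zero.2 hc))

end TailArray

lemma cast_pos_of_mem {k j : ℕ} (hj : j ∈ Icc 1 k) : (0 : ℝ) < j := by
  exact_mod_cast (mem_Icc.1 hj).1

lemma mem_Icc_one {k j : ℕ} (hj : j ∈ Icc 2 k) : j ∈ Icc 1 k :=
  Finset.Icc_subset_Icc_left one_le_two hj

lemma cast_div_le_one {k j : ℕ} (hj : j ∈ Icc 1 k) : (j : ℝ) / k ≤ 1 :=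
  div_le_one_of_le₀ (mod_cast (mem_Icc.1 hj).2) (by positivity)

lemma integral_ceil_mul {k : ℕ} (hk : 0 < k) (g : ℕ → ℝ) :
    ∫ s in (0 : ℝ)..1, g ⌈s * k⌉₊ = 1 / (k : ℝ) * ∑ j ∈ Icc 1 k, g j := by
  have hk0 : (0 : ℝ) < k := mod_cast hk
  have hcell : ∀ j : ℕ, Set.EqOn (fun s : ℝ => g ⌈s * k⌉₊) (fun _ => g (j + 1))
      (Ioc ((j : ℝ) / k) (((j + 1 : ℕ) : ℝ) / k)) := by
    intro j s hs
    have : ⌈s * k⌉₊ = j + 1 := by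
      rw [Nat.ceil_eq_iff (by omega)]
      constructor
      · simpa using (div_lt_iff₀ hk0).1 hs.1
      · exact (le_div_iff₀ hk0).1 hs.2
    simp only [this]
  have hle : ∀ j : ℕ, (j : ℝ) / k ≤ ((j + 1 : ℕ) : ℝ) / k := fun j => by gcongr; simp
  have hint : ∀ j < k, IntervalIntegrable (fun s : ℝ => g ⌈s * k⌉₊) volume
      ((j : ℝ) / k) (((j + 1 : ℕ) : ℝ) / k) := by
    intro j _
    rw [intervalIntegrable_iff_integrableOn_Ioc_of_le (hle j)]
    exact (integrableOn_const (by simp)).congr_fun (hcell j).symm measurableSet_Ioc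
  have := intervalIntegral.sum_integral_adjacent_intervals (a := fun j : ℕ => (j : ℝ) / k) hint
  simp only [Nat.cast_zero, zero_div, div_self hk0.ne'] at this
  have hIcc : Icc 1 k = Finset.Ico (0 + 1) (k + 1) := by ext; simp
  rw [← this, Finset.mul_sum, hIcc, ← Finset.sum_Ico_add', Finset.range_eq_Ico]
  apply Finset.sum_congr rfl
  intro j _
  rw [intervalIntegral.integral_of_le (hle j), setIntegral_congr_fun measurableSet_Ioc (hcell j)]
  have : ((j + 1 : ℕ) : ℝ) / k - j / k = 1 / k := by push_cast; ring
  rw [setIntegral_const, volume_real_Ioc_of_le (hle j), this, smul_eq_mul]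

lemma avg_eq_integral {k : ℕ} (hk : 1 < k) (c : ℕ → ℝ) :
    avg k c = (k : ℝ) / (k - 1) * ∫ s in (0 : ℝ)..1, if 2 ≤ ⌈s * k⌉₊ then c ⌈s * k⌉₊ else 0 := by
  rw [integral_ceil_mul (by omega) (fun j => if 2 ≤ j then c j else 0), ← Finset.sum_filter, avg,
    ← mul_assoc]
  congr 1
  · field_simp
  · congr 1
    ext j
    simp only [mem_Icc, Finset.mem_filter]; omega

lemma measurable_ceil_mul (k : ℕ) (c : ℕ → ℝ) : Measurable fun s : ℝ => c ⌈s * k⌉₊ :=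
  (measurable_from_nat (f := c)).comp (Nat.measurable_ceil.comp (measurable_id.mul_const _))

lemma tendsto_natCast_div_sub_one {ι : Type*} {F : Filter ι} {k : ι → ℕ}
    (hk : Tendsto k F atTop) : Tendsto (fun i => (k i : ℝ) / (k i - 1)) F (𝓝 1) := by
  have h1 : Tendsto (fun i => (k i : ℝ)) F atTop := tendsto_natCast_atTop_atTop.comp hk
  have h2 : Tendsto (fun i => (k i : ℝ) - 1) F atTop := tendsto_atTop_add_const_right _ _ h1
  have h3 : Tendsto (fun i => 1 + 1 / ((k i : ℝ) - 1)) F (𝓝 (1 + 0)) :=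
    tendsto_const_nhds.add (tendsto_const_nhds.div_atTop h2)
  rw [add_zero] at h3
  refine h3.congr' ?_
  filter_upwards [h2.eventually_gt_atTop 0] with i hi
  field_simp; ring

/-- Averages over an index `j` converge to integrals over `s = j / k`, by dominated convergence. -/
lemma tendsto_avg {ι : Type*} {F : Filter ι} [F.IsCountablyGenerated] {k : ι → ℕ}
    (hk : Tendsto k F atTop) {c : ι → ℕ → ℝ} {f : ℝ → ℝ} {p C : ℝ} (hp0 : 0 ≤ p) (hp1 : p < 1)
    (hbound : ∀ᶠ i in F, ∀ j ∈ Icc 2 (k i), |c i j| ≤ C * ((j : ℝ) / k i) ^ (-p))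
    (hlim : ∀ s ∈ Ioc (0 : ℝ) 1, Tendsto (fun i => c i ⌈s * k i⌉₊) F (𝓝 (f s))) :
    Tendsto (fun i => avg (k i) (c i)) F (𝓝 (∫ s in (0 : ℝ)..1, f s)) := by
  have hI : Tendsto (fun i => ∫ s in (0 : ℝ)..1, if 2 ≤ ⌈s * k i⌉₊ then c i ⌈s * k i⌉₊ else 0) F
      (𝓝 (∫ s in (0 : ℝ)..1, f s)) := by
    apply intervalIntegral.tendsto_integral_filter_of_dominated_convergence
      (fun s => |C| * s ^ (-p))
    · exact Eventually.of_forall fun i => (measurable_ceil_mul (k i)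
        (fun j => if 2 ≤ j then c i j else 0)).aestronglyMeasurable
    · filter_upwards [hbound, hk.eventually_ge_atTop 1] with i hi hk1
      refine Eventually.of_forall fun s hs => ?_
      rw [Set.uIoc_of_le zero_le_one] at hs
      have hk0 : (0 : ℝ) < k i := mod_cast hk1
      have hs0 : 0 ≤ s ^ (-p) := rpow_nonneg hs.1.le _
      split_ifs with h2
      · have hle : s ≤ (⌈s * k i⌉₊ : ℝ) / k i := by rw [le_div_iff₀ hk0]; exact Nat.le_ceil _
        have hjk : ⌈s * k i⌉₊ ≤ k i := by apply Nat.ceil_le.2; nlinarith [hs.2]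
        refine (hi _ (mem_Icc.2 ⟨h2, hjk⟩)).trans ?_
        refine (mul_le_mul_of_nonneg_right (le_abs_self C) (by positivity)).trans ?_
        exact mul_le_mul_of_nonneg_left
          (rpow_le_rpow_of_nonpos hs.1 hle (by linarith)) (abs_nonneg _)
      · rw [norm_zero]; positivity
    · exact (intervalIntegral.intervalIntegrable_rpow' (by linarith)).const_mul _
    · refine Eventually.of_forall fun s hs => ?_
      rw [Set.uIoc_of_le zero_le_one] at hs
      refine (hlim s hs).congr' ?_
      filter_upwards [(tendsto_natCast_atTop_atTop.comp hk).eventually_gt_atTop (1 / s)] with i hi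
      have : 1 < s * k i := by rw [mul_comm]; exact (div_lt_iff₀ hs.1).1 hi
      rw [if_pos]
      exact Nat.lt_ceil.2 (mod_cast this)
  have := (tendsto_natCast_div_sub_one hk).mul hI
  rw [one_mul] at this
  refine this.congr' ?_
  filter_upwards [hk.eventually_gt_atTop 1] with i hi
  rw [avg_eq_integral hi]

/-- A function on `(0, 1]` whose derivative is `O(x ^ (-p - 1))` is Lipschitz in `log x`, with
constant `O(x ^ (-p))`. -/
lemma abs_sub_le_log_sub {f f' : ℝ → ℝ} {p C : ℝ} (hp : 0 ≤ p) (hC : 0 ≤ C)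
    (hf : ∀ x ∈ Ioc (0 : ℝ) 1, HasDerivAt f (f' x) x)
    (hf' : ∀ x ∈ Ioc (0 : ℝ) 1, |f' x| ≤ C * x ^ (-p - 1)) {m x x' : ℝ} (hm : 0 < m)
    (hx : x ∈ Set.Icc m 1) (hx' : x' ∈ Set.Icc m 1) :
    |f x - f x'| ≤ C * m ^ (-p) * |log x - log x'| := by
  have hx0 : 0 < x := hm.trans_le hx.1
  have hx0' : 0 < x' := hm.trans_le hx'.1
  have := (convex_Icc (log m) 0).norm_image_sub_le_of_norm_hasDerivWithin_le
    (f := fun s => f (exp s)) (f' := fun s => f' (exp s) * exp s)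
    (C := C * m ^ (-p)) (x := log x') (y := log x)
    (fun s hs => ((hf (exp s) ⟨exp_pos s, exp_le_one_iff.2 hs.2⟩).comp s
      (hasDerivAt_exp s)).hasDerivWithinAt)
    (fun s hs => by
      have he := exp_pos s
      have hme : m ≤ exp s := (log_le_iff_le_exp hm).1 hs.1
      rw [norm_mul, norm_of_nonneg he.le, norm_eq_abs]
      calc |f' (exp s)| * exp s
          ≤ C * exp s ^ (-p - 1) * exp s := by gcongr; exact hf' _ ⟨he, exp_le_one_iff.2 hs.2⟩
        _ = C * exp s ^ (-p) := by rw [rpow_sub_one he.ne']; field_simp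
        _ ≤ C * m ^ (-p) := by
            exact mul_le_mul_of_nonneg_left (rpow_le_rpow_of_nonpos hm hme (by linarith)) hC)
    ⟨log_le_log hm hx'.1, log_nonpos hx0'.le hx'.2⟩
    ⟨log_le_log hm hx.1, log_nonpos hx0.le hx.2⟩
  simpa only [exp_log hx0, exp_log hx0', norm_eq_abs] using this

/-- Pointwise comparison of `f (y j / k)`, `j = ⌈s k⌉`, with `f s`. -/
lemma abs_sub_le_of_near {f f' : ℝ → ℝ} {p C : ℝ} (hp : 0 ≤ p) (hC : 0 ≤ C)
    (hf : ∀ x ∈ Ioc (0 : ℝ) 1, HasDerivAt f (f' x) x)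
    (hf' : ∀ x ∈ Ioc (0 : ℝ) 1, |f' x| ≤ C * x ^ (-p - 1)) {k : ℕ} {y : ℕ → ℝ} {η : ℝ}
    (hη0 : 0 < η) (hle : ∀ j ∈ Icc 1 k, y j ≤ k)
    (hlow : ∀ j ∈ Icc 1 k, (k : ℝ) ^ (-η) * j ≤ y j)
    (hnear : ∀ j ∈ Icc 1 k, |log (y j / j)| ≤ (k : ℝ) ^ η * (j : ℝ) ^ (-1 / 2 : ℝ))
    {s : ℝ} (hs0 : 0 < s) (hs1 : s ≤ 1) (hsK1 : 1 < s * k) :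
    |f (y ⌈s * k⌉₊ / k) - f s|
      ≤ 2 * C * (k : ℝ) ^ (-1 / 2 + (η + η * p)) * (s ^ (-p) * s ^ (-1 / 2 : ℝ)) := by
  have hk1 : (1 : ℝ) ≤ k := by nlinarith [Nat.cast_nonneg (α := ℝ) k]
  have hk0 : (0 : ℝ) < k := by linarith
  set K := (k : ℝ)
  have hsK0 : 0 < s * K := by linarith
  have hj1 := Nat.le_ceil (s * K)
  have hj2 := (Nat.ceil_lt_add_one hsK0.le).le
  have hjk : ⌈s * K⌉₊ ≤ k := by apply Nat.ceil_le.2; nlinarith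
  set j := ⌈s * K⌉₊
  have hj0 : (0 : ℝ) < j := hsK0.trans_le hj1
  have hj0' : 0 < j := mod_cast hj0
  have hjm : j ∈ Icc 1 k := mem_Icc.2 ⟨hj0', hjk⟩
  have hyl := hlow j hjm
  have hyu := hle j hjm
  have hKη : 0 < K ^ (-η) := rpow_pos_of_pos hk0 _
  have hKη1 : K ^ (-η) ≤ 1 := rpow_le_one_of_one_le_of_nonpos hk1 (by linarith)
  have hy0 : 0 < y j := lt_of_lt_of_le (by positivity) hyl
  have hml : K ^ (-η) * s ≤ y j / K := by
    rw [le_div_iff₀ hk0]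
    calc K ^ (-η) * s * K = K ^ (-η) * (s * K) := by ring
      _ ≤ K ^ (-η) * j := by gcongr
      _ ≤ _ := hyl
  have hlog : |log (y j / K) - log s| ≤ 2 * (K ^ η * (s * K) ^ (-1 / 2 : ℝ)) := by
    have e : log (y j / K) - log s = log (y j / j) + log (j / (s * K)) := by
      rw [log_div hy0.ne' hk0.ne', log_div hy0.ne' hj0.ne',
        log_div hj0.ne' hsK0.ne', log_mul hs0.ne' hk0.ne']
      ring
    have e1 : |log (y j / j)| ≤ K ^ η * (s * K) ^ (-1 / 2 : ℝ) := by
      refine (hnear j hjm).trans ?_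
      exact mul_le_mul_of_nonneg_left (rpow_le_rpow_of_nonpos hsK0 hj1 (by norm_num))
        (rpow_nonneg hk0.le _)
    have e2 : |log (j / (s * K))| ≤ K ^ η * (s * K) ^ (-1 / 2 : ℝ) := by
      rw [abs_of_nonneg (log_nonneg ((one_le_div hsK0).2 hj1))]
      calc log (j / (s * K)) ≤ j / (s * K) - 1 :=
            log_le_sub_one_of_pos (div_pos hj0 hsK0)
        _ ≤ (s * K) ^ (-1 : ℝ) := by
            rw [rpow_neg_one, div_sub_one hsK0.ne', div_eq_mul_inv]
            apply mul_le_of_le_one_left (by positivity); linarith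
        _ ≤ (s * K) ^ (-1 / 2 : ℝ) := rpow_le_rpow_of_exponent_le hsK1.le (by norm_num)
        _ ≤ _ := le_mul_of_one_le_left (by positivity) (one_le_rpow hk1 hη0.le)
    rw [e]
    exact (abs_add_le _ _).trans (by linarith)
  have hmpos : 0 < K ^ (-η) * s := mul_pos hKη hs0
  have h1 := abs_sub_le_log_sub hp hC hf hf' hmpos
    (x := y j / K) (x' := s) ⟨hml, (div_le_one hk0).2 hyu⟩ ⟨by nlinarith, hs1⟩
  have e3 : (K ^ (-η) * s) ^ (-p) = K ^ (η * p) * s ^ (-p) := by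
    rw [mul_rpow hKη.le hs0.le, ← rpow_mul hk0.le]; ring_nf
  have hKe : K ^ (-1 / 2 + (η + η * p)) = K ^ (-1 / 2 : ℝ) * (K ^ η * K ^ (η * p)) := by
    rw [← rpow_add hk0, ← rpow_add hk0]
  have hsK : (s * K) ^ (-1 / 2 : ℝ) = K ^ (-1 / 2 : ℝ) * s ^ (-1 / 2 : ℝ) := by
    rw [mul_rpow hs0.le hk0.le, mul_comm]
  have q0 : 0 ≤ C * (K ^ (η * p) * s ^ (-p)) :=
    mul_nonneg hC (mul_nonneg (rpow_nonneg hk0.le _) (rpow_nonneg hs0.le _))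
  calc |f (y j / K) - f s| ≤ C * (K ^ (η * p) * s ^ (-p))
        * (2 * (K ^ η * (s * K) ^ (-1 / 2 : ℝ))) := by
        rw [e3] at h1; exact h1.trans (mul_le_mul_of_nonneg_left hlog q0)
    _ = _ := by rw [hKe, hsK]; ring

/-- Averages of a function of `y j / k` differ from its integral by little more than
`k ^ (-1/2)`. -/
lemma TailArray.avg_rate {ι : Type*} {F : Filter ι} {k : ι → ℕ} {y : ι → ℕ → ℝ}
    (h : TailArray F k y) {f f' : ℝ → ℝ} {p C : ℝ} (hp : 0 ≤ p) (hp2 : p < 1 / 2)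
    (hf : ∀ x ∈ Ioc (0 : ℝ) 1, HasDerivAt f (f' x) x)
    (hf' : ∀ x ∈ Ioc (0 : ℝ) 1, |f' x| ≤ C * x ^ (-p - 1)) {ε : ℝ} (hε : 0 < ε) :
    ∀ᶠ i in F, |avg (k i) (fun j => f (y i j / k i)) - ∫ s in (0 : ℝ)..1, f s|
      ≤ (k i : ℝ) ^ (-1 / 2 + ε) := by
  have hC : 0 ≤ C := by
    have := hf' 1 ⟨one_pos, le_rfl⟩
    rw [one_rpow, mul_one] at this
    exact (abs_nonneg _).trans this
  set q := (p + 1 / 2) / 2 with hq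
  have hpq : p < q := by rw [hq]; linarith
  set C₁ := |f 1| + C / (q - p) with hC₁
  have hC₁0 : 0 ≤ C₁ := add_nonneg (abs_nonneg _) (div_nonneg hC (by linarith))
  have hfb : ∀ s ∈ Ioc (0 : ℝ) 1, |f s| ≤ C₁ * s ^ (-q) := by
    intro s hs
    have h1 := abs_sub_le_log_sub hp hC hf hf' hs.1 ⟨le_rfl, hs.2⟩ ⟨hs.2, le_rfl⟩
    rw [log_one, sub_zero, abs_of_nonpos (log_nonpos hs.1.le hs.2), ← log_inv] at h1
    have h2 : log s⁻¹ ≤ s ^ (-(q - p)) / (q - p) := by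
      have := log_le_rpow_div (inv_pos.2 hs.1).le (sub_pos.2 hpq)
      rwa [inv_rpow hs.1.le, ← rpow_neg hs.1.le] at this
    have h3 : (1 : ℝ) ≤ s ^ (-q) := one_le_rpow_of_pos_of_le_one_of_nonpos hs.1 hs.2 (by linarith)
    have h4 : s ^ (-p) * s ^ (-(q - p)) = s ^ (-q) := by rw [← rpow_add hs.1]; ring_nf
    calc |f s| ≤ |f 1| + |f s - f 1| := by have := abs_add_le (f 1) (f s - f 1); simpa using this
      _ ≤ |f 1| * s ^ (-q) + C * s ^ (-p) * (s ^ (-(q - p)) / (q - p)) := by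
          refine add_le_add (le_mul_of_one_le_right (abs_nonneg _) h3) (h1.trans ?_)
          have := rpow_nonneg hs.1.le (-p); gcongr
      _ = C₁ * s ^ (-q) := by rw [hC₁, ← h4]; ring
  have hfint : IntervalIntegrable f volume 0 1 := by
    have hdom : IntervalIntegrable (fun s : ℝ => C₁ * s ^ (-q)) volume 0 1 :=
      (intervalIntegral.intervalIntegrable_rpow' (by linarith)).const_mul _
    refine hdom.mono_fun' ?_ ?_
    · rw [Set.uIoc_of_le zero_le_one]
      have : ContinuousOn f (Ioc 0 1) := fun x hx => (hf x hx).continuousAt.continuousWithinAt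
      exact this.aestronglyMeasurable measurableSet_Ioc
    · rw [Set.uIoc_of_le zero_le_one]
      filter_upwards [ae_restrict_mem measurableSet_Ioc] with s hs; exact hfb s hs
  set η := ε / (4 * (1 + p)) with hη
  have hη0 : 0 < η := by positivity
  have hη2 : η + η * p = ε / 4 := by rw [hη]; field_simp
  set D := 2 * C + C₁
  set I₀ := ∫ s in (0 : ℝ)..1, s ^ (-q - 1 / 2) with hI₀
  set I₁ := |∫ s in (0 : ℝ)..1, f s| with hI₁
  have hk2 : ∀ᶠ i in F, (k i : ℝ) / (k i - 1) ≤ 2 :=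
    (tendsto_natCast_div_sub_one h.tendsto_k).eventually_le_const (by norm_num)
  filter_upwards [h.eventually_le_k 2, h.le_k, h.lower η hη0, h.near η hη0, hk2,
    h.mul_rpow_le (show -1 / 2 + ε / 4 < -1 / 2 + ε by linarith)
      (2 * (D * I₀) + 2 * I₁)] with i hki hle hlow hnear hk2 hfin
  have hk0 : (0 : ℝ) < k i := mod_cast (by omega : 0 < k i)
  have hk1 : (1 : ℝ) ≤ k i := mod_cast (by omega : 1 ≤ k i)
  have hk2' : (2 : ℝ) ≤ k i := mod_cast hki
  set K := (k i : ℝ)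
  set g : ℝ → ℝ := fun s => if 2 ≤ ⌈s * K⌉₊ then f (y i ⌈s * K⌉₊ / K) else 0 with hg
  have hpt : ∀ s ∈ Ioc (0 : ℝ) 1,
      |g s - f s| ≤ D * K ^ (-1 / 2 + ε / 4) * s ^ (-q - 1 / 2) := by
    intro s hs
    have hsK : (s * K) ^ (-1 / 2 : ℝ) = K ^ (-1 / 2 : ℝ) * s ^ (-1 / 2 : ℝ) := by
      rw [mul_rpow hs.1.le hk0.le, mul_comm]
    have hsq : s ^ (-q - 1 / 2) = s ^ (-q) * s ^ (-1 / 2 : ℝ) := by rw [← rpow_add hs.1]; ring_nf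
    have hKe : K ^ (-1 / 2 + ε / 4) = K ^ (-1 / 2 : ℝ) * K ^ (ε / 4) := rpow_add hk0 _ _
    have hKe1 : 1 ≤ K ^ (ε / 4) := one_le_rpow hk1 (by positivity)
    have p1 : 0 < K ^ (-1 / 2 : ℝ) := rpow_pos_of_pos hk0 _
    have p2 : 0 < s ^ (-1 / 2 : ℝ) := rpow_pos_of_pos hs.1 _
    have p3 : 0 < s ^ (-q) := rpow_pos_of_pos hs.1 _
    simp only [hg]
    split_ifs with hc
    · have hsK1 : 1 < s * K := by
        have := Nat.lt_ceil.1 (show 1 < ⌈s * K⌉₊ from hc); simpa using this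
      have e4 : s ^ (-p) ≤ s ^ (-q) := rpow_le_rpow_of_exponent_ge hs.1 hs.2 (by linarith)
      have e6 : -1 / 2 + (η + η * p) = -1 / 2 + ε / 4 := by rw [hη2]
      refine (abs_sub_le_of_near hp hC hf hf' hη0 hle hlow hnear hs.1 hs.2 hsK1).trans ?_
      rw [e6, hsq]
      have : 2 * C ≤ D := by linarith
      have hs0 : 0 < s := hs.1
      have p4 : 0 < K ^ (-1 / 2 + ε / 4) := rpow_pos_of_pos hk0 _; gcongr
    · have hsK1 : s * K ≤ 1 := by
        have : ⌈s * K⌉₊ ≤ 1 := by omega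
        have := Nat.ceil_le.1 this
        simpa using this
      have hone : 1 ≤ (s * K) ^ (-1 / 2 : ℝ) :=
        one_le_rpow_of_pos_of_le_one_of_nonpos (mul_pos hs.1 hk0) hsK1 (by norm_num)
      rw [zero_sub, abs_neg]
      calc |f s| ≤ C₁ * s ^ (-q) := hfb s hs
        _ ≤ C₁ * s ^ (-q) * (s * K) ^ (-1 / 2 : ℝ) := le_mul_of_one_le_right (by positivity) hone
        _ = C₁ * K ^ (-1 / 2 : ℝ) * (s ^ (-q) * s ^ (-1 / 2 : ℝ)) := by rw [hsK]; ring
        _ ≤ D * (K ^ (-1 / 2 : ℝ) * K ^ (ε / 4)) * (s ^ (-q) * s ^ (-1 / 2 : ℝ)) := by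
            gcongr ?_ * ?_ * _
            · linarith
            · exact le_mul_of_one_le_right p1.le hKe1
        _ = _ := by rw [hsq, hKe]
  have hgm : Measurable g := measurable_ceil_mul (k i) (fun j => if 2 ≤ j then f (y i j / K) else 0)
  have hdom : IntervalIntegrable (fun s : ℝ => D * K ^ (-1 / 2 + ε / 4) * s ^ (-q - 1 / 2))
      volume 0 1 := (intervalIntegral.intervalIntegrable_rpow' (by linarith)).const_mul _
  have hdiff : IntervalIntegrable (fun s => g s - f s) volume 0 1 := by
    refine hdom.mono_fun' (hgm.aestronglyMeasurable.sub hfint.aestronglyMeasurable_restrict_uIoc) ?_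
    rw [Set.uIoc_of_le zero_le_one]
    filter_upwards [ae_restrict_mem measurableSet_Ioc] with s hs; exact hpt s hs
  have hgint : IntervalIntegrable g volume 0 1 := by
    have := hdiff.add hfint; exact this.congr (fun s _ => by simp)
  have hmain : |(∫ s in (0 : ℝ)..1, g s) - ∫ s in (0 : ℝ)..1, f s|
      ≤ D * K ^ (-1 / 2 + ε / 4) * I₀ := by
    rw [← intervalIntegral.integral_sub hgint hfint, hI₀, ← intervalIntegral.integral_const_mul]
    refine (intervalIntegral.abs_integral_le_integral_abs zero_le_one).trans ?_
    exact intervalIntegral.integral_mono_on_of_le_Ioo zero_le_one hdiff.abs hdom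
      (fun s hs => hpt s ⟨hs.1, hs.2.le⟩)
  have hKe : K ^ (-1 : ℝ) ≤ K ^ (-1 / 2 + ε / 4) := rpow_le_rpow_of_exponent_le hk1 (by linarith)
  rw [avg_eq_integral (by omega)]
  have hK1 : 0 < K - 1 := by linarith
  have e : K / (K - 1) * (∫ s in (0 : ℝ)..1, g s) - ∫ s in (0 : ℝ)..1, f s
      = K / (K - 1) * ((∫ s in (0 : ℝ)..1, g s) - ∫ s in (0 : ℝ)..1, f s)
        + K / (K - 1) * K ^ (-1 : ℝ) * ∫ s in (0 : ℝ)..1, f s := by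
    rw [rpow_neg_one]; field_simp; ring
  calc |K / (K - 1) * (∫ s in (0 : ℝ)..1, g s) - ∫ s in (0 : ℝ)..1, f s|
      ≤ 2 * (D * K ^ (-1 / 2 + ε / 4) * I₀) + 2 * K ^ (-1 / 2 + ε / 4) * I₁ := by
        rw [e]
        have hd0 : 0 ≤ K / (K - 1) := by positivity
        refine (abs_add_le _ _).trans (add_le_add ?_ ?_)
        · rw [abs_mul, abs_of_nonneg hd0]; exact mul_le_mul hk2 hmain (abs_nonneg _) zero_le_two
        · rw [abs_mul, abs_mul, abs_of_nonneg hd0, abs_of_nonneg (by positivity), ← hI₁]; gcongr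
    _ = (2 * (D * I₀) + 2 * I₁) * K ^ (-1 / 2 + ε / 4) := by ring
    _ ≤ _ := hfin

/-! ### Exceedances with a generalized Pareto profile -/

/-- The normalized exceedance `kFun ξ (k / y j)`. -/
def exc (ξ : ℝ) (k : ℕ) (y : ℕ → ℝ) (j : ℕ) : ℝ := kFun ξ ((k : ℝ) / y j)

lemma one_add_mul_kFun (ξ : ℝ) {x : ℝ} : 1 + ξ * kFun ξ x = x ^ ξ := by
  unfold kFun
  split_ifs with h
  · simp [h]
  · field_simp; ring

/-- For nonpositive exponents, `kFun` grows at most linearly in `log x`. -/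
lemma kFun_pow_three_le {ξ z : ℝ} (hξ : ξ ≤ 0) (hz : 1 ≤ z) : kFun ξ (z ^ 3) ≤ 3 * kFun ξ z := by
  have hz0 : 0 < z := by linarith
  have e : z ^ 3 = z * (z * z) := by ring
  rw [e, kFun_mul ξ hz0 (by positivity), kFun_mul ξ hz0 hz0]
  have h1 := kFun_nonneg ξ hz
  have h2 : z ^ ξ ≤ 1 := rpow_le_one_of_one_le_of_nonpos hz hξ
  have h3 : 0 ≤ z ^ ξ := rpow_nonneg hz0.le _
  have h4 : z ^ ξ * kFun ξ z ≤ kFun ξ z := by nlinarith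
  have h5 : z ^ ξ * (z ^ ξ * kFun ξ z) ≤ kFun ξ z := by nlinarith [mul_nonneg h3 h1]
  nlinarith

lemma one_sub_inv_le_kFun {ξ z : ℝ} (hξ : -1 ≤ ξ) (hz : 1 ≤ z) : 1 - z⁻¹ ≤ kFun ξ z := by
  refine le_trans (le_of_eq ?_) (kFun_mono_exponent hξ hz)
  unfold kFun
  rw [if_neg (by norm_num), rpow_neg_one]; ring

namespace TailArray

variable {ι : Type*} {F : Filter ι} {k : ι → ℕ} {y : ι → ℕ → ℝ}

local notation:max "K[" i "]" => (k i : ℝ)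
local notation:max "E[" ξ ", " i "]" => exc ξ (k i) (y i)

lemma comp {κ : Type*} {𝓖 : Filter κ} {φ : κ → ι} (h : TailArray F k y) (hφ : Tendsto φ 𝓖 F) :
    TailArray 𝓖 (k ∘ φ) (y ∘ φ) where
  tendsto_k := h.tendsto_k.comp hφ
  mono := hφ.eventually h.mono
  le_k := hφ.eventually h.le_k
  lower ε hε := hφ.eventually (h.lower ε hε)
  upper ε hε := hφ.eventually (h.upper ε hε)
  gap ε hε := hφ.eventually (h.gap ε hε)
  near ε hε := hφ.eventually (h.near ε hε)

lemma pos (h : TailArray F k y) : ∀ᶠ i in F, ∀ j ∈ Icc 1 (k i), 0 < y i j := by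
  filter_upwards [h.lower 1 one_pos, h.k_pos] with i h1 hk j hj
  have : (0 : ℝ) < j := mod_cast (mem_Icc.1 hj).1
  exact lt_of_lt_of_le (by positivity) (h1 j hj)

lemma half_le (h : TailArray F k y) : ∀ᶠ i in F, ∀ j ∈ Icc 1 (k i),
    K[i] ^ (1 / 2 : ℝ) ≤ j → (j : ℝ) / 2 ≤ y i j := by
  filter_upwards [h.near (1 / 8) (by norm_num), h.pos, h.k_pos,
    (h.tendsto_rpow_neg (show (-1 / 8 : ℝ) < 0 by norm_num)
      ).eventually_le_const (show (0 : ℝ) < log 2 from log_pos one_lt_two)]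
    with i h1 h2 hk h4 j hj hkj
  have hj0 := cast_pos_of_mem hj
  have hy := h2 j hj
  have e1 : (j : ℝ) ^ (-1 / 2 : ℝ) ≤ K[i] ^ (-1 / 4 : ℝ) := by
    calc (j : ℝ) ^ (-1 / 2 : ℝ) ≤ (K[i] ^ (1 / 2 : ℝ)) ^ (-1 / 2 : ℝ) :=
          rpow_le_rpow_of_nonpos (by positivity) hkj (by norm_num)
      _ = K[i] ^ (-1 / 4 : ℝ) := by rw [← rpow_mul hk.le]; norm_num
  have e2 : |log (y i j / j)| ≤ log 2 := by
    calc _ ≤ K[i] ^ (1 / 8 : ℝ) * (j : ℝ) ^ (-1 / 2 : ℝ) := h1 j hj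
      _ ≤ K[i] ^ (1 / 8 : ℝ) * K[i] ^ (-1 / 4 : ℝ) := by gcongr
      _ = K[i] ^ (-1 / 8 : ℝ) := by rw [← rpow_add hk]; norm_num
      _ ≤ _ := h4
  have e3 := (abs_le.1 e2).1
  rw [← log_inv] at e3
  have e4 := (log_le_log_iff (by norm_num) (div_pos hy hj0)).1 e3
  rw [le_div_iff₀ hj0] at e4; linarith

lemma ratio_lower (h : TailArray F k y) {δ : ℝ} (hδ : 0 < δ) :
    ∀ᶠ i in F, ∀ j ∈ Icc 1 (k i), 1 / 2 * (j / K[i]) ^ (1 + δ) ≤ y i j / k i := by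
  filter_upwards [h.lower (δ / 2) (by positivity), h.half_le, h.eventually_natCast_le 1]
    with i h1 h2 h3 j hj
  have hj0 := cast_pos_of_mem hj
  have hk1 : (1 : ℝ) ≤ k i := mod_cast h3
  have hk : (0 : ℝ) < k i := by linarith
  have hjk := cast_div_le_one hj
  have hr0 : (0 : ℝ) < j / k i := by positivity
  rw [rpow_add hr0, rpow_one]
  by_cases hc : K[i] ^ (1 / 2 : ℝ) ≤ j
  · have h5 : (j / K[i]) ^ δ ≤ 1 := rpow_le_one hr0.le hjk hδ.le
    calc 1 / 2 * ((j : ℝ) / k i * (j / K[i]) ^ δ) ≤ 1 / 2 * ((j : ℝ) / k i * 1) := by gcongr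
      _ = (j / 2) / k i := by ring
      _ ≤ _ := by gcongr; exact h2 j hj hc
  · push Not at hc
    have h5 : (j / K[i]) ^ δ ≤ K[i] ^ (-(δ / 2)) := by
      calc (j / K[i]) ^ δ ≤ (K[i] ^ (1 / 2 : ℝ) / k i) ^ δ := by gcongr
        _ = K[i] ^ (-(δ / 2)) := by rw [← rpow_sub_one hk.ne', ← rpow_mul hk.le]; ring_nf
    calc 1 / 2 * ((j : ℝ) / k i * (j / K[i]) ^ δ)
        ≤ 1 / 2 * ((j : ℝ) / k i * K[i] ^ (-(δ / 2))) := by gcongr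
      _ = 1 / 2 * (K[i] ^ (-(δ / 2)) * j / k i) := by ring
      _ ≤ K[i] ^ (-(δ / 2)) * j / k i := by
          have : 0 ≤ K[i] ^ (-(δ / 2)) * j / k i := by positivity
          linarith
      _ ≤ _ := by gcongr; exact h1 j hj

lemma tendsto_ratio (h : TailArray F k y) {s : ℝ} (hs : s ∈ Ioc (0 : ℝ) 1) :
    Tendsto (fun i => y i ⌈s * k i⌉₊ / k i) F (𝓝 s) := by
  have hkR : Tendsto (fun i => K[i]) F atTop := tendsto_natCast_atTop_atTop.comp h.tendsto_k
  have h1 : Tendsto (fun i => (⌈s * k i⌉₊ : ℝ) / k i) F (𝓝 s) :=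
    (tendsto_nat_ceil_mul_div_atTop hs.1.le).comp hkR
  have h2 : Tendsto (fun i => log (y i ⌈s * k i⌉₊ / ⌈s * k i⌉₊)) F (𝓝 0) := by
    have hb : Tendsto (fun i => s ^ (-1 / 2 : ℝ) * K[i] ^ (-1 / 4 : ℝ)) F (𝓝 0) := by
      have := (h.tendsto_rpow_neg (show (-1 / 4 : ℝ) < 0 by norm_num)).const_mul (s ^ (-1 / 2 : ℝ))
      rwa [mul_zero] at this
    refine squeeze_zero_norm' ?_ hb
    filter_upwards [h.near (1 / 4) (by norm_num), hkR.eventually_ge_atTop 1] with i hi hk1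
    have hk : (0 : ℝ) < k i := by linarith
    have hsk0 : 0 < s * k i := mul_pos hs.1 hk
    have hjm : ⌈s * k i⌉₊ ∈ Icc 1 (k i) := by
      refine mem_Icc.2 ⟨Nat.ceil_pos.2 hsk0, Nat.ceil_le.2 ?_⟩; nlinarith [hs.2]
    refine (hi _ hjm).trans ?_
    calc K[i] ^ (1 / 4 : ℝ) * (⌈s * k i⌉₊ : ℝ) ^ (-1 / 2 : ℝ)
        ≤ K[i] ^ (1 / 4 : ℝ) * (s * k i) ^ (-1 / 2 : ℝ) :=
          mul_le_mul_of_nonneg_left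
            (rpow_le_rpow_of_nonpos hsk0 (Nat.le_ceil _) (by norm_num)) (by positivity)
      _ = s ^ (-1 / 2 : ℝ) * (K[i] ^ (1 / 4 : ℝ) * K[i] ^ (-1 / 2 : ℝ)) := by
          rw [mul_rpow hs.1.le hk.le]; ring
      _ = _ := by rw [← rpow_add hk]; norm_num
  have h3 := ((continuous_exp.tendsto 0).comp h2).mul h1
  rw [exp_zero, one_mul] at h3
  refine h3.congr' ?_
  filter_upwards [h.pos, hkR.eventually_ge_atTop 1] with i hi hk1
  have hk : (0 : ℝ) < k i := by linarith
  have hsk0 : 0 < s * k i := mul_pos hs.1 hk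
  have hj1 := Nat.ceil_pos.2 hsk0
  have hjm : ⌈s * k i⌉₊ ∈ Icc 1 (k i) := by
    refine mem_Icc.2 ⟨hj1, Nat.ceil_le.2 ?_⟩; nlinarith [hs.2]
  have hj0 : (0 : ℝ) < ⌈s * k i⌉₊ := mod_cast hj1
  simp only [Function.comp]
  rw [exp_log (div_pos (hi _ hjm) hj0)]; field_simp

lemma exc_nonneg (h : TailArray F k y) (ξ : ℝ) : ∀ᶠ i in F, ∀ j ∈ Icc 1 (k i), 0 ≤ E[ξ, i] j := by
  filter_upwards [h.pos, h.le_k] with i h1 h2 j hj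
  exact kFun_nonneg ξ ((one_le_div (h1 j hj)).2 (h2 j hj))

lemma exc_antitone (h : TailArray F k y) (ξ : ℝ) :
    ∀ᶠ i in F, ∀ j ∈ Icc 1 (k i), ∀ l ∈ Icc 1 (k i), j ≤ l → E[ξ, i] l ≤ E[ξ, i] j := by
  filter_upwards [h.pos, h.mono, h.k_pos] with i h1 h2 hk j hj l hl hjl
  apply (kFun_strictMonoOn ξ).monotoneOn (div_pos hk (h1 l hl)) (div_pos hk (h1 j hj))
  have := h1 j hj
  have := h2 j hj l hl hjl; gcongr

lemma exc_one_pos (h : TailArray F k y) (ξ : ℝ) : ∀ᶠ i in F, 0 < E[ξ, i] 1 := by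
  filter_upwards [h.pos, h.upper (1 / 2) (by norm_num), h.eventually_natCast_le 2] with i h1 h2 h3
  have hk : (1 : ℝ) < k i := by push_cast at h3; linarith
  have hk1 : 1 ∈ Icc 1 (k i) := by refine mem_Icc.2 ⟨le_rfl, ?_⟩; exact_mod_cast hk.le
  have hlt : K[i] ^ (1 / 2 : ℝ) < k i := by
    conv_rhs => rw [← rpow_one K[i]]
    exact rpow_lt_rpow_of_exponent_lt hk (by norm_num)
  have h4 := h2 1 hk1
  have h5 := h1 1 hk1
  rw [Nat.cast_one, mul_one] at h4
  have := kFun_strictMonoOn ξ (Set.mem_Ioi.2 one_pos)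
    (Set.mem_Ioi.2 (div_pos (one_pos.trans hk) h5)) ((one_lt_div h5).2 (h4.trans_lt hlt))
  rwa [kFun_one] at this

set_option maxHeartbeats 800000 in
/-- In the nonpositive case, all the arguments `1 + θ h_j`, `j ≥ 2`, stay away from zero as long as
`1 + θ h_1` is positive: the bound `θ > -1 / h_1` leaves a margin because `y 2 / y 1` stays away
from one. -/
lemma arg_lower (h : TailArray F k y) {ξ δ : ℝ} (hξ : ξ ≤ 0) (hξ1 : -1 < ξ) (hδ : 0 < δ) :
    ∀ᶠ i in F, ∀ θ : ℝ, 0 < 1 + θ * E[ξ, i] 1 → ∀ j ∈ Icc 2 (k i),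
      1 / 6 * (j / K[i]) ^ (-ξ + δ) ≤ 1 + θ * E[ξ, i] j := by
  set ε := δ / 8 with hε
  have hε0 : 0 < ε := by positivity
  filter_upwards [h.lower ε hε0, h.lower (1 / 16) (by norm_num), h.upper (1 / 16) (by norm_num),
    h.half_le, h.pos, h.mono, h.le_k, h.gap ε hε0, h.exc_nonneg ξ, h.exc_one_pos ξ,
    h.eventually_natCast_le 2, h.log_le_rpow hε0 2,
    h.mul_rpow_le (show (1 + 1 / 16 : ℝ) < 3 / 2 - 3 / 16 by norm_num) 8,
    eventually_le_rpow h.tendsto_k hε0 2]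
    with i hlow hlow' hup hhalf hpos hmono hle hgap hexc hexc1 hk2 hlogk hk8 hkε θ hθ j hj
  have hk2' : (2 : ℝ) ≤ k i := mod_cast hk2
  have hk1 : (1 : ℝ) ≤ k i := by linarith
  have hk : (0 : ℝ) < k i := by linarith
  have hj2 : 2 ≤ j := (mem_Icc.1 hj).1
  have hjk : j ≤ k i := (mem_Icc.1 hj).2
  have hjm : j ∈ Icc 1 (k i) := mem_Icc.2 ⟨by omega, hjk⟩
  have h1m : 1 ∈ Icc 1 (k i) := mem_Icc.2 ⟨le_rfl, by omega⟩
  have h2m : 2 ∈ Icc 1 (k i) := mem_Icc.2 ⟨by omega, by omega⟩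
  have hjk' : (j : ℝ) / k i ≤ 1 := by rw [div_le_one hk]; exact_mod_cast hjk
  have hr0 : (0 : ℝ) < j / k i := by positivity
  have hpow1 : (j / K[i]) ^ (-ξ + δ) ≤ 1 := rpow_le_one hr0.le hjk' (by linarith)
  by_cases hθ0 : 0 ≤ θ
  · have := mul_nonneg hθ0 (hexc j hjm); linarith
  push Not at hθ0
  have hy1 := hpos 1 h1m
  have hyj := hpos j hjm
  set r := K[i] / y i j with hr
  set z := y i j / y i 1 with hz
  have hrpos : 0 < r := div_pos hk hyj
  have hr1 : 1 ≤ r := (one_le_div hyj).2 (hle j hjm)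
  have hz1 : 1 ≤ z := (one_le_div hy1).2 (hmono 1 h1m j hjm (by omega))
  have hzpos : 0 < z := by linarith
  have hrz : K[i] / y i 1 = r * z := by rw [hr, hz]; field_simp
  have hsplit : E[ξ, i] 1 = E[ξ, i] j + r ^ ξ * kFun ξ z := by
    unfold exc; rw [hrz, kFun_mul ξ hrpos hzpos]
  have hkz := kFun_nonneg ξ hz1
  -- the value at the boundary `θ = -1 / h_1`
  have hbd : r ^ ξ * kFun ξ z / E[ξ, i] 1 ≤ 1 + θ * E[ξ, i] j := by
    rw [div_le_iff₀ hexc1]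
    have := hexc j hjm; nlinarith
  refine le_trans ?_ hbd
  rw [le_div_iff₀ hexc1, rpow_add hr0]
  have hrξ' : r ^ ξ = (y i j / k i) ^ (-ξ) := by
    rw [hr, ← inv_div, inv_rpow (by positivity), rpow_neg (by positivity)]
  have hy1up := hup 1 h1m
  rw [Nat.cast_one, mul_one] at hy1up
  have hrzle : r * z ≤ K[i] ^ (1 + 1 / 16 : ℝ) := by
    rw [← hrz, div_le_iff₀ hy1]
    have := hlow' 1 h1m
    rw [Nat.cast_one, mul_one] at this
    calc K[i] = K[i] ^ (1 + 1 / 16 : ℝ) * K[i] ^ (-(1 / 16) : ℝ) := by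
          rw [← rpow_add hk]; norm_num
      _ ≤ _ := by gcongr
  by_cases hc : K[i] ^ (1 / 2 : ℝ) ≤ j
  · have hyj2 := hhalf j hjm hc
    have e1 : r * z ≤ z ^ 3 := by
      have e2 : K[i] ^ (1 / 2 - 1 / 16 : ℝ) / 2 ≤ z := by
        rw [hz, le_div_iff₀ hy1]
        calc K[i] ^ (1 / 2 - 1 / 16 : ℝ) / 2 * y i 1
            ≤ K[i] ^ (1 / 2 - 1 / 16 : ℝ) / 2 * K[i] ^ (1 / 16 : ℝ) := by gcongr
          _ = K[i] ^ (1 / 2 : ℝ) / 2 := by rw [div_mul_eq_mul_div, ← rpow_add hk]; norm_num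
          _ ≤ _ := by linarith
      have e3 : (K[i] ^ (1 / 2 - 1 / 16 : ℝ)) ^ 3 = K[i] ^ (3 / 2 - 3 / 16 : ℝ) := by
        rw [← rpow_natCast, ← rpow_mul hk.le]; norm_num
      calc r * z ≤ K[i] ^ (1 + 1 / 16 : ℝ) := hrzle
        _ ≤ (K[i] ^ (1 / 2 - 1 / 16 : ℝ) / 2) ^ 3 := by rw [div_pow, e3]; linarith
        _ ≤ z ^ 3 := by gcongr
    have e4 : E[ξ, i] 1 ≤ 3 * kFun ξ z := by
      unfold exc
      rw [hrz]
      refine le_trans ?_ (kFun_pow_three_le hξ hz1)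
      exact (kFun_strictMonoOn ξ).monotoneOn (Set.mem_Ioi.2 (by positivity))
        (Set.mem_Ioi.2 (by positivity)) e1
    have e5 : 1 / 2 * (j / K[i]) ^ (-ξ) ≤ r ^ ξ := by
      rw [hrξ']
      calc 1 / 2 * (j / K[i]) ^ (-ξ) ≤ (1 / 2 : ℝ) ^ (-ξ) * (j / K[i]) ^ (-ξ) := by
            gcongr
            have := rpow_le_rpow_of_exponent_ge (x := 1 / 2) (by norm_num) (by norm_num)
              (show -ξ ≤ 1 by linarith)
            simpa using this
        _ = ((j : ℝ) / 2 / k i) ^ (-ξ) := by rw [← mul_rpow (by norm_num) hr0.le]; ring_nf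
        _ ≤ _ := by gcongr; linarith
    have e6 : (j / K[i]) ^ δ ≤ 1 := rpow_le_one hr0.le hjk' hδ.le
    calc 1 / 6 * ((j / K[i]) ^ (-ξ) * (j / K[i]) ^ δ) * E[ξ, i] 1
        ≤ 1 / 6 * ((j / K[i]) ^ (-ξ) * 1) * (3 * kFun ξ z) := by gcongr
      _ = 1 / 2 * (j / K[i]) ^ (-ξ) * kFun ξ z := by ring
      _ ≤ _ := by gcongr
  · push Not at hc
    have e1 : (j / K[i]) ^ δ ≤ K[i] ^ (-(4 * ε)) := by
      calc (j / K[i]) ^ δ ≤ (K[i] ^ (1 / 2 : ℝ) / k i) ^ δ := by gcongr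
        _ = K[i] ^ (-(4 * ε)) := by rw [← rpow_sub_one hk.ne', ← rpow_mul hk.le, hε]; ring_nf
    have e2 : E[ξ, i] 1 ≤ K[i] ^ ε := by
      unfold exc
      rw [hrz]
      have hrz1 : 1 ≤ r * z := by nlinarith
      calc kFun ξ (r * z) ≤ kFun 0 (r * z) := kFun_mono_exponent hξ hrz1
        _ = log (r * z) := by simp [kFun]
        _ ≤ log (K[i] ^ (1 + 1 / 16 : ℝ)) := log_le_log (by linarith) hrzle
        _ = (1 + 1 / 16) * log (k i) := log_rpow hk _
        _ ≤ 2 * log (k i) := by have := log_nonneg hk1; linarith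
        _ ≤ _ := hlogk
    have hkε1 : K[i] ^ (-ε) ≤ 1 := rpow_le_one_of_one_le_of_nonpos hk1 (by linarith)
    have hkε0 : 0 < K[i] ^ (-ε) := rpow_pos_of_pos hk _
    have e3 : K[i] ^ (-ε) / 2 ≤ kFun ξ z := by
      refine le_trans ?_ (one_sub_inv_le_kFun hξ1.le hz1)
      have hzl : 1 + K[i] ^ (-ε) ≤ z := by
        rw [hz, le_div_iff₀ hy1]; exact hgap.trans (hmono 2 h2m j hjm hj2)
      have : z⁻¹ ≤ (1 + K[i] ^ (-ε))⁻¹ := inv_anti₀ (by positivity) hzl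
      have h3 : (1 + K[i] ^ (-ε))⁻¹ ≤ 1 - K[i] ^ (-ε) / 2 := by
        rw [inv_le_iff_one_le_mul₀ (by positivity)]
        have : K[i] ^ (-ε) * K[i] ^ (-ε) ≤ K[i] ^ (-ε) :=
          mul_le_of_le_one_left hkε0.le hkε1
        linarith
      linarith
    have e4 : K[i] ^ (-ε) * (j / K[i]) ^ (-ξ) ≤ r ^ ξ := by
      rw [hrξ']
      calc K[i] ^ (-ε) * (j / K[i]) ^ (-ξ)
          ≤ (K[i] ^ (-ε)) ^ (-ξ) * (j / K[i]) ^ (-ξ) := by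
            gcongr
            have := rpow_le_rpow_of_exponent_ge hkε0 hkε1 (show -ξ ≤ 1 by linarith)
            simpa using this
        _ = (K[i] ^ (-ε) * j / k i) ^ (-ξ) := by rw [← mul_rpow hkε0.le hr0.le]; ring_nf
        _ ≤ _ := rpow_le_rpow (by positivity)
            (div_le_div_of_nonneg_right (hlow j hjm) hk.le) (by linarith)
    have e5 : K[i] ^ (-(4 * ε)) * K[i] ^ ε ≤ K[i] ^ (-ε) / 2 * K[i] ^ (-ε) := by
      have q1 : K[i] ^ (-(4 * ε)) * K[i] ^ ε
          = K[i] ^ (-ε) * K[i] ^ (-ε) * K[i] ^ (-ε) := by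
        rw [← rpow_add hk, ← rpow_add hk, ← rpow_add hk]; ring_nf
      have q2 : K[i] ^ (-ε) ≤ 1 / 2 := by
        rw [rpow_neg hk.le, ← one_div]; exact one_div_le_one_div_of_le two_pos hkε
      rw [q1]
      nlinarith [mul_pos hkε0 hkε0]
    calc 1 / 6 * ((j / K[i]) ^ (-ξ) * (j / K[i]) ^ δ) * E[ξ, i] 1
        ≤ 1 / 6 * ((j / K[i]) ^ (-ξ) * K[i] ^ (-(4 * ε))) * K[i] ^ ε := by gcongr
      _ = 1 / 6 * (j / K[i]) ^ (-ξ) * (K[i] ^ (-(4 * ε)) * K[i] ^ ε) := by ring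
      _ ≤ 1 / 6 * (j / K[i]) ^ (-ξ) * (K[i] ^ (-ε) / 2 * K[i] ^ (-ε)) := by gcongr
      _ ≤ (K[i] ^ (-ε) * (j / K[i]) ^ (-ξ)) * (K[i] ^ (-ε) / 2) := by
          have : 0 ≤ (j / K[i]) ^ (-ξ) * (K[i] ^ (-ε) / 2 * K[i] ^ (-ε)) := by
            positivity
          linarith
      _ ≤ r ^ ξ * kFun ξ z := by gcongr

end TailArray

/-! ### Averages in the likelihood equations -/

lemma avg_congr {k : ℕ} {c c' : ℕ → ℝ} (h : ∀ j ∈ Icc 2 k, c j = c' j) : avg k c = avg k c' := by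
  unfold avg; rw [Finset.sum_congr rfl h]

lemma avg_const_mul (k : ℕ) (x : ℝ) (c : ℕ → ℝ) : avg k (fun j => x * c j) = x * avg k c := by
  unfold avg; rw [← Finset.mul_sum]; ring

lemma avg_add (k : ℕ) (c c' : ℕ → ℝ) : avg k (fun j => c j + c' j) = avg k c + avg k c' := by
  unfold avg; rw [Finset.sum_add_distrib]; ring

lemma avg_sub (k : ℕ) (c c' : ℕ → ℝ) : avg k (fun j => c j - c' j) = avg k c - avg k c' := by
  unfold avg; rw [Finset.sum_sub_distrib]; ring

lemma avg_const {k : ℕ} (hk : 2 ≤ k) (x : ℝ) : avg k (fun _ => x) = x := by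
  have : (2 : ℝ) ≤ k := mod_cast hk
  have h0 : (k : ℝ) - 1 ≠ 0 := by linarith
  unfold avg
  rw [Finset.sum_const, Nat.card_Icc, nsmul_eq_mul, Nat.cast_sub (by omega)]
  push_cast
  field_simp; ring

/-- Average of `1 / (1 + θ h_j)`, `2 ≤ j ≤ k`. -/
def avgInv (k : ℕ) (h : ℕ → ℝ) (θ : ℝ) : ℝ := avg k fun j => 1 / (1 + θ * h j)

/-- Average of `log (1 + θ h_j)`, `2 ≤ j ≤ k`. -/
def avgLog (k : ℕ) (h : ℕ → ℝ) (θ : ℝ) : ℝ := avg k fun j => log (1 + θ * h j)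

lemma integral_rpow_zero_one {p : ℝ} (hp : -1 < p) : ∫ s in (0 : ℝ)..1, s ^ p = 1 / (1 + p) := by
  rw [integral_rpow (Or.inl hp), one_rpow, zero_rpow (by linarith), sub_zero, add_comm]

lemma integral_log_zero_one : ∫ s in (0 : ℝ)..1, log s = -1 := by rw [integral_log]; simp

namespace TailArray

variable {ι : Type*} {F : Filter ι} {k : ι → ℕ} {y : ι → ℕ → ℝ}

local notation:max "E[" ξ ", " i "]" => exc ξ (k i) (y i)

lemma log_ratio_le (h : TailArray F k y) {γ : ℝ} (hγ : 0 < γ) :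
    ∀ᶠ i in F, ∀ j ∈ Icc 1 (k i), log (k i / y i j) ≤ (1 + 2 / γ) * ((j : ℝ) / k i) ^ (-γ) := by
  filter_upwards [h.ratio_lower one_pos, h.pos, h.k_pos] with i h1 h2 hk j hj
  have hj0 := cast_pos_of_mem hj
  have hjk := cast_div_le_one hj
  have hr0 : (0 : ℝ) < j / k i := by positivity
  have e1 : (1 : ℝ) ≤ ((j : ℝ) / k i) ^ (-γ) :=
    one_le_rpow_of_pos_of_le_one_of_nonpos hr0 hjk (by linarith)
  have e2 : log ((j : ℝ) / k i)⁻¹ ≤ ((j : ℝ) / k i) ^ (-γ) / γ := by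
    have := log_le_rpow_div (inv_pos.2 hr0).le hγ; rwa [inv_rpow hr0.le, ← rpow_neg hr0.le] at this
  have e3 : log (1 / 2 * ((j : ℝ) / k i) ^ (1 + 1 : ℝ)) ≤ log (y i j / k i) :=
    log_le_log (by positivity) (h1 j hj)
  rw [log_mul (by norm_num) (by positivity), log_rpow hr0, one_div, log_inv] at e3
  rw [log_inv] at e2
  rw [← inv_div, log_inv]
  have e4 : log 2 ≤ 1 := by linarith [log_two_lt_d9]
  have e5 : (1 + 2 / γ) * ((j : ℝ) / k i) ^ (-γ)
      = ((j : ℝ) / k i) ^ (-γ) + 2 * (((j : ℝ) / k i) ^ (-γ) / γ) := by ring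
  rw [e5]; linarith

lemma exc_le_log (h : TailArray F k y) {ξ : ℝ} (hξ : ξ ≤ 0) :
    ∀ᶠ i in F, ∀ j ∈ Icc 1 (k i), E[ξ, i] j ≤ log (k i / y i j) := by
  filter_upwards [h.le_k, h.pos] with i h1 h2 j hj
  have := kFun_mono_exponent hξ ((one_le_div (h2 j hj)).2 (h1 j hj))
  simpa [kFun, exc] using this

lemma tendsto_exc (h : TailArray F k y) (ξ : ℝ) {s : ℝ} (hs : s ∈ Ioc (0 : ℝ) 1) :
    Tendsto (fun i => E[ξ, i] ⌈s * k i⌉₊) F (𝓝 (kFun ξ s⁻¹)) := by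
  have h1 : Tendsto (fun i => (y i ⌈s * k i⌉₊ / k i)⁻¹) F (𝓝 s⁻¹) :=
    (h.tendsto_ratio hs).inv₀ hs.1.ne'
  have h2 := ((hasDerivAt_kFun ξ (inv_pos.2 hs.1)).continuousAt.tendsto).comp h1
  refine h2.congr fun i => ?_
  simp only [Function.comp, exc, inv_div]

lemma tendsto_arg (h : TailArray F k y) {ξ : ℝ} {θ : ι → ℝ} (hθ : Tendsto θ F (𝓝 ξ)) {s : ℝ}
    (hs : s ∈ Ioc (0 : ℝ) 1) :
    Tendsto (fun i => 1 + θ i * E[ξ, i] ⌈s * k i⌉₊) F (𝓝 (s ^ (-ξ))) := by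
  have := (hθ.mul (h.tendsto_exc ξ hs)).const_add 1
  rwa [one_add_mul_kFun, inv_rpow hs.1.le, ← rpow_neg hs.1.le] at this

lemma inv_arg_le (h : TailArray F k y) {ξ : ℝ} (hξ : -1 / 2 < ξ) {θ : ι → ℝ}
    (hθ : Tendsto θ F (𝓝 ξ)) (hD : ∀ᶠ i in F, 0 < 1 + θ i * E[ξ, i] 1) :
    ∃ p : ℝ, 0 ≤ p ∧ p < 1 / 2 ∧ ∀ᶠ i in F, ∀ j ∈ Icc 2 (k i), 0 < 1 + θ i * E[ξ, i] j ∧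
      1 / (1 + θ i * E[ξ, i] j) ≤ 6 * ((j : ℝ) / k i) ^ (-p) := by
  by_cases hξ0 : 0 < ξ
  · refine ⟨0, le_rfl, by norm_num, ?_⟩
    filter_upwards [hθ.eventually_const_lt hξ0, h.exc_nonneg ξ] with i h1 h2 j hj
    have hjm := mem_Icc_one hj
    have := mul_nonneg h1.le (h2 j hjm)
    refine ⟨by linarith, ?_⟩
    rw [neg_zero, rpow_zero, div_le_iff₀ (by linarith)]; linarith
  · push Not at hξ0
    refine ⟨-ξ + (1 / 2 + ξ) / 2, by linarith, by linarith, ?_⟩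
    filter_upwards [h.arg_lower hξ0 (by linarith) (show 0 < (1 / 2 + ξ) / 2 by linarith), hD,
      h.k_pos] with i h1 h2 hk j hj
    have hj0 : (0 : ℝ) < j := by have := (mem_Icc.1 hj).1; exact_mod_cast (by omega : 0 < j)
    have hr0 : (0 : ℝ) < j / k i := by positivity
    have h4 := h1 _ h2 j hj
    have h5 : 0 < ((j : ℝ) / k i) ^ (-ξ + (1 / 2 + ξ) / 2) := rpow_pos_of_pos hr0 _
    have h6 : 0 < 1 + θ i * E[ξ, i] j := by linarith
    refine ⟨h6, ?_⟩
    rw [div_le_iff₀ h6, rpow_neg hr0.le, mul_assoc, inv_mul_eq_div, ← mul_div_assoc, le_div_iff₀ h5]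
    linarith

lemma tendsto_avgInv [F.IsCountablyGenerated] (h : TailArray F k y) {ξ : ℝ} (hξ : -1 / 2 < ξ)
    {θ : ι → ℝ} (hθ : Tendsto θ F (𝓝 ξ))
    (hD : ∀ᶠ i in F, 0 < 1 + θ i * E[ξ, i] 1) :
    Tendsto (fun i => avgInv (k i) E[ξ, i] (θ i)) F (𝓝 (1 / (1 + ξ))) := by
  obtain ⟨p, hp0, hp2, hb⟩ := h.inv_arg_le hξ hθ hD
  rw [← integral_rpow_zero_one (by linarith)]
  refine tendsto_avg h.tendsto_k hp0 (by linarith) (C := 6) ?_ ?_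
  · filter_upwards [hb] with i hi j hj
    rw [abs_of_pos (one_div_pos.2 (hi j hj).1)]
    exact (hi j hj).2
  · intro s hs
    have h1 : s ^ (-ξ) ≠ 0 := (rpow_pos_of_pos hs.1 _).ne'
    have := (tendsto_const_nhds (x := (1 : ℝ))).div (h.tendsto_arg hθ hs) h1
    rwa [rpow_neg hs.1.le, one_div, inv_inv] at this

lemma tendsto_avgInvSq [F.IsCountablyGenerated] (h : TailArray F k y) {ξ : ℝ} (hξ : -1 / 2 < ξ)
    {θ : ι → ℝ} (hθ : Tendsto θ F (𝓝 ξ))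
    (hD : ∀ᶠ i in F, 0 < 1 + θ i * E[ξ, i] 1) :
    Tendsto (fun i => avg (k i) fun j => 1 / (1 + θ i * E[ξ, i] j) ^ 2) F
      (𝓝 (1 / (1 + 2 * ξ))) := by
  obtain ⟨p, hp0, hp2, hb⟩ := h.inv_arg_le hξ hθ hD
  rw [← integral_rpow_zero_one (by linarith)]
  refine tendsto_avg h.tendsto_k (p := 2 * p) (by linarith) (by linarith) (C := 36) ?_ ?_
  · filter_upwards [hb] with i hi j hj
    obtain ⟨h1, h2⟩ := hi j hj
    have hr0 : (0 : ℝ) ≤ j / k i := by positivity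
    rw [abs_of_pos (by positivity), ← one_div_pow]
    calc (1 / (1 + θ i * E[ξ, i] j)) ^ 2 ≤ (6 * ((j : ℝ) / k i) ^ (-p)) ^ 2 := by gcongr
      _ = 36 * ((j : ℝ) / k i) ^ (-(2 * p)) := by
          rw [mul_pow, ← rpow_natCast (_ ^ (-p)), ← rpow_mul hr0]; norm_num
          congr 1; ring
  · intro s hs
    have h1 : s ^ (-ξ) ≠ 0 := (rpow_pos_of_pos hs.1 _).ne'
    have := (tendsto_const_nhds (x := (1 : ℝ))).div ((h.tendsto_arg hθ hs).pow 2) (pow_ne_zero 2 h1)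
    have e : 1 / (s ^ (-ξ)) ^ 2 = s ^ (2 * ξ) := by
      rw [← rpow_natCast, ← rpow_mul hs.1.le, one_div, ← rpow_neg hs.1.le]
      congr 1; push_cast; ring
    rwa [e] at this

lemma log_arg_le (h : TailArray F k y) {ξ : ℝ} {θ : ι → ℝ} (hθ : Tendsto θ F (𝓝 ξ)) :
    ∃ C : ℝ, ∀ᶠ i in F, ∀ j ∈ Icc 1 (k i), 0 < 1 + θ i * E[ξ, i] j →
      log (1 + θ i * E[ξ, i] j) ≤ C * ((j : ℝ) / k i) ^ (-(1 / 4) : ℝ) := by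
  have hpow : ∀ᶠ i in F, ∀ j ∈ Icc 1 (k i), (1 : ℝ) ≤ ((j : ℝ) / k i) ^ (-(1 / 4) : ℝ) := by
    filter_upwards [h.k_pos] with i hk j hj
    have hj0 := cast_pos_of_mem hj
    have hjk := cast_div_le_one hj
    exact one_le_rpow_of_pos_of_le_one_of_nonpos (by positivity) hjk (by norm_num)
  by_cases hξ0 : 0 < ξ
  · refine ⟨1 + ξ * (1 + 2 / (1 / 4)), ?_⟩
    filter_upwards [hθ.eventually_lt_const (show ξ < 2 * ξ by linarith), hpow, h.pos,
      hθ.eventually_const_lt hξ0, h.exc_nonneg ξ, h.log_ratio_le (show (0 : ℝ) < 1 / 4 by norm_num),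
      h.k_pos] with i h1 h2 hpos h4 h5 h6 hk j hj hb
    have hr : 0 < (k i : ℝ) / y i j := div_pos hk (hpos j hj)
    have e1 : 1 + θ i * E[ξ, i] j ≤ 2 * ((k i : ℝ) / y i j) ^ ξ := by
      rw [← one_add_mul_kFun]
      have := h5 j hj
      unfold exc at *; nlinarith
    have e2 := log_le_log hb e1
    rw [log_mul two_ne_zero (by positivity), log_rpow hr] at e2
    have e3 : log 2 ≤ 1 := by linarith [log_two_lt_d9]
    have e4 := mul_le_mul_of_nonneg_left (h6 j hj) hξ0.le
    have e5 := h2 j hj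
    calc _ ≤ _ := e2
      _ ≤ 1 * ((j : ℝ) / k i) ^ (-(1 / 4) : ℝ)
          + ξ * ((1 + 2 / (1 / 4)) * ((j : ℝ) / k i) ^ (-(1 / 4) : ℝ)) := by linarith
      _ = _ := by ring
  · push Not at hξ0
    refine ⟨(|ξ| + 1) * (1 + 2 / (1 / 4)), ?_⟩
    filter_upwards [hθ.abs.eventually_lt_const (lt_add_one _), hpow, h.exc_le_log hξ0,
      h.exc_nonneg ξ, h.log_ratio_le (show (0 : ℝ) < 1 / 4 by norm_num)] with i h1 h2 h3 h5 h6 j hj hb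
    calc _ ≤ (1 + θ i * E[ξ, i] j) - 1 := log_le_sub_one_of_pos hb
      _ ≤ |θ i| * E[ξ, i] j := by
          have := mul_le_mul_of_nonneg_right (le_abs_self (θ i)) (h5 j hj); linarith
      _ ≤ (|ξ| + 1) * ((1 + 2 / (1 / 4)) * ((j : ℝ) / k i) ^ (-(1 / 4) : ℝ)) :=
          mul_le_mul h1.le ((h3 j hj).trans (h6 j hj)) (h5 j hj) (by positivity)
      _ = _ := by ring

lemma tendsto_avgLog [F.IsCountablyGenerated] (h : TailArray F k y) {ξ : ℝ} (hξ : -1 / 2 < ξ)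
    {θ : ι → ℝ} (hθ : Tendsto θ F (𝓝 ξ))
    (hD : ∀ᶠ i in F, 0 < 1 + θ i * E[ξ, i] 1) :
    Tendsto (fun i => avgLog (k i) E[ξ, i] (θ i)) F (𝓝 ξ) := by
  obtain ⟨p, hp0, hp2, hb⟩ := h.inv_arg_le hξ hθ hD
  obtain ⟨C, hC⟩ := h.log_arg_le hθ
  have hint : ∫ s in (0 : ℝ)..1, -ξ * log s = ξ := by
    rw [intervalIntegral.integral_const_mul, integral_log_zero_one]; ring
  nth_rewrite 2 [← hint]
  refine tendsto_avg h.tendsto_k (p := 1 / 2) (by norm_num) (by norm_num) (C := |C| + 6) ?_ ?_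
  · filter_upwards [hb, hC, h.k_pos] with i hi hCi hk j hj
    obtain ⟨h1, h2⟩ := hi j hj
    have hjm := mem_Icc_one hj
    have hj0 := cast_pos_of_mem hjm
    have hjk := cast_div_le_one hjm
    have hr0 : (0 : ℝ) < j / k i := by positivity
    have g1 : ((j : ℝ) / k i) ^ (-(1 / 4) : ℝ) ≤ ((j : ℝ) / k i) ^ (-(1 / 2) : ℝ) :=
      rpow_le_rpow_of_exponent_ge hr0 hjk (by norm_num)
    have g2 : ((j : ℝ) / k i) ^ (-p) ≤ ((j : ℝ) / k i) ^ (-(1 / 2) : ℝ) :=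
      rpow_le_rpow_of_exponent_ge hr0 hjk (by linarith)
    have g3 : 0 < ((j : ℝ) / k i) ^ (-(1 / 2) : ℝ) := rpow_pos_of_pos hr0 _
    have g4 : 0 < ((j : ℝ) / k i) ^ (-(1 / 4) : ℝ) := rpow_pos_of_pos hr0 _
    have u1 : C * ((j : ℝ) / k i) ^ (-(1 / 4) : ℝ) ≤ |C| * ((j : ℝ) / k i) ^ (-(1 / 2) : ℝ) :=
      mul_le_mul (le_abs_self C) g1 g4.le (abs_nonneg _)
    have u2 := hCi j hjm h1
    have u3 : -log (1 + θ i * E[ξ, i] j) ≤ 6 * ((j : ℝ) / k i) ^ (-(1 / 2) : ℝ) := by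
      have := log_le_sub_one_of_pos (one_div_pos.2 h1)
      rw [one_div, log_inv, ← one_div] at this; linarith
    have u4 : 0 ≤ |C| * ((j : ℝ) / k i) ^ (-(1 / 2) : ℝ) := by positivity
    rw [abs_le]
    constructor <;> nlinarith
  · intro s hs
    have h1 : s ^ (-ξ) ≠ 0 := (rpow_pos_of_pos hs.1 _).ne'
    have := ((continuousAt_log h1).tendsto).comp (h.tendsto_arg hθ hs)
    rwa [log_rpow hs.1] at this

/-- At the true parameter the averages deviate from their limits by little more than
`k ^ (-1/2)`. -/
lemma avgInv_rate (h : TailArray F k y) {ξ : ℝ} (hξ : -1 / 2 < ξ) {ε : ℝ} (hε : 0 < ε) :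
    ∀ᶠ i in F, |avgInv (k i) E[ξ, i] ξ - 1 / (1 + ξ)| ≤ (k i : ℝ) ^ (-1 / 2 + ε) := by
  have hmax : -ξ ≤ max (-ξ) 0 := le_max_left _ _
  have := h.avg_rate (f := fun x => x ^ ξ) (f' := fun x => ξ * x ^ (ξ - 1)) (p := max (-ξ) 0)
    (C := |ξ|) (le_max_right _ _) (max_lt (by linarith) (by norm_num))
    (fun x hx => hasDerivAt_rpow_const (Or.inl hx.1.ne'))
    (fun x hx => by
      rw [abs_mul, abs_of_nonneg (rpow_nonneg hx.1.le _)]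
      exact mul_le_mul_of_nonneg_left
        (rpow_le_rpow_of_exponent_ge hx.1 hx.2 (by linarith)) (abs_nonneg _)) hε
  filter_upwards [this, h.pos, h.eventually_natCast_le 1] with i h1 h2 h3
  rw [integral_rpow_zero_one (by linarith)] at h1
  convert h1 using 3
  refine avg_congr fun j hj => ?_
  have hjm := mem_Icc_one hj
  have := h2 j hjm
  rw [exc, one_add_mul_kFun, one_div, ← inv_rpow (by positivity), inv_div]

lemma avgNegLog_rate (h : TailArray F k y) {ε : ℝ} (hε : 0 < ε) :
    ∀ᶠ i in F, |avg (k i) (fun j => log (k i / y i j)) - 1| ≤ (k i : ℝ) ^ (-1 / 2 + ε) := by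
  have := h.avg_rate (f := fun x => -log x) (f' := fun x => -x⁻¹) (p := 0)
    (C := 1) le_rfl (by norm_num)
    (fun x hx => (hasDerivAt_log hx.1.ne').neg)
    (fun x hx => by
      rw [abs_neg, abs_of_pos (inv_pos.2 hx.1), neg_zero, zero_sub, rpow_neg_one, one_mul]) hε
  filter_upwards [this] with i h1
  rw [intervalIntegral.integral_neg, integral_log_zero_one] at h1
  convert h1 using 3
  · congr 1
    ext j
    rw [← inv_div, log_inv]
  · ring

lemma avgLog_rate (h : TailArray F k y) (ξ : ℝ) {ε : ℝ} (hε : 0 < ε) :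
    ∀ᶠ i in F, |avgLog (k i) E[ξ, i] ξ - ξ| ≤ (k i : ℝ) ^ (-1 / 2 + ε) := by
  filter_upwards [h.avgNegLog_rate (half_pos hε), h.pos, h.k_pos,
    h.mul_rpow_le (show -1 / 2 + ε / 2 < -1 / 2 + ε by linarith) |ξ|]
    with i h1 h2 hk h4
  have e : avgLog (k i) E[ξ, i] ξ = ξ * avg (k i) (fun j => log (k i / y i j)) := by
    rw [← avg_const_mul]
    refine avg_congr fun j hj => ?_
    have hjm := mem_Icc_one hj
    rw [exc, one_add_mul_kFun, log_rpow (div_pos hk (h2 j hjm))]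
  rw [e, ← mul_sub_one, abs_mul]
  exact (mul_le_mul_of_nonneg_left h1 (abs_nonneg _)).trans h4

end TailArray

/-! ### The profile function -/

lemma exists_mem_uIcc_sub_eq {f f' : ℝ → ℝ} {a b : ℝ}
    (hf : ∀ t ∈ uIcc a b, HasDerivAt f (f' t) t) :
    ∃ t ∈ uIcc a b, f b - f a = (b - a) * f' t := by
  rcases lt_trichotomy a b with hab | hab | hab
  · rw [Set.uIcc_of_le hab.le] at hf ⊢
    obtain ⟨t, ht, he⟩ := exists_hasDerivAt_eq_slope f f' hab
      (fun t ht => (hf t ht).continuousAt.continuousWithinAt)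
      (fun t ht => hf t (Set.Ioo_subset_Icc_self ht))
    refine ⟨t, Set.Ioo_subset_Icc_self ht, ?_⟩
    rw [he]; field_simp
  · subst hab; exact ⟨a, Set.left_mem_uIcc, by ring⟩
  · rw [Set.uIcc_of_ge hab.le] at hf ⊢
    obtain ⟨t, ht, he⟩ := exists_hasDerivAt_eq_slope f f' hab
      (fun t ht => (hf t ht).continuousAt.continuousWithinAt)
      (fun t ht => hf t (Set.Ioo_subset_Icc_self ht))
    refine ⟨t, Set.Ioo_subset_Icc_self ht, ?_⟩
    rw [he]; field_simp; ring

lemma arg_pos_of_first {θ h₁ h : ℝ} (h0 : 0 ≤ h) (hh : h ≤ h₁) (hθ : 0 < 1 + θ * h₁) :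
    0 < 1 + θ * h := by
  by_cases hc : 0 ≤ θ
  · have := mul_nonneg hc h0; linarith
  · push Not at hc; nlinarith

lemma arg_pos_of_mem_uIcc {θ θ' t h : ℝ} (h0 : 0 ≤ h) (h1 : 0 < 1 + θ * h) (h2 : 0 < 1 + θ' * h)
    (ht : t ∈ uIcc θ θ') : 0 < 1 + t * h := by
  rcases Set.mem_uIcc.1 ht with ⟨h3, -⟩ | ⟨h3, -⟩
  · nlinarith [mul_le_mul_of_nonneg_right h3 h0]
  · nlinarith [mul_le_mul_of_nonneg_right h3 h0]

lemma hasDerivAt_avgInv {k : ℕ} {h : ℕ → ℝ} {θ : ℝ} (hb : ∀ j ∈ Icc 2 k, 0 < 1 + θ * h j) :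
    HasDerivAt (avgInv k h) (avg k fun j => -h j / (1 + θ * h j) ^ 2) θ := by
  unfold avgInv avg
  apply HasDerivAt.const_mul
  apply HasDerivAt.fun_sum
  intro j hj
  have h1 : HasDerivAt (fun θ => 1 + θ * h j) (h j) θ := by
    simpa using ((hasDerivAt_id θ).mul_const (h j)).const_add 1
  simpa [one_div] using h1.fun_inv (hb j hj).ne'

lemma hasDerivAt_avgLog {k : ℕ} {h : ℕ → ℝ} {θ : ℝ} (hb : ∀ j ∈ Icc 2 k, 0 < 1 + θ * h j) :
    HasDerivAt (avgLog k h) (avg k fun j => h j / (1 + θ * h j)) θ := by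
  unfold avgLog avg
  apply HasDerivAt.const_mul
  apply HasDerivAt.fun_sum
  intro j hj
  have h1 : HasDerivAt (fun θ => 1 + θ * h j) (h j) θ := by
    simpa using ((hasDerivAt_id θ).mul_const (h j)).const_add 1
  exact h1.log (hb j hj).ne'

/-- The profile function of the pseudo-likelihood equations, which equals one at the root up to the
contribution of the largest exceedance. -/
def profile (k : ℕ) (h : ℕ → ℝ) (θ : ℝ) : ℝ := avgInv k h θ * (1 + avgLog k h θ)

lemma avg_excess_div {k : ℕ} (hk : 2 ≤ k) {h : ℕ → ℝ} {θ : ℝ} (hθ : θ ≠ 0)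
    (hb : ∀ j ∈ Icc 2 k, 0 < 1 + θ * h j) :
    avg k (fun j => h j / (1 + θ * h j)) = (1 - avgInv k h θ) / θ := by
  have e : avg k (fun j => h j / (1 + θ * h j)) = avg k (fun j => θ⁻¹ * (1 - 1 / (1 + θ * h j))) :=
    avg_congr fun j hj => by
      have := (hb j hj).ne'; rw [eq_inv_mul_iff_mul_eq₀ hθ, one_sub_div this]; ring
  rw [e, avg_const_mul, avg_sub, avg_const hk, avgInv, div_eq_inv_mul]

lemma avg_excess_div_sq {k : ℕ} {h : ℕ → ℝ} {θ : ℝ} (hθ : θ ≠ 0) :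
    avg k (fun j => -h j / (1 + θ * h j) ^ 2)
      = (avg k (fun j => 1 / (1 + θ * h j) ^ 2) - avgInv k h θ) / θ := by
  rw [div_eq_inv_mul, avgInv, ← avg_sub, ← avg_const_mul]
  refine avg_congr fun j hj => ?_
  field_simp; ring

lemma hasDerivAt_profile {k : ℕ} (hk : 2 ≤ k) {h : ℕ → ℝ} {θ : ℝ} (hθ : θ ≠ 0)
    (hb : ∀ j ∈ Icc 2 k, 0 < 1 + θ * h j) :
    HasDerivAt (profile k h)
      ((avg k (fun j => 1 / (1 + θ * h j) ^ 2) - avgInv k h θ) / θ * (1 + avgLog k h θ)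
        + avgInv k h θ * ((1 - avgInv k h θ) / θ)) θ := by
  rw [← avg_excess_div hk hθ hb, ← avg_excess_div_sq hθ]
  exact (hasDerivAt_avgInv hb).mul ((hasDerivAt_avgLog hb).const_add 1)

lemma tendsto_log_pow_mul (n : ℕ) : Tendsto (fun x : ℝ => x * log x ^ n) (𝓝[>] 0) (𝓝 0) := by
  rcases Nat.eq_zero_or_pos n with rfl | hn
  · simp only [pow_zero, mul_one]; exact tendsto_id.mono_left nhdsWithin_le_nhds
  have hn' : (0 : ℝ) < n := mod_cast hn
  have := (tendsto_log_mul_rpow_nhdsGT_zero (inv_pos.2 hn')).pow n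
  rw [zero_pow hn.ne'] at this
  refine this.congr' ?_
  filter_upwards [self_mem_nhdsWithin] with x hx
  rw [mul_pow, rpow_inv_natCast_pow (le_of_lt hx) hn.ne', mul_comm]

lemma abs_log_le_rpow {x γ : ℝ} (hx : x ∈ Ioc (0 : ℝ) 1) (hγ : 0 < γ) :
    |log x| ≤ 1 / γ * x ^ (-γ) := by
  have := log_le_rpow_div (inv_pos.2 hx.1).le hγ
  rw [log_inv, inv_rpow hx.1.le, ← rpow_neg hx.1.le] at this
  rw [abs_of_nonpos (log_nonpos hx.1.le hx.2)]
  linarith [this, (by ring : 1 / γ * x ^ (-γ) = x ^ (-γ) / γ)]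

lemma intervalIntegrable_log_pow (n : ℕ) :
    IntervalIntegrable (fun x : ℝ => log x ^ n) volume 0 1 := by
  rcases Nat.eq_zero_or_pos n with rfl | hn
  · simp
  have hdom : IntervalIntegrable
      (fun s : ℝ => (1 / (1 / (2 * n : ℝ))) ^ n * s ^ (-(1 / 2) : ℝ)) volume 0 1 :=
    (intervalIntegral.intervalIntegrable_rpow' (by norm_num)).const_mul _
  refine hdom.mono_fun' ?_ ?_
  · exact (measurable_log.pow_const n).aestronglyMeasurable
  · rw [Set.uIoc_of_le zero_le_one]
    filter_upwards [ae_restrict_mem measurableSet_Ioc] with s hs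
    rw [norm_pow, norm_eq_abs]
    calc |log s| ^ n ≤ (1 / (1 / (2 * n : ℝ)) * s ^ (-(1 / (2 * n : ℝ)))) ^ n := by
          gcongr; exact abs_log_le_rpow hs (by positivity)
      _ = _ := by
          rw [mul_pow, ← rpow_mul_natCast hs.1.le]
          congr 2; field_simp

lemma integral_log_sq : ∫ s in (0 : ℝ)..1, log s ^ 2 = 2 := by
  have hd : ∀ x ∈ Ioo (0 : ℝ) 1,
      HasDerivAt (fun x => x * log x ^ 2 - 2 * (x * log x ^ 1) + 2 * x) (log x ^ 2) x := by
    intro x hx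
    have hl := hasDerivAt_log hx.1.ne'
    have h2 := ((hasDerivAt_id x).mul (hl.pow 2)).sub
      (((hasDerivAt_id x).mul (hl.pow 1)).const_mul 2) |>.add ((hasDerivAt_id x).const_mul 2)
    refine h2.congr_deriv ?_
    have := hx.1.ne'
    simp only [id, Pi.pow_apply]
    field_simp; ring
  rw [intervalIntegral.integral_eq_sub_of_hasDerivAt_of_tendsto one_pos hd
    (intervalIntegrable_log_pow 2) (fa := 0) (fb := 2)]
  · norm_num
  · have h1 := ((tendsto_log_pow_mul 2).sub ((tendsto_log_pow_mul 1).const_mul 2)).add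
      ((tendsto_id.mono_left nhdsWithin_le_nhds :
        Tendsto (fun x : ℝ => x) (𝓝[>] 0) (𝓝 0)).const_mul 2)
    simpa using h1
  · have : ContinuousAt (fun x => x * log x ^ 2 - 2 * (x * log x ^ 1) + 2 * x) (1 : ℝ) := by
      have := continuousAt_log one_ne_zero; fun_prop
    have h1 := this.tendsto.mono_left (nhdsWithin_le_nhds (s := Set.Iio 1)); simpa using h1

lemma integral_neg_log_cube : ∫ s in (0 : ℝ)..1, (-log s) ^ 3 = 6 := by
  have hd : ∀ x ∈ Ioo (0 : ℝ) 1, HasDerivAt (fun x => x * log x ^ 3 - 3 * (x * log x ^ 2)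
        + 6 * (x * log x ^ 1) - 6 * x) (log x ^ 3) x := by
    intro x hx
    have hl := hasDerivAt_log hx.1.ne'
    have h2 := (((hasDerivAt_id x).mul (hl.pow 3)).sub
      (((hasDerivAt_id x).mul (hl.pow 2)).const_mul 3) |>.add
      (((hasDerivAt_id x).mul (hl.pow 1)).const_mul 6)).sub ((hasDerivAt_id x).const_mul 6)
    refine h2.congr_deriv ?_
    have := hx.1.ne'
    simp only [id, Pi.pow_apply]
    field_simp; ring
  have e : ∀ s : ℝ, (-log s) ^ 3 = -(log s ^ 3) := fun s => by ring
  simp_rw [e]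
  rw [intervalIntegral.integral_neg, intervalIntegral.integral_eq_sub_of_hasDerivAt_of_tendsto
    one_pos hd (intervalIntegrable_log_pow 3) (fa := 0) (fb := -6)]
  · norm_num
  · have h1 := (((tendsto_log_pow_mul 3).sub ((tendsto_log_pow_mul 2).const_mul 3)).add
      ((tendsto_log_pow_mul 1).const_mul 6)).sub
      ((tendsto_id.mono_left nhdsWithin_le_nhds :
        Tendsto (fun x : ℝ => x) (𝓝[>] 0) (𝓝 0)).const_mul 6)
    simpa using h1
  · have : ContinuousAt (fun x => x * log x ^ 3 - 3 * (x * log x ^ 2)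
        + 6 * (x * log x ^ 1) - 6 * x) (1 : ℝ) := by have := continuousAt_log one_ne_zero; fun_prop
    have h1 := this.tendsto.mono_left (nhdsWithin_le_nhds (s := Set.Iio 1)); simpa using h1

lemma hasDerivAt_log_one_add_sub {t : ℝ} (ht : 0 < 1 + t) :
    HasDerivAt (fun y => log (1 + y) - y + y ^ 2 / 2) (t ^ 2 / (1 + t)) t := by
  have h1 : HasDerivAt (fun y => log (1 + y)) (1 / (1 + t)) t :=
    ((hasDerivAt_id t).const_add 1).log ht.ne'
  have h2 := (h1.sub (hasDerivAt_id t)).add (((hasDerivAt_id t).pow 2).div_const 2)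
  refine h2.congr_deriv ?_
  simp only [id]
  field_simp; ring

lemma one_add_pos_of_mem_uIcc {y t : ℝ} (hy : 0 < 1 + y) (ht : t ∈ uIcc 0 y) : 0 < 1 + t := by
  rcases Set.mem_uIcc.1 ht with ⟨h, -⟩ | ⟨h, -⟩ <;> linarith

lemma abs_le_of_mem_uIcc_zero {y t : ℝ} (ht : t ∈ uIcc 0 y) : |t| ≤ |y| := by
  rcases Set.mem_uIcc.1 ht with ⟨h, h'⟩ | ⟨h, h'⟩
  · rw [abs_of_nonneg h, abs_of_nonneg (h.trans h')]; exact h'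
  · rw [abs_of_nonpos h', abs_of_nonpos (h.trans h')]; linarith

/-- Third-order remainder of the logarithm, with the correct singularity at `-1`. -/
lemma abs_log_one_add_sub_le {y : ℝ} (hy : 0 < 1 + y) :
    |log (1 + y) - y + y ^ 2 / 2| ≤ |y| ^ 3 * (1 + 1 / (1 + y)) := by
  obtain ⟨t, ht, he⟩ := exists_mem_uIcc_sub_eq (a := 0) (b := y)
    (fun t ht => hasDerivAt_log_one_add_sub (one_add_pos_of_mem_uIcc hy ht))
  simp only [add_zero, log_one, sub_zero] at he
  norm_num at he
  have h1 := one_add_pos_of_mem_uIcc hy ht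
  have h2 := abs_le_of_mem_uIcc_zero ht
  have h3 : 1 / (1 + t) ≤ 1 + 1 / (1 + y) := by
    have p := one_div_pos.2 hy
    rcases Set.mem_uIcc.1 ht with ⟨h, -⟩ | ⟨h, -⟩
    · have : 1 / (1 + t) ≤ 1 := by rw [div_le_one h1]; linarith
      linarith
    · have : 1 / (1 + t) ≤ 1 / (1 + y) := one_div_le_one_div_of_le hy (by linarith); linarith
  have e : log (1 + y) - y + y ^ 2 / 2 = y * (t ^ 2 * (1 / (1 + t))) := by rw [he]; ring
  rw [e, abs_mul, abs_mul, abs_of_pos (one_div_pos.2 h1), abs_pow]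
  calc |y| * (|t| ^ 2 * (1 / (1 + t))) ≤ |y| * (|y| ^ 2 * (1 + 1 / (1 + y))) := by gcongr
    _ = _ := by ring

lemma abs_log_one_add_sub_cube_le {y : ℝ} (hy : |y| ≤ 1 / 2) :
    |log (1 + y) - y + y ^ 2 / 2 - y ^ 3 / 3| ≤ 2 * y ^ 4 := by
  have hy' := abs_le.1 hy
  have hy0 : 0 < 1 + y := by linarith
  have hd : ∀ t ∈ uIcc 0 y,
      HasDerivAt (fun y => log (1 + y) - y + y ^ 2 / 2 - y ^ 3 / 3) (-t ^ 3 / (1 + t)) t := by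
    intro t ht
    have h0 := one_add_pos_of_mem_uIcc hy0 ht
    refine ((hasDerivAt_log_one_add_sub h0).sub
      (((hasDerivAt_id t).pow 3).div_const 3)).congr_deriv ?_
    simp only [id]
    field_simp; ring
  obtain ⟨t, ht, he⟩ := exists_mem_uIcc_sub_eq hd
  simp only [add_zero, log_one, sub_zero] at he
  norm_num at he
  have h2 := abs_le_of_mem_uIcc_zero ht
  have h4 := abs_le.1 (h2.trans hy)
  have h1 : 0 < 1 + t := by linarith
  have h3 : 1 / (1 + t) ≤ 2 := by rw [div_le_iff₀ h1]; linarith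
  have e : log (1 + y) - y + y ^ 2 / 2 - y ^ 3 / 3 = -(y * (t ^ 3 * (1 / (1 + t)))) := by
    rw [he]; ring
  have e4 : 2 * y ^ 4 = |y| * (|y| ^ 3 * 2) := by rw [← Even.pow_abs (by decide : Even 4)]; ring
  rw [e, abs_neg, abs_mul, abs_mul, abs_of_pos (one_div_pos.2 h1), abs_pow, e4]; gcongr

/-! ### Expansion of the profile function -/

lemma exc_zero (k : ℕ) (y : ℕ → ℝ) (j : ℕ) : exc 0 k y j = log (k / y j) := by simp [exc, kFun]

/-- Scaled third-order remainder of the averaged logarithm at `θ = 0`. -/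
def logRemainder (k : ℕ) (h : ℕ → ℝ) (θ : ℝ) : ℝ :=
  avg k fun j => (log (1 + θ * h j) - θ * h j + (θ * h j) ^ 2 / 2) / θ ^ 3

lemma avgInv_eq_expansion {k : ℕ} (hk : 2 ≤ k) {h : ℕ → ℝ} {θ : ℝ}
    (hb : ∀ j ∈ Icc 2 k, 0 < 1 + θ * h j) :
    avgInv k h θ = 1 - θ * avg k h + θ ^ 2 * avg k (fun j => h j ^ 2)
      - θ ^ 3 * avg k (fun j => h j ^ 3 / (1 + θ * h j)) := by
  rw [← avg_const_mul, ← avg_const_mul, ← avg_const_mul]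
  nth_rewrite 1 [← avg_const hk 1]
  rw [← avg_sub, ← avg_add, ← avg_sub]
  refine avg_congr fun j hj => ?_
  have := (hb j hj).ne'
  rw [← mul_div_assoc, eq_sub_iff_add_eq, ← add_div, div_eq_iff this]; ring

lemma one_add_avgLog_eq_expansion {k : ℕ} (h : ℕ → ℝ) {θ : ℝ} (hθ : θ ≠ 0) :
    1 + avgLog k h θ = 1 + θ * avg k h - θ ^ 2 * (avg k (fun j => h j ^ 2) / 2)
      + θ ^ 3 * logRemainder k h θ := by
  have e : avg k (fun j => h j ^ 2) / 2 = avg k (fun j => 1 / 2 * h j ^ 2) := by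
    rw [avg_const_mul]; ring
  rw [e, logRemainder, ← avg_const_mul, ← avg_const_mul, ← avg_const_mul, add_sub_assoc,
    ← avg_sub, add_assoc, ← avg_add, avgLog]
  congr 1
  refine avg_congr fun j _ => ?_
  rw [mul_div_cancel₀ _ (pow_ne_zero 3 hθ)]; ring

namespace TailArray

variable {ι : Type*} {F : Filter ι} {k : ι → ℕ} {y : ι → ℕ → ℝ}

local notation:max "K[" i "]" => (k i : ℝ)
local notation:max "E[" ξ ", " i "]" => exc ξ (k i) (y i)

lemma tendsto_of_rate (h : TailArray F k y) {z : ι → ℝ} {a : ℝ}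
    (hz : ∀ ε > (0 : ℝ), ∀ᶠ i in F, |z i - a| ≤ K[i] ^ (-1 / 2 + ε)) : Tendsto z F (𝓝 a) := by
  rw [tendsto_iff_norm_sub_tendsto_zero]
  exact squeeze_zero' (Eventually.of_forall fun i => norm_nonneg _) (hz (1 / 4) (by norm_num))
    (h.tendsto_rpow_neg (by norm_num))

lemma avg_exc_zero_rate (h : TailArray F k y) {ε : ℝ} (hε : 0 < ε) :
    ∀ᶠ i in F, |avg (k i) E[0, i] - 1| ≤ K[i] ^ (-1 / 2 + ε) := by
  filter_upwards [h.avgNegLog_rate hε] with i hi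
  have e : E[0, i] = fun j => log (k i / y i j) := funext fun j => exc_zero _ _ _; rwa [e]

lemma avg_exc_zero_sq_rate (h : TailArray F k y) {ε : ℝ} (hε : 0 < ε) :
    ∀ᶠ i in F, |avg (k i) (fun j => E[0, i] j ^ 2) - 2| ≤ K[i] ^ (-1 / 2 + ε) := by
  have := h.avg_rate (f := fun x => log x ^ 2) (f' := fun x => 2 * log x * x⁻¹)
    (p := 1 / 4) (C := 8) (by norm_num) (by norm_num)
    (fun x hx => by refine ((hasDerivAt_log hx.1.ne').fun_pow 2).congr_deriv ?_; norm_num)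
    (fun x hx => by
      rw [abs_mul, abs_mul, abs_of_pos (inv_pos.2 hx.1), abs_two, rpow_sub_one hx.1.ne']
      have := abs_log_le_rpow hx (show (0 : ℝ) < 1 / 4 by norm_num)
      have h2 := inv_pos.2 hx.1
      calc 2 * |log x| * x⁻¹ ≤ 2 * (1 / (1 / 4) * x ^ (-(1 / 4) : ℝ)) * x⁻¹ := by gcongr
        _ = _ := by rw [div_eq_mul_inv (x ^ _)]; ring) hε
  filter_upwards [this] with i h1
  rw [integral_log_sq] at h1
  convert h1 using 3
  refine avg_congr fun j _ => ?_
  rw [exc_zero, ← inv_div, log_inv, neg_sq]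

lemma exc_zero_cube_le (h : TailArray F k y) : ∀ᶠ i in F, ∀ j ∈ Icc 1 (k i),
    E[0, i] j ^ 3 ≤ 49 ^ 3 * (j / K[i]) ^ (-(1 / 8) : ℝ) := by
  filter_upwards [h.log_ratio_le (show (0 : ℝ) < 1 / 24 by norm_num), h.exc_nonneg 0] with i h1 h2 j hj
  have h3 := h1 j hj
  have h4 := h2 j hj
  rw [exc_zero] at h4 ⊢
  have hr0 : (0 : ℝ) ≤ j / k i := by positivity
  calc _ ≤ ((1 + 2 / (1 / 24)) * (j / K[i]) ^ (-(1 / 24) : ℝ)) ^ 3 := by gcongr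
    _ = _ := by rw [mul_pow, ← rpow_mul_natCast hr0]; norm_num

lemma eventually_arg_pos_self (h : TailArray F k y) (ξ : ℝ) : ∀ᶠ i in F, 0 < 1 + ξ * E[ξ, i] 1 := by
  filter_upwards [h.pos, h.eventually_le_k 1, h.k_pos] with i h1 h2 hk
  rw [exc, one_add_mul_kFun]
  exact rpow_pos_of_pos (div_pos hk (h1 1 (mem_Icc.2 ⟨le_rfl, h2⟩))) _

variable {θ : ι → ℝ}

/-- The mean value theorem between `ξ` and `θ`, at a point that still tends to `ξ` and stays in the
domain of the likelihood equations. -/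
lemma exists_mean_value (h : TailArray F k y) {ξ : ℝ} (hξ : -1 / 2 < ξ) (hξ0 : ξ ≠ 0)
    (hθ : Tendsto θ F (𝓝 ξ)) (hD : ∀ᶠ i in F, 0 < 1 + θ i * E[ξ, i] 1) {f f' : ι → ℝ → ℝ}
    (hf : ∀ᶠ i in F, ∀ t, t ≠ 0 → (∀ j ∈ Icc 2 (k i), 0 < 1 + t * E[ξ, i] j) →
      HasDerivAt (f i) (f' i t) t) :
    ∃ t : ι → ℝ, Tendsto t F (𝓝 ξ) ∧ (∀ᶠ i in F, 0 < 1 + t i * E[ξ, i] 1) ∧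
      ∀ᶠ i in F, f i (θ i) - f i ξ = (θ i - ξ) * f' i (t i) := by
  have hDξ := h.eventually_arg_pos_self ξ
  obtain ⟨p, -, -, hb⟩ := h.inv_arg_le hξ hθ hD
  obtain ⟨p', -, -, hb'⟩ := h.inv_arg_le hξ (tendsto_const_nhds (x := ξ)) hDξ
  have hex : ∀ᶠ i in F, ∃ t ∈ uIcc ξ (θ i), f i (θ i) - f i ξ = (θ i - ξ) * f' i t := by
    filter_upwards [hb, hb', h.exc_nonneg ξ, hf,
      (tendsto_iff_norm_sub_tendsto_zero.1 hθ).eventually_lt_const (abs_pos.2 hξ0)]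
      with i h1 h2 h3 h4 h5
    refine exists_mem_uIcc_sub_eq fun t ht => h4 t ?_ fun j hj =>
      arg_pos_of_mem_uIcc (h3 j (mem_Icc_one hj)) (h2 j hj).1 (h1 j hj).1 ht
    rintro rfl
    have h6 := Set.abs_sub_left_of_mem_uIcc ht
    rw [zero_sub, abs_neg] at h6; exact h6.not_gt h5
  choose! t ht using fun i (hi : ∃ t ∈ uIcc ξ (θ i), f i (θ i) - f i ξ = (θ i - ξ) * f' i t) => hi
  refine ⟨t, ?_, ?_, hex.mono fun i hi => (ht i hi).2⟩
  · rw [tendsto_iff_norm_sub_tendsto_zero]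
    exact squeeze_zero' (Eventually.of_forall fun i => norm_nonneg _)
      (hex.mono fun i hi => Set.abs_sub_left_of_mem_uIcc (ht i hi).1)
      (tendsto_iff_norm_sub_tendsto_zero.1 hθ)
  · filter_upwards [hex, hD, hDξ, h.exc_one_pos ξ] with i h1 h2 h3 h4
    exact arg_pos_of_mem_uIcc h4.le h3 h2 (ht i h1).1

variable [F.IsCountablyGenerated]

lemma tendsto_avg_exc_cube_div (h : TailArray F k y) (hθ : Tendsto θ F (𝓝 0))
    (hD : ∀ᶠ i in F, 0 < 1 + θ i * E[0, i] 1) :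
    Tendsto (fun i => avg (k i) fun j =>
      E[0, i] j ^ 3 / (1 + θ i * E[0, i] j)) F (𝓝 6) := by
  obtain ⟨p, hp0, hp2, hb⟩ := h.inv_arg_le (by norm_num) hθ hD
  rw [← integral_neg_log_cube]
  refine tendsto_avg h.tendsto_k (p := 1 / 8 + p) (by linarith) (by linarith)
    (C := 49 ^ 3 * 6) ?_ ?_
  · filter_upwards [hb, h.exc_zero_cube_le, h.exc_nonneg 0, h.k_pos] with i hi h2 h3 hk j hj
    have hjm := mem_Icc_one hj
    have hj0 := cast_pos_of_mem hjm
    have hr0 : (0 : ℝ) < j / k i := by positivity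
    obtain ⟨h5, h6⟩ := hi j hj
    have h7 := h3 j hjm
    have h8 := h2 j hjm
    rw [abs_of_nonneg (by positivity), div_eq_mul_one_div, neg_add, rpow_add hr0]
    calc _ ≤ (49 ^ 3 * (j / K[i]) ^ (-(1 / 8) : ℝ)) * (6 * (j / K[i]) ^ (-p)) := by gcongr
      _ = _ := by ring
  · intro s hs
    have h2 : Tendsto (fun i => E[0, i] ⌈s * k i⌉₊ ^ 3 / (1 + θ i * E[0, i] ⌈s * k i⌉₊)) F (𝓝 _) :=
      ((h.tendsto_exc 0 hs).pow 3).div (h.tendsto_arg hθ hs) (by simp)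
    simpa [kFun] using h2

lemma tendsto_logRemainder (h : TailArray F k y) (hθ : Tendsto θ F (𝓝 0))
    (hD : ∀ᶠ i in F, 0 < 1 + θ i * E[0, i] 1) (hθ0 : ∀ᶠ i in F, θ i ≠ 0) :
    Tendsto (fun i => logRemainder (k i) E[0, i] (θ i)) F (𝓝 2) := by
  obtain ⟨p, hp0, hp2, hb⟩ := h.inv_arg_le (by norm_num) hθ hD
  have hI : ∫ s in (0 : ℝ)..1, (-log s) ^ 3 / 3 = 2 := by
    rw [intervalIntegral.integral_div, integral_neg_log_cube]; norm_num
  rw [← hI]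
  refine tendsto_avg h.tendsto_k (p := 1 / 8 + p) (by linarith) (by linarith)
    (C := 49 ^ 3 * 7) ?_ ?_
  · filter_upwards [hb, h.exc_zero_cube_le, h.exc_nonneg 0, h.eventually_natCast_le 1, hθ0]
      with i hi h2 h3 h4 hθi j hj
    have hjm := mem_Icc_one hj
    have hj0 := cast_pos_of_mem hjm
    have hr0 : (0 : ℝ) < j / k i := by positivity
    have hjk := cast_div_le_one hjm
    obtain ⟨h5, h6⟩ := hi j hj
    have h7 := h3 j hjm
    have h8 := h2 j hjm
    have h9 : (1 : ℝ) ≤ (j / K[i]) ^ (-p) :=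
      one_le_rpow_of_pos_of_le_one_of_nonpos hr0 hjk (by linarith)
    have h10 := abs_log_one_add_sub_le h5
    have h11 : 0 < |θ i| ^ 3 := by positivity
    rw [abs_div, abs_pow, div_le_iff₀ h11, neg_add, rpow_add hr0]
    have h13 : |θ i * E[0, i] j| ^ 3 = |θ i| ^ 3 * E[0, i] j ^ 3 := by
      rw [abs_mul, mul_pow, abs_of_nonneg h7]
    rw [h13] at h10
    have h14 : 1 + 1 / (1 + θ i * E[0, i] j) ≤ 7 * (j / K[i]) ^ (-p) := by linarith
    calc _ ≤ _ := h10
      _ ≤ |θ i| ^ 3 * (49 ^ 3 * (j / K[i]) ^ (-(1 / 8) : ℝ))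
          * (7 * (j / K[i]) ^ (-p)) := by gcongr
      _ = _ := by ring
  · intro s hs
    have h1 := h.tendsto_exc 0 hs
    have hk0 : kFun 0 s⁻¹ = -log s := by simp [kFun]
    rw [hk0] at h1
    have h2 : Tendsto (fun i => 2 * |θ i| * E[0, i] ⌈s * k i⌉₊ ^ 4) F (𝓝 0) := by
      have := (hθ.abs.const_mul 2).mul (h1.pow 4); simpa using this
    have h3 : Tendsto (fun i => |θ i * E[0, i] ⌈s * k i⌉₊|) F (𝓝 0) := by
      simpa using (hθ.mul h1).abs
    have h4 : Tendsto (fun i => (log (1 + θ i * E[0, i] ⌈s * k i⌉₊)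
        - θ i * E[0, i] ⌈s * k i⌉₊ + (θ i * E[0, i] ⌈s * k i⌉₊) ^ 2 / 2)
        / θ i ^ 3 - E[0, i] ⌈s * k i⌉₊ ^ 3 / 3) F (𝓝 0) := by
      refine squeeze_zero_norm' ?_ h2
      filter_upwards [h3.eventually_le_const (show (0 : ℝ) < 1 / 2 by norm_num), hθ0] with i h5 h6
      have h7 := abs_log_one_add_sub_cube_le h5
      set e := E[0, i] ⌈s * k i⌉₊
      have h11 : 0 < |θ i| ^ 3 := by positivity
      have e1 : (log (1 + θ i * e) - θ i * e + (θ i * e) ^ 2 / 2) / θ i ^ 3 - e ^ 3 / 3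
          = (log (1 + θ i * e) - θ i * e + (θ i * e) ^ 2 / 2 - (θ i * e) ^ 3 / 3) / θ i ^ 3 := by
        field_simp
      rw [norm_eq_abs, e1, abs_div, abs_pow, div_le_iff₀ h11]
      refine h7.trans (le_of_eq ?_)
      rw [mul_pow, ← Even.pow_abs (by decide : Even 4) (θ i)]; ring
    have h5 := h4.add ((h1.pow 3).div_const 3); simpa using h5

lemma profile_expansion_of_eq_zero (h : TailArray F k y) (hθ : Tendsto θ F (𝓝 0))
    (hD : ∀ᶠ i in F, 0 < 1 + θ i * E[0, i] 1) (hθ0 : ∀ᶠ i in F, θ i ≠ 0) :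
    ∃ S : ι → ℝ, Tendsto S F (𝓝 (-1)) ∧ ∀ ε > (0 : ℝ), ∀ᶠ i in F,
      |(profile (k i) E[0, i] (θ i) - 1) / θ i ^ 2 - θ i * S i| ≤ K[i] ^ (-1 / 2 + ε) := by
  set m := fun i => avg (k i) E[0, i]
  set S2 := fun i => avg (k i) (fun j => E[0, i] j ^ 2)
  set C3 := fun i => avg (k i) (fun j =>
      E[0, i] j ^ 3 / (1 + θ i * E[0, i] j)) with hC3
  set D3 := fun i => logRemainder (k i) E[0, i] (θ i)
  have tm : Tendsto m F (𝓝 1) := h.tendsto_of_rate fun ε hε => h.avg_exc_zero_rate hε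
  have tS : Tendsto S2 F (𝓝 2) := h.tendsto_of_rate fun ε hε => h.avg_exc_zero_sq_rate hε
  have tC : Tendsto C3 F (𝓝 6) := h.tendsto_avg_exc_cube_div hθ hD
  have tD : Tendsto D3 F (𝓝 2) := h.tendsto_logRemainder hθ hD hθ0
  obtain ⟨p, -, -, hb⟩ := h.inv_arg_le (by norm_num) hθ hD
  set S : ι → ℝ := fun i => D3 i + 3 * m i * S2 i / 2 - C3 i
    + θ i * (-m i * D3 i - S2 i ^ 2 / 2 - C3 i * m i)
    + θ i ^ 2 * (S2 i * D3 i + C3 i * S2 i / 2) - θ i ^ 3 * (C3 i * D3 i) with hS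
  refine ⟨S, ?_, ?_⟩
  · have key : Tendsto S F (𝓝 _) :=
      (((tD.add (((tm.const_mul 3).mul tS).div_const 2)).sub tC).add
      (hθ.mul (((tm.neg.mul tD).sub ((tS.pow 2).div_const 2)).sub (tC.mul tm)))).add
      ((hθ.pow 2).mul ((tS.mul tD).add ((tC.mul tS).div_const 2))) |>.sub
      ((hθ.pow 3).mul (tC.mul tD))
    convert key using 2; norm_num
  · intro ε hε
    filter_upwards [h.avg_exc_zero_rate (half_pos hε), h.avg_exc_zero_sq_rate (half_pos hε), hb,
      hθ0, tm.eventually_lt_const (show (1 : ℝ) < 2 by norm_num),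
      tm.eventually_const_lt (show (0 : ℝ) < 1 by norm_num),
      h.eventually_le_k 2,
      h.mul_rpow_le (show -1 / 2 + ε / 2 < -1 / 2 + ε by linarith) 4]
      with i h1 h2 h3 h4 h5 h6 h7 h8
    have e : (profile (k i) E[0, i] (θ i) - 1) / θ i ^ 2 - θ i * S i
        = (S2 i - 2) / 2 - (m i - 1) * (m i + 1) := by
      rw [sub_eq_iff_eq_add, div_eq_iff (pow_ne_zero 2 h4), profile,
        avgInv_eq_expansion h7 (fun j hj => (h3 j hj).1), one_add_avgLog_eq_expansion _ h4, hS]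
      change (1 - θ i * m i + θ i ^ 2 * S2 i - θ i ^ 3 * C3 i)
        * (1 + θ i * m i - θ i ^ 2 * (S2 i / 2) + θ i ^ 3 * D3 i) - 1 = _
      ring
    rw [e]
    change |m i - 1| ≤ _ at h1
    change |S2 i - 2| ≤ _ at h2
    calc _ ≤ |(S2 i - 2) / 2| + |(m i - 1) * (m i + 1)| := abs_sub _ _
      _ = |S2 i - 2| / 2 + |m i - 1| * (m i + 1) := by
        rw [abs_div, abs_mul, abs_two, abs_of_pos (show 0 < m i + 1 by linarith)]
      _ ≤ 4 * K[i] ^ (-1 / 2 + ε / 2) := by nlinarith [abs_nonneg (m i - 1)]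
      _ ≤ _ := h8

lemma profile_expansion_of_ne_zero (h : TailArray F k y) {ξ : ℝ} (hξ : -1 / 2 < ξ) (hξ0 : ξ ≠ 0)
    (hθ : Tendsto θ F (𝓝 ξ)) (hD : ∀ᶠ i in F, 0 < 1 + θ i * E[ξ, i] 1) :
    ∃ S : ι → ℝ, Tendsto S F (𝓝 (-1 / ((1 + 2 * ξ) * (1 + ξ) ^ 2))) ∧ ∀ ε > (0 : ℝ), ∀ᶠ i in F,
      |(profile (k i) E[ξ, i] (θ i) - 1) / θ i ^ 2 - (θ i - ξ) * S i|
        ≤ K[i] ^ (-1 / 2 + ε) := by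
  set P' : ι → ℝ → ℝ := fun i t =>
    (avg (k i) (fun j => 1 / (1 + t * E[ξ, i] j) ^ 2)
      - avgInv (k i) E[ξ, i] t) / t * (1 + avgLog (k i) E[ξ, i] t)
      + avgInv (k i) E[ξ, i] t * ((1 - avgInv (k i) E[ξ, i] t) / t) with hP'
  obtain ⟨t, htt, hDt, hex⟩ := h.exists_mean_value hξ hξ0 hθ hD (f' := P')
    ((h.eventually_le_k 2).mono fun i hi t ht hpos => hasDerivAt_profile hi ht hpos)
  have tP : Tendsto (fun i => P' i (t i)) F (𝓝 (-ξ ^ 2 / ((1 + 2 * ξ) * (1 + ξ) ^ 2))) := by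
    have t1 := h.tendsto_avgInv hξ htt hDt
    have t2 := h.tendsto_avgInvSq hξ htt hDt
    have t3 := h.tendsto_avgLog hξ htt hDt
    have key : Tendsto (fun i => P' i (t i)) F (𝓝 _) :=
      (((t2.sub t1).div htt hξ0).mul (t3.const_add 1)).add
      (t1.mul ((t1.const_sub 1).div htt hξ0))
    convert key using 2
    have q1 : 1 + ξ ≠ 0 := by linarith
    have q2 : 1 + 2 * ξ ≠ 0 := by linarith
    have e1 : 1 / (1 + 2 * ξ) - 1 / (1 + ξ) = -ξ / ((1 + 2 * ξ) * (1 + ξ)) := by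
      rw [div_sub_div _ _ q2 q1]; ring
    have e2 : 1 - 1 / (1 + ξ) = ξ / (1 + ξ) := by rw [one_sub_div q1]; ring
    have e3 : -ξ / ((1 + 2 * ξ) * (1 + ξ)) / ξ = -1 / ((1 + 2 * ξ) * (1 + ξ)) := by
      rw [div_right_comm, neg_div_self hξ0]
    have e4 : ξ / (1 + ξ) / ξ = 1 / (1 + ξ) := by rw [div_right_comm, div_self hξ0]
    rw [e1, e2, e3, e4, div_mul_eq_mul_div, div_mul_div_comm, div_add_div _ _ (by positivity)
      (by positivity), div_eq_div_iff (by positivity) (by positivity)]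
    ring
  refine ⟨fun i => P' i (t i) / θ i ^ 2, ?_, ?_⟩
  · have key : Tendsto (fun i => P' i (t i) / θ i ^ 2) F (𝓝 _) :=
      tP.div (hθ.pow 2) (pow_ne_zero 2 hξ0)
    convert key using 2
    rw [div_right_comm, neg_div_self (pow_ne_zero 2 hξ0)]
  · intro ε hε
    filter_upwards [hex, h.avgInv_rate hξ (half_pos hε), h.avgLog_rate ξ (half_pos hε),
      ((hθ.pow 2).eventually_const_lt (show ξ ^ 2 / 2 < ξ ^ 2 by
        have : 0 < ξ ^ 2 := by positivity
        linarith)),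
      h.mul_rpow_le (show -1 / 2 + ε / 2 < -1 / 2 + ε by linarith)
        ((2 + |ξ| + 1 / (1 + ξ)) / (ξ ^ 2 / 2)),
      (h.tendsto_rpow_neg (show -1 / 2 + 1 / 4 < (0 : ℝ) by norm_num)).eventually_le_const one_pos,
      h.avgLog_rate ξ (show (0 : ℝ) < 1 / 4 by norm_num)]
      with i h1 h2 h3 h4 h5 h6 h7
    have hξ2 : 0 < ξ ^ 2 := by positivity
    have hθ2 : 0 < θ i ^ 2 := by linarith
    have e : (profile (k i) E[ξ, i] (θ i) - 1) / θ i ^ 2 - (θ i - ξ) * (P' i (t i) / θ i ^ 2)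
        = (profile (k i) E[ξ, i] ξ - 1) / θ i ^ 2 := by rw [← mul_div_assoc, ← h1]; ring
    rw [e, abs_div, abs_of_pos hθ2]
    set M := avgInv (k i) E[ξ, i] ξ
    set L := avgLog (k i) E[ξ, i] ξ
    have q1 : 0 < 1 + ξ := by linarith
    have e2 : profile (k i) E[ξ, i] ξ - 1
        = (M - 1 / (1 + ξ)) * (1 + L) + 1 / (1 + ξ) * (L - ξ) := by
      change M * (1 + L) - 1 = _; field_simp; ring
    have e3 : |1 + L| ≤ 2 + |ξ| := by
      have : 1 + L = 1 + ξ + (L - ξ) := by ring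
      rw [this]
      refine (abs_add_le _ _).trans ?_
      have := abs_add_le 1 ξ
      rw [abs_one] at this; linarith
    have e4 : |profile (k i) E[ξ, i] ξ - 1|
        ≤ (2 + |ξ| + 1 / (1 + ξ)) * K[i] ^ (-1 / 2 + ε / 2) := by
      rw [e2]
      refine (abs_add_le _ _).trans ?_
      rw [abs_mul, abs_mul, abs_of_pos (one_div_pos.2 q1)]
      calc |M - 1 / (1 + ξ)| * |1 + L| + 1 / (1 + ξ) * |L - ξ|
          ≤ K[i] ^ (-1 / 2 + ε / 2) * (2 + |ξ|)
            + 1 / (1 + ξ) * K[i] ^ (-1 / 2 + ε / 2) := by gcongr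
        _ = _ := by ring
    calc _ ≤ ((2 + |ξ| + 1 / (1 + ξ)) * K[i] ^ (-1 / 2 + ε / 2)) / (ξ ^ 2 / 2) := by gcongr
      _ = ((2 + |ξ| + 1 / (1 + ξ)) / (ξ ^ 2 / 2)) * K[i] ^ (-1 / 2 + ε / 2) := by ring
      _ ≤ _ := h5

/-- Local behaviour of the profile function near the true parameter: after division by `θ ^ 2` it
is a linear function of `θ - ξ` with a negative slope, up to an error of order almost
`k ^ (-1/2)`. The point `θ = 0` is a double zero of `profile - 1`, which is why the case `ξ = 0`
needs third-order expansions while for `ξ ≠ 0` the mean value theorem suffices. -/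
lemma profile_expansion (h : TailArray F k y) {ξ : ℝ} (hξ : -1 / 2 < ξ)
    (hθ : Tendsto θ F (𝓝 ξ)) (hD : ∀ᶠ i in F, 0 < 1 + θ i * E[ξ, i] 1)
    (hθ0 : ∀ᶠ i in F, θ i ≠ 0) :
    ∃ S : ι → ℝ, Tendsto S F (𝓝 (-1 / ((1 + 2 * ξ) * (1 + ξ) ^ 2))) ∧ ∀ ε > (0 : ℝ), ∀ᶠ i in F,
      |(profile (k i) E[ξ, i] (θ i) - 1) / θ i ^ 2 - (θ i - ξ) * S i|
        ≤ K[i] ^ (-1 / 2 + ε) := by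
  by_cases hξ0 : ξ = 0
  · subst hξ0; simpa using h.profile_expansion_of_eq_zero hθ hD hθ0
  · exact h.profile_expansion_of_ne_zero hξ hξ0 hθ hD

end TailArray

/-! ### The level at a consistent root -/

/-- The exponent `ℓ = log (1 + θ h₁) / (σ θ)`, for which `(1 + θ h₁) ^ (-1 / (σ θ)) = exp (-ℓ)`. -/
def level (h₁ θ σ : ℝ) : ℝ := log (1 + θ * h₁) / (σ * θ)

/-- The pseudo-likelihood equations for exceedances `h j`, in the parameters `θ` and `σ`, the shape
being `σ θ`; the two fractional powers of `1 + θ h 1` are written with `exp (-level)`. -/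
structure ScaledRoot (k : ℕ) (h : ℕ → ℝ) (θ σ : ℝ) : Prop where
  ne_zero : θ ≠ 0
  scale_pos : 0 < σ
  arg_pos : 0 < 1 + θ * h 1
  eq_log : avgLog k h θ + exp (-level (h 1) θ σ) * log (1 + θ * h 1)
    / (1 - exp (-level (h 1) θ σ)) = σ * θ
  eq_inv : avgInv k h θ = 1 / (1 + σ * θ) * ((1 - exp (-level (h 1) θ σ) / (1 + θ * h 1))
    / (1 - exp (-level (h 1) θ σ)))

lemma level_pos {h₁ θ σ : ℝ} (hθ : θ ≠ 0) (hσ : 0 < σ) (hb : 0 < 1 + θ * h₁) (h0 : 0 < h₁) :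
    0 < level h₁ θ σ := by
  unfold level
  rcases lt_or_gt_of_ne hθ with h | h
  · exact div_pos_of_neg_of_neg (log_neg hb (by nlinarith)) (by nlinarith)
  · exact div_pos (log_pos (by nlinarith)) (by positivity)

lemma exp_level_mul {h₁ θ σ : ℝ} (hθ : θ ≠ 0) (hσ : 0 < σ) (hb : 0 < 1 + θ * h₁) :
    exp (level h₁ θ σ * (σ * θ)) = 1 + θ * h₁ := by
  unfold level; rw [div_mul_cancel₀ _ (mul_ne_zero hσ.ne' hθ), exp_log hb]

lemma ScaledRoot.profile_sub_one {k : ℕ} {h : ℕ → ℝ} {θ σ : ℝ} (hr : ScaledRoot k h θ σ)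
    (h0 : 0 < h 1) (hs : 1 + σ * θ ≠ 0) :
    profile k h θ - 1 = exp (-level (h 1) θ σ) / (1 - exp (-level (h 1) θ σ))
      * (1 - 1 / (1 + θ * h 1) - avgInv k h θ * log (1 + θ * h 1)) := by
  have hl := level_pos hr.ne_zero hr.scale_pos hr.arg_pos h0
  have h1 := hr.eq_log
  have h2 := hr.eq_inv
  have hb := hr.arg_pos.ne'
  have hu : 1 - exp (-level (h 1) θ σ) ≠ 0 := by
    have : exp (-level (h 1) θ σ) < 1 := by rw [exp_lt_one_iff]; linarith
    linarith
  rw [profile]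
  generalize exp (-level (h 1) θ σ) = u at *
  generalize log (1 + θ * h 1) = lb at *
  generalize 1 + θ * h 1 = b at *
  generalize avgInv k h θ = M at *
  have h3 : 1 + avgLog k h θ = (1 + σ * θ) - u * lb / (1 - u) := by linarith
  have h4 : M * (1 + σ * θ) = (1 - u / b) / (1 - u) := by rw [h2]; field_simp
  have h5 : M * (1 + avgLog k h θ) - 1 = (1 - u / b) / (1 - u) - M * (u * lb / (1 - u)) - 1 := by
    rw [h3, mul_sub, h4]
  rw [h5]
  field_simp; ring

lemma abs_one_sub_inv_sub_log_le {b : ℝ} (hb : 0 < b) :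
    |1 - 1 / b - log b| ≤ log b ^ 2 * (1 + 1 / b) := by
  have h1 := log_le_sub_one_of_pos (one_div_pos.2 hb)
  rw [one_div, log_inv, ← one_div] at h1
  have h2 := add_one_le_exp (log b)
  rw [exp_log hb] at h2
  have h3 := one_div_pos.2 hb
  rw [abs_le]
  refine ⟨?_, by nlinarith [sq_nonneg (log b), mul_nonneg (sq_nonneg (log b)) h3.le]⟩
  generalize log b = l at *
  rcases le_total 0 l with hl | hl
  · have : 1 / b ≤ 1 / (1 + l) := one_div_le_one_div_of_le (by linarith) (by linarith)
    have h4 : l - 1 + 1 / (1 + l) ≤ l ^ 2 := by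
      rw [← le_sub_iff_add_le', div_le_iff₀ (by linarith)]; nlinarith [mul_nonneg hl (sq_nonneg l)]
    have : 0 ≤ l ^ 2 * (1 / b) := by positivity
    nlinarith
  · have h4 : (l - 1) * b + 1 ≤ l ^ 2 := by nlinarith
    have h5 := mul_le_mul_of_nonneg_right h4 h3.le
    have h6 : ((l - 1) * b + 1) * (1 / b) = l - 1 + 1 / b := by field_simp
    rw [h6] at h5
    nlinarith [sq_nonneg l]

namespace TailArray

variable {ι : Type*} {F : Filter ι} {k : ι → ℕ} {y : ι → ℕ → ℝ} {θ σ : ι → ℝ}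

local notation:max "E[" ξ ", " i "]" => exc ξ (k i) (y i)
local notation:max "L[" ξ ", " i "]" => level (E[ξ, i] 1) (θ i) (σ i)

/-- The contribution of the largest exceedance to the profile equation, relative to `θ ^ 2`. -/
lemma first_term_bound [F.IsCountablyGenerated] (h : TailArray F k y) {ξ : ℝ} (hξ : -1 / 2 < ξ)
    (hθ : Tendsto θ F (𝓝 ξ)) (hD : ∀ᶠ i in F, 0 < 1 + θ i * E[ξ, i] 1)
    (hθ0 : ∀ᶠ i in F, θ i ≠ 0) :
    ∃ C : ℝ, 0 < C ∧ ∀ᶠ i in F, |(1 - 1 / (1 + θ i * E[ξ, i] 1)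
        - avgInv (k i) E[ξ, i] (θ i) * log (1 + θ i * E[ξ, i] 1)) / θ i ^ 2|
      ≤ C * ((1 + (log (1 + θ i * E[ξ, i] 1) / θ i) ^ 2) * (1 + 1 / (1 + θ i * E[ξ, i] 1))) := by
  by_cases hξ0 : ξ = 0
  · subst hξ0
    obtain ⟨p, -, -, hb⟩ := h.inv_arg_le (by norm_num) hθ hD
    have tm := h.tendsto_of_rate fun ε hε => h.avg_exc_zero_rate hε
    have tS := h.tendsto_of_rate fun ε hε => h.avg_exc_zero_sq_rate hε
    have tC := h.tendsto_avg_exc_cube_div hθ hD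
    have tG := ((tm.sub (hθ.mul tS)).add ((hθ.pow 2).mul tC)).abs
    norm_num at tG
    refine ⟨3, by norm_num, ?_⟩
    filter_upwards [hD, hθ0, tG.eventually_le_const one_lt_two, hb,
      h.eventually_le_k 2] with i h1 h2 h3 h4 h5
    have e := avgInv_eq_expansion h5 fun j hj => (h4 j hj).1
    set G := avg (k i) E[0, i] - θ i * avg (k i) (fun j => E[0, i] j ^ 2)
      + θ i ^ 2 * avg (k i) (fun j => E[0, i] j ^ 3 / (1 + θ i * E[0, i] j)) with hG
    have e' : avgInv (k i) E[0, i] (θ i) = 1 - θ i * G := by rw [e, hG]; ring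
    rw [e']
    have h6 := abs_one_sub_inv_sub_log_le h1
    generalize 1 + θ i * E[0, i] 1 = b at *
    set lb := log b
    have h7 : 0 < θ i ^ 2 := by positivity
    rw [abs_div, abs_of_pos h7, div_le_iff₀ h7]
    have e2 : 1 - 1 / b - (1 - θ i * G) * lb
        = (1 - 1 / b - lb) + θ i ^ 2 * (G * (lb / θ i)) := by field_simp; ring
    have e3 : lb ^ 2 = θ i ^ 2 * (lb / θ i) ^ 2 := by field_simp
    rw [e3] at h6
    set w := lb / θ i
    rw [e2]
    have h9 : |G * w| ≤ 2 * (1 + w ^ 2) := by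
      rw [abs_mul]
      have : |w| ≤ 1 + w ^ 2 := by nlinarith [sq_nonneg (|w| - 1), sq_abs w]
      exact mul_le_mul h3 this (abs_nonneg _) (by norm_num)
    calc |1 - 1 / b - lb + θ i ^ 2 * (G * w)|
        ≤ |1 - 1 / b - lb| + |θ i ^ 2 * (G * w)| := abs_add_le _ _
      _ ≤ θ i ^ 2 * w ^ 2 * (1 + 1 / b) + θ i ^ 2 * (2 * (1 + w ^ 2)) := by
          rw [abs_mul, abs_of_pos h7]; gcongr
      _ ≤ _ := by
          have q1 : 0 ≤ θ i ^ 2 * (1 / b) := by positivity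
          have q2 : 0 ≤ θ i ^ 2 * w ^ 2 * (1 / b) := by positivity
          nlinarith
  · have tM := (h.tendsto_avgInv hξ hθ hD).abs
    set M₀ := |1 / (1 + ξ)| + 1
    refine ⟨(1 + M₀ * (|ξ| + 1)) / (ξ ^ 2 / 2), by positivity, ?_⟩
    filter_upwards [hD, hθ0, tM.eventually_le_const (lt_add_one _),
      hθ.abs.eventually_le_const (lt_add_one _), ((hθ.pow 2).eventually_const_lt
        (show ξ ^ 2 / 2 < ξ ^ 2 by
          have : 0 < ξ ^ 2 := by positivity
          linarith))] with i h1 h2 h3 h4 h5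
    have hξ2 : 0 < ξ ^ 2 := by positivity
    have h6 := one_div_pos.2 h1
    generalize 1 + θ i * E[ξ, i] 1 = b at *
    generalize avgInv (k i) E[ξ, i] (θ i) = M at *
    have e3 : log b = θ i * (log b / θ i) := by field_simp
    set w := log b / θ i
    rw [abs_div, abs_of_pos (show 0 < θ i ^ 2 by linarith), div_mul_eq_mul_div]
    have h7 : |w| ≤ 1 + w ^ 2 := by nlinarith [sq_nonneg (|w| - 1), sq_abs w]
    have h8 : |1 - 1 / b - M * log b| ≤ (1 + 1 / b) + M₀ * ((|ξ| + 1) * (1 + w ^ 2)) := by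
      refine (abs_sub _ _).trans ?_
      refine add_le_add ?_ ?_
      · rw [abs_le]; constructor <;> linarith
      · rw [e3, abs_mul, abs_mul]; gcongr
    have h9 : (1 + 1 / b) + M₀ * ((|ξ| + 1) * (1 + w ^ 2))
        ≤ (1 + M₀ * (|ξ| + 1)) * ((1 + w ^ 2) * (1 + 1 / b)) := by
      have q1 : 0 ≤ w ^ 2 * (1 + 1 / b) := by positivity
      have q2 : 0 ≤ M₀ * (|ξ| + 1) * ((1 + w ^ 2) * (1 / b)) := by positivity
      nlinarith
    gcongr
    exact h8.trans h9

lemma level_term_le {C : ℝ} {ξ : ℝ} {ℓ : ι → ℝ} (hξ : -1 / 2 < ξ) (hℓ : Tendsto ℓ F atTop)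
    (hσ : ∀ᶠ i in F, 0 < σ i ∧ σ i ≤ 2)
    (hσθ : ∀ᶠ i in F, -1 / 2 + (1 / 2 + ξ) / 2 ≤ σ i * θ i) :
    ∀ᶠ i in F, C * (exp (-ℓ i) / (1 - exp (-ℓ i)) * ((1 + (ℓ i * σ i) ^ 2)
      * (1 + 1 / exp (ℓ i * (σ i * θ i))))) ≤ exp (-(ℓ i / 2)) := by
  set d := min ((1 / 2 + ξ) / 2) (1 / 2)
  have hd0 : 0 < d := lt_min (by linarith) (by norm_num)
  have h1 : Tendsto (fun i => |C| * 4 * (1 * exp (-d * ℓ i)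
      + 4 * (ℓ i ^ (2 : ℝ) * exp (-d * ℓ i)))) F (𝓝 0) := by
    have a1 := (tendsto_rpow_mul_exp_neg_mul_atTop_nhds_zero 2 d hd0).comp hℓ
    have a2 := (tendsto_rpow_mul_exp_neg_mul_atTop_nhds_zero 0 d hd0).comp hℓ
    simp only [Function.comp_def, rpow_zero] at a1 a2
    simpa using ((a2).add (a1.const_mul 4)).const_mul (|C| * 4)
  filter_upwards [h1.eventually_le_const one_pos, hσ, hσθ, hℓ.eventually_ge_atTop 1]
    with i g1 g2 g3 g4
  set l := ℓ i
  have hu : exp (-l) ≤ 1 / 2 := by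
    have := exp_le_exp.2 (neg_le_neg g4)
    have h2 : exp (-1) ≤ 1 / 2 := by
      rw [exp_neg, inv_le_comm₀ (exp_pos _) (by norm_num)]
      have := add_one_le_exp (1 : ℝ)
      norm_num at this ⊢; exact this
    linarith
  have e1 : exp (-l) / (1 - exp (-l)) ≤ 2 * exp (-l) := by
    rw [div_le_iff₀ (by linarith)]; nlinarith [exp_pos (-l)]
  have e2 : 1 + (l * σ i) ^ 2 ≤ 1 + 4 * l ^ (2 : ℝ) := by
    have : σ i ^ 2 ≤ 4 := by nlinarith
    rw [mul_pow, rpow_two]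
    nlinarith [sq_nonneg l]
  have e3 : exp (-l) * (1 + 1 / exp (l * (σ i * θ i))) ≤ 2 * (exp (-(l / 2)) * exp (-d * l)) := by
    rw [one_div, ← exp_neg, mul_add, mul_one, ← exp_add, ← exp_add]
    have d1 : d ≤ (1 / 2 + ξ) / 2 := min_le_left _ _
    have d2 : d ≤ 1 / 2 := min_le_right _ _
    have q1 : exp (-l) ≤ exp (-(l / 2) + -d * l) := by apply exp_le_exp.2; nlinarith
    have q2 : exp (-l + -(l * (σ i * θ i))) ≤ exp (-(l / 2) + -d * l) := by
      apply exp_le_exp.2; nlinarith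
    linarith
  have hu0 := exp_pos (-l)
  have h0 : 0 ≤ exp (-l) / (1 - exp (-l)) := div_nonneg hu0.le (by linarith)
  calc C * (exp (-l) / (1 - exp (-l)) * ((1 + (l * σ i) ^ 2)
        * (1 + 1 / exp (l * (σ i * θ i)))))
      ≤ |C| * (2 * exp (-l) * ((1 + 4 * l ^ (2 : ℝ)) * (1 + 1 / exp (l * (σ i * θ i))))) := by
        gcongr; exact le_abs_self C
    _ = |C| * 2 * (1 + 4 * l ^ (2 : ℝ)) * (exp (-l) * (1 + 1 / exp (l * (σ i * θ i)))) := by ring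
    _ ≤ |C| * 2 * (1 + 4 * l ^ (2 : ℝ)) * (2 * (exp (-(l / 2)) * exp (-d * l))) := by gcongr
    _ = (|C| * 4 * (1 * exp (-d * l) + 4 * (l ^ (2 : ℝ) * exp (-d * l))))
        * exp (-(l / 2)) := by ring
    _ ≤ 1 * exp (-(l / 2)) := by gcongr
    _ = _ := one_mul _

/-- A root is close to the true parameter, up to a term that is exponentially small in `level`. -/
lemma abs_sub_le_of_root [F.IsCountablyGenerated] (h : TailArray F k y) {ξ : ℝ} (hξ : -1 / 2 < ξ)
    (hθ : Tendsto θ F (𝓝 ξ)) (hσ : Tendsto σ F (𝓝 1))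
    (hr : ∀ᶠ i in F, ScaledRoot (k i) E[ξ, i] (θ i) (σ i))
    (hℓ : Tendsto (fun i => L[ξ, i]) F atTop) {ε : ℝ}
    (hε : 0 < ε) :
    ∀ᶠ i in F, |θ i - ξ| ≤ (k i : ℝ) ^ (-1 / 2 + ε)
      + exp (-(L[ξ, i] / 2)) := by
  have hD : ∀ᶠ i in F, 0 < 1 + θ i * E[ξ, i] 1 := hr.mono fun i hi => hi.arg_pos
  have hθ0 : ∀ᶠ i in F, θ i ≠ 0 := hr.mono fun i hi => hi.ne_zero
  obtain ⟨C, hC0, hC⟩ := h.first_term_bound hξ hθ hD hθ0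
  obtain ⟨S, hS, hexp⟩ := h.profile_expansion hξ hθ hD hθ0
  set s₀ := 1 / ((1 + 2 * ξ) * (1 + ξ) ^ 2)
  have q1 : 0 < 1 + 2 * ξ := by linarith
  have q2 : 0 < 1 + ξ := by linarith
  have hs₀p : 0 < s₀ := by positivity
  rw [neg_div] at hS
  have hσθ : Tendsto (fun i => σ i * θ i) F (𝓝 ξ) := by simpa using hσ.mul hθ
  have hσe : ∀ᶠ i in F, 0 < σ i ∧ σ i ≤ 2 :=
    (hσ.eventually_const_lt one_pos).and (hσ.eventually_le_const one_lt_two)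
  have hσθe : ∀ᶠ i in F, -1 / 2 + (1 / 2 + ξ) / 2 ≤ σ i * θ i :=
    hσθ.eventually_const_le (by linarith)
  filter_upwards [level_term_le (C := C / (s₀ / 2)) hξ hℓ hσe hσθe, hC, hr, hexp _ (half_pos hε),
    h.exc_one_pos ξ, hσe, hσθe, hS.eventually_le_const (show -s₀ < -(s₀ / 2) by linarith),
    h.mul_rpow_le (show -1 / 2 + ε / 2 < -1 / 2 + ε by linarith) (1 / (s₀ / 2))]
    with i g1 g2 g3 g4 g5 g6 g7 g8 g9
  have hθi := g3.ne_zero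
  have hl := level_pos g3.ne_zero g3.scale_pos g3.arg_pos g5
  have e1 := g3.profile_sub_one g5 (by linarith)
  rw [exp_level_mul g3.ne_zero g3.scale_pos g3.arg_pos] at g1
  have e2 : L[ξ, i] * σ i = log (1 + θ i * E[ξ, i] 1) / θ i := by
    unfold level
    have := g6.1.ne'; field_simp
  rw [e2] at g1
  rw [e1, mul_div_assoc] at g4
  have hu : 0 < 1 - exp (-L[ξ, i]) := by
    have : exp (-L[ξ, i]) < 1 := by rw [exp_lt_one_iff]; linarith
    linarith
  set u := exp (-L[ξ, i])
  have hu1 : 0 < u / (1 - u) := by positivity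
  set η := (1 - 1 / (1 + θ i * E[ξ, i] 1)
        - avgInv (k i) E[ξ, i] (θ i) * log (1 + θ i * E[ξ, i] 1)) / θ i ^ 2
  have e3 : |(θ i - ξ) * S i| ≤ (k i : ℝ) ^ (-1 / 2 + ε / 2) + u / (1 - u) * |η| := by
    have := abs_sub_abs_le_abs_sub ((θ i - ξ) * S i) (u / (1 - u) * η)
    rw [abs_sub_comm, abs_mul (u / (1 - u)), abs_of_pos hu1] at this; linarith
  have e4 : |θ i - ξ| * (s₀ / 2) ≤ |(θ i - ξ) * S i| := by
    rw [abs_mul]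
    gcongr
    rw [abs_of_neg (by linarith)]; linarith
  set W := (1 + (log (1 + θ i * E[ξ, i] 1) / θ i) ^ 2) * (1 + 1 / (1 + θ i * E[ξ, i] 1))
  have e5 : u / (1 - u) * |η| ≤ u / (1 - u) * (C * W) := by gcongr
  have e6 : |θ i - ξ| ≤ 1 / (s₀ / 2) * (k i : ℝ) ^ (-1 / 2 + ε / 2)
      + C / (s₀ / 2) * (u / (1 - u) * W) := by
    have : |θ i - ξ| * (s₀ / 2) ≤ (k i : ℝ) ^ (-1 / 2 + ε / 2) + u / (1 - u) * (C * W) := by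
      linarith
    rw [← le_div_iff₀ (by positivity)] at this
    refine this.trans (le_of_eq ?_); ring
  linarith

end TailArray

/-- Monotonicity of `log (1 + θ h) / θ` in `θ`, in a rough form. -/
lemma min_le_log_div {h θ : ℝ} (hθ : θ ≠ 0) (hb : 0 < 1 + θ * h) (h0 : 0 < h) :
    min h (1 / |θ|) / 2 ≤ log (1 + θ * h) / θ := by
  rcases lt_or_gt_of_ne hθ with hn | hp
  · have h1 := log_le_sub_one_of_pos hb
    have h2 : h ≤ log (1 + θ * h) / θ := by rw [le_div_iff_of_neg hn]; linarith
    have := min_le_left h (1 / |θ|); linarith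
  · have h1 := log_le_sub_one_of_pos (one_div_pos.2 hb)
    rw [one_div, log_inv] at h1
    rw [le_div_iff₀ hp, abs_of_pos hp]
    refine le_trans ?_ (show 1 - (1 + θ * h)⁻¹ ≤ _ by linarith)
    have e : 1 - (1 + θ * h)⁻¹ = θ * h / (1 + θ * h) := by field_simp; ring
    rw [e, le_div_iff₀ hb]
    have hθh : 0 < θ * h := by positivity
    rcases le_total h (1 / θ) with hc | hc
    · rw [min_eq_left hc]; rw [le_div_iff₀ hp] at hc; nlinarith
    · rw [min_eq_right hc]
      rw [div_le_iff₀ hp] at hc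
      field_simp; nlinarith

lemma abs_log_one_add_sub_self_le {z : ℝ} (hz : |z| ≤ 1 / 2) :
    |log (1 + z) - z| ≤ 2 * z ^ 2 := by
  have hb : 0 < 1 + z := by linarith [(abs_le.1 hz).1]
  have h1 := abs_log_one_add_sub_le hb
  have h2 : 1 / (1 + z) ≤ 2 := by rw [div_le_iff₀ hb]; linarith [(abs_le.1 hz).1]
  have h3 := abs_sub (log (1 + z) - z + z ^ 2 / 2) (z ^ 2 / 2)
  rw [add_sub_cancel_right, abs_of_nonneg (by positivity : 0 ≤ z ^ 2 / 2)] at h3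
  nlinarith [mul_le_mul_of_nonneg_left h2 (pow_nonneg (abs_nonneg z) 3), sq_abs z, sq_nonneg |z|]

lemma abs_log_one_add_le {z : ℝ} (hz : |z| ≤ 1 / 2) : |log (1 + z)| ≤ 2 * |z| := by
  have h := abs_log_one_add_sub_self_le hz
  have e := abs_sub_abs_le_abs_sub (log (1 + z)) z
  nlinarith [sq_abs z, abs_nonneg z]

lemma one_add_mul_exc_eq (ξ θ : ℝ) (k : ℕ) (y : ℕ → ℝ) :
    1 + θ * exc ξ k y 1 = (k / y 1) ^ ξ + (θ - ξ) * exc ξ k y 1 := by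
  rw [← one_add_mul_kFun, exc]; ring

namespace TailArray

variable {ι : Type*} {F : Filter ι} {k : ι → ℕ} {y : ι → ℕ → ℝ} {θ σ : ι → ℝ}

local notation:max "K[" i "]" => (k i : ℝ)
local notation:max "E[" ξ ", " i "]" => exc ξ (k i) (y i)
local notation:max "L[" ξ ", " i "]" => level (E[ξ, i] 1) (θ i) (σ i)

lemma one_mem (h : TailArray F k y) : ∀ᶠ i in F, 1 ∈ Icc 1 (k i) := by
  filter_upwards [h.eventually_le_k 1] with i hi; exact mem_Icc.2 ⟨le_rfl, hi⟩

lemma tendsto_natCast (h : TailArray F k y) : Tendsto (fun i => K[i]) F atTop :=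
  tendsto_natCast_atTop_atTop.comp h.tendsto_k

lemma tendsto_log (h : TailArray F k y) : Tendsto (fun i => log (k i)) F atTop :=
  tendsto_log_atTop.comp h.tendsto_natCast

lemma ratio_nonneg (h : TailArray F k y) : ∀ᶠ i in F, 0 ≤ K[i] / y i 1 := by
  filter_upwards [h.pos, h.one_mem] with i h1 h2; exact div_nonneg (Nat.cast_nonneg _) (h1 1 h2).le

lemma ratio_one_ge (h : TailArray F k y) {ε : ℝ} (hε : 0 < ε) :
    ∀ᶠ i in F, K[i] ^ (1 - ε) ≤ k i / y i 1 := by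
  filter_upwards [h.upper ε hε, h.pos, h.one_mem, h.k_pos] with i h1 h2 h3 hk
  have := h1 1 h3
  rw [Nat.cast_one, mul_one] at this
  rw [le_div_iff₀ (h2 1 h3)]
  calc K[i] ^ (1 - ε) * y i 1 ≤ K[i] ^ (1 - ε) * K[i] ^ ε := by gcongr
    _ = k i := by rw [← rpow_add hk]; simp

lemma ratio_one_le (h : TailArray F k y) {ε : ℝ} (hε : 0 < ε) :
    ∀ᶠ i in F, k i / y i 1 ≤ K[i] ^ (1 + ε) := by
  filter_upwards [h.lower ε hε, h.pos, h.one_mem, h.k_pos] with i h1 h2 h3 hk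
  have := h1 1 h3
  rw [Nat.cast_one, mul_one] at this
  rw [div_le_iff₀ (h2 1 h3)]
  calc K[i] = K[i] ^ (1 + ε) * K[i] ^ (-ε) := by rw [← rpow_add hk]; simp
    _ ≤ _ := by gcongr

lemma log_ratio_one_ge (h : TailArray F k y) :
    ∀ᶠ i in F, 3 / 4 * log (k i) ≤ log (k i / y i 1) := by
  filter_upwards [h.ratio_one_ge (show (0 : ℝ) < 1 / 4 by norm_num), h.k_pos] with i h1 hk
  have := log_le_log (by positivity) h1
  rw [log_rpow hk] at this; linarith

lemma log_ratio_one_le (h : TailArray F k y) :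
    ∀ᶠ i in F, log (k i / y i 1) ≤ 5 / 4 * log (k i) := by
  filter_upwards [h.ratio_one_le (show (0 : ℝ) < 1 / 4 by norm_num), h.k_pos,
    h.pos, h.one_mem] with i h1 hk h5 h6
  have := log_le_log (div_pos hk (h5 1 h6)) h1
  rw [log_rpow hk] at this; linarith

lemma tendsto_exc_one (h : TailArray F k y) {ξ : ℝ} (hξ : 0 ≤ ξ) :
    Tendsto (fun i => E[ξ, i] 1) F atTop := by
  have h1 : Tendsto (fun i => 3 / 4 * log (k i)) F atTop :=
    (h.tendsto_log).const_mul_atTop (by norm_num)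
  refine tendsto_atTop_mono' _ ?_ h1
  filter_upwards [h.log_ratio_one_ge, h.pos, h.le_k, h.one_mem] with i g1 g2 g3 g4
  refine g1.trans ?_
  have := kFun_mono_exponent hξ ((one_le_div (g2 1 g4)).2 (g3 1 g4))
  simpa [kFun, exc] using this

lemma exc_one_le_of_neg (h : TailArray F k y) {ξ : ℝ} (hξ : ξ < 0) : ∀ᶠ i in F,
    E[ξ, i] 1 ≤ 1 / -ξ := by
  filter_upwards [h.pos, h.one_mem, h.k_pos] with i h1 h2 hk
  have := rpow_pos_of_pos (div_pos hk (h1 1 h2)) ξ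
  rw [exc, kFun, if_neg hξ.ne, ← neg_div_neg_eq]
  have : 0 < -ξ := by linarith
  gcongr; linarith

lemma ratio_one_rpow_le (h : TailArray F k y) {ξ : ℝ} (hξ : ξ < 0) (hξ1 : -1 < ξ) {ε : ℝ}
    (hε : 0 < ε) : ∀ᶠ i in F, (K[i] / y i 1) ^ ξ ≤ K[i] ^ (ξ + ε) := by
  filter_upwards [h.ratio_one_ge hε, h.one_le_k] with i h1 hk1
  have hk : (0 : ℝ) < k i := by linarith
  calc _ ≤ (K[i] ^ (1 - ε)) ^ ξ :=
        rpow_le_rpow_of_nonpos (by positivity) h1 hξ.le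
    _ = K[i] ^ ((1 - ε) * ξ) := by rw [rpow_mul hk.le]
    _ ≤ _ := rpow_le_rpow_of_exponent_le hk1 (by nlinarith)

lemma tendsto_arg_one_of_neg (h : TailArray F k y) {ξ : ℝ} (hξ : ξ < 0) (hξ1 : -1 < ξ)
    (hθ : Tendsto θ F (𝓝 ξ)) : Tendsto (fun i => 1 + θ i * E[ξ, i] 1) F (𝓝 0) := by
  have h1 : Tendsto (fun i => K[i] ^ (ξ + -ξ / 2) + |θ i - ξ| * (1 / -ξ)) F (𝓝 0) := by
    have := (h.tendsto_rpow_neg (show ξ + -ξ / 2 < 0 by linarith)).add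
      ((tendsto_iff_norm_sub_tendsto_zero.1 hθ).mul_const (1 / -ξ))
    simpa using this
  refine squeeze_zero_norm' ?_ h1
  filter_upwards [h.ratio_one_rpow_le hξ hξ1 (show 0 < -ξ / 2 by linarith),
    h.exc_one_le_of_neg hξ, h.exc_one_pos ξ, h.ratio_nonneg] with i g2 g3 g4 g5
  rw [one_add_mul_exc_eq ξ, norm_eq_abs]
  refine (abs_add_le _ _).trans ?_
  rw [abs_mul, abs_of_pos g4, abs_of_nonneg (rpow_nonneg g5 ξ)]; gcongr

/-- Consistency alone makes the level diverge; for negative `ξ` this is because `1 + θ h₁ → 0`. -/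
lemma tendsto_level (h : TailArray F k y) {ξ : ℝ} (hξ : -1 / 2 < ξ)
    (hθ : Tendsto θ F (𝓝 ξ)) (hσ : Tendsto σ F (𝓝 1))
    (hD : ∀ᶠ i in F, 0 < 1 + θ i * E[ξ, i] 1) (hθ0 : ∀ᶠ i in F, θ i ≠ 0) :
    Tendsto (fun i => L[ξ, i]) F atTop := by
  have hσθ : Tendsto (fun i => σ i * θ i) F (𝓝 ξ) := by simpa using hσ.mul hθ
  rcases lt_trichotomy ξ 0 with hneg | hzero | hpos
  · have h1 : Tendsto (fun i => 1 + θ i * E[ξ, i] 1) F (𝓝[>] 0) :=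
      tendsto_nhdsWithin_iff.2 ⟨h.tendsto_arg_one_of_neg hneg (by linarith) hθ, hD⟩
    have h2 := (tendsto_log_nhdsGT_zero.comp h1).atBot_mul_neg (inv_lt_zero.2 hneg)
      (hσθ.inv₀ hneg.ne)
    simpa [level, div_eq_mul_inv, Function.comp_def] using h2
  · subst hzero
    have h1 : Tendsto (fun i => |θ i|) F (𝓝[>] 0) :=
      tendsto_nhdsWithin_iff.2 ⟨by simpa using hθ.abs, hθ0.mono fun i hi => abs_pos.2 hi⟩
    have h2 : Tendsto (fun i => 1 / |θ i|) F atTop := by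
      simpa [Function.comp_def] using tendsto_inv_nhdsGT_zero.comp h1
    have h3 : Tendsto (fun i => min (E[0, i] 1) (1 / |θ i|)) F atTop :=
      by
      refine tendsto_atTop.2 fun b => ?_
      filter_upwards [(h.tendsto_exc_one le_rfl).eventually_ge_atTop b,
        h2.eventually_ge_atTop b] with i g1 g2 using le_min g1 g2
    refine tendsto_atTop_mono' _ ?_ (h3.atTop_div_const (show (0 : ℝ) < 4 by norm_num))
    filter_upwards [hD, hθ0, h.exc_one_pos 0, hσ.eventually_const_lt one_pos,
      hσ.eventually_le_const one_lt_two] with i g1 g2 g3 g4 g5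
    have := min_le_log_div g2 g1 g3
    have g6 : 0 ≤ min (E[0, i] 1) (1 / |θ i|) := le_min g3.le (by positivity)
    rw [level, mul_comm (σ i), ← div_div, le_div_iff₀ g4]; nlinarith
  · have h1 : Tendsto (fun i => 1 + θ i * E[ξ, i] 1) F atTop :=
      tendsto_atTop_add_const_left _ _ (Tendsto.pos_mul_atTop hpos hθ (h.tendsto_exc_one hpos.le))
    have h2 := (tendsto_log_atTop.comp h1).atTop_mul_pos (inv_pos.2 hpos) (hσθ.inv₀ hpos.ne')
    simpa [level, div_eq_mul_inv, Function.comp_def] using h2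

/-- The rate obtained from `abs_sub_le_of_root` by feeding the bound back into the size of `level`.
For negative `ξ` the rate must beat `k ^ ξ`, the size of `1 + ξ h₁`. -/
lemma exists_rate_of_abs_sub_le (h : TailArray F k y) {ξ : ℝ} (hξ : -1 / 2 < ξ)
    (hθ : Tendsto θ F (𝓝 ξ)) (hσ : Tendsto σ F (𝓝 1))
    (hD : ∀ᶠ i in F, 0 < 1 + θ i * E[ξ, i] 1) (hθ0 : ∀ᶠ i in F, θ i ≠ 0)
    (hb : ∀ ε > (0 : ℝ), ∀ᶠ i in F, |θ i - ξ| ≤ K[i] ^ (-1 / 2 + ε)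
      + exp (-(L[ξ, i] / 2))) :
    ∃ c : ℝ, max (-ξ) 0 < c ∧ ∀ᶠ i in F, |θ i - ξ| ≤ K[i] ^ (-c) := by
  have hσθ : Tendsto (fun i => σ i * θ i) F (𝓝 ξ) := by simpa using hσ.mul hθ
  rcases lt_trichotomy ξ 0 with hneg | hzero | hpos
  · obtain ⟨g, hg⟩ : ∃ g, g = -ξ := ⟨_, rfl⟩
    have hg0 : 0 < g := by linarith
    rw [← hg, max_eq_left hg0.le]
    set γ := (1 + 1 / (2 * g)) / 2 with hγ
    have hγg : γ * g = (g + 1 / 2) / 2 := by rw [hγ]; field_simp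
    have h1g : 1 < 1 / (2 * g) := by rw [lt_div_iff₀ (by linarith)]; linarith
    have hγ1 : 1 < γ := by rw [hγ]; linarith
    have hγ2 : γ < 1 / (2 * g) := by rw [hγ]; linarith
    set c := (g + γ * g) / 2 with hc
    set d := γ * g - c with hd
    have hd0 : 0 < d := by rw [hd, hc, hγg]; linarith
    set ε := d / (4 * γ) with hε
    have hε0 : 0 < ε := by positivity
    have hεγ : γ * (2 * ε) = d / 2 := by rw [hε]; field_simp; norm_num
    have hεd : ε ≤ d / 4 := by
      rw [hε]; apply div_le_div_of_nonneg_left hd0.le (by norm_num); linarith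
    refine ⟨c, by rw [hc, hγg]; linarith, ?_⟩
    have tb := h.tendsto_arg_one_of_neg hneg (by linarith) hθ
    have tbγ : Tendsto (fun i => (1 + θ i * E[ξ, i] 1) ^ (γ - 1)) F (𝓝 0) := by
      have := tb.rpow_const (p := γ - 1) (Or.inr (by linarith))
      rwa [zero_rpow (by linarith)] at this
    have tσ : Tendsto (fun i => -(1 / (2 * (σ i * θ i)))) F (𝓝 (1 / (2 * g))) := by
      have key : Tendsto (fun i => -(1 / (2 * (σ i * θ i)))) F (𝓝 _) :=
        ((tendsto_const_nhds (x := (1 : ℝ))).div (hσθ.const_mul 2) (by linarith)).neg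
      convert key using 2; rw [hg]; ring
    filter_upwards [hb ε hε0, tσ.eventually_const_lt hγ2, tb.eventually_le_const one_pos,
      tbγ.eventually_le_const (show 0 < g / 2 by positivity), hD,
      h.ratio_one_rpow_le hneg (by linarith) hε0, h.exc_one_le_of_neg hneg, h.exc_one_pos ξ,
      h.one_le_k,
      h.mul_rpow_le (show ξ + ε < ξ + 2 * ε by linarith) (2 * (1 + 1 / g)),
      h.mul_rpow_le (show γ * (ξ + 2 * ε) < -c by
        rw [mul_add, hεγ, show γ * ξ = -(γ * g) by rw [hg]; ring]; linarith) 2,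
      h.mul_rpow_le (show -1 / 2 + ε < -c by linarith) 2,
      hσθ.eventually_lt_const hneg]
      with i g1 g2 g3 g4 g5 g7 g8 g9 hk1 g11 g12 g13 g14
    have g6 := one_add_mul_exc_eq ξ (θ i) (k i) (y i)
    have hk : (0 : ℝ) < k i := by linarith
    have e1 : exp (-(L[ξ, i] / 2))
        = (1 + θ i * E[ξ, i] 1) ^ (-(1 / (2 * (σ i * θ i)))) := by
      rw [rpow_def_of_pos g5, level]
      congr 1
      have := g14.ne; field_simp
    rw [e1] at g1
    set b := 1 + θ i * E[ξ, i] 1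
    have e2 : b ^ (-(1 / (2 * (σ i * θ i)))) ≤ b ^ γ := rpow_le_rpow_of_exponent_ge g5 g3 g2.le
    have e3 : b ^ γ ≤ g / 2 * b := by
      have : b ^ γ = b ^ (γ - 1) * b := by rw [← rpow_add_one g5.ne']; ring_nf
      rw [this]; gcongr
    have e4 : b ≤ K[i] ^ (ξ + ε) + 1 / g * |θ i - ξ| := by
      rw [← hg] at g8
      have : (θ i - ξ) * E[ξ, i] 1 ≤ |θ i - ξ| * (1 / g) := by
        calc _ ≤ |θ i - ξ| * E[ξ, i] 1 := by gcongr; exact le_abs_self _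
          _ ≤ _ := by gcongr
      linarith
    have e5 : K[i] ^ (-1 / 2 + ε) ≤ K[i] ^ (ξ + ε) :=
      rpow_le_rpow_of_exponent_le hk1 (by linarith)
    have e6 : b ≤ K[i] ^ (ξ + 2 * ε) := by
      have : 1 / g * |θ i - ξ| ≤ 1 / g * (K[i] ^ (ξ + ε) + g / 2 * b) := by gcongr; linarith
      have e : 1 / g * (K[i] ^ (ξ + ε) + g / 2 * b) = 1 / g * K[i] ^ (ξ + ε) + b / 2 := by
        field_simp
      linarith
    have e7 : b ^ γ ≤ K[i] ^ (γ * (ξ + 2 * ε)) := by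
      calc b ^ γ ≤ (K[i] ^ (ξ + 2 * ε)) ^ γ := by gcongr
        _ = _ := by rw [← rpow_mul hk.le]; ring_nf
    linarith
  · subst hzero
    refine ⟨1 / 10, by norm_num, ?_⟩
    filter_upwards [hb (1 / 4) (by norm_num), hθ0, hD, h.exc_one_pos 0, h.log_ratio_one_ge,
      hσ.eventually_const_lt one_pos, hσ.eventually_le_const (show (1 : ℝ) < 3 / 2 by norm_num),
      hθ.abs.eventually_le_const (show |(0 : ℝ)| < 1 / 144 by norm_num),
      h.mul_rpow_le (show (-1 / 2 + 1 / 4 : ℝ) < -(1 / 10) by norm_num) 4,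
      h.mul_rpow_le (show (-(1 / 8) : ℝ) < -(1 / 10) by norm_num) 4,
      h.k_pos] with i g1 g2 g3 g4 g5 g6 g7 g8 g9 g10 hk
    rw [sub_zero] at g1 ⊢
    have hx := abs_pos.2 g2
    have e1 := min_le_log_div g2 g3 g4
    have e2 : min (E[0, i] 1) (1 / |θ i|) / 6 ≤ L[0, i] / 2 := by
      have g6' : 0 ≤ min (E[0, i] 1) (1 / |θ i|) := le_min g4.le (by positivity)
      rw [level, mul_comm (σ i), ← div_div, div_div _ (σ i), le_div_iff₀ (by positivity)]; nlinarith
    have e3 : exp (-(L[0, i] / 2))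
        ≤ K[i] ^ (-(1 / 8) : ℝ) + 72 * |θ i| ^ 2 := by
      refine (exp_le_exp.2 (neg_le_neg e2)).trans ?_
      rcases le_total (E[0, i] 1) (1 / |θ i|) with hc | hc
      · rw [min_eq_left hc, exc_zero]
        have : exp (-(log (k i / y i 1) / 6)) ≤ K[i] ^ (-(1 / 8) : ℝ) := by
          rw [rpow_def_of_pos hk]
          apply exp_le_exp.2; linarith
        have h0 : 0 ≤ 72 * |θ i| ^ 2 := by positivity
        linarith
      · rw [min_eq_right hc, div_div, exp_neg]
        have h0 : 0 ≤ K[i] ^ (-(1 / 8) : ℝ) := by positivity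
        have q := quadratic_le_exp_of_nonneg (show 0 ≤ 1 / (|θ i| * 6) by positivity)
        have q0 : 0 ≤ 1 / (|θ i| * 6) := by positivity
        have q1 : (1 / (|θ i| * 6)) ^ 2 / 2 ≤ exp (1 / (|θ i| * 6)) := by linarith
        have q2 : (exp (1 / (|θ i| * 6)))⁻¹ ≤ ((1 / (|θ i| * 6)) ^ 2 / 2)⁻¹ :=
          inv_anti₀ (by positivity) q1
        have q3 : ((1 / (|θ i| * 6)) ^ 2 / 2)⁻¹ = 72 * |θ i| ^ 2 := by field_simp; norm_num
        linarith
    have e4 : 72 * |θ i| ^ 2 ≤ |θ i| / 2 := by nlinarith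
    linarith
  · rw [max_eq_right (by linarith)]
    refine ⟨1 / 10, by norm_num, ?_⟩
    filter_upwards [hb (1 / 4) (by norm_num), hD,
      h.ratio_one_ge (show (0 : ℝ) < 1 / 4 by norm_num),
      hθ.eventually_const_le (show ξ / 2 < ξ by linarith),
      hσθ.eventually_le_const (show ξ < 2 * ξ by linarith),
      hσθ.eventually_const_lt hpos, h.one_le_k,
      h.mul_rpow_le (show ξ / 2 < 3 / 4 * ξ by linarith) 2,
      h.mul_rpow_le (show (-1 / 2 + 1 / 4 : ℝ) < -(1 / 10) by norm_num) 2,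
      h.mul_rpow_le (show (-(1 / 8) : ℝ) < -(1 / 10) by norm_num) 2]
      with i g1 g2 g4 g5 g6 g7 hk1 g9 g10 g11
    have g3 := one_add_mul_exc_eq ξ (θ i) (k i) (y i)
    have hk : (0 : ℝ) < k i := by linarith
    have e1 : K[i] ^ (3 / 4 * ξ) ≤ (k i / y i 1) ^ ξ := by
      calc K[i] ^ (3 / 4 * ξ) = (K[i] ^ (1 - 1 / 4 : ℝ)) ^ ξ := by
            rw [← rpow_mul hk.le]; norm_num
        _ ≤ _ := by gcongr
    have e2 : K[i] ^ (ξ / 2) ≤ 1 + θ i * E[ξ, i] 1 := by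
      have q0 : 1 ≤ K[i] ^ (ξ / 2) := one_le_rpow hk1 (by linarith)
      nlinarith
    have e3 := log_le_log (by positivity) e2
    rw [log_rpow hk] at e3
    have e4 : log (k i) / 4 ≤ L[ξ, i] := by
      rw [level, le_div_iff₀ g7]
      have := log_nonneg hk1; nlinarith
    have e5 : exp (-(L[ξ, i] / 2)) ≤ K[i] ^ (-(1 / 8) : ℝ) := by
      rw [rpow_def_of_pos hk]
      apply exp_le_exp.2; linarith
    linarith

/-- Once `θ - ξ` is small compared with `k ^ (-c)`, `c > max (-ξ) 0`, the exponent
`log (1 + θ h₁) / θ` is close to its value at `θ = ξ`. -/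
lemma log_arg_div_sub_le (h : TailArray F k y) {ξ c : ℝ} (hξ : -1 / 2 < ξ) (hc : max (-ξ) 0 < c)
    (hθ0 : ∀ᶠ i in F, θ i ≠ 0) (hθ : ∀ᶠ i in F, |θ i - ξ| ≤ K[i] ^ (-c)) :
    ∃ d > (0 : ℝ), ∀ᶠ i in F, 0 < 1 + θ i * E[ξ, i] 1 ∧
      |log (1 + θ i * E[ξ, i] 1) / θ i - log (k i / y i 1)| ≤ K[i] ^ (-d) := by
  have hcg : -ξ < c := (le_max_left _ _).trans_lt hc
  have hc0 : 0 < c := (le_max_right _ _).trans_lt hc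
  by_cases hξ0 : ξ = 0
  · subst hξ0
    refine ⟨c / 2, by positivity, ?_⟩
    filter_upwards [hθ0, hθ, h.log_ratio_one_le, h.exc_one_pos 0, h.k_pos,
      h.log_le_rpow (show 0 < c / 8 by positivity) (5 / 4),
      h.mul_rpow_le (show -c + c / 8 < 0 by linarith) 2,
      h.mul_rpow_le (show -c + c / 8 + c / 8 < -(c / 2) by linarith) 2]
      with i g1 g2 g3 g4 hk g6 g7 g8
    rw [exc_zero] at g4 ⊢
    set L := log (k i / y i 1)
    rw [sub_zero] at g2
    have hL : L ≤ K[i] ^ (c / 8) := by linarith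
    have hz : |θ i * L| ≤ K[i] ^ (-c + c / 8) := by
      rw [abs_mul, abs_of_pos g4, rpow_add hk]; gcongr
    rw [rpow_zero] at g7
    have hz2 : |θ i * L| ≤ 1 / 2 := by linarith
    have h1 := abs_log_one_add_sub_self_le hz2
    refine ⟨by linarith [(abs_le.1 hz2).1], ?_⟩
    have e : log (1 + θ i * L) / θ i - L = (log (1 + θ i * L) - θ i * L) / θ i := by field_simp
    rw [e, abs_div, div_le_iff₀ (abs_pos.2 g1)]
    refine h1.trans ?_
    have e2 : 2 * (θ i * L) ^ 2 = 2 * (|θ i * L| * L) * |θ i| := by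
      rw [abs_mul, abs_of_pos g4, mul_pow, ← sq_abs (θ i)]; ring
    rw [e2]
    gcongr
    calc 2 * (|θ i * L| * L) ≤ 2 * (K[i] ^ (-c + c / 8) * K[i] ^ (c / 8)) := by gcongr
      _ ≤ _ := by rw [← rpow_add hk]; exact g8
  · -- `r = k / y₁`; the quotient of `1 + θ h₁` and `r ^ ξ` is `1 + z` with a small `z`
    obtain ⟨g, hg⟩ : ∃ g, g = max (-ξ) 0 := ⟨_, rfl⟩
    rw [← hg] at hc
    have hg0 : 0 ≤ g := hg ▸ le_max_right _ _
    set e := (c - g) / 8 with he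
    have he0 : 0 < e := by rw [he]; linarith
    have hθt := h.tendsto_of_abs_sub_le (by linarith) hθ
    have hξa : 0 < |ξ| := abs_pos.2 hξ0
    refine ⟨e, he0, ?_⟩
    filter_upwards [hθ0, hθ, h.log_ratio_one_le, h.exc_one_pos 0, h.exc_one_pos ξ,
      h.one_le_k, h.ratio_one_le he0, h.pos, h.one_mem, h.le_k,
      hθt.abs.eventually_const_lt (show |ξ| / 2 < |ξ| by linarith),
      h.mul_rpow_le (show -c + (g + e) < 0 by linarith) (2 * (1 / |ξ|)),
      h.mul_rpow_le (show -c + (g + e) < -e by linarith) (2 * (2 * (1 / |ξ|) / (|ξ| / 2))),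
      h.mul_rpow_le (show -c + e < -e by linarith) (2 * (1 / (|ξ| / 2))),
      h.log_le_rpow he0 (5 / 4)]
      with i g1 g2 g3 g4 g5 hk1 g7 g8 g9 g10 g11 g12 g13 g14 g15
    have hk : (0 : ℝ) < k i := by linarith
    have hr0 : 0 < K[i] / y i 1 := div_pos hk (g8 1 g9)
    rw [exc_zero] at g4
    have hexc : E[ξ, i] 1 = kFun ξ (k i / y i 1) := rfl
    rw [hexc] at g5 ⊢
    have harg : 1 + θ i * kFun ξ (k i / y i 1)
        = (K[i] / y i 1) ^ ξ * (1 + (θ i - ξ) * (kFun ξ (k i / y i 1)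
          * (K[i] / y i 1) ^ (-ξ))) := by
      have h1 := one_add_mul_kFun ξ (x := K[i] / y i 1)
      rw [rpow_neg hr0.le]
      have h2 := (rpow_pos_of_pos hr0 ξ).ne'
      field_simp; linarith
    set r := K[i] / y i 1
    have hkr : kFun ξ r * r ^ (-ξ) ≤ 1 / |ξ| * K[i] ^ (g + e) := by
      have q1 : kFun ξ r * r ^ (-ξ) = (1 - r ^ (-ξ)) / ξ := by
        rw [kFun, if_neg hξ0, div_mul_eq_mul_div, sub_mul, ← rpow_add hr0, add_neg_cancel,
          rpow_zero, one_mul]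
      rw [q1]
      rcases lt_or_gt_of_ne hξ0 with hn | hp
      · have hgξ : g = -ξ := by rw [hg, max_eq_left (by linarith)]
        rw [abs_of_neg hn, ← neg_div_neg_eq, one_div_mul_eq_div]
        have : r ^ (-ξ) ≤ K[i] ^ (g + e) := by
          calc r ^ (-ξ) ≤ (K[i] ^ (1 + e)) ^ (-ξ) :=
                rpow_le_rpow hr0.le g7 (by linarith)
            _ = K[i] ^ ((1 + e) * (-ξ)) := by rw [rpow_mul hk.le]
            _ ≤ _ := rpow_le_rpow_of_exponent_le hk1 (by rw [hgξ]; nlinarith)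
        have : 0 < -ξ := by linarith
        gcongr; linarith
      · rw [abs_of_pos hp, one_div_mul_eq_div]
        have q2 : 1 ≤ K[i] ^ (g + e) := one_le_rpow hk1 (by linarith)
        have q3 := rpow_pos_of_pos hr0 (-ξ)
        gcongr; linarith
    have hw0 : 0 ≤ kFun ξ r * r ^ (-ξ) := by positivity
    have hz : |(θ i - ξ) * (kFun ξ r * r ^ (-ξ))| ≤ 1 / |ξ| * K[i] ^ (-c + (g + e)) := by
      rw [abs_mul, abs_of_nonneg hw0, rpow_add hk]
      calc _ ≤ K[i] ^ (-c) * (1 / |ξ| * K[i] ^ (g + e)) := by gcongr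
        _ = _ := by ring
    rw [rpow_zero] at g12
    have hz2 : |(θ i - ξ) * (kFun ξ r * r ^ (-ξ))| ≤ 1 / 2 := by linarith
    have hlz := abs_log_one_add_le hz2
    have hzp := (abs_le.1 hz2).1
    rw [harg]
    generalize (θ i - ξ) * (kFun ξ r * r ^ (-ξ)) = z at *
    have hrξ := rpow_pos_of_pos hr0 ξ
    have hz1 : 0 < 1 + z := by linarith
    refine ⟨mul_pos hrξ hz1, ?_⟩
    rw [log_mul hrξ.ne' hz1.ne', log_rpow hr0]
    have e1 : (ξ * log r + log (1 + z)) / θ i - log r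
        = log (1 + z) / θ i + (ξ - θ i) * log r / θ i := by field_simp; ring
    rw [e1]
    refine (abs_add_le _ _).trans ?_
    rw [abs_div, abs_div, abs_mul, abs_sub_comm, abs_of_pos g4]
    have e2 : |log (1 + z)| / |θ i| ≤ (2 * (1 / |ξ|) / (|ξ| / 2)) * K[i] ^ (-c + (g + e)) := by
      rw [div_mul_eq_mul_div]
      have : |log (1 + z)| ≤ 2 * (1 / |ξ|) * K[i] ^ (-c + (g + e)) := by linarith
      gcongr
    have e3 : |θ i - ξ| * log r / |θ i| ≤ (1 / (|ξ| / 2)) * K[i] ^ (-c + e) := by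
      rw [one_div_mul_eq_div, rpow_add hk]
      have : log r ≤ K[i] ^ e := by linarith
      gcongr
    linarith

end TailArray

namespace TailArray

variable {ι : Type*} {F : Filter ι} {k : ι → ℕ} {y : ι → ℕ → ℝ} {θ σ : ι → ℝ}

local notation:max "K[" i "]" => (k i : ℝ)
local notation:max "E[" ξ ", " i "]" => exc ξ (k i) (y i)
local notation:max "L[" ξ ", " i "]" => level (E[ξ, i] 1) (θ i) (σ i)

/-- `avgLog / θ` deviates from one by a multiple of `θ - ξ`, up to an error of order almost
`k ^ (-1/2)`. -/
lemma avgLog_div_expansion [F.IsCountablyGenerated] (h : TailArray F k y) {ξ : ℝ}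
    (hξ : -1 / 2 < ξ) (hθ : Tendsto θ F (𝓝 ξ))
    (hD : ∀ᶠ i in F, 0 < 1 + θ i * E[ξ, i] 1) (hθ0 : ∀ᶠ i in F, θ i ≠ 0) :
    ∃ (B : ι → ℝ) (β : ℝ), Tendsto B F (𝓝 β) ∧ ∀ ε > (0 : ℝ), ∀ᶠ i in F,
      |avgLog (k i) E[ξ, i] (θ i) / θ i - 1| ≤ K[i] ^ (-1 / 2 + ε) + |θ i - ξ| * |B i| := by
  by_cases hξ0 : ξ = 0
  · subst hξ0
    have tS := h.tendsto_of_rate fun ε hε => h.avg_exc_zero_sq_rate hε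
    have tD := h.tendsto_logRemainder hθ hD hθ0
    refine ⟨_, _, (tS.div_const 2).neg.add (hθ.mul tD), fun ε hε => ?_⟩
    filter_upwards [h.avg_exc_zero_rate hε, hθ0] with i h1 h2
    have e := one_add_avgLog_eq_expansion (k := k i) E[0, i] h2
    have e2 : avgLog (k i) E[0, i] (θ i) / θ i - 1 = (avg (k i) E[0, i] - 1)
          + (θ i - 0) * (-(avg (k i) (fun j => E[0, i] j ^ 2) / 2)
            + θ i * logRemainder (k i) E[0, i] (θ i)) := by
      rw [div_sub_one h2, div_eq_iff h2]; linear_combination e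
    rw [e2]
    refine (abs_add_le _ _).trans ?_
    rw [abs_mul]; gcongr
  · obtain ⟨t, htt, hDt, hex⟩ := h.exists_mean_value hξ hξ0 hθ hD
      (f' := fun i t => (1 - avgInv (k i) E[ξ, i] t) / t)
      ((h.eventually_le_k 2).mono fun i hi t ht hpos => by
        rw [← avg_excess_div hi ht hpos]; exact hasDerivAt_avgLog hpos)
    have tB := ((((h.tendsto_avgInv hξ htt hDt).const_sub 1).div htt hξ0).sub_const 1).div hθ hξ0
    refine ⟨_, _, tB, fun ε hε => ?_⟩
    filter_upwards [hex, h.avgLog_rate ξ (half_pos hε), hθ0,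
      hθ.abs.eventually_const_lt (show |ξ| / 2 < |ξ| by linarith [abs_pos.2 hξ0]),
      h.mul_rpow_le (show -1 / 2 + ε / 2 < -1 / 2 + ε by linarith)
        (1 / (|ξ| / 2))] with i h1 h2 h3 h4 h5
    have e2 : avgLog (k i) E[ξ, i] (θ i) / θ i - 1 = (avgLog (k i) E[ξ, i] ξ - ξ) / θ i
          + (θ i - ξ) * (((1 - avgInv (k i) E[ξ, i] (t i)) / t i - 1) / θ i) := by
      rw [← mul_div_assoc, ← add_div, div_sub_one h3, mul_sub, ← h1]; ring
    rw [e2]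
    refine (abs_add_le _ _).trans ?_
    rw [abs_mul, abs_div]
    refine add_le_add (le_trans ?_ h5) le_rfl
    rw [one_div_mul_eq_div]; gcongr

/-- At a consistent root the truncation statistic is asymptotically equivalent to `y 1`. -/
theorem tendsto_level_sub [F.IsCountablyGenerated] (h : TailArray F k y) {ξ : ℝ} (hξ : -1 / 2 < ξ)
    (hθ : Tendsto θ F (𝓝 ξ)) (hσ : Tendsto σ F (𝓝 1))
    (hr : ∀ᶠ i in F, ScaledRoot (k i) E[ξ, i] (θ i) (σ i)) :
    Tendsto (fun i => L[ξ, i] - log (k i / y i 1)) F (𝓝 0) := by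
  have hD : ∀ᶠ i in F, 0 < 1 + θ i * E[ξ, i] 1 := hr.mono fun i hi => hi.arg_pos
  have hθ0 : ∀ᶠ i in F, θ i ≠ 0 := hr.mono fun i hi => hi.ne_zero
  have hℓ := h.tendsto_level hξ hθ hσ hD hθ0
  obtain ⟨c, hc, hrate⟩ := h.exists_rate_of_abs_sub_le hξ hθ hσ hD hθ0
    fun ε hε => h.abs_sub_le_of_root hξ hθ hσ hr hℓ hε
  have hc0 : 0 < c := (le_max_right _ _).trans_lt hc
  obtain ⟨d, hd, hΛ⟩ := h.log_arg_div_sub_le hξ hc hθ0 hrate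
  obtain ⟨B, β, hB, hL⟩ := h.avgLog_div_expansion hξ hθ hD hθ0
  set Λ := fun i => log (1 + θ i * E[ξ, i] 1) / θ i with hΛdef
  have tk := h.tendsto_log
  have hΛL : Tendsto (fun i => Λ i - log (k i / y i 1)) F (𝓝 0) :=
    squeeze_zero_norm' (hΛ.mono fun i hi => hi.2) (h.tendsto_rpow_neg (by linarith))
  have hΛlow : ∀ᶠ i in F, log (k i) / 2 ≤ Λ i := by
    filter_upwards [hΛL.eventually_const_le (show (-1 : ℝ) < 0 by norm_num), h.log_ratio_one_ge,
      tk.eventually_ge_atTop 4] with i h1 h2 h3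
    linarith
  have hΛup : ∀ᶠ i in F, Λ i ≤ 2 * log (k i) := by
    filter_upwards [hΛL.eventually_le_const (show (0 : ℝ) < 1 by norm_num), h.log_ratio_one_le,
      tk.eventually_ge_atTop 4] with i h1 h2 h3
    linarith
  have tΛ : Tendsto Λ F atTop := tendsto_atTop_mono' _ hΛlow (tk.atTop_div_const (by norm_num))
  -- the equation for the logarithms determines `σ`, up to `o (1 / log k)`
  have hσlog : Tendsto (fun i => (σ i - 1) * log (k i)) F (𝓝 0) := by
    have b1 : Tendsto (fun i => K[i] ^ (-(1 / 8) : ℝ) + K[i] ^ (-(c / 2)) * |B i|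
        + 4 * (Λ i ^ (2 : ℝ) * exp (-(1 / 2) * Λ i))) F (𝓝 0) := by
      have a1 := h.tendsto_rpow_neg (show (-(1 / 8) : ℝ) < 0 by norm_num)
      have a2 := (h.tendsto_rpow_neg (show -(c / 2) < 0 by linarith)).mul hB.abs
      have a3 := ((tendsto_rpow_mul_exp_neg_mul_atTop_nhds_zero 2 (1 / 2) (by norm_num)).comp
        tΛ).const_mul 4
      have := (a1.add a2).add a3
      simpa [Function.comp_def] using this
    refine squeeze_zero_norm' ?_ b1
    filter_upwards [hr, hL (1 / 4) (by norm_num), hrate, hσ.eventually_const_lt one_pos,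
      hσ.eventually_le_const one_lt_two, hΛlow, tΛ.eventually_ge_atTop 4,
      h.one_le_k,
      h.log_le_rpow (show (0 : ℝ) < 1 / 8 by norm_num) 1,
      h.log_le_rpow (show 0 < c / 2 by linarith) 1]
      with i g1 g2 g3 g4 g5 g6 g7 hk1 g9 g10
    have hk : (0 : ℝ) < k i := by linarith
    have hlk := log_nonneg hk1
    have e0 := g1.eq_log
    have eb : log (1 + θ i * E[ξ, i] 1) = θ i * Λ i := by
      rw [hΛdef]
      have := g1.ne_zero; field_simp
    have el : L[ξ, i] = Λ i / σ i := by
      have := g1.ne_zero; rw [level, eb]; field_simp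
    rw [eb, el] at e0
    set u := exp (-(Λ i / σ i))
    have hu : u ≤ exp (-(1 / 2) * Λ i) := by
      apply exp_le_exp.2
      have : Λ i / 2 ≤ Λ i / σ i := by gcongr
      linarith
    have hu2 : u ≤ 1 / 2 := by
      have q := add_one_le_exp (1 / 2 * Λ i)
      have q2 : exp (-(1 / 2) * Λ i) = (exp (1 / 2 * Λ i))⁻¹ := by rw [← exp_neg]; ring_nf
      refine hu.trans ?_
      rw [q2, inv_le_comm₀ (exp_pos _) (by norm_num)]
      norm_num; linarith
    have hu0 : 0 < u := exp_pos _
    have e1 : σ i - 1 = (avgLog (k i) E[ξ, i] (θ i) / θ i - 1) + u / (1 - u) * Λ i := by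
      have := g1.ne_zero
      have e3 : avgLog (k i) E[ξ, i] (θ i) = θ i * (σ i - u / (1 - u) * Λ i) := by
        rw [mul_sub, ← mul_comm (σ i), ← e0]; ring
      rw [e3, mul_div_cancel_left₀ _ this]; ring
    have e2 : u / (1 - u) ≤ 2 * u := by rw [div_le_iff₀ (by linarith)]; nlinarith
    have e3 : 0 ≤ u / (1 - u) := div_nonneg hu0.le (by linarith)
    have e4 : |σ i - 1| ≤ K[i] ^ (-1 / 2 + 1 / 4 : ℝ) + K[i] ^ (-c) * |B i|
        + 2 * exp (-(1 / 2) * Λ i) * Λ i := by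
      rw [e1]
      refine (abs_add_le _ _).trans ?_
      rw [abs_of_nonneg (a := u / (1 - u) * Λ i) (by positivity)]
      refine add_le_add (g2.trans (by gcongr)) ?_
      gcongr; linarith
    have e5 : K[i] ^ (-1 / 2 + 1 / 4 : ℝ) * log (k i) ≤ K[i] ^ (-(1 / 8) : ℝ) := by
      calc _ ≤ K[i] ^ (-1 / 2 + 1 / 4 : ℝ) * K[i] ^ (1 / 8 : ℝ) := by gcongr; linarith
        _ = _ := by rw [← rpow_add hk]; norm_num
    have e6 : K[i] ^ (-c) * log (k i) ≤ K[i] ^ (-(c / 2)) := by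
      calc _ ≤ K[i] ^ (-c) * K[i] ^ (c / 2) := by gcongr; linarith
        _ = _ := by rw [← rpow_add hk]; ring_nf
    rw [norm_eq_abs, abs_mul, abs_of_nonneg hlk]
    calc |σ i - 1| * log (k i)
        ≤ (K[i] ^ (-1 / 2 + 1 / 4 : ℝ) + K[i] ^ (-c) * |B i|
          + 2 * exp (-(1 / 2) * Λ i) * Λ i) * log (k i) := by gcongr
      _ = K[i] ^ (-1 / 2 + 1 / 4 : ℝ) * log (k i) + K[i] ^ (-c) * log (k i) * |B i|
          + 2 * exp (-(1 / 2) * Λ i) * Λ i * log (k i) := by ring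
      _ ≤ K[i] ^ (-(1 / 8) : ℝ) + K[i] ^ (-(c / 2)) * |B i|
          + 2 * exp (-(1 / 2) * Λ i) * Λ i * (2 * Λ i) := by gcongr; linarith
      _ = _ := by rw [rpow_two]; ring
  have key : Tendsto (fun i => (Λ i - log (k i / y i 1))
      + 2 * |(σ i - 1) * log (k i)| / σ i) F (𝓝 0) := by
    have := hΛL.add (((hσlog.abs).const_mul 2).div hσ one_ne_zero); simpa using this
  have key' : Tendsto (fun i => (Λ i - log (k i / y i 1))
      - 2 * |(σ i - 1) * log (k i)| / σ i) F (𝓝 0) := by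
    have := hΛL.sub (((hσlog.abs).const_mul 2).div hσ one_ne_zero); simpa using this
  have hfin : ∀ᶠ i in F, |L[ξ, i] - Λ i|
      ≤ 2 * |(σ i - 1) * log (k i)| / σ i := by
    filter_upwards [hr, hσ.eventually_const_lt one_pos, hΛup, tΛ.eventually_ge_atTop 0,
      tk.eventually_ge_atTop 0] with i g1 g2 g3 g4 g5
    have el : L[ξ, i] - Λ i = -((σ i - 1) * Λ i) / σ i := by
      have := g1.ne_zero
      rw [level, hΛdef]
      field_simp; ring
    rw [el, abs_div, abs_neg, abs_of_pos g2, abs_mul, abs_mul, abs_of_nonneg g4, abs_of_nonneg g5]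
    have := mul_le_mul_of_nonneg_left g3 (abs_nonneg (σ i - 1))
    refine div_le_div_of_nonneg_right ?_ g2.le; linarith
  refine tendsto_of_tendsto_of_tendsto_of_le_of_le' key' key ?_ ?_
  · filter_upwards [hfin] with i hi; linarith [(abs_le.1 hi).1]
  · filter_upwards [hfin] with i hi; linarith [(abs_le.1 hi).2]

end TailArray

/-! ### Elimination of the scale -/

/-- `log (1 + y) / y`, extended continuously to `y = 0`. -/
def logQuot (y : ℝ) : ℝ := if y = 0 then 1 else log (1 + y) / y

/-- `(log (1 + y) - y / (1 + y)) / y ^ 2`, extended continuously to `y = 0`. -/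
def logQuotSq (y : ℝ) : ℝ :=
  if y = 0 then 1 / 2 else (log (1 + y) - y / (1 + y)) / y ^ 2

/-- `(exp (-y) - 1 + y) / y ^ 2`, extended continuously to `y = 0`. -/
def expQuotSq (y : ℝ) : ℝ := if y = 0 then 1 / 2 else (exp (-y) - 1 + y) / y ^ 2

lemma continuousAt_zero_of_abs_sub_le {f : ℝ → ℝ} {C : ℝ}
    (h : ∀ y : ℝ, y ≠ 0 → |y| ≤ 1 / 2 → |f y - f 0| ≤ C * |y|) : ContinuousAt f 0 := by
  have h1 : Tendsto (fun y : ℝ => |C| * |y|) (𝓝 0) (𝓝 0) := by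
    have : Continuous fun y : ℝ => |C| * |y| := by fun_prop
    simpa using this.tendsto 0
  rw [ContinuousAt, tendsto_iff_norm_sub_tendsto_zero]
  refine squeeze_zero' (Eventually.of_forall fun i => norm_nonneg _) ?_ h1
  filter_upwards [Metric.ball_mem_nhds (0 : ℝ) (show (0 : ℝ) < 1 / 2 by norm_num)] with y hy
  by_cases h0 : y = 0
  · simp [h0]
  · rw [mem_ball_zero_iff, norm_eq_abs] at hy
    have := h y h0 hy.le
    have h2 : C * |y| ≤ |C| * |y| := by gcongr; exact le_abs_self C
    exact this.trans h2

lemma continuousAt_logQuot {y : ℝ} (hy : 0 < 1 + y) : ContinuousAt logQuot y := by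
  by_cases h0 : y = 0
  · subst h0
    refine continuousAt_zero_of_abs_sub_le (C := 2) fun y hy0 hy2 => ?_
    have h1 := abs_log_one_add_sub_self_le hy2
    have h2 := abs_pos.2 hy0
    rw [logQuot, logQuot, if_pos rfl, if_neg hy0, div_sub_one hy0, abs_div, div_le_iff₀ h2]
    rw [← sq_abs y] at h1
    linarith [h1, (by ring : 2 * |y| ^ 2 = 2 * |y| * |y|)]
  · have h1 : ContinuousAt (fun y => log (1 + y) / y) y :=
      ContinuousAt.div ((continuousAt_const.add continuousAt_id).log hy.ne') continuousAt_id h0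
    refine h1.congr ?_
    filter_upwards [isOpen_ne.mem_nhds h0] with z hz
    rw [logQuot, if_neg hz]

lemma continuousAt_logQuotSq {y : ℝ} (hy : 0 < 1 + y) : ContinuousAt logQuotSq y := by
  by_cases h0 : y = 0
  · subst h0
    refine continuousAt_zero_of_abs_sub_le (C := 5) fun y hy0 hy2 => ?_
    obtain ⟨h3, h4⟩ := abs_le.1 hy2
    have hb : 0 < 1 + y := by linarith
    have h1 := abs_log_one_add_sub_le hb
    have h5 : 1 / (1 + y) ≤ 2 := by rw [div_le_iff₀ hb]; linarith
    have h6 := one_div_pos.2 hb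
    rw [logQuotSq, logQuotSq, if_pos rfl, if_neg hy0]
    have e : (log (1 + y) - y / (1 + y)) / y ^ 2 - 1 / 2
        = ((log (1 + y) - y + y ^ 2 / 2) - y ^ 3 * (1 / (1 + y))) / y ^ 2 := by field_simp; ring
    rw [e, abs_div, abs_pow, div_le_iff₀ (by positivity)]
    refine (abs_sub _ _).trans ?_
    rw [abs_mul, abs_pow, abs_of_pos h6]
    calc _ ≤ |y| ^ 3 * (1 + 1 / (1 + y)) + |y| ^ 3 * (1 / (1 + y)) := by gcongr
      _ ≤ |y| ^ 3 * 3 + |y| ^ 3 * 2 := by gcongr; linarith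
      _ = _ := by ring
  · have h1 : ContinuousAt (fun y => (log (1 + y) - y / (1 + y)) / y ^ 2) y := by
      have := (continuousAt_const.add continuousAt_id).log hy.ne' (f := fun y : ℝ => 1 + y)
      have hd : ContinuousAt (fun y : ℝ => y / (1 + y)) y :=
        ContinuousAt.div continuousAt_id (continuousAt_const.add continuousAt_id) hy.ne'
      exact (this.sub hd).div (continuousAt_id.pow 2) (pow_ne_zero 2 h0)
    refine h1.congr ?_
    filter_upwards [isOpen_ne.mem_nhds h0] with z hz
    rw [logQuotSq, if_neg hz]

lemma continuous_expQuotSq : Continuous expQuotSq := by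
  refine continuous_iff_continuousAt.2 fun y => ?_
  by_cases h0 : y = 0
  · subst h0
    refine continuousAt_zero_of_abs_sub_le (C := 1) fun y hy0 hy2 => ?_
    have h1 := exp_bound (x := -y) (by rw [abs_neg]; linarith) (n := 3) (by norm_num)
    rw [expQuotSq, expQuotSq, if_pos rfl, if_neg hy0]
    have e : (exp (-y) - 1 + y) / y ^ 2 - 1 / 2
        = (exp (-y) - ∑ m ∈ Finset.range 3, (-y) ^ m / (m.factorial : ℝ)) / y ^ 2 := by
      simp only [Finset.sum_range_succ, Finset.sum_range_zero, Nat.factorial]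
      field_simp
      push_cast; ring
    rw [e, abs_div, abs_pow, div_le_iff₀ (by positivity)]
    refine h1.trans ?_
    rw [abs_neg]
    calc _ ≤ |y| ^ 3 * 1 := by gcongr; norm_num [Nat.factorial]
      _ = _ := by ring
  · have h1 : ContinuousAt (fun y => (exp (-y) - 1 + y) / y ^ 2) y :=
      ContinuousAt.div (by fun_prop) (by fun_prop) (pow_ne_zero 2 h0)
    refine h1.congr ?_
    filter_upwards [isOpen_ne.mem_nhds h0] with z hz
    rw [expQuotSq, if_neg hz]

lemma measurable_logQuot : Measurable logQuot :=
  Measurable.ite (measurableSet_singleton 0) measurable_const (by fun_prop)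

lemma measurable_logQuotSq : Measurable logQuotSq :=
  Measurable.ite (measurableSet_singleton 0) measurable_const (by fun_prop)

lemma mul_logQuot {θ : ℝ} (hθ : θ ≠ 0) (h : ℝ) : h * logQuot (θ * h) = log (1 + θ * h) / θ := by
  by_cases h0 : h = 0
  · simp [h0]
  · rw [logQuot, if_neg (mul_ne_zero hθ h0)]; field_simp

lemma sq_mul_logQuotSq {θ h : ℝ} (hθ : θ ≠ 0) (hb : 1 + θ * h ≠ 0) :
    θ ^ 2 * (h ^ 2 * logQuotSq (θ * h)) = log (1 + θ * h) - (1 - 1 / (1 + θ * h)) := by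
  by_cases h0 : h = 0
  · simp [h0]
  · rw [logQuotSq, if_neg (mul_ne_zero hθ h0)]; field_simp; ring

lemma exp_neg_eq_expQuotSq (y : ℝ) : exp (-y) = 1 - y + y ^ 2 * expQuotSq y := by
  by_cases h0 : y = 0
  · simp [h0]
  · rw [expQuotSq, if_neg h0]; field_simp; ring

/-- The function `ℓ ↦ 1 / ℓ - 1 / (exp ℓ - 1)`. -/
def levelRatio (ℓ : ℝ) : ℝ := 1 / ℓ - 1 / (exp ℓ - 1)

lemma exp_sub_one_pos {ℓ : ℝ} (hℓ : 0 < ℓ) : 0 < exp ℓ - 1 := by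
  have := add_one_lt_exp hℓ.ne'; linarith

lemma hasDerivAt_levelRatio {ℓ : ℝ} (hℓ : 0 < ℓ) :
    HasDerivAt levelRatio (-(1 / ℓ ^ 2) + exp ℓ / (exp ℓ - 1) ^ 2) ℓ := by
  have h1 := (hasDerivAt_inv hℓ.ne')
  have h2 := ((hasDerivAt_exp ℓ).sub_const 1).fun_inv (exp_sub_one_pos hℓ).ne'
  have h3 := h1.sub h2
  have e : levelRatio = (fun ℓ : ℝ => ℓ⁻¹) - fun ℓ => (exp ℓ - 1)⁻¹ := by ext x; simp [levelRatio]
  rw [e]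
  refine h3.congr_deriv ?_
  rw [neg_div, sub_neg_eq_add, one_div]

lemma strictAntiOn_levelRatio : StrictAntiOn levelRatio (Ioi 0) := by
  refine strictAntiOn_of_deriv_neg (convex_Ioi 0)
    (fun x hx => (hasDerivAt_levelRatio hx).continuousAt.continuousWithinAt) fun x hx => ?_
  rw [interior_Ioi] at hx
  have hx0 : 0 < x := hx
  rw [(hasDerivAt_levelRatio hx).deriv, neg_add_lt_iff_lt_add, add_zero,
    div_lt_div_iff₀ (by have := exp_sub_one_pos hx0; positivity) (by positivity), one_mul]
  have h1 : x / 2 < sinh (x / 2) := self_lt_sinh_iff.2 (by positivity)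
  rw [sinh_eq] at h1
  have e1 : exp x = exp (x / 2) ^ 2 := by rw [← exp_nat_mul]; congr 1; push_cast; ring
  have e2 : exp (x / 2) * exp (-(x / 2)) = 1 := by rw [← exp_add]; simp
  have e3 := exp_pos (x / 2)
  have h2 : x * exp (x / 2) < exp x - 1 := by rw [e1]; nlinarith
  calc exp x * x ^ 2 = (x * exp (x / 2)) ^ 2 := by rw [e1]; ring
    _ < _ := by gcongr

lemma one_div_three_mul_le_levelRatio {ℓ : ℝ} (hℓ : 1 ≤ ℓ) : 1 / (3 * ℓ) ≤ levelRatio ℓ := by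
  have h1 := quadratic_le_exp_of_nonneg (show 0 ≤ ℓ by linarith)
  have h2 : 1 / (exp ℓ - 1) ≤ 1 / (3 / 2 * ℓ) :=
    one_div_le_one_div_of_le (by linarith) (by nlinarith)
  have e : 1 / (3 * ℓ) = 1 / ℓ - 1 / (3 / 2 * ℓ) := by field_simp; norm_num
  rw [e, levelRatio]; linarith

/-- A measurable right inverse of `levelRatio`, continuous on `(0, levelRatio 1]`. -/
lemma exists_inverse_levelRatio : ∃ φ : ℝ → ℝ, Measurable φ ∧
    ContinuousOn φ (Ioc 0 (levelRatio 1)) ∧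
    ∀ s ∈ Ioc 0 (levelRatio 1), 1 ≤ φ s ∧ levelRatio (φ s) = s := by
  have hcont : ContinuousOn levelRatio (Ioi 0) :=
    fun x hx => (hasDerivAt_levelRatio hx).continuousAt.continuousWithinAt
  have hex : ∀ s ∈ Ioc 0 (levelRatio 1), ∃ ℓ, 1 ≤ ℓ ∧ levelRatio ℓ = s := by
    intro s hs
    have h1 : 1 ≤ max 1 (1 / s) := le_max_left _ _
    have h2 : levelRatio (max 1 (1 / s)) ≤ s := by
      have hp : 0 < exp (max 1 (1 / s)) - 1 := exp_sub_one_pos (by linarith)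
      have : 1 / max 1 (1 / s) ≤ s := by rw [one_div_le (by linarith) hs.1]; exact le_max_right _ _
      have := one_div_pos.2 hp
      rw [levelRatio]; linarith
    have h3 := intermediate_value_Icc' h1 (hcont.mono fun x hx => one_pos.trans_le hx.1)
    obtain ⟨ℓ, hℓ, he⟩ := h3 ⟨h2, hs.2⟩
    exact ⟨ℓ, hℓ.1, he⟩
  choose! ψ hψ using hex
  have hψc : ContinuousOn ψ (Ioc 0 (levelRatio 1)) := by
    intro s hs
    refine tendsto_order.2 ⟨fun a ha => ?_, fun b hb => ?_⟩
    · by_cases ha1 : a < 1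
      · filter_upwards [self_mem_nhdsWithin] with s' hs'; exact ha1.trans_le (hψ s' hs').1
      · push Not at ha1
        have ha0 : a ∈ Ioi (0 : ℝ) := one_pos.trans_le ha1
        have h1 : s < levelRatio a := by
          rw [← (hψ s hs).2]; exact strictAntiOn_levelRatio ha0 (ha0.trans ha) ha
        filter_upwards [self_mem_nhdsWithin, nhdsWithin_le_nhds (Iio_mem_nhds h1)] with s' hs' h2
        by_contra hc
        push Not at hc
        have h3 := strictAntiOn_levelRatio.antitoneOn
          (one_pos.trans_le (hψ s' hs').1 : ψ s' ∈ Ioi (0 : ℝ)) ha0 hc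
        rw [(hψ s' hs').2] at h3
        exact absurd h2 (not_lt.2 h3)
    · have hs0 : ψ s ∈ Ioi (0 : ℝ) := one_pos.trans_le (hψ s hs).1
      have hb0 : b ∈ Ioi (0 : ℝ) := lt_trans (Set.mem_Ioi.1 hs0) hb
      have h1 : levelRatio b < s := by rw [← (hψ s hs).2]; exact strictAntiOn_levelRatio hs0 hb0 hb
      filter_upwards [self_mem_nhdsWithin, nhdsWithin_le_nhds (Ioi_mem_nhds h1)] with s' hs' h2
      by_contra hc
      push Not at hc
      have h3 := strictAntiOn_levelRatio.antitoneOn hb0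
        (one_pos.trans_le (hψ s' hs').1 : ψ s' ∈ Ioi (0 : ℝ)) hc
      rw [(hψ s' hs').2] at h3
      exact absurd h2 (not_lt.2 h3)
  classical
  refine ⟨(Ioc 0 (levelRatio 1)).piecewise ψ fun _ => 1,
    hψc.measurable_piecewise continuousOn_const measurableSet_Ioc, ?_, fun s hs => ?_⟩
  · exact hψc.congr fun s hs => Set.piecewise_eq_of_mem _ _ _ hs
  · rw [Set.piecewise_eq_of_mem _ _ _ hs]; exact hψ s hs

/-- Inverse function of `levelRatio`. -/
def levelInv : ℝ → ℝ := exists_inverse_levelRatio.choose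

lemma measurable_levelInv : Measurable levelInv := exists_inverse_levelRatio.choose_spec.1

lemma continuousOn_levelInv : ContinuousOn levelInv (Ioc 0 (levelRatio 1)) :=
  exists_inverse_levelRatio.choose_spec.2.1

lemma one_le_levelInv {s : ℝ} (hs : s ∈ Ioc 0 (levelRatio 1)) : 1 ≤ levelInv s :=
  (exists_inverse_levelRatio.choose_spec.2.2 s hs).1

lemma levelRatio_levelInv {s : ℝ} (hs : s ∈ Ioc 0 (levelRatio 1)) :
    levelRatio (levelInv s) = s :=
  (exists_inverse_levelRatio.choose_spec.2.2 s hs).2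

/-- Average of `log (1 + θ h_j) / θ`, `2 ≤ j ≤ k`, extended continuously to `θ = 0`. -/
def avgLogQuot (k : ℕ) (h : ℕ → ℝ) (θ : ℝ) : ℝ := avg k fun j => h j * logQuot (θ * h j)

/-- `log (1 + θ h₁) / θ`, extended continuously to `θ = 0`. -/
def logQuotOne (h : ℕ → ℝ) (θ : ℝ) : ℝ := h 1 * logQuot (θ * h 1)

/-- The value of `level` forced by the first pseudo-likelihood equation for given `θ`. -/
def rootLevel (k : ℕ) (h : ℕ → ℝ) (θ : ℝ) : ℝ :=
  levelInv (avgLogQuot k h θ / logQuotOne h θ)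

/-- The value of `σ` forced by the first pseudo-likelihood equation for given `θ`. -/
def rootScale (k : ℕ) (h : ℕ → ℝ) (θ : ℝ) : ℝ := logQuotOne h θ / rootLevel k h θ

/-- The second pseudo-likelihood equation with `σ` eliminated, divided by `θ ^ 2` so that its
trivial double zero at `θ = 0` disappears. -/
def rootFun (k : ℕ) (h : ℕ → ℝ) (θ : ℝ) : ℝ :=
  avg k (fun j => h j ^ 2 * logQuotSq (θ * h j))
    - rootScale k h θ ^ 2 * (1 - rootLevel k h θ / (exp (rootLevel k h θ) - 1)
      * (1 + rootLevel k h θ * expQuotSq (θ * logQuotOne h θ))) / (1 + rootScale k h θ * θ)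

lemma avgLogQuot_of_ne_zero {θ : ℝ} (hθ : θ ≠ 0) (k : ℕ) (h : ℕ → ℝ) :
    avgLogQuot k h θ = avgLog k h θ / θ := by
  rw [avgLogQuot, avgLog, div_eq_inv_mul, ← avg_const_mul]
  refine avg_congr fun j _ => ?_
  rw [mul_logQuot hθ, div_eq_inv_mul]

/-- What has to be known about `θ` for the elimination of `σ` to make sense. -/
structure RootDomain (k : ℕ) (h : ℕ → ℝ) (θ : ℝ) : Prop where
  arg_pos : ∀ j ∈ Icc 1 k, 0 < 1 + θ * h j
  ratio_mem : avgLogQuot k h θ / logQuotOne h θ ∈ Ioc 0 (levelRatio 1)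
  log_pos : 0 < logQuotOne h θ
  shape_pos : 0 < 1 + rootScale k h θ * θ

section

variable {k : ℕ} {h : ℕ → ℝ} {θ : ℝ}

lemma RootDomain.one_le_level (hd : RootDomain k h θ) :
    1 ≤ rootLevel k h θ := one_le_levelInv hd.ratio_mem

lemma RootDomain.scale_pos (hd : RootDomain k h θ) :
    0 < rootScale k h θ := div_pos hd.log_pos (one_pos.trans_le hd.one_le_level)

lemma avgLogQuot_eq (hr : avgLogQuot k h θ / logQuotOne h θ ∈ Ioc 0 (levelRatio 1))
    (h3 : 0 < logQuotOne h θ) :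
    avgLogQuot k h θ = rootScale k h θ * (1 - rootLevel k h θ / (exp (rootLevel k h θ) - 1)) := by
  have h1 := levelRatio_levelInv hr
  have h2 : 0 < rootLevel k h θ := one_pos.trans_le (one_le_levelInv hr)
  change levelRatio (rootLevel k h θ) = _ at h1
  rw [eq_div_iff h3.ne'] at h1
  rw [← h1, rootScale, levelRatio]
  have := exp_sub_one_pos h2; field_simp

lemma inv_exp_sub_one {ℓ : ℝ} (hℓ : 0 < ℓ) : exp (-ℓ) / (1 - exp (-ℓ)) = 1 / (exp ℓ - 1) := by
  have h1 : exp (-ℓ) < 1 := by rw [exp_lt_one_iff]; linarith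
  have h2 : exp (-ℓ) * exp ℓ = 1 := by rw [← exp_add]; simp
  rw [div_eq_div_iff (by linarith) (exp_sub_one_pos hℓ).ne']; linarith

lemma RootDomain.level_eq (hd : RootDomain k h θ) (hθ : θ ≠ 0) :
    level (h 1) θ (rootScale k h θ) = rootLevel k h θ := by
  have h1 := hd.log_pos
  have h2 := one_pos.trans_le hd.one_le_level
  have e : log (1 + θ * h 1) = θ * logQuotOne h θ := by rw [logQuotOne, mul_logQuot hθ]; field_simp
  rw [level, e, rootScale]; field_simp

/-- The elimination, as an identity. -/
lemma RootDomain.rootFun_eq (hk : 2 ≤ k) (hd : RootDomain k h θ)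
    (hθ : θ ≠ 0) :
    θ ^ 2 * ((1 + rootScale k h θ * θ) * rootFun k h θ) = (profile k h θ - 1)
      - 1 / (exp (rootLevel k h θ) - 1)
        * (1 - 1 / (1 + θ * h 1) - avgInv k h θ * log (1 + θ * h 1)) := by
  have h1 := hd.log_pos
  have h2 := one_pos.trans_le hd.one_le_level
  have hb := hd.arg_pos 1 (mem_Icc.2 ⟨le_rfl, by omega⟩)
  have e : log (1 + θ * h 1) = θ * logQuotOne h θ := by rw [logQuotOne, mul_logQuot hθ]; field_simp
  have eΛ : logQuotOne h θ = rootScale k h θ * rootLevel k h θ := by rw [rootScale]; field_simp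
  have einv : 1 / (1 + θ * h 1) = 1 - θ * logQuotOne h θ
      + (θ * logQuotOne h θ) ^ 2 * expQuotSq (θ * logQuotOne h θ) := by
    rw [← exp_neg_eq_expQuotSq, exp_neg, ← e, exp_log hb, one_div]
  have eL : avgLog k h θ = θ * (rootScale k h θ
      * (1 - rootLevel k h θ / (exp (rootLevel k h θ) - 1))) := by
    rw [← avgLogQuot_eq hd.ratio_mem hd.log_pos, avgLogQuot_of_ne_zero hθ]; field_simp
  have eM : avgInv k h θ = 1 - avgLog k h θ
      + θ ^ 2 * avg k (fun j => h j ^ 2 * logQuotSq (θ * h j)) := by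
    have e1 : avgInv k h θ = avg k (fun j => 1 - log (1 + θ * h j)
        + θ ^ 2 * (h j ^ 2 * logQuotSq (θ * h j))) := avg_congr fun j hj => by
      rw [sq_mul_logQuotSq hθ (hd.arg_pos j (mem_Icc_one hj)).ne']; ring
    rw [e1, avg_add, avg_sub, avg_const hk, avg_const_mul, avgLog]
  rw [einv, e, profile, eM, eL, rootFun]
  have hs := hd.shape_pos.ne'
  generalize avg k (fun j => h j ^ 2 * logQuotSq (θ * h j)) = K
  generalize expQuotSq (θ * logQuotOne h θ) = R
  rw [eΛ]
  generalize rootScale k h θ = s at *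
  generalize rootLevel k h θ = l at *
  rw [mul_sub, mul_div_cancel₀ _ hs, one_div, div_eq_mul_inv]
  generalize (exp l - 1)⁻¹ = v; ring

lemma RootDomain.scaledRoot (hk : 2 ≤ k) (hd : RootDomain k h θ)
    (hθ : θ ≠ 0) (h0 : rootFun k h θ = 0) : ScaledRoot k h θ (rootScale k h θ) := by
  have h2 := one_pos.trans_le hd.one_le_level
  have hb := hd.arg_pos 1 (mem_Icc.2 ⟨le_rfl, by omega⟩)
  have hid := hd.rootFun_eq hk hθ
  rw [h0, mul_zero, mul_zero] at hid
  have e : log (1 + θ * h 1) = θ * (rootScale k h θ * rootLevel k h θ) := by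
    rw [rootScale, div_mul_cancel₀ _ h2.ne', logQuotOne, mul_logQuot hθ]; field_simp
  have eL : avgLog k h θ = θ * (rootScale k h θ
      * (1 - rootLevel k h θ / (exp (rootLevel k h θ) - 1))) := by
    rw [← avgLogQuot_eq hd.ratio_mem hd.log_pos, avgLogQuot_of_ne_zero hθ]; field_simp
  have hu : exp (-rootLevel k h θ) < 1 := by rw [exp_lt_one_iff]; linarith
  have hv := inv_exp_sub_one h2
  refine ⟨hθ, hd.scale_pos, hb, ?_, ?_⟩
  · rw [hd.level_eq hθ, mul_div_right_comm, hv, e, eL]; ring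
  · rw [hd.level_eq hθ]
    have hs := hd.shape_pos
    have hone : (1 - exp (-rootLevel k h θ) / (1 + θ * h 1)) / (1 - exp (-rootLevel k h θ))
        = 1 + 1 / (exp (rootLevel k h θ) - 1) * (1 - 1 / (1 + θ * h 1)) := by
      rw [← hv]
      have : 1 - exp (-rootLevel k h θ) ≠ 0 := by linarith
      field_simp; ring
    rw [hone, one_div_mul_eq_div, eq_div_iff hs.ne']
    rw [profile, eL, e] at hid
    linear_combination (-1 : ℝ) * hid

end

/-! ### Sign change on a shrinking box -/

lemma continuousOn_rootFun {k : ℕ} (hk : 1 ≤ k) {h : ℕ → ℝ} {s : Set ℝ}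
    (hd : ∀ θ ∈ s, RootDomain k h θ) : ContinuousOn (rootFun k h) s := by
  have hq : ∀ f : ℝ → ℝ, (∀ y, 0 < 1 + y → ContinuousAt f y) → ∀ j ∈ Icc 1 k, ∀ a : ℝ,
      ContinuousOn (fun θ => a * f (θ * h j)) s := fun f hf j hj a θ hθ =>
    (continuousAt_const.mul (ContinuousAt.comp (f := fun θ : ℝ => θ * h j)
      (hf _ ((hd θ hθ).arg_pos j hj)) (by fun_prop))).continuousWithinAt
  have c1 : ContinuousOn (logQuotOne h) s :=
    hq _ (fun _ => continuousAt_logQuot) 1 (mem_Icc.2 ⟨le_rfl, hk⟩) _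
  have c2 : ContinuousOn (avgLogQuot k h) s := continuousOn_const.mul
    (continuousOn_finsetSum _ fun j hj => hq _ (fun _ => continuousAt_logQuot) j (mem_Icc_one hj) _)
  have c3 : ContinuousOn (fun θ => avg k fun j => h j ^ 2 * logQuotSq (θ * h j)) s :=
    continuousOn_const.mul (continuousOn_finsetSum _ fun j hj =>
      hq _ (fun _ => continuousAt_logQuotSq) j (mem_Icc_one hj) _)
  have c4 : ContinuousOn (rootLevel k h) s :=
    continuousOn_levelInv.comp (c2.div c1 fun θ hθ => (hd θ hθ).log_pos.ne')
      fun θ hθ => (hd θ hθ).ratio_mem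
  have c4pos : ∀ θ ∈ s, 0 < rootLevel k h θ := fun θ hθ =>
    one_pos.trans_le (hd θ hθ).one_le_level
  have c5 : ContinuousOn (rootScale k h) s := c1.div c4 fun θ hθ => (c4pos θ hθ).ne'
  have c6 : ContinuousOn (fun θ => expQuotSq (θ * logQuotOne h θ)) s :=
    continuous_expQuotSq.comp_continuousOn (continuousOn_id.mul c1)
  have c7 : ContinuousOn (fun θ => exp (rootLevel k h θ) - 1) s :=
    (continuous_exp.comp_continuousOn c4).sub continuousOn_const
  exact c3.sub (((c5.pow 2).mul (continuousOn_const.sub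
    ((c4.div c7 fun θ hθ => (exp_sub_one_pos (c4pos θ hθ)).ne').mul
      (continuousOn_const.add (c4.mul c6))))).div
    (continuousOn_const.add (c5.mul continuousOn_id)) fun θ hθ => (hd θ hθ).shape_pos.ne')

namespace TailArray

variable {ι : Type*} {F : Filter ι} {k : ι → ℕ} {y : ι → ℕ → ℝ} {θ : ι → ℝ}

local notation:max "K[" i "]" => (k i : ℝ)
local notation:max "E[" ξ ", " i "]" => exc ξ (k i) (y i)
local notation:max "L[" ξ ", " θ ", " i "]" => rootLevel (k i) E[ξ, i] (θ i)
local notation:max "S[" ξ ", " θ ", " i "]" => rootScale (k i) E[ξ, i] (θ i)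
local notation:max "Λ[" ξ ", " θ ", " i "]" => logQuotOne E[ξ, i] (θ i)
local notation:max "M[" ξ ", " θ ", " i "]" => avgLogQuot (k i) E[ξ, i] (θ i)

/-- Limits of the eliminated quantities when `θ - ξ` is of smaller order than `k ^ (-c)`;
the value `θ = 0` is allowed. -/
lemma logQuot_limits [F.IsCountablyGenerated] (h : TailArray F k y) {ξ c : ℝ} (hξ : -1 / 2 < ξ)
    (hc : max (-ξ) 0 < c) (hθ : ∀ᶠ i in F, |θ i - ξ| ≤ K[i] ^ (-c)) :
    Tendsto (fun i => Λ[ξ, θ, i] - log (k i / y i 1)) F (𝓝 0) ∧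
    Tendsto (fun i => M[ξ, θ, i]) F (𝓝 1) ∧
    ∀ᶠ i in F, 0 < 1 + θ i * E[ξ, i] 1 := by
  have hc0 : 0 < c := (le_max_right _ _).trans_lt hc
  have hsplit : F = (F ⊓ 𝓟 {i | θ i = 0}) ⊔ (F ⊓ 𝓟 {i | θ i = 0}ᶜ) := by
    rw [← inf_sup_left, sup_principal, Set.union_compl_self, principal_univ, inf_top_eq]
  set 𝓖 := F ⊓ 𝓟 {i | θ i = 0}
  set 𝓗 := F ⊓ 𝓟 {i | θ i = 0}ᶜ
  have hH : TailArray 𝓗 k y := h.comp (φ := id) inf_le_left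
  have hH0 : ∀ᶠ i in 𝓗, θ i ≠ 0 := mem_inf_of_right (mem_principal_self _)
  have hG0 : ∀ᶠ i in 𝓖, θ i = 0 := mem_inf_of_right (mem_principal_self _)
  have hθt := h.tendsto_of_abs_sub_le hc0 hθ
  obtain ⟨d, hd, hΛ⟩ := hH.log_arg_div_sub_le hξ hc hH0 (hθ.filter_mono inf_le_left)
  have hHD : ∀ᶠ i in 𝓗, 0 < 1 + θ i * E[ξ, i] 1 := hΛ.mono fun i hi => hi.1
  have hHt : Tendsto θ 𝓗 (𝓝 ξ) := hθt.mono_left inf_le_left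
  obtain ⟨B, β, hB, hL⟩ := hH.avgLog_div_expansion hξ hHt hHD hH0
  have H1 : Tendsto (fun i => Λ[ξ, θ, i] - log (k i / y i 1)) 𝓗 (𝓝 0) := by
    refine squeeze_zero_norm' ?_ (hH.tendsto_rpow_neg (neg_lt_zero.2 hd))
    filter_upwards [hΛ, hH0] with i h1 h2
    rw [logQuotOne, mul_logQuot h2]; exact h1.2
  have H2 : Tendsto (fun i => M[ξ, θ, i]) 𝓗 (𝓝 1) := by
    rw [tendsto_iff_norm_sub_tendsto_zero]
    have b : Tendsto (fun i => K[i] ^ (-1 / 2 + 1 / 4 : ℝ) + |θ i - ξ| * |B i|) 𝓗 (𝓝 0) := by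
      have := (hH.tendsto_rpow_neg
        (show (-1 / 2 + 1 / 4 : ℝ) < 0 by norm_num)).add
        ((tendsto_iff_norm_sub_tendsto_zero.1 hHt).mul hB.abs)
      simpa using this
    refine squeeze_zero' (Eventually.of_forall fun i => norm_nonneg _) ?_ b
    filter_upwards [hL (1 / 4) (by norm_num), hH0] with i h1 h2
    rw [avgLogQuot_of_ne_zero h2]; exact h1
  by_cases hξ0 : ξ = 0
  · subst hξ0
    have hG : TailArray 𝓖 k y := h.comp (φ := id) inf_le_left
    rw [hsplit]
    refine ⟨Tendsto.sup ?_ H1, Tendsto.sup ?_ H2, eventually_sup.2 ⟨?_, hHD⟩⟩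
    · refine tendsto_const_nhds.congr' ?_
      filter_upwards [hG0] with i hi
      rw [logQuotOne, hi, zero_mul, logQuot, if_pos rfl, exc_zero]; ring
    · refine (hG.tendsto_of_rate fun ε hε => hG.avg_exc_zero_rate hε).congr' ?_
      filter_upwards [hG0] with i hi
      refine avg_congr fun j _ => ?_
      rw [hi, zero_mul, logQuot, if_pos rfl, mul_one]
    · filter_upwards [hG0] with i hi; rw [hi]; norm_num
  · have hbot : 𝓖 = ⊥ := by
      refine empty_mem_iff_bot.1 ?_
      filter_upwards [hG0, (hθt.mono_left (inf_le_left : 𝓖 ≤ F)).eventually_ne hξ0] with i h1 h2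
      exact h2 h1
    rw [hbot, bot_sup_eq] at hsplit
    rw [hsplit]
    exact ⟨H1, H2, hHD⟩

/-- On the box the level diverges and the scale forced by the first equation tends to one. -/
lemma rootDomain_limits [F.IsCountablyGenerated] (h : TailArray F k y) {ξ c : ℝ} (hξ : -1 / 2 < ξ)
    (hc : max (-ξ) 0 < c) (hθ : ∀ᶠ i in F, |θ i - ξ| ≤ K[i] ^ (-c)) :
    (∀ᶠ i in F, RootDomain (k i) E[ξ, i] (θ i)) ∧
    Tendsto (fun i => L[ξ, θ, i]) F atTop ∧
    Tendsto (fun i => S[ξ, θ, i]) F (𝓝 1) := by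
  obtain ⟨h1, h2, h3⟩ := h.logQuot_limits hξ hc hθ
  have hc0 : 0 < c := (le_max_right _ _).trans_lt hc
  have hθt := h.tendsto_of_abs_sub_le hc0 hθ
  have tk := h.tendsto_log
  have tΛ : Tendsto (fun i => Λ[ξ, θ, i]) F atTop := by
    refine tendsto_atTop_mono' _ ?_ (tk.atTop_div_const two_pos)
    filter_upwards [h1.eventually_const_le (show (-1 : ℝ) < 0 by norm_num), h.log_ratio_one_ge,
      tk.eventually_ge_atTop 4] with i g1 g2 g3
    linarith
  have ts : Tendsto (fun i => M[ξ, θ, i]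
      / Λ[ξ, θ, i]) F (𝓝 0) := h2.div_atTop tΛ
  have hs1 : 0 < levelRatio 1 :=
    lt_of_lt_of_le (by norm_num) (one_div_three_mul_le_levelRatio le_rfl)
  have hmem : ∀ᶠ i in F, M[ξ, θ, i]
      / Λ[ξ, θ, i] ∈ Ioc 0 (levelRatio 1) := by
    filter_upwards [ts.eventually_le_const hs1, h2.eventually_const_lt one_pos,
      tΛ.eventually_gt_atTop 0] with i g1 g2 g3
    exact ⟨div_pos g2 g3, g1⟩
  have tℓ : Tendsto (fun i => L[ξ, θ, i]) F atTop := by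
    have t1 : Tendsto (fun i => (M[ξ, θ, i]
      / Λ[ξ, θ, i])⁻¹ / 3) F atTop := by
      refine Tendsto.atTop_div_const (by norm_num) (tendsto_inv_nhdsGT_zero.comp ?_)
      exact tendsto_nhdsWithin_iff.2 ⟨ts, hmem.mono fun i hi => hi.1⟩
    refine tendsto_atTop_mono' _ ?_ t1
    filter_upwards [hmem] with i hi
    have q1 := one_le_levelInv hi
    have q2 := one_div_three_mul_le_levelRatio q1
    rw [levelRatio_levelInv hi] at q2
    change _ ≤ levelInv _
    rw [div_le_iff₀ three_pos, inv_le_comm₀ hi.1 (by linarith), mul_comm, ← one_div]; exact q2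
  have tq : Tendsto (fun i => 1 - L[ξ, θ, i]
      / (exp (L[ξ, θ, i]) - 1)) F (𝓝 1) := by
    have t1 : Tendsto (fun x : ℝ => x / (exp x - 1)) atTop (𝓝 0) := by
      have a1 : Tendsto (fun x : ℝ => 2 * x⁻¹) atTop (𝓝 0) := by
        simpa using tendsto_inv_atTop_zero.const_mul (2 : ℝ)
      refine squeeze_zero' ?_ ?_ a1
      · filter_upwards [eventually_gt_atTop 0] with x hx
        exact div_nonneg hx.le (exp_sub_one_pos hx).le
      · filter_upwards [eventually_gt_atTop 0] with x hx
        rw [div_le_iff₀ (exp_sub_one_pos hx)]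
        have := quadratic_le_exp_of_nonneg hx.le
        have e : x = 2 * x⁻¹ * (x ^ 2 / 2) := by field_simp
        calc x = 2 * x⁻¹ * (x ^ 2 / 2) := e
          _ ≤ _ := by gcongr; linarith
    simpa using (t1.comp tℓ).const_sub 1
  have hσeq : ∀ᶠ i in F, M[ξ, θ, i]
      = S[ξ, θ, i] * (1 - L[ξ, θ, i]
      / (exp (L[ξ, θ, i]) - 1)) := by
    filter_upwards [hmem, tΛ.eventually_gt_atTop 0] with i hi g3 using avgLogQuot_eq hi g3
  have tσ : Tendsto (fun i => S[ξ, θ, i]) F (𝓝 1) := by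
    have t1 : Tendsto (fun i => M[ξ, θ, i] / (1 - L[ξ, θ, i]
      / (exp (L[ξ, θ, i]) - 1))) F (𝓝 (1 / 1)) :=
      h2.div tq one_ne_zero
    rw [div_one] at t1
    refine t1.congr' ?_
    filter_upwards [hσeq, tq.eventually_const_lt one_pos] with i g1 g2
    rw [g1, mul_div_cancel_right₀ _ g2.ne']
  refine ⟨?_, tℓ, tσ⟩
  have tshape : Tendsto (fun i => 1 + S[ξ, θ, i] * θ i) F
      (𝓝 (1 + 1 * ξ)) := (tσ.mul hθt).const_add 1
  filter_upwards [hmem, tΛ.eventually_gt_atTop 0, h3,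
    tshape.eventually_const_lt (show 0 < 1 + 1 * ξ by linarith), h.exc_nonneg ξ,
    h.exc_antitone ξ, h.one_mem] with i g1 g2 g3 g4 g5 g6 g7
  exact ⟨fun j hj => arg_pos_of_first (g5 j hj) (g6 1 g7 j hj (mem_Icc.1 hj).1) g3, g1, g2, g4⟩

set_option maxHeartbeats 1000000 in
/-- At the two ends of the box `|θ - ξ| ≤ k ^ (-c)`, `c < 1 / 2`, the linear part of the profile
function dominates all error terms, so `rootFun` has opposite signs there. -/
lemma sign_rootFun [F.IsCountablyGenerated] (h : TailArray F k y) {ξ c : ℝ} (hξ : -1 / 2 < ξ)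
    (hc : max (-ξ) 0 < c) (hc2 : c < 1 / 2) {δ : ℝ} (hδ : |δ| = 1) :
    ∀ᶠ i in F, δ * rootFun (k i) E[ξ, i] (ξ + δ * K[i] ^ (-c)) < 0 := by
  have hc0 : 0 < c := (le_max_right _ _).trans_lt hc
  set θ : ι → ℝ := fun i => ξ + δ * K[i] ^ (-c) with hθdef
  have hθ : ∀ i, |θ i - ξ| = K[i] ^ (-c) := fun i => by
    rw [hθdef]
    simp only [add_sub_cancel_left, abs_mul, hδ, one_mul]
    exact abs_of_nonneg (by positivity)
  have hθt : Tendsto θ F (𝓝 ξ) := by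
    rw [tendsto_iff_norm_sub_tendsto_zero]
    simp only [norm_eq_abs, hθ]
    exact h.tendsto_rpow_neg (by linarith)
  have hθ0 : ∀ᶠ i in F, θ i ≠ 0 := by
    by_cases hξ0 : ξ = 0
    · filter_upwards [h.k_pos] with i hk h0
      have := hθ i
      rw [h0, hξ0, sub_zero, abs_zero] at this
      exact (rpow_pos_of_pos hk (-c)).ne this
    · exact hθt.eventually_ne hξ0
  have hθle : ∀ᶠ i in F, |θ i - ξ| ≤ K[i] ^ (-c) := Eventually.of_forall fun i => (hθ i).le
  obtain ⟨r1, r2, r3⟩ := h.rootDomain_limits hξ hc hθle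
  obtain ⟨l1, -, hD⟩ := h.logQuot_limits hξ hc hθle
  obtain ⟨C, hC0, hC⟩ := h.first_term_bound hξ hθt hD hθ0
  obtain ⟨S, hS, hexp⟩ := h.profile_expansion hξ hθt hD hθ0
  set s₀ := 1 / ((1 + 2 * ξ) * (1 + ξ) ^ 2)
  have q1 : 0 < 1 + 2 * ξ := by linarith
  have q2 : 0 < 1 + ξ := by linarith
  have hs₀p : 0 < s₀ := by positivity
  rw [neg_div] at hS
  have hσθ : Tendsto (fun i => S[ξ, θ, i] * θ i) F (𝓝 ξ) := by
    simpa using r3.mul hθt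
  have hσe : ∀ᶠ i in F, 0 < S[ξ, θ, i] ∧ S[ξ, θ, i] ≤ 2 :=
    (r3.eventually_const_lt one_pos).and (r3.eventually_le_const one_lt_two)
  have hσθe : ∀ᶠ i in F, -1 / 2 + (1 / 2 + ξ) / 2
      ≤ S[ξ, θ, i] * θ i := hσθ.eventually_const_le (by linarith)
  set ε := (1 / 2 - c) / 2 with hε
  have hε0 : 0 < ε := by rw [hε]; linarith
  have tk := h.tendsto_log
  have hlev : ∀ᶠ i in F, exp (-(L[ξ, θ, i] / 2)) ≤ K[i] ^ (-1 / 2 + ε) := by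
    filter_upwards [r1, h.ratio_one_ge (show 0 < ε / 2 by positivity), h.k_pos,
      l1.eventually_const_le (show (-1 : ℝ) < 0 by norm_num), hσe,
      r3.eventually_le_const (show 1 < 1 + ε / 2 by linarith),
      tk.eventually_ge_atTop (1 / (ε / 2))] with i g1 g2 hk g4 g5 g6 g7
    have e1 := log_le_log (by positivity) g2
    rw [log_rpow hk] at e1
    rw [div_le_iff₀ (by positivity)] at g7
    have eΛ : Λ[ξ, θ, i] = S[ξ, θ, i]
        * L[ξ, θ, i] := by
      have := one_pos.trans_le g1.one_le_level; rw [rootScale]; field_simp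
    rw [eΛ] at g4
    have q0 := g1.one_le_level
    rw [rpow_def_of_pos hk]
    apply exp_le_exp.2
    set l := L[ξ, θ, i]
    have e2 : (1 + ε / 2) * l ≥ (1 - ε) * log (k i) := by nlinarith
    have e3 : (1 + ε / 2) * ((1 - 2 * ε) * log (k i)) ≤ (1 - ε) * log (k i) := by nlinarith
    have e4 : (1 - 2 * ε) * log (k i) ≤ l := le_of_mul_le_mul_left (e3.trans e2) (by positivity)
    linarith
  filter_upwards [level_term_le (C := C) hξ r2 hσe hσθe, hC, r1, hexp ε hε0, hlev, hθ0,
    hS.eventually_le_const (show -s₀ < -(s₀ / 2) by linarith), h.k_pos,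
    h.mul_rpow_le (show -1 / 2 + ε < -c by rw [hε]; linarith) (3 / (s₀ / 2)),
    h.eventually_le_k 2]
    with i g1 g2 g3 g4 g5 g6 g7 hk g9 g10
  have hb := g3.arg_pos 1 (mem_Icc.2 ⟨le_rfl, by omega⟩)
  have hl := one_pos.trans_le g3.one_le_level
  have eΛ : log (1 + θ i * E[ξ, i] 1) / θ i
      = L[ξ, θ, i] * S[ξ, θ, i] := by
    rw [← mul_logQuot g6, rootScale, mul_div_cancel₀ _ hl.ne']; rfl
  have eb : exp (L[ξ, θ, i]
      * (S[ξ, θ, i] * θ i)) = 1 + θ i * E[ξ, i] 1 := by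
    rw [← mul_assoc, ← eΛ, div_mul_cancel₀ _ g6, exp_log hb]
  rw [eb, ← eΛ] at g1
  have hid := g3.rootFun_eq g10 g6
  rw [← inv_exp_sub_one hl] at hid
  have hu : exp (-L[ξ, θ, i]) < 1 := by rw [exp_lt_one_iff]; linarith
  have hv : 0 ≤ exp (-L[ξ, θ, i]) / (1 - exp (-L[ξ, θ, i])) :=
    div_nonneg (exp_pos _).le (by linarith)
  have hsh := g3.shape_pos
  change δ * rootFun (k i) E[ξ, i] (θ i) < 0
  set v := exp (-L[ξ, θ, i]) / (1 - exp (-L[ξ, θ, i]))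
  set η := (1 - 1 / (1 + θ i * E[ξ, i] 1)
        - avgInv (k i) E[ξ, i] (θ i) * log (1 + θ i * E[ξ, i] 1)) with hη
  set W := (1 + (log (1 + θ i * E[ξ, i] 1) / θ i) ^ 2) * (1 + 1 / (1 + θ i * E[ξ, i] 1))
  have e1 : (1 + S[ξ, θ, i] * θ i) * rootFun (k i) E[ξ, i] (θ i)
      = (profile (k i) E[ξ, i] (θ i) - 1) / θ i ^ 2 - v * (η / θ i ^ 2) := by
    rw [← mul_div_assoc, ← sub_div, eq_div_iff (pow_ne_zero 2 g6), ← hid]; ring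
  have e2 : |v * (η / θ i ^ 2)| ≤ K[i] ^ (-1 / 2 + ε) := by
    rw [abs_mul, abs_of_nonneg hv]
    calc v * |η / θ i ^ 2| ≤ v * (C * W) := by gcongr
      _ = C * (v * W) := by ring
      _ ≤ _ := g1.trans g5
  set R := rootFun (k i) E[ξ, i] (θ i)
  have e3 : δ * ((1 + S[ξ, θ, i] * θ i) * R)
      ≤ K[i] ^ (-c) * S i + 2 * K[i] ^ (-1 / 2 + ε) := by
    have hθξ : θ i - ξ = δ * K[i] ^ (-c) := by rw [hθdef]; ring
    have hδ2 : δ * δ = 1 := by rw [← abs_mul_abs_self, hδ]; norm_num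
    have a1 : δ * ((1 + S[ξ, θ, i] * θ i) * R)
        = K[i] ^ (-c) * S i + δ * ((profile (k i) E[ξ, i] (θ i) - 1) / θ i ^ 2
          - (θ i - ξ) * S i) - δ * (v * (η / θ i ^ 2)) := by
      rw [e1, hθξ]; linear_combination (K[i] ^ (-c) * S i) * hδ2
    have a2 : δ * ((profile (k i) E[ξ, i] (θ i) - 1) / θ i ^ 2
          - (θ i - ξ) * S i) ≤ K[i] ^ (-1 / 2 + ε) := by
      refine (le_abs_self _).trans ?_; rw [abs_mul, hδ, one_mul]; exact g4
    have a3 : -(δ * (v * (η / θ i ^ 2))) ≤ K[i] ^ (-1 / 2 + ε) := by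
      refine (neg_le_abs _).trans ?_; rw [abs_mul, hδ, one_mul]; exact e2
    linarith
  have hkε := rpow_pos_of_pos hk (-1 / 2 + ε)
  have hkc := rpow_pos_of_pos hk (-c)
  have e4 : K[i] ^ (-c) * S i ≤ -(3 * K[i] ^ (-1 / 2 + ε)) := by
    rw [div_mul_eq_mul_div, div_le_iff₀ (by positivity)] at g9
    have := mul_le_mul_of_nonneg_left g7 hkc.le; linarith
  by_contra hcon
  push Not at hcon
  have : 0 ≤ (1 + S[ξ, θ, i] * θ i) * (δ * R) := by positivity
  linarith

lemma eventually_forall_near {P : ι → ℝ → Prop} {b : ι → ℝ} {ξ : ℝ}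
    (hP : ∀ᶠ p in (F.comap Prod.fst ⊓ 𝓟 {p : ι × ℝ | |p.2 - ξ| ≤ b p.1}), P p.1 p.2) :
    ∀ᶠ i in F, ∀ θ, |θ - ξ| ≤ b i → P i θ := by
  rw [eventually_inf_principal, eventually_comap] at hP
  filter_upwards [hP] with i hi θ hθ
  exact hi (i, θ) rfl hθ

/-- The box on which the root is found. -/
theorem root_box [F.IsCountablyGenerated] (h : TailArray F k y) {ξ c : ℝ} (hξ : -1 / 2 < ξ)
    (hc : max (-ξ) 0 < c) (hc2 : c < 1 / 2) :
    (∀ᶠ i in F, ∀ θ, |θ - ξ| ≤ K[i] ^ (-c) → RootDomain (k i) E[ξ, i] θ) ∧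
    (∀ ε > (0 : ℝ), ∀ᶠ i in F, ∀ θ, |θ - ξ| ≤ K[i] ^ (-c) →
      |rootScale (k i) E[ξ, i] θ - 1| ≤ ε) ∧
    ∀ᶠ i in F, 0 < rootFun (k i) E[ξ, i] (ξ - K[i] ^ (-c)) ∧
      rootFun (k i) E[ξ, i] (ξ + K[i] ^ (-c)) < 0 := by
  set 𝓖 := F.comap Prod.fst ⊓ 𝓟 {p : ι × ℝ | |p.2 - ξ| ≤ (k p.1 : ℝ) ^ (-c)}
  have hG : TailArray 𝓖 (k ∘ Prod.fst) (y ∘ Prod.fst) :=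
    h.comp (tendsto_comap.mono_left inf_le_left)
  have hθ : ∀ᶠ p in 𝓖, |p.2 - ξ| ≤ ((k ∘ Prod.fst) p : ℝ) ^ (-c) :=
    mem_inf_of_right (mem_principal_self _)
  obtain ⟨r1, -, r3⟩ := hG.rootDomain_limits hξ hc hθ
  refine ⟨eventually_forall_near r1, fun ε hε => eventually_forall_near
    (P := fun i θ => |rootScale (k i) E[ξ, i] θ - 1| ≤ ε) ?_, ?_⟩
  · have := (tendsto_iff_norm_sub_tendsto_zero.1 r3).eventually_le_const hε; simpa using this
  · filter_upwards [h.sign_rootFun hξ hc hc2 (δ := 1) (by norm_num),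
      h.sign_rootFun hξ hc hc2 (δ := -1) (by norm_num)] with i g1 g2
    rw [one_mul, one_mul] at g1
    rw [neg_one_mul, neg_one_mul, ← sub_eq_add_neg] at g2
    exact ⟨by linarith, g1⟩

end TailArray

/-! ### Measurable selection of a root -/

/-- Measurable selection of a zero of a continuous function that changes sign: the supremum of the
rationals before which the function stays positive at rational points. -/
lemma exists_measurable_zero {α : Type*} [MeasurableSpace α] (g : α → ℝ → ℝ)
    (hg : ∀ θ, Measurable fun x => g x θ) {a b : ℝ} (hab : a < b) :
    ∃ s : α → ℝ, Measurable s ∧ ∀ x, ContinuousOn (g x) (Set.Icc a b) → 0 < g x a → g x b < 0 →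
      s x ∈ Set.Icc a b ∧ g x (s x) = 0 := by
  classical
  set good : ℚ → Set α := fun c => {x | ∀ q : ℚ, a ≤ q → (q : ℝ) ≤ c → 0 < g x q} with hgood
  have hgm : ∀ c, MeasurableSet (good c) := fun c => by
    have : good c = ⋂ q : ℚ, {x | a ≤ q → (q : ℝ) ≤ c → 0 < g x q} := by ext x; simp [hgood]
    rw [this]
    refine MeasurableSet.iInter fun q => ?_
    by_cases h1 : a ≤ q
    · by_cases h2 : (q : ℝ) ≤ c
      · simpa [h1, h2] using measurableSet_lt measurable_const (hg q)
      · simp [h2]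
    · simp [h1]
  set f : ℚ → α → ℝ := fun c x => if a ≤ c ∧ (c : ℝ) ≤ b ∧ x ∈ good c then (c : ℝ) else a with hf
  have hfm : ∀ c, Measurable (f c) := fun c => by
    by_cases h1 : a ≤ c ∧ (c : ℝ) ≤ b
    · have : f c = fun x => if x ∈ good c then (c : ℝ) else a := by ext x; simp [hf, h1.1, h1.2]
      rw [this]
      exact Measurable.ite (hgm c) measurable_const measurable_const
    · have : f c = fun _ => a := by
        ext x
        simp only [hf]
        rw [if_neg]
        exact fun h => h1 ⟨h.1, h.2.1⟩
      rw [this]; exact measurable_const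
  have hfle : ∀ c x, f c x ≤ b := fun c x => by
    simp only [hf]; split_ifs with h
    · exact h.2.1
    · exact hab.le
  have hlef : ∀ c x, a ≤ f c x := fun c x => by
    simp only [hf]; split_ifs with h
    · exact h.1
    · exact le_rfl
  have hbdd : ∀ x, BddAbove (Set.range fun c => f c x) := fun x =>
    ⟨b, by rintro _ ⟨c, rfl⟩; exact hfle c x⟩
  refine ⟨fun x => ⨆ c, f c x, Measurable.iSup hfm, fun x hc ha hb => ?_⟩
  set s := ⨆ c, f c x
  have hsb : s ≤ b := ciSup_le fun c => hfle c x
  have hsa : a ≤ s := (hlef 0 x).trans (le_ciSup (hbdd x) 0)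
  refine ⟨⟨hsa, hsb⟩, ?_⟩
  -- before `s` the function is positive at rational points
  have hbelow : ∀ q : ℚ, a ≤ q → (q : ℝ) < s → 0 < g x q := by
    intro q hq hqs
    obtain ⟨c, hcq⟩ := exists_lt_of_lt_ciSup hqs
    simp only [hf] at hcq
    split_ifs at hcq with h
    · exact h.2.2 q hq hcq.le
    · linarith
  have hcs : ContinuousWithinAt (g x) (Set.Icc a b) s := hc s ⟨hsa, hsb⟩
  rcases lt_trichotomy (g x s) 0 with hneg | hzero | hpos
  · exfalso
    have hsa' : a < s := by
      rcases hsa.lt_or_eq with h | h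
      · exact h
      · rw [← h] at hneg; linarith
    have h1 := hcs.eventually_lt_const hneg
    obtain ⟨δ, hδ, hball⟩ := Metric.eventually_nhds_iff.1 (eventually_nhdsWithin_iff.1 h1)
    obtain ⟨q, hq1, hq2⟩ := exists_rat_btwn (max_lt hsa' (show s - δ < s by linarith))
    have hq3 := (max_lt_iff.1 hq1)
    have := @hball (q : ℝ) (by rw [dist_eq, abs_lt]; constructor <;> linarith)
      ⟨hq3.1.le, by linarith⟩
    linarith [hbelow q hq3.1.le hq2]
  · exact hzero
  · exfalso
    have hsb' : s < b := by
      rcases hsb.lt_or_eq with h | h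
      · exact h
      · rw [h] at hpos; linarith
    obtain ⟨δ, hδ, hball⟩ := Metric.eventually_nhds_iff.1
      (eventually_nhdsWithin_iff.1 (hcs.eventually_const_lt hpos))
    obtain ⟨c, hc1, hc2⟩ := exists_rat_btwn (lt_min hsb' (show s < s + δ by linarith))
    have hc3 := lt_min_iff.1 hc2
    have hmem : x ∈ good c := by
      intro q hq hqc
      rcases lt_or_ge (q : ℝ) s with h | h
      · exact hbelow q hq h
      · exact hball (by rw [dist_eq, abs_lt]; constructor <;> linarith) ⟨hq, by linarith⟩
    have : f c x = c := by simp only [hf]; rw [if_pos ⟨by linarith, hc3.1.le, hmem⟩]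
    have := le_ciSup (hbdd x) c
    change f c x ≤ s at this; linarith

section Measurability

variable {α : Type*} [MeasurableSpace α] {h : α → ℕ → ℝ} {θ : α → ℝ}

lemma measurable_avg (k : ℕ) (hh : ∀ j, Measurable fun x => h x j) :
    Measurable fun x => avg k (h x) :=
  measurable_const.mul (Finset.measurable_sum _ fun j _ => hh j)

lemma measurable_logQuotOne (hh : ∀ j, Measurable fun x => h x j) (hθ : Measurable θ) :
    Measurable fun x => logQuotOne (h x) (θ x) :=
  (hh 1).mul (measurable_logQuot.comp (hθ.mul (hh 1)))

lemma measurable_avgLogQuot (k : ℕ) (hh : ∀ j, Measurable fun x => h x j) (hθ : Measurable θ) :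
    Measurable fun x => avgLogQuot k (h x) (θ x) :=
  measurable_avg k fun j => (hh j).mul (measurable_logQuot.comp (hθ.mul (hh j)))

lemma measurable_rootLevel (k : ℕ) (hh : ∀ j, Measurable fun x => h x j) (hθ : Measurable θ) :
    Measurable fun x => rootLevel k (h x) (θ x) :=
  measurable_levelInv.comp ((measurable_avgLogQuot k hh hθ).div (measurable_logQuotOne hh hθ))

lemma measurable_rootScale (k : ℕ) (hh : ∀ j, Measurable fun x => h x j) (hθ : Measurable θ) :
    Measurable fun x => rootScale k (h x) (θ x) :=
  (measurable_logQuotOne hh hθ).div (measurable_rootLevel k hh hθ)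

lemma measurable_rootFun (k : ℕ) (hh : ∀ j, Measurable fun x => h x j) (hθ : Measurable θ) :
    Measurable fun x => rootFun k (h x) (θ x) := by
  have h1 := measurable_logQuotOne hh hθ
  have h3 := measurable_rootLevel k hh hθ
  have h4 := measurable_rootScale k hh hθ
  have h5 := measurable_avg k fun j =>
    ((hh j).pow_const 2).mul (measurable_logQuotSq.comp (hθ.mul (hh j)))
  exact h5.sub (((h4.pow_const 2).mul ((h3.div ((measurable_exp.comp h3).sub_const 1)).mul
    ((h3.mul (continuous_expQuotSq.measurable.comp (hθ.mul h1))).const_add 1)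
      |>.const_sub 1)).div ((h4.mul hθ).const_add 1))

end Measurability

/-! ### The equation at `θ = 0` -/

/-- The term by which the averaged square exceeds the square of the average if `θ = 0` is a root,
as a function of the level, relative to the squared largest exceedance. -/
def levelDefect (ℓ : ℝ) : ℝ :=
  1 / (exp ℓ - 1) / ℓ - (1 / (exp ℓ - 1)) ^ 2 - 1 / (exp ℓ - 1) / 2

/-- For large levels the defect varies much less than the average `H * levelRatio ℓ` itself. -/
lemma exists_levelDefect_bound : ∃ L₀ : ℝ, 1 ≤ L₀ ∧ ∀ H ℓ ℓ' : ℝ, 0 < H → L₀ ≤ ℓ → ℓ < ℓ' →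
    H * levelRatio ℓ ≤ 11 / 10 → 9 / 10 ≤ H * levelRatio ℓ' →
    |H ^ 2 * (levelDefect ℓ - levelDefect ℓ')|
      ≤ 1 / 10 * (H * levelRatio ℓ - H * levelRatio ℓ') := by
  have ht : Tendsto (fun ℓ : ℝ => 2000 * (ℓ ^ (3 : ℝ) * exp (-1 * ℓ))) atTop (𝓝 0) := by
    simpa using (tendsto_rpow_mul_exp_neg_mul_atTop_nhds_zero 3 1 one_pos).const_mul 2000
  obtain ⟨L, hL⟩ := eventually_atTop.1 (ht.eventually_le_const one_pos)
  refine ⟨max L 1, le_max_right _ _, fun H ℓ ℓ' hH hℓ hlt hm hm' => ?_⟩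
  have h1 : 1 ≤ ℓ := (le_max_right _ _).trans hℓ
  have hsmall := hL ℓ ((le_max_left _ _).trans hℓ)
  have hℓ0 : 0 < ℓ := by linarith
  have hℓ'0 : 0 < ℓ' := by linarith
  have he1 := exp_sub_one_pos hℓ0
  have he2 := exp_sub_one_pos hℓ'0
  have hr := one_div_three_mul_le_levelRatio h1
  have hexp2 : 2 ≤ exp ℓ := by have := add_one_le_exp ℓ; linarith
  have hexp2' : 2 ≤ exp ℓ' := by have := add_one_le_exp ℓ'; linarith
  -- sizes of the two levels relative to `H`
  have hH1 : H ≤ 33 / 10 * ℓ := by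
    have : H * (1 / (3 * ℓ)) ≤ 11 / 10 := (mul_le_mul_of_nonneg_left hr hH.le).trans hm
    rw [mul_one_div, div_le_iff₀ (by positivity)] at this; linarith
  have hH2 : ℓ' ≤ 4 * ℓ := by
    have : levelRatio ℓ' ≤ 1 / ℓ' := by have := one_div_pos.2 he2; rw [levelRatio]; linarith
    have h3 : 9 / 10 ≤ H * (1 / ℓ') := hm'.trans (mul_le_mul_of_nonneg_left this hH.le)
    rw [mul_one_div, le_div_iff₀ hℓ'0] at h3; linarith
  obtain ⟨v, hv⟩ : ∃ v, v = 1 / (exp ℓ - 1) := ⟨_, rfl⟩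
  obtain ⟨v', hv'⟩ : ∃ v', v' = 1 / (exp ℓ' - 1) := ⟨_, rfl⟩
  obtain ⟨D, hD⟩ : ∃ D, D = 1 / ℓ - 1 / ℓ' := ⟨_, rfl⟩
  have hv0 : 0 < v := by rw [hv]; positivity
  have hv'0 : 0 < v' := by rw [hv']; positivity
  have hDeq : (ℓ' - ℓ) = D * (ℓ * ℓ') := by rw [hD]; field_simp
  have hD0 : 0 < D := by
    have : 0 < D * (ℓ * ℓ') := by rw [← hDeq]; linarith
    exact pos_of_mul_pos_left this (by positivity)
  have hvv : v' ≤ v := by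
    rw [hv, hv']; exact one_div_le_one_div_of_le he1 (by linarith [exp_le_exp.2 hlt.le])
  have hv1 : v ≤ 1 := by rw [hv, div_le_one he1]; linarith
  have hvexp : v ≤ 2 * exp (-1 * ℓ) := by
    have e : exp (-1 * ℓ) * exp ℓ = 1 := by rw [← exp_add]; simp
    have q : exp (-1 * ℓ) ≤ 1 / 2 := by rw [le_div_iff₀ two_pos]; nlinarith
    rw [hv, div_le_iff₀ he1, mul_sub, mul_assoc, e]; linarith
  have hvsmall : 1000 * (v * ℓ ^ 3) ≤ 1 := by
    have e : ℓ ^ (3 : ℝ) = ℓ ^ 3 := by norm_cast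
    rw [e] at hsmall
    have : v * ℓ ^ 3 ≤ 2 * exp (-1 * ℓ) * ℓ ^ 3 := by gcongr
    linarith
  have hdiff : v - v' ≤ 8 * v * ℓ ^ 2 * D := by
    have e1 : v - v' = (exp ℓ' - exp ℓ) * v * v' := by rw [hv, hv']; field_simp; ring
    have e2 : exp ℓ' - exp ℓ ≤ exp ℓ' * (ℓ' - ℓ) := by
      have q := add_one_le_exp (ℓ - ℓ')
      have : exp ℓ = exp ℓ' * exp (ℓ - ℓ') := by rw [← exp_add]; ring_nf
      rw [this]
      nlinarith [exp_pos ℓ']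
    have e3 : exp ℓ' * v' ≤ 2 := by rw [hv', mul_one_div, div_le_iff₀ he2]; linarith
    calc v - v' ≤ (exp ℓ' * (ℓ' - ℓ)) * v * v' := by rw [e1]; gcongr
      _ = (exp ℓ' * v') * ((ℓ' - ℓ) * v) := by ring
      _ ≤ 2 * ((ℓ' - ℓ) * v) := by
          have : 0 ≤ (ℓ' - ℓ) * v := mul_nonneg (by linarith) hv0.le; gcongr
      _ = 2 * v * (ℓ * ℓ') * D := by rw [hDeq]; ring
      _ ≤ 2 * v * (ℓ * (4 * ℓ)) * D := by gcongr
      _ = _ := by ring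
  have hℓ3 : ℓ ^ 2 ≤ ℓ ^ 3 := pow_le_pow_right₀ h1 (by norm_num)
  have hℓ2 : 1 ≤ ℓ ^ 2 := one_le_pow₀ h1
  have hdef : |levelDefect ℓ - levelDefect ℓ'| ≤ 29 * v * ℓ ^ 2 * D := by
    have e : levelDefect ℓ - levelDefect ℓ' = (v - v') * (1 / ℓ - (v + v') - 1 / 2) + v' * D := by
      rw [levelDefect, levelDefect, ← hv, ← hv', hD]; ring
    have hl1 : 1 / ℓ ≤ 1 := by rw [div_le_one hℓ0]; exact h1
    have hl0 : 0 < 1 / ℓ := by positivity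
    rw [e]
    refine (abs_add_le _ _).trans ?_
    rw [abs_mul, abs_of_nonneg (sub_nonneg.2 hvv), abs_of_nonneg (show 0 ≤ v' * D by positivity)]
    have q1 : |1 / ℓ - (v + v') - 1 / 2| ≤ 7 / 2 := by rw [abs_le]; constructor <;> linarith
    calc _ ≤ (8 * v * ℓ ^ 2 * D) * (7 / 2) + v * D := by gcongr
      _ ≤ (8 * v * ℓ ^ 2 * D) * (7 / 2) + v * D * ℓ ^ 2 := by
          nlinarith
      _ = _ := by ring
  have hRHS : H * levelRatio ℓ - H * levelRatio ℓ' = H * (D - (v - v')) := by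
    rw [levelRatio, levelRatio, ← hv, ← hv', hD]; ring
  rw [hRHS, abs_mul, abs_of_nonneg (sq_nonneg H)]
  have hHD : 0 < H * D := by positivity
  calc H ^ 2 * |levelDefect ℓ - levelDefect ℓ'|
      ≤ H * (33 / 10 * ℓ) * (29 * v * ℓ ^ 2 * D) := by rw [sq]; gcongr
    _ = (957 / 10 * (v * ℓ ^ 3)) * (H * D) := by ring
    _ ≤ (1 / 10 * (1 - 8 * (v * ℓ ^ 2))) * (H * D) := by
        have : v * ℓ ^ 2 ≤ v * ℓ ^ 3 := by gcongr
        refine mul_le_mul_of_nonneg_right ?_ hHD.le; linarith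
    _ = 1 / 10 * (H * (D - 8 * v * ℓ ^ 2 * D)) := by ring
    _ ≤ _ := by gcongr

/-- Two configurations with the same largest exceedance that both have the root `θ = 0`, and whose
remaining exceedances differ in a single entry, `e` against `e'`: the two entries are equal or
their sum is close to four. -/
lemma exists_rootFun_zero_dichotomy : ∃ L₀ : ℝ, 1 ≤ L₀ ∧
    ∀ (k : ℕ) (h h' : ℕ → ℝ) (e e' : ℝ), 2 ≤ k → h 1 = h' 1 → RootDomain k h 0 →
      RootDomain k h' 0 → L₀ ≤ rootLevel k h 0 → L₀ ≤ rootLevel k h' 0 →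
      rootFun k h 0 = 0 → rootFun k h' 0 = 0 → |avg k h - 1| ≤ 1 / 10 → |avg k h' - 1| ≤ 1 / 10 →
      ((k : ℝ) - 1) * (avg k h - avg k h') = e - e' →
      ((k : ℝ) - 1) * (avg k (fun j => h j ^ 2) - avg k (fun j => h' j ^ 2)) = e ^ 2 - e' ^ 2 →
      e = e' ∨ 34 / 10 ≤ e + e' := by
  obtain ⟨L₀, hL1, hL⟩ := exists_levelDefect_bound
  refine ⟨L₀, hL1, fun k h h' e e' hk h1 hd hd' hl hl' hr hr' hm hm' hs1 hs2 => ?_⟩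
  have hk' : (2 : ℝ) ≤ k := mod_cast hk
  have key : ∀ g : ℕ → ℝ, RootDomain k g 0 → rootFun k g 0 = 0 →
      avg k g = g 1 * levelRatio (rootLevel k g 0) ∧ 0 < g 1 ∧
      avg k (fun j => g j ^ 2) / 2 = avg k g ^ 2 + g 1 ^ 2 * levelDefect (rootLevel k g 0) := by
    intro g hd hr
    have hΛ : logQuotOne g 0 = g 1 := by simp [logQuotOne, logQuot]
    have hN : avgLogQuot k g 0 = avg k g := by refine avg_congr fun j _ => ?_; simp [logQuot]
    have hg := hd.log_pos
    rw [hΛ] at hg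
    have hℓ := one_pos.trans_le hd.one_le_level
    have e1 := levelRatio_levelInv hd.ratio_mem
    change levelRatio (rootLevel k g 0) = _ at e1
    rw [hΛ, hN, eq_div_iff hg.ne', mul_comm] at e1
    refine ⟨e1.symm, hg, ?_⟩
    have e2 : avg k (fun j => g j ^ 2 * logQuotSq (0 * g j)) = avg k (fun j => g j ^ 2) / 2 := by
      rw [div_eq_inv_mul, ← avg_const_mul]
      refine avg_congr fun j _ => ?_
      simp [logQuotSq]; ring
    rw [rootFun, e2, sub_eq_zero] at hr
    rw [hr, ← e1, rootScale, hΛ, levelRatio, levelDefect]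
    simp only [zero_mul, mul_zero, add_zero, expQuotSq, if_true]
    have := exp_sub_one_pos hℓ
    field_simp; ring
  obtain ⟨a1, hH, a2⟩ := key h hd hr
  obtain ⟨b1, -, b2⟩ := key h' hd' hr'
  rw [← h1] at b1 b2
  set ℓ := rootLevel k h 0
  set ℓ' := rootLevel k h' 0
  obtain ⟨m1, m2⟩ := abs_le.1 hm
  obtain ⟨m3, m4⟩ := abs_le.1 hm'
  by_cases hee : e = e'
  · exact Or.inl hee
  right
  have hkp : (0 : ℝ) < k - 1 := by linarith
  have hne : avg k h - avg k h' ≠ 0 := by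
    intro h0
    rw [h0, mul_zero] at hs1
    exact hee (by linarith)
  -- the difference of the averaged squares
  have hW : |h 1 ^ 2 * (levelDefect ℓ - levelDefect ℓ')| ≤ 1 / 10 * |avg k h - avg k h'| := by
    rcases lt_trichotomy ℓ ℓ' with hlt | heq | hgt
    · have := hL (h 1) ℓ ℓ' hH hl hlt (by linarith) (by linarith)
      rw [← a1, ← b1] at this
      exact this.trans (by gcongr; exact le_abs_self _)
    · exact absurd (by rw [a1, b1, heq, sub_self]) hne
    · have := hL (h 1) ℓ' ℓ hH hl' hgt (by linarith) (by linarith)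
      rw [← a1, ← b1] at this
      rw [← abs_neg, ← mul_neg, neg_sub, abs_sub_comm (avg k h)]
      exact this.trans (by gcongr; exact le_abs_self _)
  have hfac : (e - e') * (e + e') = (e - e') * (2 * (avg k h + avg k h'))
      + 2 * ((k : ℝ) - 1) * (h 1 ^ 2 * (levelDefect ℓ - levelDefect ℓ')) := by
    have : (e - e') * (e + e') = e ^ 2 - e' ^ 2 := by ring
    rw [this, ← hs2, ← hs1]
    linear_combination (2 * ((k : ℝ) - 1)) * a2 - (2 * ((k : ℝ) - 1)) * b2
  have habs : |(e - e') * ((e + e') - 2 * (avg k h + avg k h'))| ≤ |e - e'| * (1 / 5) := by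
    have e1 : (e - e') * ((e + e') - 2 * (avg k h + avg k h'))
        = 2 * ((k : ℝ) - 1) * (h 1 ^ 2 * (levelDefect ℓ - levelDefect ℓ')) := by
      linear_combination hfac
    rw [e1, abs_mul, abs_of_pos (by linarith : 0 < 2 * ((k : ℝ) - 1)), ← hs1,
      abs_mul ((k : ℝ) - 1), abs_of_pos hkp]
    have := mul_le_mul_of_nonneg_left hW (by linarith : 0 ≤ 2 * ((k : ℝ) - 1)); linarith
  rw [abs_mul] at habs
  have h2 := le_of_mul_le_mul_left habs (abs_pos.2 (sub_ne_zero.2 hee))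
  have := (abs_le.1 h2).1; linarith

/-! ### Order statistics -/

lemma orderStat_eq {n : ℕ} (x : Fin n → ℝ) {i : ℕ} (h1 : 1 ≤ i) (h2 : i ≤ n) :
    orderStat x i = x (Tuple.sort x ⟨i - 1, by omega⟩) := dif_pos ⟨h1, h2⟩

lemma orderStat_le_iff {n : ℕ} (x : Fin n → ℝ) {i : ℕ} (h1 : 1 ≤ i) (h2 : i ≤ n) (y : ℝ) :
    orderStat x i ≤ y ↔ i ≤ (Finset.univ.filter fun l => x l ≤ y).card := by
  rw [orderStat_eq x h1 h2]
  have := Tuple.lt_card_le_iff_apply_le_of_monotone (j := ⟨i - 1, by omega⟩) (a := y)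
    (Tuple.monotone_sort x)
  simp only [Function.comp_apply] at this
  rw [← this]
  have hc : (Finset.univ.filter fun l => x (Tuple.sort x l) ≤ y).card
      = (Finset.univ.filter fun l => x l ≤ y).card := by
    refine Finset.card_bij (fun l _ => Tuple.sort x l) ?_ ?_ ?_
    · intro l hl; simpa using hl
    · intro a _ b _ h; exact (Tuple.sort x).injective h
    · intro b hb; exact ⟨(Tuple.sort x).symm b, by simpa using hb, by simp⟩
  rw [hc]; omega

lemma orderStat_mono {n : ℕ} (x : Fin n → ℝ) {i j : ℕ} (h1 : 1 ≤ i) (hij : i ≤ j) (h2 : j ≤ n) :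
    orderStat x i ≤ orderStat x j :=
  (orderStat_le_iff x h1 (hij.trans h2) _).2
    (hij.trans ((orderStat_le_iff x (h1.trans hij) h2 _).1 le_rfl))

lemma exists_eq_orderStat {n : ℕ} (x : Fin n → ℝ) {i : ℕ} (h1 : 1 ≤ i) (h2 : i ≤ n) :
    ∃ l, x l = orderStat x i := ⟨_, (orderStat_eq x h1 h2).symm⟩

lemma le_orderStat_last {n : ℕ} (x : Fin n → ℝ) (l : Fin n) : x l ≤ orderStat x n := by
  have hn : 1 ≤ n := by have := l.2; omega
  have h := (orderStat_le_iff x hn le_rfl (orderStat x n)).1 le_rfl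
  have h2 : (Finset.univ.filter fun l => x l ≤ orderStat x n) = Finset.univ := by
    rw [← Finset.card_eq_iff_eq_univ]; exact le_antisymm (Finset.card_le_univ _) (by simpa using h)
  have h3 : l ∈ (Finset.univ.filter fun l => x l ≤ orderStat x n) := by rw [h2]; simp
  exact (Finset.mem_filter.1 h3).2

lemma measurable_orderStat {n : ℕ} (i : ℕ) : Measurable fun x : Fin n → ℝ => orderStat x i := by
  by_cases h : 1 ≤ i ∧ i ≤ n
  · refine measurable_of_Iic fun y => ?_
    have : (fun x : Fin n → ℝ => orderStat x i) ⁻¹' Iic y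
        = {x | (i : ℝ) ≤ ∑ l, if x l ≤ y then (1 : ℝ) else 0} := by
      ext x
      simp only [Set.mem_preimage, Set.mem_Iic, Set.mem_ofPred_eq, orderStat_le_iff x h.1 h.2]
      rw [Finset.sum_boole]
      exact_mod_cast Iff.rfl
    rw [this]
    refine measurableSet_le measurable_const (Finset.measurable_sum _ fun l _ => ?_)
    exact Measurable.ite (measurableSet_le (measurable_pi_apply l) measurable_const)
      measurable_const measurable_const
  · have : (fun x : Fin n → ℝ => orderStat x i) = fun _ => 0 := by ext x; exact dif_neg h
    rw [this]; exact measurable_const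

lemma measurable_exceed {n : ℕ} (k j : ℕ) : Measurable fun x : Fin n → ℝ => exceed x k j :=
  (measurable_orderStat _).sub (measurable_orderStat _)

lemma measurable_testStat {n : ℕ} (k : ℕ) {ξh τh : (Fin n → ℝ) → ℝ} (hξ : Measurable ξh)
    (hτ : Measurable τh) : Measurable fun x => testStat x k (ξh x) (τh x) :=
  measurable_const.mul ((measurable_const.add (hτ.mul (measurable_exceed k 1))).pow
    (measurable_const.div hξ))

lemma measurableSet_isLikelihoodRoot {n : ℕ} (k : ℕ) {ξh τh : (Fin n → ℝ) → ℝ}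
    (hξ : Measurable ξh) (hτ : Measurable τh) :
    MeasurableSet {x | IsLikelihoodRoot x k (ξh x) (τh x)} := by
  have he : ∀ j, Measurable fun x : Fin n → ℝ => 1 + τh x * exceed x k j := fun j =>
    measurable_const.add (hτ.mul (measurable_exceed k j))
  have hp : Measurable fun x => (1 + τh x * exceed x k 1) ^ (-1 / ξh x) :=
    (he 1).pow (measurable_const.div hξ)
  have hq : Measurable fun x => (1 + τh x * exceed x k 1) ^ (-1 - 1 / ξh x) :=
    (he 1).pow (measurable_const.sub (measurable_const.div hξ))
  have : {x | IsLikelihoodRoot x k (ξh x) (τh x)} =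
      {x | 0 < ξh x / τh x} ∩ ((⋂ j ∈ Icc 1 k, {x | 0 < 1 + τh x * exceed x k j}) ∩
      ({x | 1 / ((k : ℝ) - 1) * ∑ j ∈ Icc 2 k, log (1 + τh x * exceed x k j)
      + (1 + τh x * exceed x k 1) ^ (-1 / ξh x) * log (1 + τh x * exceed x k 1)
          / (1 - (1 + τh x * exceed x k 1) ^ (-1 / ξh x)) = ξh x} ∩
      {x | 1 / ((k : ℝ) - 1) * ∑ j ∈ Icc 2 k, 1 / (1 + τh x * exceed x k j)
      = 1 / (1 + ξh x) * ((1 - (1 + τh x * exceed x k 1) ^ (-1 - 1 / ξh x))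
          / (1 - (1 + τh x * exceed x k 1) ^ (-1 / ξh x)))})) := by
    ext x
    simp only [Set.mem_ofPred_eq, Set.mem_inter_iff, Set.mem_iInter]
    exact ⟨fun h => ⟨h.1, h.2, h.3, h.4⟩, fun h => ⟨h.1, h.2.1, h.2.2.1, h.2.2.2⟩⟩
  rw [this]
  refine (measurableSet_lt measurable_const (hξ.div hτ)).inter
    ((Finset.measurableSet_biInter _ fun j _ => measurableSet_lt measurable_const (he j)).inter
    ((measurableSet_eq_fun ?_ hξ).inter (measurableSet_eq_fun ?_ ?_)))
  · exact (measurable_const.mul (Finset.measurable_sum _ fun j _ => (he j).log)).add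
      ((hp.mul (he 1).log).div (measurable_const.sub hp))
  · exact measurable_const.mul (Finset.measurable_sum _ fun j _ => measurable_const.div (he j))
  · exact (measurable_const.div (measurable_const.add hξ)).mul
      ((measurable_const.sub hq).div (measurable_const.sub hp))

/-- Order statistics of an antitone image of a sample. -/
lemma orderStat_comp_antitoneOn {n : ℕ} {f : ℝ → ℝ} {s : Set ℝ} (hf : AntitoneOn f s)
    {v : Fin n → ℝ} (hv : ∀ i, v i ∈ s) {j : ℕ} (h1 : 1 ≤ j) (h2 : j ≤ n) :
    orderStat (fun i => f (v i)) (n - j + 1) = f (orderStat v j) := by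
  set x : Fin n → ℝ := fun i => f (v i) with hx
  have hm : Monotone (x ∘ (Fin.revPerm.trans (Tuple.sort v))) := by
    intro a b hab
    simp only [Function.comp_apply, Equiv.trans_apply, Fin.revPerm_apply, hx]
    exact hf (hv _) (hv _) (Tuple.monotone_sort v (Fin.rev_le_rev.2 hab))
  have h3 := congrFun (Tuple.comp_sort_eq_comp_iff_monotone.2 hm) ⟨n - j, by omega⟩
  rw [orderStat_eq x (by omega) (by omega), orderStat_eq v h1 h2]
  have h4 : Fin.rev (⟨n - j, by omega⟩ : Fin n) = ⟨j - 1, by omega⟩ := by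
    ext; simp only [Fin.val_rev]; omega
  simp only [Function.comp_apply, Equiv.trans_apply, Fin.revPerm_apply, h4] at h3
  have h5 : (⟨n - j + 1 - 1, by omega⟩ : Fin n) = ⟨n - j, by omega⟩ := by ext; simp
  rw [h5, ← h3]

/-- Sums over the exceedances as sums over the sample. -/
lemma sum_exceed {n k : ℕ} (hk : k < n) (x : Fin n → ℝ) {f : ℝ → ℝ} (hf : f 0 = 0) :
    ∑ j ∈ Icc 1 k, f (exceed x k j) = ∑ l, f (max (x l - orderStat x (n - k)) 0) := by
  classical
  set c := orderStat x (n - k)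
  rw [← Equiv.sum_comp (Tuple.sort x)]
  have h1 : ∀ l : Fin n, x (Tuple.sort x l) = orderStat x (l + 1) := fun l => by
    rw [orderStat_eq x (by omega) (by omega)]; rfl
  simp only [h1]
  rw [Fin.sum_univ_eq_sum_range (fun l => f (max (orderStat x (l + 1) - c) 0)) n]
  have h2 : n = (n - k) + k := by omega
  have h3 : Finset.range n = Finset.range (n - k) ∪ Finset.Ico (n - k) n := by
    ext a; simp only [Finset.mem_range, Finset.mem_union, Finset.mem_Ico]; omega
  rw [h3, Finset.sum_union (by
    rw [Finset.disjoint_left]; intro a; simp only [Finset.mem_range, Finset.mem_Ico]; omega)]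
  rw [Finset.sum_eq_zero (s := Finset.range (n - k)), zero_add]
  · refine Finset.sum_bij (fun j _ => n - j) ?_ ?_ ?_ ?_
    · intro j hj; simp only [mem_Icc] at hj; simp only [Finset.mem_Ico]; omega
    · intro a ha b hb h; simp only [mem_Icc] at ha hb; omega
    · intro b hb; simp only [Finset.mem_Ico] at hb
      exact ⟨n - b, by simp only [mem_Icc]; omega, by omega⟩
    · intro j hj
      simp only [mem_Icc] at hj
      rw [max_eq_left]
      · rfl
      · exact sub_nonneg.2 (orderStat_mono x (by omega) (by omega) (by omega))
  · intro l hl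
    simp only [Finset.mem_range] at hl
    rw [max_eq_right, hf]
    exact sub_nonpos.2 (orderStat_mono x (by omega) (by omega) (by omega))

/-! ### The scaled form of the likelihood equations -/

/-- The exceedances divided by a scale. -/
def sExceed {n : ℕ} (x : Fin n → ℝ) (k : ℕ) (a : ℝ) (j : ℕ) : ℝ := exceed x k j / a

lemma rpow_neg_one_div_eq {b ξ σ θ : ℝ} (hb : 0 < b) (h : σ * θ = ξ) :
    b ^ (-1 / ξ) = exp (-(log b / (σ * θ))) := by rw [rpow_def_of_pos hb, h]; congr 1; ring

lemma isLikelihoodRoot_iff {n : ℕ} {x : Fin n → ℝ} {k : ℕ} {ξ τ a : ℝ} (hk : 1 ≤ k) (ha : 0 < a) :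
    IsLikelihoodRoot x k ξ τ ↔ ScaledRoot k (sExceed x k a) (τ * a) (ξ / τ / a) ∧
      ∀ j ∈ Icc 1 k, 0 < 1 + τ * a * sExceed x k a j := by
  have hmul : ∀ j, τ * a * sExceed x k a j = τ * exceed x k j := fun j => by
    rw [sExceed]; field_simp
  have h1 : 1 ∈ Icc 1 k := mem_Icc.2 ⟨le_rfl, hk⟩
  by_cases hτ : τ = 0
  · constructor
    · intro h; have := h.scale_pos; simp [hτ] at this
    · rintro ⟨h, -⟩; exact absurd (by simp [hτ]) h.ne_zero
  by_cases hb : 0 < 1 + τ * exceed x k 1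
  · have hst : ξ / τ / a * (τ * a) = ξ := by field_simp
    have e1 : (1 + τ * exceed x k 1) ^ (-1 / ξ)
        = exp (-level (sExceed x k a 1) (τ * a) (ξ / τ / a)) := by
      rw [level, hmul, rpow_neg_one_div_eq hb hst]
    have e2 : (1 + τ * exceed x k 1) ^ (-1 - 1 / ξ)
        = exp (-level (sExceed x k a 1) (τ * a) (ξ / τ / a)) / (1 + τ * exceed x k 1) := by
      rw [← e1, show -1 - 1 / ξ = -1 / ξ - 1 by ring, rpow_sub_one hb.ne']
    constructor
    · intro h
      refine ⟨⟨mul_ne_zero hτ ha.ne', div_pos h.scale_pos ha, by rw [hmul]; exact hb, ?_, ?_⟩, ?_⟩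
      · have := h.eq_xi
        rw [e1] at this
        simpa only [avgLog, avg, hmul, hst] using this
      · have := h.eq_tau
        rw [e1, e2] at this
        simpa only [avgInv, avg, hmul, hst] using this
      · simpa only [hmul] using h.arg_pos
    · rintro ⟨h, hp⟩
      refine ⟨?_, by simpa only [hmul] using hp, ?_, ?_⟩
      · have := mul_pos h.scale_pos ha; rwa [div_mul_cancel₀ _ ha.ne'] at this
      · rw [e1]; simpa only [avgLog, avg, hmul, hst] using h.eq_log
      · rw [e1, e2]; simpa only [avgInv, avg, hmul, hst] using h.eq_inv
  · exact ⟨fun h => absurd (h.arg_pos 1 h1) hb, fun h => absurd (by simpa only [hmul] using h.1.arg_pos) hb⟩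

lemma testStat_eq {n : ℕ} {x : Fin n → ℝ} {k : ℕ} {ξ τ a : ℝ} (ha : 0 < a)
    (h : ScaledRoot k (sExceed x k a) (τ * a) (ξ / τ / a)) :
    testStat x k ξ τ = k * exp (-level (sExceed x k a 1) (τ * a) (ξ / τ / a)) := by
  have hτ : τ ≠ 0 := by rintro rfl; exact h.ne_zero (zero_mul _)
  have hmul : τ * a * sExceed x k a 1 = τ * exceed x k 1 := by rw [sExceed]; field_simp
  have hst : ξ / τ / a * (τ * a) = ξ := by field_simp
  have hb := h.arg_pos
  rw [hmul] at hb
  rw [testStat, level, hmul, rpow_neg_one_div_eq hb hst]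

/-! ### Convergence in probability as convergence along a filter -/

/-- The filter of events of probability tending to one along a sequence of probability spaces:
a family of statements holds eventually along it if it holds with probability tending to one, and
convergence along it is convergence in probability. -/
def inProb {Ω : ℕ → Type*} [∀ n, MeasurableSpace (Ω n)] (P : ∀ n, Measure (Ω n)) :
    Filter (Σ n, Ω n) where
  sets := {S | Tendsto (fun n => P n {ω | ⟨n, ω⟩ ∉ S}) atTop (𝓝 0)}
  univ_sets := by simp
  sets_of_superset := fun {S R} hS hSR => by
    refine tendsto_of_tendsto_of_tendsto_of_le_of_le tendsto_const_nhds hS (fun n => zero_le)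
      fun n => measure_mono fun ω hω h => hω (hSR h)
  inter_sets := fun {S R} hS hR => by
    have := Tendsto.add hS hR
    rw [add_zero] at this
    refine tendsto_of_tendsto_of_tendsto_of_le_of_le tendsto_const_nhds this (fun n => zero_le)
      fun n => (measure_mono fun ω hω => ?_).trans (measure_union_le _ _)
    by_contra h
    simp only [Set.mem_union, Set.mem_ofPred_eq, not_or, not_not] at h; exact hω h

section InProb

variable {Ω : ℕ → Type*} [∀ n, MeasurableSpace (Ω n)] {P Q : ∀ n, Measure (Ω n)}

lemma eventually_inProb_iff {p : (Σ n, Ω n) → Prop} :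
    (∀ᶠ i in inProb P, p i) ↔ Tendsto (fun n => P n {ω | ¬ p ⟨n, ω⟩}) atTop (𝓝 0) := Iff.rfl

lemma eventually_inProb_of_le {p : (Σ n, Ω n) → Prop} {u : ℕ → ENNReal}
    (hu : Tendsto u atTop (𝓝 0)) (h : ∀ᶠ n in atTop, P n {ω | ¬ p ⟨n, ω⟩} ≤ u n) :
    ∀ᶠ i in inProb P, p i :=
  eventually_inProb_iff.2 (tendsto_of_tendsto_of_tendsto_of_le_of_le' tendsto_const_nhds hu
    (Eventually.of_forall fun _ => zero_le) h)

lemma tendsto_fst_inProb : Tendsto (fun i : Σ n, Ω n => i.1) (inProb P) atTop := by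
  refine tendsto_atTop.2 fun m => eventually_inProb_iff.2 ?_
  refine tendsto_const_nhds.congr' ?_
  filter_upwards [eventually_ge_atTop m] with n hn; simp [hn]

lemma smallInProb_iff {Z : ∀ n, Ω n → ℝ} :
    SmallInProb P Z ↔ Tendsto (fun i : Σ n, Ω n => Z i.1 i.2) (inProb P) (𝓝 0) := by
  rw [Metric.tendsto_nhds]
  refine forall₂_congr fun ε _ => ?_
  rw [eventually_inProb_iff]; simp

lemma eventually_inProb_of_ae {p : (Σ n, Ω n) → Prop} (h : ∀ n, ∀ᵐ ω ∂P n, p ⟨n, ω⟩) :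
    ∀ᶠ i in inProb P, p i := by
  refine eventually_inProb_iff.2 (tendsto_const_nhds.congr fun n => ?_); exact (ae_iff.1 (h n)).symm

/-- Measures dominated up to constants tending to one give a smaller filter. -/
lemma inProb_mono {c : ℕ → ENNReal} (hc : Tendsto c atTop (𝓝 1)) (h : ∀ n, P n ≤ c n • Q n) :
    inProb P ≤ inProb Q := by
  intro S hS
  have h1 := ENNReal.Tendsto.mul hc (Or.inr (by simp)) hS (Or.inr (by simp))
  rw [mul_zero] at h1
  exact tendsto_of_tendsto_of_tendsto_of_le_of_le tendsto_const_nhds h1 (fun n => zero_le)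
    fun n => h n _

end InProb

/-! ### The deterministic results along arbitrary filters -/

namespace TailArray

variable {ι : Type*} {F : Filter ι} {k : ι → ℕ} {y : ι → ℕ → ℝ} {θ σ : ι → ℝ}

local notation:max "K[" i "]" => (k i : ℝ)
local notation:max "E[" ξ ", " i "]" => exc ξ (k i) (y i)

/-- A tail array along a filter is one along a coarser countably generated filter. -/
lemma exists_isCountablyGenerated (h : TailArray F k y) :
    ∃ 𝓖 : Filter ι, 𝓖.IsCountablyGenerated ∧ F ≤ 𝓖 ∧ TailArray 𝓖 k y := by
  set S : ℕ → Set ι := fun m => {i |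
    (∀ j ∈ Icc 1 (k i), K[i] ^ (-(1 / ((m : ℝ) + 1))) * j ≤ y i j) ∧
    (∀ j ∈ Icc 1 (k i), y i j ≤ K[i] ^ (1 / ((m : ℝ) + 1)) * j) ∧
    ((1 + K[i] ^ (-(1 / ((m : ℝ) + 1)))) * y i 1 ≤ y i 2) ∧
    ∀ j ∈ Icc 1 (k i),
      |log (y i j / j)| ≤ K[i] ^ (1 / ((m : ℝ) + 1)) * (j : ℝ) ^ (-1 / 2 : ℝ)} with hS
  set M : Set ι := {i | (∀ j ∈ Icc 1 (k i), ∀ l ∈ Icc 1 (k i), j ≤ l → y i j ≤ y i l) ∧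
    ∀ j ∈ Icc 1 (k i), y i j ≤ k i} with hM
  set 𝓖 : Filter ι := comap k atTop ⊓ 𝓟 M ⊓ ⨅ m, 𝓟 (S m)
  have hkG : Tendsto k 𝓖 atTop := tendsto_comap.mono_left (inf_le_left.trans inf_le_left)
  have hMG : ∀ᶠ i in 𝓖, i ∈ M :=
    (eventually_principal.2 fun _ hx => hx).filter_mono (inf_le_left.trans inf_le_right)
  have hSG : ∀ ε > (0 : ℝ), ∀ᶠ i in 𝓖, ∃ δ, 0 < δ ∧ δ ≤ ε ∧ (1 : ℝ) ≤ k i ∧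
      (∀ j ∈ Icc 1 (k i), K[i] ^ (-δ) * j ≤ y i j) ∧
      (∀ j ∈ Icc 1 (k i), y i j ≤ K[i] ^ δ * j) ∧
      ((1 + K[i] ^ (-δ)) * y i 1 ≤ y i 2) ∧
      ∀ j ∈ Icc 1 (k i), |log (y i j / j)| ≤ K[i] ^ δ * (j : ℝ) ^ (-1 / 2 : ℝ) := by
    intro ε hε
    obtain ⟨m, hm⟩ := exists_nat_one_div_lt hε
    have h1 : ∀ᶠ i in 𝓖, i ∈ S m := (eventually_principal.2 fun _ hx => hx).filter_mono
      (inf_le_right.trans (iInf_le _ m))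
    filter_upwards [h1, hkG.eventually_ge_atTop 1] with i hi h2
    exact ⟨1 / ((m : ℝ) + 1), by positivity, hm.le, mod_cast h2, hi⟩
  refine ⟨𝓖, inferInstance, ?_, hkG, hMG.mono fun i hi => hi.1, hMG.mono fun i hi => hi.2, ?_, ?_, ?_,
    ?_⟩
  · refine le_inf (le_inf h.tendsto_k.le_comap (le_principal_iff.2 ?_))
      (le_iInf fun m => le_principal_iff.2 ?_)
    · filter_upwards [h.mono, h.le_k] with i h1 h2 using ⟨h1, h2⟩
    · have hε : (0 : ℝ) < 1 / ((m : ℝ) + 1) := by positivity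
      filter_upwards [h.lower _ hε, h.upper _ hε, h.gap _ hε, h.near _ hε] with i h1 h2 h3 h4
        using ⟨h1, h2, h3, h4⟩
  · intro ε hε
    filter_upwards [hSG ε hε] with i ⟨δ, _, hδ, hk, h1, _⟩ j hj
    exact (mul_le_mul_of_nonneg_right (rpow_le_rpow_of_exponent_le hk (by linarith))
      (Nat.cast_nonneg _)).trans (h1 j hj)
  · intro ε hε
    filter_upwards [hSG ε hε] with i ⟨δ, _, hδ, hk, _, h1, _⟩ j hj
    exact (h1 j hj).trans (mul_le_mul_of_nonneg_right
      (rpow_le_rpow_of_exponent_le hk (by linarith)) (Nat.cast_nonneg _))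
  · intro ε hε
    filter_upwards [hSG ε hε, hkG.eventually_ge_atTop 1] with i ⟨δ, _, hδ, hk, h0, _, h1, _⟩ hk1
    have hy : 0 ≤ y i 1 := le_trans (by positivity) (h0 1 (mem_Icc.2 ⟨le_rfl, hk1⟩))
    refine le_trans (mul_le_mul_of_nonneg_right ?_ hy) h1
    have := rpow_le_rpow_of_exponent_le hk (neg_le_neg hδ); linarith
  · intro ε hε
    filter_upwards [hSG ε hε] with i ⟨δ, _, hδ, hk, _, _, _, h1⟩ j hj
    exact (h1 j hj).trans (mul_le_mul_of_nonneg_right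
      (rpow_le_rpow_of_exponent_le hk (by linarith)) (by positivity))

lemma tendsto_level_sub_log (h : TailArray F k y) {ξ : ℝ} (hξ : -1 / 2 < ξ)
    (hθ : Tendsto θ F (𝓝 ξ)) (hσ : Tendsto σ F (𝓝 1))
    (hr : ∀ᶠ i in F, ScaledRoot (k i) E[ξ, i] (θ i) (σ i)) :
    Tendsto (fun i => level (E[ξ, i] 1) (θ i) (σ i) - log (k i / y i 1)) F (𝓝 0) := by
  obtain ⟨𝓖, hcg, hle, hG⟩ := h.exists_isCountablyGenerated
  set R : Set ι := {i | ScaledRoot (k i) E[ξ, i] (θ i) (σ i)}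
  set 𝓗 : Filter ι := 𝓖 ⊓ comap θ (𝓝 ξ) ⊓ comap σ (𝓝 1) ⊓ 𝓟 R
  have h1 : 𝓗 ≤ 𝓖 := inf_le_left.trans (inf_le_left.trans inf_le_left)
  have hfin := TailArray.tendsto_level_sub (F := 𝓗) (hG.comp (tendsto_id'.2 h1)) hξ
    (tendsto_comap.mono_left (inf_le_left.trans (inf_le_left.trans inf_le_right)))
    (tendsto_comap.mono_left (inf_le_left.trans inf_le_right))
    ((eventually_principal.2 fun _ hx => hx).filter_mono inf_le_right)
  exact hfin.mono_left (le_inf (le_inf (le_inf hle hθ.le_comap) hσ.le_comap) (le_principal_iff.2 hr))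

/-- Near `ξ`, the equation for `θ` alone is well posed and changes sign. -/
lemma sign_change (h : TailArray F k y) {ξ c : ℝ} (hξ : -1 / 2 < ξ)
    (hc : max (-ξ) 0 < c) (hc2 : c < 1 / 2) :
    (∀ᶠ i in F, ∀ θ, |θ - ξ| ≤ K[i] ^ (-c) → RootDomain (k i) E[ξ, i] θ) ∧
    (∀ ε > 0, ∀ᶠ i in F, ∀ θ, |θ - ξ| ≤ K[i] ^ (-c) →
      |rootScale (k i) E[ξ, i] θ - 1| ≤ ε) ∧
    ∀ᶠ i in F, 0 < rootFun (k i) E[ξ, i] (ξ - K[i] ^ (-c)) ∧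
      rootFun (k i) E[ξ, i] (ξ + K[i] ^ (-c)) < 0 := by
  obtain ⟨𝓖, hcg, hle, hG⟩ := h.exists_isCountablyGenerated
  obtain ⟨h1, h2, h3⟩ := hG.root_box hξ hc hc2
  exact ⟨h1.filter_mono hle, fun ε hε => (h2 ε hε).filter_mono hle, h3.filter_mono hle⟩

lemma limits_at_zero (h : TailArray F k y) : (∀ᶠ i in F, RootDomain (k i) E[0, i] 0) ∧
    Tendsto (fun i => rootLevel (k i) E[0, i] 0) F atTop ∧
    Tendsto (fun i => avg (k i) E[0, i]) F (𝓝 1) := by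
  obtain ⟨𝓖, hcg, hle, hG⟩ := h.exists_isCountablyGenerated
  have h0 : ∀ᶠ i in 𝓖, |(0 : ℝ) - 0| ≤ K[i] ^ (-(1 / 4) : ℝ) :=
    Eventually.of_forall fun i => by simp only [sub_zero, abs_zero]; positivity
  obtain ⟨h1, h2, -⟩ := hG.rootDomain_limits (ξ := 0) (θ := fun _ => 0) (by norm_num)
    (by norm_num) h0
  obtain ⟨-, h3, -⟩ := hG.logQuot_limits (ξ := 0) (θ := fun _ => 0) (by norm_num) (by norm_num) h0
  refine ⟨h1.filter_mono hle, h2.mono_left hle, ?_⟩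
  simpa [avgLogQuot, logQuot] using h3.mono_left hle

end TailArray

/-! ### Order statistics of uniform samples -/

/-- Finite real sequences, with their length. -/
abbrev Sample := Σ n, Fin n → ℝ

/-- The law of `n` independent uniform variables. -/
def unifPi (n : ℕ) : Measure (Fin n → ℝ) := Measure.pi fun _ => unif

instance (n : ℕ) : IsProbabilityMeasure (unifPi n) := by unfold unifPi; infer_instance

lemma ae_unifPi (n : ℕ) : ∀ᵐ v ∂unifPi n, ∀ l, v l ∈ Ioo (0 : ℝ) 1 :=
  ae_all_iff.2 fun l => (Measure.quasiMeasurePreserving_eval (fun _ : Fin n => unif) l).ae ae_unif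

lemma unif_le_volume : unif ≤ volume := Measure.restrict_le_self

lemma unif_real_Iic {t : ℝ} (h0 : 0 ≤ t) (h1 : t ≤ 1) : unif.real (Iic t) = t := by
  have e : (Iic t ∩ Ioo 0 1 : Set ℝ) =ᵐ[volume] Ioc 0 t := by
    have : (Ioo 0 1 : Set ℝ) =ᵐ[volume] Ioc 0 1 := Ioo_ae_eq_Ioc
    have e2 : (Iic t ∩ Ioc 0 1 : Set ℝ) = Ioc 0 t := by
      ext v
      simp only [Set.mem_inter_iff, Set.mem_Iic, Set.mem_Ioc]
      exact ⟨fun h => ⟨h.2.1, h.1⟩, fun h => ⟨h.2, h.1, h.2.trans h1⟩⟩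
    exact e2 ▸ ae_eq_set_inter (ae_eq_refl _) this
  rw [Measure.real, unif, Measure.restrict_apply' measurableSet_Ioo, measure_congr e,
    volume_Ioc, sub_zero, ENNReal.toReal_ofReal h0]

/-- The number of sample points in `(-∞, t]`. -/
def countLe {n : ℕ} (v : Fin n → ℝ) (t : ℝ) : ℝ :=
  ∑ l, (Iic t).indicator (fun _ => (1 : ℝ)) (v l)

lemma orderStat_le_iff_countLe {n : ℕ} (x : Fin n → ℝ) {i : ℕ} (h1 : 1 ≤ i) (h2 : i ≤ n) (y : ℝ) :
    orderStat x i ≤ y ↔ (i : ℝ) ≤ countLe x y := by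
  classical
  rw [orderStat_le_iff x h1 h2, countLe]
  simp only [Set.indicator_apply, Set.mem_Iic]
  rw [Finset.sum_boole]
  exact_mod_cast Iff.rfl

lemma measurable_countLe {n : ℕ} (t : ℝ) : Measurable fun v : Fin n → ℝ => countLe v t :=
  Finset.measurable_sum _ fun l _ =>
    (measurable_const.indicator measurableSet_Iic).comp (measurable_pi_apply l)

lemma countLe_mem {n : ℕ} (v : Fin n → ℝ) (t : ℝ) : countLe v t ∈ Set.Icc (0 : ℝ) n := by
  have h : ∀ l, (Iic t).indicator (fun _ => (1 : ℝ)) (v l) ∈ Set.Icc (0 : ℝ) 1 := fun l => by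
    simp only [Set.indicator_apply]; split_ifs <;> simp
  refine ⟨Finset.sum_nonneg fun l _ => (h l).1, ?_⟩
  have := Finset.sum_le_sum (s := Finset.univ) fun l _ => (h l).2
  simpa [countLe] using this

lemma mgf_countLe_le {n : ℕ} {t : ℝ} (h0 : 0 ≤ t) (h1 : t ≤ 1) (s : ℝ) :
    mgf (fun v : Fin n → ℝ => countLe v t) (unifPi n) s ≤ exp (n * t * (exp s - 1)) := by
  have e1 : ∀ x, exp (s * (Iic t).indicator (fun _ => (1 : ℝ)) x)
      = 1 + (Iic t).indicator (fun _ => exp s - 1) x := fun x => by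
    simp only [Set.indicator_apply]; split_ifs <;> simp
  have e2 : ∫ x, exp (s * (Iic t).indicator (fun _ => (1 : ℝ)) x) ∂unif
      = 1 + t * (exp s - 1) := by
    simp only [e1]
    rw [integral_add (integrable_const _) ((integrable_const _).indicator measurableSet_Iic),
      integral_indicator_const _ measurableSet_Iic, unif_real_Iic h0 h1]
    simp
  have e3 : mgf (fun v : Fin n → ℝ => countLe v t) (unifPi n) s = (1 + t * (exp s - 1)) ^ n := by
    have := integral_fintype_prod_eq_pow (ι := Fin n) (μ := unif)
      (fun x => exp (s * (Iic t).indicator (fun _ => (1 : ℝ)) x))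
    rw [e2, Fintype.card_fin] at this
    rw [← this]
    simp only [mgf, countLe, Finset.mul_sum, exp_sum]; rfl
  have h2 : 0 ≤ 1 + t * (exp s - 1) := by nlinarith [exp_pos s]
  rw [e3, mul_assoc, exp_nat_mul]
  exact pow_le_pow_left₀ h2 (by linarith [add_one_le_exp (t * (exp s - 1))]) n

lemma integrable_exp_countLe {n : ℕ} (t s : ℝ) :
    Integrable (fun v : Fin n → ℝ => exp (s * countLe v t)) (unifPi n) := by
  refine Integrable.of_bound (C := exp (|s| * n))
    ((measurable_countLe t).const_mul s).exp.aestronglyMeasurable (ae_of_all _ fun v => ?_)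
  rw [norm_eq_abs, abs_of_pos (exp_pos _)]
  have := countLe_mem v t
  exact exp_le_exp.2 (mul_le_mul (le_abs_self s) this.2 this.1 (abs_nonneg s))

lemma orderStat_mem_of_forall {n : ℕ} {v : Fin n → ℝ} {s : Set ℝ} (hv : ∀ l, v l ∈ s) {j : ℕ}
    (h1 : 1 ≤ j) (h2 : j ≤ n) : orderStat v j ∈ s := by
  obtain ⟨l, hl⟩ := exists_eq_orderStat v h1 h2; exact hl ▸ hv l

/-- A Chernoff bound for uniform order statistics. -/
lemma unifPi_abs_sub_gt_le {n j : ℕ} (h1 : 1 ≤ j) (h2 : j ≤ n) {K : ℝ} (hK : 0 ≤ K) :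
    unifPi n {v | K * sqrt j < |n * orderStat v j - j|}
      ≤ ofReal (2 * exp (1 / 4 - K / 4)) := by
  have hn : (0 : ℝ) < n := mod_cast (by omega : 0 < n)
  have hj : (1 : ℝ) ≤ sqrt j := one_le_sqrt.2 (mod_cast h1)
  set q := sqrt j
  have hqj : (j : ℝ) = q ^ 2 := (sq_sqrt (Nat.cast_nonneg j)).symm
  set s := 1 / (2 * q) with hs
  have hs0 : 0 < s := by positivity
  have hsq : s * q = 1 / 2 := by rw [hs]; field_simp
  have hs1 : s ≤ 1 / 2 := by nlinarith
  have hexp : ∀ r : ℝ, |r| ≤ 1 → exp r - 1 ≤ r + r ^ 2 := fun r hr => by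
    have := (abs_le.1 (abs_exp_sub_one_sub_id_le hr)).2; linarith
  have hE : 0 ≤ exp (1 / 4 - K / 4) := (exp_pos _).le
  -- the two tails
  have hlow : unifPi n {v | n * orderStat v j < j - K * q} ≤ ofReal (exp (1 / 4 - K / 4)) := by
    by_cases hneg : (j : ℝ) - K * q < 0
    · have : unifPi n {v | n * orderStat v j < j - K * q} = 0 := by
        refine measure_eq_zero_iff_ae_notMem.2 ?_
        filter_upwards [ae_unifPi n] with v hv h
        have := (orderStat_mem_of_forall hv h1 h2).1
        have : 0 < (n : ℝ) * orderStat v j := by positivity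
        linarith
      rw [this]; exact zero_le
    rw [not_lt] at hneg
    set t := (j - K * q) / n with ht
    have ht0 : 0 ≤ t := div_nonneg hneg hn.le
    have hjn : (j : ℝ) ≤ n := mod_cast h2
    have ht1 : t ≤ 1 := by rw [ht, div_le_one hn]; nlinarith [mul_nonneg hK (zero_le_one.trans hj)]
    have hnt : n * t = j - K * q := by rw [ht]; field_simp
    have hsub : {v : Fin n → ℝ | n * orderStat v j < j - K * q} ⊆ {v | (j : ℝ) ≤ countLe v t} := by
      intro v hv
      have hv' : (n : ℝ) * orderStat v j < j - K * q := hv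
      refine (orderStat_le_iff_countLe v h1 h2 t).1 ?_
      rw [ht, le_div_iff₀ hn]; linarith
    refine (measure_mono hsub).trans ?_
    rw [← ofReal_measureReal]
    refine ENNReal.ofReal_le_ofReal ((measure_ge_le_exp_mul_mgf (j : ℝ) hs0.le
      (integrable_exp_countLe t s)).trans ?_)
    refine (mul_le_mul_of_nonneg_left (mgf_countLe_le ht0 ht1 s) (exp_pos _).le).trans ?_
    rw [← exp_add, exp_le_exp, hnt]
    have h3 := mul_le_mul_of_nonneg_left (hexp s (by rw [abs_of_pos hs0]; linarith)) hneg
    have h4 : (j - K * q) * (s + s ^ 2) - s * j = (s * q) ^ 2 - K * (s * q) - K * (s * q) * s := by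
      rw [hqj]; ring
    rw [hsq] at h4
    nlinarith [mul_nonneg hK hs0.le]
  have hhigh : unifPi n {v | j + K * q < n * orderStat v j} ≤ ofReal (exp (1 / 4 - K / 4)) := by
    by_cases hbig : (n : ℝ) < j + K * q
    · have : unifPi n {v | j + K * q < n * orderStat v j} = 0 := by
        refine measure_eq_zero_iff_ae_notMem.2 ?_
        filter_upwards [ae_unifPi n] with v hv h
        have := (orderStat_mem_of_forall hv h1 h2).2
        have h3 : (j : ℝ) + K * q < n * orderStat v j := h; nlinarith
      rw [this]; exact zero_le
    rw [not_lt] at hbig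
    set t := (j + K * q) / n with ht
    have hjq : (0 : ℝ) ≤ j + K * q := by positivity
    have ht0 : 0 ≤ t := div_nonneg hjq hn.le
    have ht1 : t ≤ 1 := by rw [ht, div_le_one hn]; exact hbig
    have hnt : n * t = j + K * q := by rw [ht]; field_simp
    have hsub : {v : Fin n → ℝ | j + K * q < n * orderStat v j} ⊆ {v | countLe v t ≤ j} := by
      intro v hv
      have hv' : (j : ℝ) + K * q < n * orderStat v j := hv
      have h3 : ¬ orderStat v j ≤ t := by rw [ht, not_le, div_lt_iff₀ hn]; linarith
      rw [orderStat_le_iff_countLe v h1 h2 t, not_le] at h3; exact h3.le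
    refine (measure_mono hsub).trans ?_
    rw [← ofReal_measureReal]
    refine ENNReal.ofReal_le_ofReal ((measure_le_le_exp_mul_mgf (j : ℝ) (neg_nonpos.2 hs0.le)
      (integrable_exp_countLe t (-s))).trans ?_)
    refine (mul_le_mul_of_nonneg_left (mgf_countLe_le ht0 ht1 (-s)) (exp_pos _).le).trans ?_
    rw [← exp_add, exp_le_exp, hnt]
    have h3 := mul_le_mul_of_nonneg_left (hexp (-s) (by rw [abs_neg, abs_of_pos hs0]; linarith)) hjq
    have h4 : (j + K * q) * (-s + (-s) ^ 2) + s * j = (s * q) ^ 2 - K * (s * q) + K * (s * q) * s := by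
      rw [hqj]; ring
    rw [hsq] at h4
    nlinarith [mul_nonneg hK hs0.le, mul_le_mul_of_nonneg_left hs1 hK]
  have hsub : {v : Fin n → ℝ | K * q < |n * orderStat v j - j|}
      ⊆ {v | n * orderStat v j < j - K * q} ∪ {v | j + K * q < n * orderStat v j} := by
    intro v hv
    rcases lt_abs.1 (show K * q < |n * orderStat v j - j| from hv) with h | h
    · right; show j + K * q < n * orderStat v j; linarith
    · left; show n * orderStat v j < j - K * q; linarith
  refine (measure_mono hsub).trans ((measure_union_le _ _).trans ((add_le_add hlow hhigh).trans ?_))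
  rw [← ENNReal.ofReal_add hE hE, two_mul]

/-- The two smallest points of a uniform sample are rarely close to each other. -/
lemma unifPi_pair_le (n : ℕ) {M d : ℝ} (hd : 0 ≤ d) :
    unifPi n {v | ∃ i l, i ≠ l ∧ n * v i ≤ M ∧ |n * v l - n * v i| ≤ d} ≤ ofReal (2 * M * d) := by
  rcases Nat.eq_zero_or_pos n with rfl | hn0
  · simp only [IsEmpty.exists_iff]; simp
  have hn : (0 : ℝ) < n := mod_cast hn0
  set B : Set (ℝ × ℝ) := {p | n * p.1 ≤ M ∧ |n * p.2 - n * p.1| ≤ d}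
  have hBm : MeasurableSet B :=
    ((isClosed_le (f := fun p : ℝ × ℝ => (n : ℝ) * p.1) (by fun_prop) continuous_const).inter
      (isClosed_le (f := fun p : ℝ × ℝ => |(n : ℝ) * p.2 - n * p.1|) (by fun_prop)
        continuous_const)).measurableSet
  have hpair : ∀ i l : Fin n, i ≠ l → unifPi n {v | n * v i ≤ M ∧ |n * v l - n * v i| ≤ d}
      ≤ ofReal (2 * M * d / n ^ 2) := by
    intro i l hil
    have hind : IndepFun (fun v : Fin n → ℝ => v i) (fun v => v l) (unifPi n) :=
      (iIndepFun_pi (μ := fun _ : Fin n => unif) (X := fun _ x => x)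
        fun _ => aemeasurable_id).indepFun hil
    have hmap : (unifPi n).map (fun v => (v i, v l)) = unif.prod unif := by
      rw [(indepFun_iff_map_prod_eq_prod_map_map (measurable_pi_apply i).aemeasurable
        (measurable_pi_apply l).aemeasurable).1 hind]
      congr 1 <;> exact (measurePreserving_eval (fun _ : Fin n => unif) _).map_eq
    have h1 : unifPi n {v | n * v i ≤ M ∧ |n * v l - n * v i| ≤ d} = unif.prod unif B := by
      rw [← hmap, Measure.map_apply (by fun_prop) hBm]; rfl
    rw [h1, Measure.prod_apply hBm]
    have h2 : ∀ x, unif (Prod.mk x ⁻¹' B)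
        ≤ (Iic (M / n)).indicator (fun _ => ofReal (2 * d / n)) x := by
      intro x
      by_cases hx : x ≤ M / n
      · rw [Set.indicator_of_mem (Set.mem_Iic.2 hx)]
        have hsub : Prod.mk x ⁻¹' B ⊆ Set.Icc (x - d / n) (x + d / n) := by
          intro z hz
          have := abs_le.1 hz.2
          have e1 : z - x = (n * z - n * x) / n := by field_simp
          have e2 : (n * z - n * x) / n ≤ d / n := div_le_div_of_nonneg_right this.2 hn.le
          have e3 : -d / n ≤ (n * z - n * x) / n := div_le_div_of_nonneg_right this.1 hn.le
          rw [neg_div] at e3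
          exact ⟨by linarith, by linarith⟩
        refine (unif_le_volume _).trans ((measure_mono hsub).trans ?_)
        rw [volume_Icc]
        exact ENNReal.ofReal_le_ofReal (by ring_nf; exact le_rfl)
      · have : Prod.mk x ⁻¹' B = ∅ := by
          ext z
          simp only [Set.mem_preimage, Set.mem_empty_iff_false, iff_false]
          intro hz
          exact hx ((le_div_iff₀ hn).2 (by have := hz.1; simp only at this; linarith))
        rw [this]; simp
    refine (lintegral_mono h2).trans ?_
    rw [lintegral_indicator_const measurableSet_Iic]
    have h3 : unif (Iic (M / n)) ≤ ofReal (M / n) := by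
      rw [unif, Measure.restrict_apply' measurableSet_Ioo]
      refine (measure_mono (t := Ioc 0 (M / n)) fun z hz => ⟨hz.2.1, hz.1⟩).trans ?_
      rw [volume_Ioc, sub_zero]
    refine (mul_le_mul_right h3 _).trans ?_
    rw [← ENNReal.ofReal_mul (by positivity)]
    exact ENNReal.ofReal_le_ofReal (by apply le_of_eq; field_simp)
  have hsub : {v : Fin n → ℝ | ∃ i l, i ≠ l ∧ n * v i ≤ M ∧ |n * v l - n * v i| ≤ d}
      ⊆ ⋃ p ∈ (Finset.univ : Finset (Fin n × Fin n)).filter (fun p => p.1 ≠ p.2),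
        {v | n * v p.1 ≤ M ∧ |n * v p.2 - n * v p.1| ≤ d} := by
    rintro v ⟨i, l, hil, h⟩
    simp only [Set.mem_iUnion]
    exact ⟨(i, l), by simpa using hil, h⟩
  refine (measure_mono hsub).trans ((measure_biUnion_finset_le _ _).trans ?_)
  refine (Finset.sum_le_sum fun p hp => hpair p.1 p.2 (Finset.mem_filter.1 hp).2).trans ?_
  refine (Finset.sum_le_sum_of_subset (Finset.subset_univ _)).trans ?_
  rw [Finset.sum_const, Finset.card_univ, Fintype.card_prod, Fintype.card_fin, nsmul_eq_mul,
    ← ENNReal.ofReal_natCast, ← ENNReal.ofReal_mul (by positivity)]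
  refine ENNReal.ofReal_le_ofReal (le_of_eq ?_)
  push_cast; field_simp

lemma le_orderStat_one_iff {n : ℕ} (hn : 1 ≤ n) (v : Fin n → ℝ) (t : ℝ) :
    t < orderStat v 1 ↔ ∀ l, t < v l := by
  constructor
  · intro h l
    by_contra hl
    rw [not_lt] at hl
    exact absurd ((orderStat_le_iff v le_rfl hn t).2
      (Finset.card_pos.2 ⟨l, by simpa using hl⟩)) (not_le.2 h)
  · intro h
    obtain ⟨l, hl⟩ := exists_eq_orderStat v le_rfl hn; exact hl ▸ h l

/-- The smallest of `n` uniform variables, in the scale `1 / n`. -/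
lemma unifPi_orderStat_one_gt {n : ℕ} (hn : 1 ≤ n) {x : ℝ} (h0 : 0 ≤ x) (h1 : x ≤ n) :
    (unifPi n).real {v | x < n * orderStat v 1} = (1 - x / n) ^ n := by
  have hn0 : (0 : ℝ) < n := mod_cast hn
  have hset : {v : Fin n → ℝ | x < n * orderStat v 1} = Set.univ.pi fun _ => (Iic (x / n))ᶜ := by
    ext v
    simp only [Set.mem_ofPred_eq, Set.mem_pi, Set.mem_univ, forall_true_left, Set.mem_compl_iff,
      Set.mem_Iic, not_le]
    rw [← le_orderStat_one_iff hn, div_lt_iff₀ hn0, mul_comm]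
  rw [hset, Measure.real, unifPi, Measure.pi_pi, Finset.prod_const, ENNReal.toReal_pow,
    Finset.card_univ, Fintype.card_fin, ← Measure.real, probReal_compl_eq_one_sub measurableSet_Iic,
    unif_real_Iic (by positivity) ((div_le_one hn0).2 h1)]

/-- An array `w i 1 ≤ … ≤ w i (k + 1)`, `k = k i`, that behaves along `F` like `n` times the `k + 1`
smallest order statistics of `n` uniform variables. -/
structure UniformTail {ι : Type*} (F : Filter ι) (k : ι → ℕ) (w : ι → ℕ → ℝ) : Prop where
  tendsto_k : Tendsto k F atTop
  mono : ∀ᶠ i in F, ∀ j ∈ Icc 1 (k i + 1), ∀ l ∈ Icc 1 (k i + 1), j ≤ l → w i j ≤ w i l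
  close : ∀ ε > (0 : ℝ), ∀ᶠ i in F, ∀ j ∈ Icc 1 (k i + 1), |w i j - j| ≤ (k i : ℝ) ^ ε * sqrt j
  one_ge : ∀ ε > (0 : ℝ), ∀ᶠ i in F, (k i : ℝ) ^ (-ε) ≤ w i 1
  gap_ge : ∀ ε > (0 : ℝ), ∀ᶠ i in F, (k i : ℝ) ^ (-ε) ≤ w i 2 - w i 1

lemma abs_orderStat_two_sub_one {n : ℕ} (hn : 2 ≤ n) (v : Fin n → ℝ) :
    ∃ i l, i ≠ l ∧ v i = orderStat v 1 ∧ v l = orderStat v 2 := by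
  refine ⟨_, _, ?_, (orderStat_eq v le_rfl (by omega)).symm, (orderStat_eq v (by omega) hn).symm⟩
  intro h
  have := (Tuple.sort v).injective h; simp at this

/-- With probability tending to one, the `k + 1` smallest points of a uniform sample satisfy all
bounds of a uniform tail simultaneously. -/
lemma uniformTail_unifPi {k : ℕ → ℕ} (hk : Tendsto k atTop atTop) (hkn : ∀ᶠ n in atTop, k n + 1 ≤ n) :
    UniformTail (inProb unifPi) (fun i => k i.1) (fun i j => i.1 * orderStat i.2 j) := by
  have hkP : Tendsto (fun i : Sample => k i.1) (inProb unifPi) atTop :=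
    hk.comp tendsto_fst_inProb
  have hofReal : ∀ {u : ℕ → ℝ}, Tendsto u atTop (𝓝 0) →
      Tendsto (fun n => ofReal (u n)) atTop (𝓝 0) := fun hu => by
    simpa using ENNReal.tendsto_ofReal hu
  have hclose : ∀ ε > (0 : ℝ), ∀ᶠ i : Sample in inProb unifPi,
      ∀ j ∈ Icc 1 (k i.1 + 1), |i.1 * orderStat i.2 j - j| ≤ (k i.1 : ℝ) ^ ε * sqrt j := by
    intro ε hε
    have hu : Tendsto (fun n => (12 : ℝ) * (k n : ℝ) ^ (-1 : ℝ)) atTop (𝓝 0) := by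
      simpa using (tendsto_rpow_neg_of_tendsto hk (b := -1) (by norm_num)).const_mul 12
    refine eventually_inProb_of_le (hofReal hu) ?_
    filter_upwards [hkn, eventually_log_le_rpow hk hε 8, hk.eventually_ge_atTop 1] with n h1 h2 h3
    have hk1 : (1 : ℝ) ≤ k n := mod_cast h3
    have hk0 : (0 : ℝ) < k n := by linarith
    have hsub : {v : Fin n → ℝ | ¬ ∀ j ∈ Icc 1 (k n + 1),
        |n * orderStat v j - j| ≤ (k n : ℝ) ^ ε * sqrt j}
        ⊆ ⋃ j ∈ Icc 1 (k n + 1), {v | (k n : ℝ) ^ ε * sqrt j < |n * orderStat v j - j|} := by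
      intro v hv
      simp only [Set.mem_ofPred_eq, not_forall, not_le] at hv
      obtain ⟨j, hj, h⟩ := hv
      simp only [Set.mem_iUnion]
      exact ⟨j, hj, h⟩
    refine (measure_mono hsub).trans ((measure_biUnion_finset_le _ _).trans ?_)
    refine (Finset.sum_le_sum fun j hj => unifPi_abs_sub_gt_le (mem_Icc.1 hj).1
      ((mem_Icc.1 hj).2.trans h1) (rpow_nonneg hk0.le ε)).trans ?_
    rw [Finset.sum_const, Nat.card_Icc, nsmul_eq_mul, ← ENNReal.ofReal_natCast,
      ← ENNReal.ofReal_mul (by positivity)]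
    refine ENNReal.ofReal_le_ofReal ?_
    have e1 : exp (1 / 4 - (k n : ℝ) ^ ε / 4) ≤ 3 * (k n : ℝ) ^ (-2 : ℝ) := by
      rw [show (k n : ℝ) ^ (-2 : ℝ) = exp (log (k n) * -2) from rpow_def_of_pos hk0 _]
      have : exp (1 / 4 - (k n : ℝ) ^ ε / 4) ≤ exp 1 * exp (log (k n) * -2) := by
        rw [← exp_add, exp_le_exp]; linarith
      refine this.trans (mul_le_mul_of_nonneg_right ?_ (exp_pos _).le)
      linarith [exp_one_lt_d9]
    have e2 : (k n : ℝ) * (k n : ℝ) ^ (-2 : ℝ) = (k n : ℝ) ^ (-1 : ℝ) := by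
      rw [← rpow_one_add' hk0.le (by norm_num)]; norm_num
    have e3 : ((k n + 1 + 1 - 1 : ℕ) : ℝ) ≤ 2 * k n := by
      rw [show k n + 1 + 1 - 1 = k n + 1 by omega]; push_cast; linarith
    calc ((k n + 1 + 1 - 1 : ℕ) : ℝ) * (2 * exp (1 / 4 - (k n : ℝ) ^ ε / 4))
        ≤ (2 * k n) * (2 * (3 * (k n : ℝ) ^ (-2 : ℝ))) :=
          mul_le_mul e3 (by linarith) (by positivity) (by positivity)
      _ = 12 * ((k n : ℝ) * (k n : ℝ) ^ (-2 : ℝ)) := by ring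
      _ = _ := by rw [e2]
  have hall : ∀ᶠ i : Sample in inProb unifPi, k i.1 + 1 ≤ i.1 ∧ 1 ≤ k i.1 :=
    (tendsto_fst_inProb.eventually hkn).and (hkP.eventually_ge_atTop 1)
  refine ⟨hkP, ?_, hclose, ?_, ?_⟩
  · filter_upwards [hall] with i hi j hj l hl hjl
    rw [mem_Icc] at hj hl
    exact mul_le_mul_of_nonneg_left (orderStat_mono _ hj.1 hjl (hl.2.trans hi.1)) (Nat.cast_nonneg _)
  · intro ε hε
    refine eventually_inProb_of_le (hofReal (tendsto_rpow_neg_of_tendsto hk (neg_lt_zero.2 hε))) ?_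
    filter_upwards [hkn, hk.eventually_ge_atTop 1] with n h1 h2
    have hn1 : 1 ≤ n := by omega
    have hn : (1 : ℝ) ≤ n := mod_cast hn1
    have hk1 : (1 : ℝ) ≤ k n := mod_cast h2
    set x := (k n : ℝ) ^ (-ε)
    have hx0 : 0 ≤ x := by positivity
    have hx1 : x ≤ 1 := rpow_le_one_of_one_le_of_nonpos hk1 (by linarith)
    have hm : MeasurableSet {v : Fin n → ℝ | x < n * orderStat v 1} :=
      measurableSet_lt measurable_const ((measurable_orderStat 1).const_mul _)
    have h3 := unifPi_orderStat_one_gt hn1 hx0 (hx1.trans hn)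
    have h4 := one_add_mul_le_pow (a := -(x / n)) (by
      have : x / n ≤ 1 := (div_le_one (by linarith)).2 (hx1.trans hn); linarith) n
    have h5 : (n : ℝ) * -(x / n) = -x := by field_simp
    have h6 : (unifPi n).real {v : Fin n → ℝ | x < n * orderStat v 1}ᶜ ≤ x := by
      rw [probReal_compl_eq_one_sub hm, h3, sub_eq_add_neg 1 (x / n)]; linarith
    refine (measure_mono (fun v hv => ?_)).trans
      ((ofReal_measureReal (μ := unifPi n)).symm.le.trans (ENNReal.ofReal_le_ofReal h6))
    simp only [Set.mem_compl_iff, Set.mem_ofPred_eq, not_lt, not_le] at hv ⊢; exact hv.le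
  · intro ε hε
    have hsmall : ∀ᶠ i : Sample in inProb unifPi, ¬ ∃ a b, a ≠ b ∧
        i.1 * i.2 a ≤ (k i.1 : ℝ) ^ (ε / 2) ∧ |i.1 * i.2 b - i.1 * i.2 a| ≤ (k i.1 : ℝ) ^ (-ε) := by
      have hu : Tendsto (fun n => 2 * (k n : ℝ) ^ (-(ε / 2))) atTop (𝓝 0) := by
        simpa using (tendsto_rpow_neg_of_tendsto hk (b := -(ε / 2)) (by linarith)).const_mul 2
      refine eventually_inProb_of_le (hofReal hu) ?_
      filter_upwards [hk.eventually_ge_atTop 1] with n h1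
      have hk0 : (0 : ℝ) < k n := mod_cast h1
      simp only [not_not]
      refine (unifPi_pair_le n (by positivity)).trans (le_of_eq ?_)
      rw [mul_assoc, ← rpow_add hk0]; ring_nf
    filter_upwards [hall, hsmall, hclose (ε / 4) (by linarith),
      eventually_mul_rpow_le hkP (show ε / 4 < ε / 2 by linarith) 2,
      eventually_le_rpow hkP (show 0 < ε / 4 by linarith) 1] with i hi h1 h2 h3 h4
    by_contra hcon
    rw [not_le] at hcon
    refine h1 ?_
    obtain ⟨a, b, hab, ha, hb⟩ := abs_orderStat_two_sub_one (by omega) i.2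
    have h5 := h2 1 (mem_Icc.2 ⟨le_rfl, by omega⟩)
    simp only [Nat.cast_one, sqrt_one, mul_one] at h5
    have h6 : orderStat i.2 1 ≤ orderStat i.2 2 := orderStat_mono _ le_rfl (by omega) (by omega)
    refine ⟨a, b, hab, ?_, ?_⟩
    · rw [ha]; linarith [(abs_le.1 h5).2]
    · rw [ha, hb, abs_of_nonneg]
      · exact hcon.le
      · exact sub_nonneg.2 (mul_le_mul_of_nonneg_left h6 (Nat.cast_nonneg _))

namespace UniformTail

variable {ι : Type*} {F : Filter ι} {k : ι → ℕ} {w : ι → ℕ → ℝ}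

local notation:max "K[" i "]" => (k i : ℝ)

lemma upper (h : UniformTail F k w) {ε : ℝ} (hε : 0 < ε) :
    ∀ᶠ i in F, ∀ j ∈ Icc 1 (k i + 1), w i j ≤ K[i] ^ ε * j := by
  filter_upwards [h.close (ε / 2) (by linarith), eventually_le_rpow h.tendsto_k (half_pos hε) 1,
    eventually_mul_rpow_le h.tendsto_k (half_lt_self hε) 2] with i h1 h2 h3 j hj
  have hj1 : (1 : ℝ) ≤ j := mod_cast (mem_Icc.1 hj).1
  have h4 := (abs_le.1 (h1 j hj)).2
  have h5 : sqrt j ≤ j := (sqrt_le_left (by linarith)).2 (by nlinarith)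
  nlinarith [mul_le_mul_of_nonneg_left h5 (zero_le_one.trans h2)]

lemma lower (h : UniformTail F k w) {ε : ℝ} (hε : 0 < ε) :
    ∀ᶠ i in F, ∀ j ∈ Icc 1 (k i + 1), K[i] ^ (-ε) * j ≤ w i j := by
  filter_upwards [h.close (ε / 4) (by linarith), eventually_le_rpow h.tendsto_k hε 2,
    eventually_mul_rpow_le h.tendsto_k (show ε / 2 < ε - ε / 4 by linarith) 4, h.mono,
    h.one_ge (ε / 4) (by linarith), h.tendsto_k.eventually_ge_atTop 1] with i h1 h2 h3 h4 h5 h6 j hj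
  have hk0 : (0 : ℝ) < k i := mod_cast h6
  have hj1 : (1 : ℝ) ≤ j := mod_cast (mem_Icc.1 hj).1
  set q := sqrt j
  have hqj : q * q = j := mul_self_sqrt (by linarith)
  have hq0 : 0 < q := sqrt_pos.2 (by linarith)
  have hkε : K[i] ^ (-ε) * K[i] ^ ε = 1 := by rw [← rpow_add hk0]; simp
  have hm := rpow_pos_of_pos hk0 (-ε)
  by_cases hc : K[i] ^ (ε / 4) ≤ q / 2
  · have h7 := (abs_le.1 (h1 j hj)).1
    have h8 : K[i] ^ (ε / 4) * q ≤ j / 2 := by nlinarith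
    have h9 : K[i] ^ (-ε) ≤ 1 / 2 := by nlinarith
    nlinarith
  · rw [not_le] at hc
    have hj4 : (j : ℝ) ≤ 4 * K[i] ^ (ε / 2) := by
      have e : K[i] ^ (ε / 2) = K[i] ^ (ε / 4) * K[i] ^ (ε / 4) := by
        rw [← rpow_add hk0]; ring_nf
      rw [e, ← hqj]
      have := mul_self_le_mul_self hq0.le (show q ≤ 2 * K[i] ^ (ε / 4) by linarith); linarith
    have h7 := h4 1 (mem_Icc.2 ⟨le_rfl, by omega⟩) j hj (mem_Icc.1 hj).1
    refine le_trans ?_ (h5.trans h7)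
    calc K[i] ^ (-ε) * j ≤ K[i] ^ (-ε) * K[i] ^ (ε - ε / 4) :=
          mul_le_mul_of_nonneg_left (hj4.trans h3) hm.le
      _ = K[i] ^ (-(ε / 4)) := by rw [← rpow_add hk0]; ring_nf

lemma abs_log_le (h : UniformTail F k w) {ε : ℝ} (hε : 0 < ε) :
    ∀ᶠ i in F, ∀ j ∈ Icc 1 (k i + 1), 0 < w i j ∧ |log (w i j / j)| ≤ ε * log (k i) := by
  filter_upwards [h.lower hε, h.upper hε, h.tendsto_k.eventually_ge_atTop 1] with i h1 h2 h3 j hj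
  have hk0 : (0 : ℝ) < k i := mod_cast h3
  have hj0 := cast_pos_of_mem hj
  have hw0 : 0 < w i j := lt_of_lt_of_le (by positivity) (h1 j hj)
  refine ⟨hw0, abs_le.2 ⟨?_, ?_⟩⟩
  · rw [← neg_mul, ← log_rpow hk0]; exact log_le_log (by positivity) ((le_div_iff₀ hj0).2 (h1 j hj))
  · rw [← log_rpow hk0]; exact log_le_log (by positivity) ((div_le_iff₀ hj0).2 (h2 j hj))

lemma near (h : UniformTail F k w) {ε : ℝ} (hε : 0 < ε) : ∀ᶠ i in F, ∀ j ∈ Icc 1 (k i + 1),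
      |log (w i j / j)| ≤ K[i] ^ ε * (j : ℝ) ^ (-1 / 2 : ℝ) := by
  filter_upwards [h.close (ε / 2) (by linarith), h.abs_log_le (half_pos hε),
    eventually_mul_rpow_le h.tendsto_k (half_lt_self hε) 2,
    eventually_log_le_rpow h.tendsto_k (half_pos hε) ε,
    h.tendsto_k.eventually_ge_atTop 1] with i h1 h2 h3 h4 h5 j hj
  have hk0 : (0 : ℝ) < k i := mod_cast h5
  have hj0 := cast_pos_of_mem hj
  set q := sqrt j with hq
  have hqj : q * q = j := mul_self_sqrt (by linarith)
  have hq0 : 0 < q := sqrt_pos.2 hj0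
  have hpow : (j : ℝ) ^ (-1 / 2 : ℝ) = q⁻¹ := by rw [hq, sqrt_eq_rpow, ← rpow_neg hj0.le]; norm_num
  rw [hpow, ← div_eq_mul_inv, le_div_iff₀ hq0]
  by_cases hc : K[i] ^ (ε / 2) ≤ q / 2
  · have e1 : w i j / j = 1 + (w i j - j) / j := by field_simp; ring
    have e2 : |(w i j - j) / j| * q ≤ K[i] ^ (ε / 2) := by
      rw [abs_div, abs_of_pos hj0, div_mul_eq_mul_div, div_le_iff₀ hj0]
      have := mul_le_mul_of_nonneg_right (h1 j hj) hq0.le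
      rwa [mul_assoc, hqj] at this
    have e3 : |(w i j - j) / j| ≤ 1 / 2 := by
      have : |(w i j - j) / j| * q ≤ 1 / 2 * q := by linarith
      exact le_of_mul_le_mul_right this hq0
    rw [e1]
    nlinarith [abs_log_one_add_le e3]
  · rw [not_le] at hc
    have hlog0 : 0 ≤ ε / 2 * log (k i) := (abs_nonneg _).trans (h2 j hj).2
    have e : K[i] ^ ε = K[i] ^ (ε / 2) * K[i] ^ (ε / 2) := by
      rw [← rpow_add hk0]; ring_nf
    calc |log (w i j / j)| * q ≤ (ε / 2 * log (k i)) * (2 * K[i] ^ (ε / 2)) :=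
          mul_le_mul (h2 j hj).2 (by linarith) hq0.le hlog0
      _ ≤ K[i] ^ ε := by rw [e]; nlinarith

lemma abs_last_sub_le (h : UniformTail F k w) {c : ℝ} (hc : 0 < c) :
    ∀ᶠ i in F, |w i (k i + 1) - k i| ≤ c * k i := by
  filter_upwards [h.close (1 / 4) (by norm_num),
    eventually_mul_rpow_le h.tendsto_k (show (3 / 4 : ℝ) < 1 by norm_num) (4 / c),
    eventually_mul_rpow_le h.tendsto_k one_pos (2 / c),
    h.tendsto_k.eventually_ge_atTop 1] with i h1 h2 h3 h4
  have hk : (1 : ℝ) ≤ k i := mod_cast h4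
  have hk0 : (0 : ℝ) < k i := by linarith
  have f1 := h1 (k i + 1) (mem_Icc.2 ⟨by omega, le_rfl⟩)
  push_cast at f1
  have f2 : sqrt (k i + 1) ≤ 2 * K[i] ^ (1 / 2 : ℝ) := by
    rw [← sqrt_eq_rpow, sqrt_le_left (by positivity), mul_pow, sq_sqrt hk0.le]; linarith
  have f3 : K[i] ^ (1 / 4 : ℝ) * K[i] ^ (1 / 2 : ℝ) = K[i] ^ (3 / 4 : ℝ) := by
    rw [← rpow_add hk0]; norm_num
  have f4 := mul_le_mul_of_nonneg_left f2 (rpow_nonneg hk0.le (1 / 4))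
  rw [rpow_one, div_mul_eq_mul_div, div_le_iff₀ hc] at h2 h3
  rw [rpow_zero] at h3
  have f5 := abs_le.1 f1
  exact abs_le.2 ⟨by linarith, by linarith⟩

end UniformTail

/-! ### Exceedances as a perturbed uniform tail -/

/-- The inverse of `kFun ξ`. -/
def kInv (ξ h : ℝ) : ℝ := if ξ = 0 then exp h else (1 + ξ * h) ^ (1 / ξ)

lemma kInv_pos {ξ h : ℝ} (hp : 0 < 1 + ξ * h) : 0 < kInv ξ h := by
  unfold kInv; split_ifs
  · exact exp_pos h
  · exact rpow_pos_of_pos hp _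

lemma kFun_kInv {ξ h : ℝ} (hp : 0 < 1 + ξ * h) : kFun ξ (kInv ξ h) = h := by
  unfold kFun kInv; split_ifs with h0
  · exact log_exp h
  · rw [← rpow_mul hp.le, one_div_mul_cancel h0, rpow_one]; field_simp; ring

lemma kInv_le_kInv {ξ h h' : ℝ} (hp : 0 < 1 + ξ * h) (hp' : 0 < 1 + ξ * h') (hle : h ≤ h') :
    kInv ξ h ≤ kInv ξ h' := by
  refine ((kFun_strictMonoOn ξ).le_iff_le (kInv_pos hp) (kInv_pos hp')).1 ?_
  rwa [kFun_kInv hp, kFun_kInv hp']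

lemma one_le_kInv {ξ h : ℝ} (hp : 0 < 1 + ξ * h) (h0 : 0 ≤ h) : 1 ≤ kInv ξ h := by
  refine ((kFun_strictMonoOn ξ).le_iff_le (Set.mem_Ioi.2 one_pos) (kInv_pos hp)).1 ?_
  rwa [kFun_kInv hp, kFun_one]

lemma abs_log_kInv_sub_le {ξ x s : ℝ} (hx : 0 < x) (hs : |ξ * s| ≤ 1 / 2) :
    0 < 1 + ξ * (kFun ξ x + x ^ ξ * s) ∧
      |log (kInv ξ (kFun ξ x + x ^ ξ * s)) - log x| ≤ 2 * |s| := by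
  have hxp := rpow_pos_of_pos hx ξ
  have e : 1 + ξ * (kFun ξ x + x ^ ξ * s) = x ^ ξ * (1 + ξ * s) := by
    rw [mul_add, ← add_assoc, one_add_mul_kFun]; ring
  have h1 : 0 < 1 + ξ * s := by linarith [(abs_le.1 hs).1]
  refine ⟨e ▸ mul_pos hxp h1, ?_⟩
  unfold kInv
  split_ifs with h0
  · subst h0
    simp only [kFun, if_true, rpow_zero, one_mul, log_exp, add_sub_cancel_left]
    linarith [abs_nonneg s]
  · rw [e, log_rpow (mul_pos hxp h1), log_mul hxp.ne' h1.ne', log_rpow hx]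
    have e2 : 1 / ξ * (ξ * log x + log (1 + ξ * s)) - log x
        = log (1 + ξ * s) / ξ := by field_simp; ring
    rw [e2, abs_div, div_le_iff₀ (abs_pos.2 h0)]
    have := abs_log_one_add_le hs
    rw [abs_mul] at this; linarith

/-- The position that an exceedance of size `h` would have in an exact generalized Pareto sample. -/
def tailPos (ξ : ℝ) (k : ℕ) (h : ℕ → ℝ) (j : ℕ) : ℝ := k / kInv ξ (h j)

namespace UniformTail

variable {ι : Type*} {F : Filter ι} {k : ι → ℕ} {w h : ι → ℕ → ℝ}

local notation:max "K[" i "]" => (k i : ℝ)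
local notation:max "Y[" ξ ", " i "]" => tailPos ξ (k i) (h i)

lemma log_tailPos (hu : UniformTail F k w) {ξ γ : ℝ} (hγ : ξ ≤ γ) (hγ2 : γ - ξ < 1 / 2)
    (herr : ∀ ε > (0 : ℝ), ∀ᶠ i in F, ∀ j ∈ Icc 1 (k i),
      |h i j - kFun ξ (k i / w i j)| ≤ K[i] ^ (-1 / 2 + ε) * (k i / w i j) ^ γ)
    {ε : ℝ} (hε : 0 < ε) :
    ∀ᶠ i in F, ∀ j ∈ Icc 1 (k i), 0 < 1 + ξ * h i j ∧
      |log (Y[ξ, i] j / w i j)|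
        ≤ K[i] ^ (-1 / 2 + ε) * (K[i] / j) ^ (γ - ξ) := by
  set p := γ - ξ
  set ε' := min ε (1 / 2 - p) / 4 with hε'
  have hε0 : 0 < ε' := by rw [hε']; have := lt_min hε (sub_pos.2 hγ2); linarith
  have hεε : 4 * ε' ≤ ε := by rw [hε']; linarith [min_le_left ε (1 / 2 - p)]
  have hεp : 4 * ε' ≤ 1 / 2 - p := by rw [hε']; linarith [min_le_right ε (1 / 2 - p)]
  have hp0 : 0 ≤ p := sub_nonneg.2 hγ
  filter_upwards [herr ε' hε0, hu.lower hε0, hu.tendsto_k.eventually_ge_atTop 1,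
    eventually_mul_rpow_le hu.tendsto_k (show -1 / 2 + 2 * ε' < -1 / 2 + ε by linarith) 2,
    eventually_mul_rpow_le hu.tendsto_k (show -1 / 2 + 2 * ε' + p < 0 by linarith) (2 * |ξ|)]
    with i h1 h2 h3 h4 h5 j hj
  have hk1 : (1 : ℝ) ≤ k i := mod_cast h3
  have hk0 : (0 : ℝ) < k i := by linarith
  have hj' := mem_Icc.1 hj
  have hj0 : (0 : ℝ) < j := mod_cast hj'.1
  have hj1 : (1 : ℝ) ≤ j := mod_cast hj'.1
  have hlow := h2 j (mem_Icc.2 ⟨hj'.1, by omega⟩)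
  have hw0 : 0 < w i j := lt_of_lt_of_le (by positivity) hlow
  set x := K[i] / w i j with hx
  have hx0 : 0 < x := div_pos hk0 hw0
  set s := (h i j - kFun ξ x) * x ^ (-ξ) with hs
  have hxx : x ^ ξ * x ^ (-ξ) = 1 := by rw [← rpow_add hx0]; simp
  have hh : h i j = kFun ξ x + x ^ ξ * s := by
    rw [hs]; linear_combination (-(h i j - kFun ξ x)) * hxx
  have hxle : x ≤ K[i] / j * K[i] ^ ε' := by
    rw [hx, div_le_iff₀ hw0]
    have e : K[i] ^ ε' * K[i] ^ (-ε') = 1 := by rw [← rpow_add hk0]; simp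
    calc K[i] = K[i] / j * (K[i] ^ ε' * K[i] ^ (-ε')) * j := by
          rw [e]; field_simp
      _ = K[i] / j * K[i] ^ ε' * (K[i] ^ (-ε') * j) := by ring
      _ ≤ _ := mul_le_mul_of_nonneg_left hlow (by positivity)
  have hxp : x ^ p ≤ (K[i] / j) ^ p * K[i] ^ ε' := by
    refine (rpow_le_rpow hx0.le hxle hp0).trans ?_
    rw [mul_rpow (by positivity) (by positivity), ← rpow_mul hk0.le]
    refine mul_le_mul_of_nonneg_left (rpow_le_rpow_of_exponent_le hk1 ?_) (by positivity); nlinarith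
  have hsb : |s| ≤ K[i] ^ (-1 / 2 + 2 * ε') * (K[i] / j) ^ p := by
    have hxξ := rpow_pos_of_pos hx0 (-ξ)
    rw [hs, abs_mul, abs_of_pos hxξ]
    calc _ ≤ K[i] ^ (-1 / 2 + ε') * x ^ γ * x ^ (-ξ) :=
          mul_le_mul_of_nonneg_right (h1 j hj) hxξ.le
      _ = K[i] ^ (-1 / 2 + ε') * x ^ p := by rw [mul_assoc, ← rpow_add hx0, ← sub_eq_add_neg]
      _ ≤ K[i] ^ (-1 / 2 + ε') * ((K[i] / j) ^ p * K[i] ^ ε') :=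
          mul_le_mul_of_nonneg_left hxp (by positivity)
      _ = _ := by
          rw [show -1 / 2 + 2 * ε' = (-1 / 2 + ε') + ε' by ring, rpow_add hk0 (-1 / 2 + ε') ε']; ring
  have hkj : (K[i] / j) ^ p ≤ K[i] ^ p :=
    rpow_le_rpow (by positivity) (div_le_self hk0.le hj1) hp0
  have hsξ : |ξ * s| ≤ 1 / 2 := by
    have : |s| ≤ K[i] ^ (-1 / 2 + 2 * ε' + p) := by
      rw [rpow_add hk0]; exact hsb.trans (mul_le_mul_of_nonneg_left hkj (by positivity))
    rw [rpow_zero] at h5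
    rw [abs_mul]
    nlinarith [mul_le_mul_of_nonneg_left this (abs_nonneg ξ)]
  obtain ⟨g1, g2⟩ := abs_log_kInv_sub_le hx0 hsξ
  rw [← hh] at g1 g2
  refine ⟨g1, ?_⟩
  have hI := kInv_pos g1
  have e : log (Y[ξ, i] j / w i j) = -(log (kInv ξ (h i j)) - log x) := by
    rw [tailPos, hx, log_div (by positivity) hw0.ne', log_div hk0.ne' hI.ne',
      log_div hk0.ne' hw0.ne']
    ring
  rw [e, abs_neg]
  refine g2.trans ?_
  have : 0 ≤ (K[i] / j) ^ p := by positivity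
  nlinarith

/-- If the normalized exceedances follow a generalized Pareto profile in a uniform tail up to an
error of order `k ^ (-1/2)`, the corresponding positions form a tail array. -/
theorem tailArray (hu : UniformTail F k w) {ξ γ : ℝ} (hγ : ξ ≤ γ) (hγ2 : γ - ξ < 1 / 2)
    (herr : ∀ ε > (0 : ℝ), ∀ᶠ i in F, ∀ j ∈ Icc 1 (k i),
      |h i j - kFun ξ (k i / w i j)| ≤ K[i] ^ (-1 / 2 + ε) * (k i / w i j) ^ γ)
    (hanti : ∀ᶠ i in F, ∀ j ∈ Icc 1 (k i), ∀ l ∈ Icc 1 (k i), j ≤ l → h i l ≤ h i j)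
    (hnonneg : ∀ᶠ i in F, ∀ j ∈ Icc 1 (k i), 0 ≤ h i j) :
    TailArray F k (fun i => Y[ξ, i]) ∧
      (∀ᶠ i in F, ∀ j ∈ Icc 1 (k i), exc ξ (k i) Y[ξ, i] j = h i j) ∧
      Tendsto (fun i => log (Y[ξ, i] 1 / w i 1)) F (𝓝 0) := by
  set p := γ - ξ
  have hp0 : 0 ≤ p := sub_nonneg.2 hγ
  have hY := fun {ε : ℝ} (hε : 0 < ε) => hu.log_tailPos hγ hγ2 herr hε
  set δ := (1 / 2 - p) / 2 with hδ
  have hδ0 : 0 < δ := by rw [hδ]; linarith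
  have hk1 : ∀ᶠ i in F, (1 : ℝ) ≤ k i := by
    filter_upwards [hu.tendsto_k.eventually_ge_atTop 1] with i hi using mod_cast hi
  have hw : ∀ᶠ i in F, ∀ j ∈ Icc 1 (k i), 0 < w i j := by
    filter_upwards [hu.abs_log_le one_pos] with i hi j hj
    exact (hi j (Finset.Icc_subset_Icc_right (Nat.le_succ _) hj)).1
  have hpos : ∀ᶠ i in F, ∀ j ∈ Icc 1 (k i), 0 < 1 + ξ * h i j := by
    filter_upwards [hY one_pos] with i hi j hj using (hi j hj).1
  have hy0 : ∀ᶠ i in F, ∀ j ∈ Icc 1 (k i), 0 < Y[ξ, i] j := by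
    filter_upwards [hpos, hk1] with i h1 h2 j hj; exact div_pos (by linarith) (kInv_pos (h1 j hj))
  -- uniform closeness of the positions to the uniform tail
  have hunif : ∀ᶠ i in F, ∀ j ∈ Icc 1 (k i),
      |log (Y[ξ, i] j / w i j)| ≤ K[i] ^ (-δ) := by
    filter_upwards [hY hδ0, hk1] with i h1 h2 j hj
    have hk0 : (0 : ℝ) < k i := by linarith
    have hj1 : (1 : ℝ) ≤ j := mod_cast (mem_Icc.1 hj).1
    refine (h1 j hj).2.trans ?_
    have hkj : (K[i] / j) ^ p ≤ K[i] ^ p :=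
      rpow_le_rpow (by positivity) (div_le_self hk0.le hj1) hp0
    refine (mul_le_mul_of_nonneg_left hkj (by positivity)).trans (le_of_eq ?_)
    rw [← rpow_add hk0]; congr 1; rw [hδ]; ring
  have hsplit : ∀ᶠ i in F, ∀ j ∈ Icc 1 (k i), |log (Y[ξ, i] j / j)|
      ≤ |log (Y[ξ, i] j / w i j)| + |log (w i j / j)| := by
    filter_upwards [hy0, hw] with i h1 h2 j hj
    have hj0 := cast_pos_of_mem hj
    have e : log (Y[ξ, i] j / j)
        = log (Y[ξ, i] j / w i j) + log (w i j / j) := by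
      rw [log_div (h1 j hj).ne' hj0.ne', log_div (h1 j hj).ne' (h2 j hj).ne',
        log_div (h2 j hj).ne' hj0.ne']
      ring
    rw [e]; exact abs_add_le _ _
  have hlog : ∀ ε > (0 : ℝ), ∀ᶠ i in F, ∀ j ∈ Icc 1 (k i),
      |log (Y[ξ, i] j / j)| ≤ ε * log (k i) := by
    intro ε hε
    have tk : Tendsto (fun i => log (k i)) F atTop :=
      tendsto_log_atTop.comp (tendsto_natCast_atTop_atTop.comp hu.tendsto_k)
    filter_upwards [hsplit, hunif, hu.abs_log_le (half_pos hε), hk1,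
      tk.eventually_ge_atTop (2 / ε)] with i h1 h2 h3 h4 h5 j hj
    have h6 := (h3 j (Finset.Icc_subset_Icc_right (Nat.le_succ _) hj)).2
    have h7 : K[i] ^ (-δ) ≤ 1 := rpow_le_one_of_one_le_of_nonpos h4 (by linarith)
    have h8 := (div_le_iff₀ hε).1 h5
    linarith [h1 j hj, h2 j hj]
  have hrpow : ∀ ε > (0 : ℝ), ∀ᶠ i in F, ∀ j ∈ Icc 1 (k i),
      K[i] ^ (-ε) * j ≤ Y[ξ, i] j ∧ Y[ξ, i] j ≤ K[i] ^ ε * j := by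
    intro ε hε
    filter_upwards [hlog ε hε, hy0, hk1] with i h1 h2 h3 j hj
    have hj0 := cast_pos_of_mem hj
    have hk0 : (0 : ℝ) < k i := by linarith
    have hq := div_pos (h2 j hj) hj0
    obtain ⟨a1, a2⟩ := abs_le.1 (h1 j hj)
    rw [← neg_mul, ← log_rpow hk0, log_le_log_iff (by positivity) hq, le_div_iff₀ hj0] at a1
    rw [← log_rpow hk0, log_le_log_iff hq (by positivity), div_le_iff₀ hj0] at a2
    exact ⟨a1, a2⟩
  refine ⟨⟨hu.tendsto_k, ?_, ?_, fun ε hε => (hrpow ε hε).mono fun i hi j hj => (hi j hj).1,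
    fun ε hε => (hrpow ε hε).mono fun i hi j hj => (hi j hj).2, ?_, ?_⟩, ?_, ?_⟩
  · filter_upwards [hpos, hanti, hk1] with i h1 h2 h3 j hj l hl hjl
    exact div_le_div_of_nonneg_left (by linarith) (kInv_pos (h1 l hl))
      (kInv_le_kInv (h1 l hl) (h1 j hj) (h2 j hj l hl hjl))
  · filter_upwards [hpos, hnonneg, hk1] with i h1 h2 h3 j hj
    exact div_le_self (by linarith) (one_le_kInv (h1 j hj) (h2 j hj))
  · intro ε hε
    set η := min ε δ / 4 with hη
    have hη0 : 0 < η := by rw [hη]; have := lt_min hε hδ0; linarith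
    have hηε : 4 * η ≤ ε := by rw [hη]; linarith [min_le_left ε δ]
    have hηδ : 4 * η ≤ δ := by rw [hη]; linarith [min_le_right ε δ]
    filter_upwards [hunif, hy0, hw, hk1, hu.upper hη0, hu.gap_ge η hη0,
      eventually_mul_rpow_le hu.tendsto_k (show -ε < -(2 * η) by linarith) 2,
      eventually_mul_rpow_le hu.tendsto_k (show -δ < -(2 * η) by linarith) 8,
      hu.tendsto_k.eventually_ge_atTop 2] with i h1 h2 h3 h4 h5 h6 h7 h8 h9
    have hk0 : (0 : ℝ) < k i := by linarith
    have m1 : 1 ∈ Icc 1 (k i) := mem_Icc.2 ⟨le_rfl, by omega⟩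
    have m2 : 2 ∈ Icc 1 (k i) := mem_Icc.2 ⟨by omega, h9⟩
    set y₁ := Y[ξ, i] 1
    set y₂ := Y[ξ, i] 2
    set t := K[i] ^ (-δ)
    set ρ := K[i] ^ (-(2 * η)) with hρ
    have hρ0 : 0 < ρ := rpow_pos_of_pos hk0 _
    have ht0 : 0 < t := rpow_pos_of_pos hk0 _
    have ht1 : ρ ≤ 1 := rpow_le_one_of_one_le_of_nonpos h4 (by linarith)
    have hy1p := h2 1 m1
    have hw1 := h3 1 m1
    have hw2 := h3 2 m2
    have f1 : w i 1 * (1 + ρ) ≤ w i 2 := by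
      have g1 := h5 1 (mem_Icc.2 ⟨le_rfl, by omega⟩)
      rw [Nat.cast_one, mul_one] at g1
      have g2 : K[i] ^ η * ρ = K[i] ^ (-η) := by rw [hρ, ← rpow_add hk0]; ring_nf
      nlinarith [mul_le_mul_of_nonneg_right g1 hρ0.le]
    have f2 : w i 2 * (1 - t) ≤ y₂ := by
      have g1 := (abs_le.1 (h1 2 m2)).1
      have g2 := add_one_le_exp (log (y₂ / w i 2))
      rw [exp_log (div_pos (h2 2 m2) hw2)] at g2
      have : 1 - t ≤ y₂ / w i 2 := by linarith
      rw [le_div_iff₀ hw2] at this; linarith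
    have f3 : y₁ * (1 - t) ≤ w i 1 := by
      have g1 := (abs_le.1 (h1 1 m1)).2
      have g2 := add_one_le_exp (-log (y₁ / w i 1))
      rw [exp_neg, exp_log (div_pos hy1p hw1), inv_div] at g2
      have : 1 - t ≤ w i 1 / y₁ := by linarith
      rw [le_div_iff₀ hy1p] at this; linarith
    have f4 : (1 : ℝ) + K[i] ^ (-ε) ≤ (1 + ρ) * (1 - t) * (1 - t) := by
      nlinarith [mul_pos hρ0 ht0, mul_pos ht0 ht0, mul_pos hρ0 (mul_pos ht0 ht0)]
    have f5 : 0 ≤ 1 - t := by linarith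
    calc (1 + K[i] ^ (-ε)) * y₁ ≤ (1 + ρ) * (1 - t) * (1 - t) * y₁ :=
          mul_le_mul_of_nonneg_right f4 hy1p.le
      _ = (1 + ρ) * (1 - t) * (y₁ * (1 - t)) := by ring
      _ ≤ (1 + ρ) * (1 - t) * w i 1 := mul_le_mul_of_nonneg_left f3 (by positivity)
      _ = (w i 1 * (1 + ρ)) * (1 - t) := by ring
      _ ≤ w i 2 * (1 - t) := mul_le_mul_of_nonneg_right f1 f5
      _ ≤ y₂ := f2
  · intro ε hε
    filter_upwards [hsplit, hY (half_pos hε), hu.near (half_pos hε), hk1,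
      eventually_mul_rpow_le hu.tendsto_k (half_lt_self hε) 2] with i h1 h2 h3 h4 h5 j hj
    have hk0 : (0 : ℝ) < k i := by linarith
    have hj' := mem_Icc.1 hj
    have hj0 : (0 : ℝ) < j := mod_cast hj'.1
    have hjk : (1 : ℝ) ≤ K[i] / j := by rw [le_div_iff₀ hj0, one_mul]; exact_mod_cast hj'.2
    have g1 := h3 j (mem_Icc.2 ⟨hj'.1, by omega⟩)
    have g2 : K[i] ^ (-1 / 2 + ε / 2) * (K[i] / j) ^ p
        ≤ K[i] ^ (ε / 2) * (j : ℝ) ^ (-1 / 2 : ℝ) := by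
      calc _ ≤ K[i] ^ (-1 / 2 + ε / 2) * (K[i] / j) ^ (1 / 2 : ℝ) :=
            mul_le_mul_of_nonneg_left (rpow_le_rpow_of_exponent_le hjk hγ2.le) (by positivity)
        _ = _ := by
            rw [div_rpow hk0.le hj0.le, neg_div, rpow_neg hj0.le, rpow_add hk0, rpow_neg hk0.le]
            field_simp
    have g3 : (0 : ℝ) ≤ (j : ℝ) ^ (-1 / 2 : ℝ) := by positivity
    nlinarith [h1 j hj, (h2 j hj).2]
  · filter_upwards [hpos, hk1] with i h1 h2 j hj
    have hk0 : K[i] ≠ 0 := by linarith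
    rw [exc, tailPos, div_div_cancel₀ hk0, kFun_kInv (h1 j hj)]
  · refine squeeze_zero_norm' ?_ (tendsto_rpow_neg_of_tendsto hu.tendsto_k (neg_lt_zero.2 hδ0))
    filter_upwards [hunif, hu.tendsto_k.eventually_ge_atTop 1] with i h1 h2
    exact h1 1 (mem_Icc.2 ⟨le_rfl, h2⟩)

end UniformTail

lemma abs_kFun_le {ξ x : ℝ} (hx : 0 < x) (h : |ξ * log x| ≤ 1) :
    |kFun ξ x| ≤ 2 * |log x| := by
  unfold kFun; split_ifs with h0
  · linarith [abs_nonneg (log x)]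
  · rw [abs_div, div_le_iff₀ (abs_pos.2 h0), rpow_def_of_pos hx, mul_comm (log x)]
    have := abs_exp_sub_one_le h
    rw [abs_mul] at this; linarith

set_option maxHeartbeats 800000 in
/-- The second-order condition gives a generalized Pareto profile of the exceedances, up to an error
of order `k ^ (-1/2)`, which is also the order of the fluctuations of the threshold. -/
lemma UniformTail.abs_exceed_sub_le {ι : Type*} {F : Filter ι} {k : ι → ℕ} {w h : ι → ℕ → ℝ}
    (hu : UniformTail F k w) {μ : Measure ℝ} [IsProbabilityMeasure μ] {a A : ℝ → ℝ} {ξ ρ δ : ℝ}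
    (hU : SecondOrder (tailQuantile μ) a A ξ ρ) (hρ : ρ ≤ 0) (hδ : 0 < δ) {t : ι → ℝ}
    (ht : Tendsto t F atTop) {C₁ : ℝ} (hA : ∀ᶠ i in F, |A (t i)| ≤ C₁ * (k i : ℝ) ^ (-1 / 2 : ℝ))
    (hh : ∀ᶠ i in F, ∀ j ∈ Icc 1 (k i), h i j = (tailQuantile μ (t i * (k i / w i j))
      - tailQuantile μ (t i * (k i / w i (k i + 1)))) / a (t i)) {ε : ℝ} (hε : 0 < ε) :
    ∀ᶠ i in F, ∀ j ∈ Icc 1 (k i), |h i j - kFun ξ (k i / w i j)|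
      ≤ (k i : ℝ) ^ (-1 / 2 + ε) * (k i / w i j) ^ (max ξ 0 + δ) := by
  obtain ⟨C, t₀, hC⟩ := hU.exists_bound hρ hδ
  set γ := max ξ 0 + δ with hγ
  have hγ0 : 0 < γ := by rw [hγ]; linarith [le_max_right ξ 0]
  set ε' := min ε (1 / 4) / 2 with hε'
  have hε0 : 0 < ε' := by rw [hε']; have := lt_min hε (show (0 : ℝ) < 1 / 4 by norm_num); linarith
  have hεε : ε' < ε := by rw [hε']; linarith [min_le_left ε (1 / 4)]
  have hε4 : ε' < 1 / 4 := by rw [hε']; linarith [min_le_right ε (1 / 4)]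
  set B := |C| * |C₁| with hB
  have hB0 : 0 ≤ B := by positivity
  filter_upwards [hh, hA, ht.eventually_ge_atTop t₀, hu.near hε0, hu.mono,
    hu.tendsto_k.eventually_ge_atTop 1, hu.abs_log_le one_pos,
    eventually_mul_rpow_le hu.tendsto_k (show -1 / 2 + ε' < -1 / 2 + ε by linarith)
      (B + (B * 2 ^ γ + 4) * 2 ^ γ),
    hu.abs_last_sub_le (one_half_pos (α := ℝ)),
    eventually_mul_rpow_le hu.tendsto_k (show -1 / 2 + ε' < 0 by linarith) (2 * |ξ|)]
    with i h1 h2 h3 h5 h6 h7 h8 h9 hw'b h11 j hj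
  have hk1 : (1 : ℝ) ≤ k i := mod_cast h7
  have hk0 : (0 : ℝ) < k i := by linarith
  have hj' := mem_Icc.1 hj
  have m1 : k i + 1 ∈ Icc 1 (k i + 1) := mem_Icc.2 ⟨by omega, le_rfl⟩
  have mj : j ∈ Icc 1 (k i + 1) := mem_Icc.2 ⟨hj'.1, by omega⟩
  have hw1 := (h8 _ m1).1
  have hwj := (h8 _ mj).1
  set K := (k i : ℝ) ^ (-1 / 2 : ℝ) with hK
  set D := (k i : ℝ) ^ (-1 / 2 + ε') with hD
  have hK0 : 0 < K := rpow_pos_of_pos hk0 _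
  have hKD : K ≤ D := rpow_le_rpow_of_exponent_le hk1 (by linarith)
  set w' := w i (k i + 1)
  -- the threshold lies within a factor two of its nominal position
  have hw'l := (abs_le.1 hw'b).1
  have hw'u := (abs_le.1 hw'b).2
  set x := (k i : ℝ) / w i j
  set x' := (k i : ℝ) / w' with hx'
  have hx'l : 1 / 2 ≤ x' := by rw [hx', le_div_iff₀ hw1]; linarith
  have hx'u : x' ≤ 2 := by rw [hx', div_le_iff₀ hw1]; linarith
  have hxl : 1 / 2 ≤ x := hx'l.trans
    (div_le_div_of_nonneg_left hk0.le hwj (h6 _ mj _ m1 (by omega)))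
  have hx'0 : 0 < x' := by linarith
  have hx0 : 0 < x := by linarith
  have hlogx' : |log x'| ≤ 2 * D := by
    have g1 := h5 _ m1
    have e : log x' = -(log (w' / (k i + 1 : ℕ)) + log (1 + 1 / (k i : ℝ))) := by
      rw [hx', log_div hk0.ne' hw1.ne', log_div hw1.ne' (by positivity),
        show (1 : ℝ) + 1 / k i = (k i + 1 : ℕ) / k i by push_cast; field_simp,
        log_div (by positivity) hk0.ne']
      ring
    have g2 : |log (1 + 1 / (k i : ℝ))| ≤ D := by
      have g0 : (1 : ℝ) ≤ 1 + 1 / k i := le_add_of_nonneg_right (by positivity)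
      rw [abs_of_nonneg (log_nonneg g0)]
      have g3 := log_le_sub_one_of_pos (show (0 : ℝ) < 1 + 1 / k i by positivity)
      have g4 : (1 : ℝ) / k i = (k i : ℝ) ^ (-1 : ℝ) := by rw [rpow_neg_one, one_div]
      have g5 : (k i : ℝ) ^ (-1 : ℝ) ≤ D := rpow_le_rpow_of_exponent_le hk1 (by linarith); linarith
    have g6 : (k i : ℝ) ^ ε' * ((k i + 1 : ℕ) : ℝ) ^ (-1 / 2 : ℝ) ≤ D := by
      have g7 : ((k i + 1 : ℕ) : ℝ) ^ (-1 / 2 : ℝ) ≤ K :=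
        rpow_le_rpow_of_nonpos hk0 (by push_cast; linarith) (by norm_num)
      have g8 : D = (k i : ℝ) ^ ε' * K := by rw [hD, hK, ← rpow_add hk0, add_comm]
      rw [g8]
      exact mul_le_mul_of_nonneg_left g7 (by positivity)
    rw [e, abs_neg]
    linarith [abs_add_le (log (w' / (k i + 1 : ℕ))) (log (1 + 1 / (k i : ℝ)))]
  have hkx' : |kFun ξ x'| ≤ 4 * D := by
    have : |ξ * log x'| ≤ 1 := by
      rw [rpow_zero] at h11
      rw [abs_mul]
      nlinarith [mul_le_mul_of_nonneg_left hlogx' (abs_nonneg ξ)]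
    linarith [abs_kFun_le hx'0 this]
  have hCA : C * |A (t i)| ≤ B * D := by
    calc C * |A (t i)| ≤ |C| * (|C₁| * K) := mul_le_mul (le_abs_self C)
          (h2.trans (mul_le_mul_of_nonneg_right (le_abs_self C₁) hK0.le)) (abs_nonneg _) (abs_nonneg _)
      _ = B * K := by rw [hB]; ring
      _ ≤ B * D := mul_le_mul_of_nonneg_left hKD hB0
  have e1 := (hC _ h3 x hxl).trans (mul_le_mul_of_nonneg_right hCA (by positivity))
  have e2 := (hC _ h3 x' hx'l).trans (mul_le_mul_of_nonneg_right hCA (by positivity))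
  have e3 : x' ^ γ ≤ 2 ^ γ := rpow_le_rpow hx'0.le hx'u hγ0.le
  have e4 : 1 ≤ 2 ^ γ * x ^ γ := by
    rw [← mul_rpow (by norm_num) hx0.le]; exact one_le_rpow (by linarith) hγ0.le
  have e5 : h i j - kFun ξ x = ((tailQuantile μ (t i * x) - tailQuantile μ (t i)) / a (t i) - kFun ξ x)
      - ((tailQuantile μ (t i * x') - tailQuantile μ (t i)) / a (t i) - kFun ξ x') - kFun ξ x' := by
    rw [h1 j hj]; ring
  have hxγ : 0 < x ^ γ := by positivity
  have e6 : |h i j - kFun ξ x| ≤ B * D * x ^ γ + B * D * x' ^ γ + 4 * D := by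
    have f1 := abs_le.1 e1
    have f2 := abs_le.1 e2
    have f3 := abs_le.1 hkx'
    rw [e5]
    exact abs_le.2 ⟨by linarith, by linarith⟩
  refine e6.trans ?_
  have e7 : B * D * x' ^ γ + 4 * D ≤ (B * 2 ^ γ + 4) * D * (2 ^ γ * x ^ γ) := by
    have : B * D * x' ^ γ ≤ B * D * 2 ^ γ := mul_le_mul_of_nonneg_left e3 (by positivity)
    have : 0 ≤ (B * 2 ^ γ + 4) * D := by positivity
    nlinarith
  calc _ ≤ ((B + (B * 2 ^ γ + 4) * 2 ^ γ) * D) * x ^ γ := by linarith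
    _ ≤ _ := mul_le_mul_of_nonneg_right h9 hxγ.le

variable {μ : Measure ℝ} [IsProbabilityMeasure μ] {a A : ℝ → ℝ} {ξ ρ l : ℝ} {k : ℕ → ℕ} {T : ℕ → ℝ}

/-! ### Samples from the parent distribution -/

/-- The sample with law `μ` obtained from a uniform sample by the quantile transform. -/
def qSample (μ : Measure ℝ) {n : ℕ} (v : Fin n → ℝ) : Fin n → ℝ :=
  fun l => quantile μ (1 - v l)

lemma orderStat_qSample (μ : Measure ℝ) [IsProbabilityMeasure μ] {n : ℕ} {v : Fin n → ℝ}
    (hv : ∀ l, v l ∈ Ioo (0 : ℝ) 1) {j : ℕ} (h1 : 1 ≤ j) (h2 : j ≤ n) :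
    orderStat (qSample μ v) (n - j + 1) = quantile μ (1 - orderStat v j) :=
  orderStat_comp_antitoneOn (f := fun u => quantile μ (1 - u)) (s := Ioo 0 1)
    (fun u hu w hw huw => quantile_mono μ (by linarith [hw.2]) (by linarith) (by linarith [hu.1]))
    hv h1 h2

lemma eventually_succ_le
    (hkn : Tendsto (fun n : ℕ => (k n : ℝ) / n) atTop (𝓝 0)) : ∀ᶠ n in atTop, k n + 1 ≤ n := by
  filter_upwards [hkn.eventually_lt_const one_pos, eventually_ge_atTop 1] with n h1 h2
  have hn : (0 : ℝ) < n := mod_cast h2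
  rw [div_lt_one hn] at h1
  exact_mod_cast h1

lemma tendsto_div_atTop (hk : Tendsto k atTop atTop)
    (hkn : Tendsto (fun n : ℕ => (k n : ℝ) / n) atTop (𝓝 0)) :
    Tendsto (fun n : ℕ => (n : ℝ) / k n) atTop atTop := by
  have h : Tendsto (fun n : ℕ => (k n : ℝ) / n) atTop (𝓝[>] 0) := by
    refine tendsto_nhdsWithin_iff.2 ⟨hkn, ?_⟩
    filter_upwards [hk.eventually_ge_atTop 1, eventually_ge_atTop 1] with n h1 h2
    have h3 : (0 : ℝ) < k n := mod_cast h1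
    have h4 : (0 : ℝ) < n := mod_cast h2
    exact div_pos h3 h4
  refine h.inv_tendsto_nhdsGT_zero.congr fun n => ?_; simp

/-- The rate of the second-order function along the intermediate sequence. -/
lemma exists_abs_le_of_tendsto_sqrt_mul (hk : Tendsto k atTop atTop) {B : ℕ → ℝ}
    (hA : Tendsto (fun n : ℕ => sqrt (k n : ℝ) * B n) atTop (𝓝 l)) :
    ∃ C, ∀ᶠ n in atTop, |B n| ≤ C * (k n : ℝ) ^ (-1 / 2 : ℝ) := by
  refine ⟨|l| + 1, ?_⟩
  filter_upwards [hA.abs.eventually_le_const (lt_add_one |l|), hk.eventually_ge_atTop 1] with n h1 h2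
  have hk0 : (0 : ℝ) < k n := mod_cast h2
  rw [abs_mul, abs_of_pos (sqrt_pos.2 hk0), sqrt_eq_rpow] at h1
  have hp := rpow_pos_of_pos hk0 (1 / 2)
  rw [neg_div, rpow_neg hk0.le, ← div_eq_mul_inv, le_div_iff₀ hp]; linarith

lemma exceed_nonneg {n k j : ℕ} (x : Fin n → ℝ) (hj : j ∈ Icc 1 k) (hk : k + 1 ≤ n) :
    0 ≤ exceed x k j := by
  have := mem_Icc.1 hj; exact sub_nonneg.2 (orderStat_mono x (by omega) (by omega) (by omega))

lemma exceed_antitone {n k j l : ℕ} (x : Fin n → ℝ) (hj : j ∈ Icc 1 k)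
    (hjl : j ≤ l) (hk : k + 1 ≤ n) : exceed x k l ≤ exceed x k j := by
  have := mem_Icc.1 hj
  exact sub_le_sub_right (orderStat_mono x (by omega) (by omega) (by omega)) _

/-- The exceedances of a sample from the parent distribution, in the scale `a (n / k)`, are with
probability tending to one those of a tail array whose first entry is asymptotic to `n` times the
smallest of the underlying uniform variables. -/
theorem tailArray_qSample
    (hξ : -1 / 2 < ξ) (hρ : ρ ≤ 0) (hU : SecondOrder (tailQuantile μ) a A ξ ρ)
    (hk : Tendsto k atTop atTop)
    (hkn : Tendsto (fun n : ℕ => (k n : ℝ) / n) atTop (𝓝 0))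
    (hA : Tendsto (fun n : ℕ => sqrt (k n) * A (n / k n)) atTop (𝓝 l)) :
    let h : Sample → ℕ → ℝ := fun i =>
      sExceed (qSample μ i.2) (k i.1) (a (i.1 / k i.1))
    TailArray (inProb unifPi) (fun i => k i.1) (fun i => tailPos ξ (k i.1) (h i)) ∧
      (∀ᶠ i in inProb unifPi, ∀ j ∈ Icc 1 (k i.1),
        exc ξ (k i.1) (tailPos ξ (k i.1) (h i)) j = h i j) ∧
      Tendsto (fun i => log (tailPos ξ (k i.1) (h i) 1 / (i.1 * orderStat i.2 1)))
        (inProb unifPi) (𝓝 0) := by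
  intro h
  have hsucc := eventually_succ_le hkn
  have hu := uniformTail_unifPi hk hsucc
  have ht := tendsto_div_atTop hk hkn
  obtain ⟨C₁, hC₁⟩ := exists_abs_le_of_tendsto_sqrt_mul hk hA
  have hfst : Tendsto (fun i : Sample => i.1) (inProb unifPi) atTop := tendsto_fst_inProb
  set δ := (1 / 2 - max 0 (-ξ)) / 2 with hδ
  have hmax : max 0 (-ξ) < 1 / 2 := max_lt (by norm_num) (by linarith)
  have hδ0 : 0 < δ := by rw [hδ]; linarith
  have hmm : max ξ 0 - ξ = max 0 (-ξ) := by
    rcases le_total ξ 0 with hle | hle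
    · rw [max_eq_right hle, max_eq_right (by linarith)]; ring
    · rw [max_eq_left hle, max_eq_left (by linarith)]; ring
  have hok : ∀ᶠ i : Sample in inProb unifPi, k i.1 + 1 ≤ i.1 ∧ 1 ≤ k i.1 ∧
      0 < a ((i.1 : ℝ) / k i.1) :=
    hfst.eventually (hsucc.and ((hk.eventually_ge_atTop 1).and (ht.eventually hU.pos_a)))
  refine hu.tailArray (γ := max ξ 0 + δ) (by linarith [le_max_left ξ 0]) (by linarith)
    (fun ε hε => hu.abs_exceed_sub_le hU hρ hδ0 (ht.comp hfst) (hfst.eventually hC₁) ?_ hε) ?_ ?_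
  · have hae : ∀ᶠ i : Sample in inProb unifPi, ∀ l, i.2 l ∈ Ioo (0 : ℝ) 1 :=
      eventually_inProb_of_ae ae_unifPi
    filter_upwards [hok, hae] with i ⟨h1, h2, _⟩ h3 j hj
    have hj' := mem_Icc.1 hj
    have hn0 : (0 : ℝ) < i.1 := mod_cast (by omega : 0 < i.1)
    have key : ∀ m, 1 ≤ m → m ≤ i.1 → tailQuantile μ (((fun n : ℕ => (n : ℝ) / k n) ∘ fun i => i.1) i
        * (k i.1 / (i.1 * orderStat i.2 m))) = orderStat (qSample μ i.2) (i.1 - m + 1) := by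
      intro m hm1 hm2
      have hv0 := (orderStat_mem_of_forall h3 hm1 hm2).1
      rw [orderStat_qSample μ h3 hm1 hm2, tailQuantile]
      congr 2
      simp only [Function.comp_apply]; field_simp
    rw [key j hj'.1 (by omega), key (k i.1 + 1) (by omega) h1,
      show i.1 - (k i.1 + 1) + 1 = i.1 - k i.1 by omega]
    rfl
  · filter_upwards [hok] with i ⟨h1, _, h2⟩ j hj m hm hjm
    exact div_le_div_of_nonneg_right (exceed_antitone _ hj hjm h1) h2.le
  · filter_upwards [hok] with i ⟨h1, _, h2⟩ j hj; exact div_nonneg (exceed_nonneg _ hj h1) h2.le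

/-! ### Convergence in law to the exponential distribution -/

lemma quantile_exp_one_sub {u : ℝ} (hu : u ∈ Ioo (0 : ℝ) 1) :
    quantile (expMeasure 1) (1 - u) = -log u := by
  have : IsProbabilityMeasure (expMeasure 1) := isProbabilityMeasure_expMeasure one_pos
  have hlog : 0 < -log u := neg_pos.2 (log_neg hu.1 hu.2)
  have key : ∀ y, quantile (expMeasure 1) (1 - u) ≤ y ↔ -log u ≤ y := by
    intro y
    rw [quantile_le_iff _ (by linarith [hu.2]) (by linarith [hu.1]), cdf_expMeasure_eq one_pos]
    split_ifs with hy
    · rw [one_mul, neg_le, le_log_iff_exp_le hu.1]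
      constructor <;> intro h <;> linarith
    · constructor <;> intro h
      · linarith [hu.2]
      · linarith
  exact le_antisymm ((key _).2 le_rfl) ((key _).1 le_rfl)

/-- The quantile coupling: convergence of distribution functions to the exponential one gives the
representation `E (1 + o_p(1))`. -/
lemma eqInLawExpOneAddSmall_of_tendsto {Ω : ℕ → Type*} [∀ n, MeasurableSpace (Ω n)]
    {P : ∀ n, Measure (Ω n)} [∀ n, IsProbabilityMeasure (P n)] {Z : ∀ n, Ω n → ℝ}
    (hZ : ∀ n, Measurable (Z n))
    (h : ∀ x : ℝ, 0 < x → Tendsto (fun n => (P n).real {ω | Z n ω ≤ x}) atTop (𝓝 (1 - exp (-x)))) :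
    EqInLawExpOneAddSmall P Z := by
  have hprob : ∀ n, IsProbabilityMeasure ((P n).map (Z n)) := fun n =>
    Measure.isProbabilityMeasure_map (hZ n).aemeasurable
  have : IsProbabilityMeasure (expMeasure 1) := isProbabilityMeasure_expMeasure one_pos
  set E : ℝ → ℝ := fun u => quantile (expMeasure 1) (1 - u)
  set V : ℕ → ℝ → ℝ := fun n u => quantile ((P n).map (Z n)) (1 - u) with hV
  have hEm : AEMeasurable E unif := measurable_quantile_one_sub _
  have hVm : ∀ n, AEMeasurable (V n) unif := fun n => measurable_quantile_one_sub _
  have hpair : ∀ n, AEMeasurable (fun u => (E u, V n u / E u - 1)) unif := fun n =>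
    hEm.prodMk (((hVm n).div hEm).sub_const 1)
  have hcdf : ∀ n x, cdf ((P n).map (Z n)) x = (P n).real {ω | Z n ω ≤ x} := fun n x => by
    rw [cdf_eq_real, Measure.real, Measure.map_apply (hZ n) measurableSet_Iic]; rfl
  have hlim : ∀ u ∈ Ioo (0 : ℝ) 1, Tendsto (fun n => V n u / E u - 1) atTop (𝓝 0) := by
    intro u hu
    have hlog : 0 < -log u := neg_pos.2 (log_neg hu.1 hu.2)
    have hEu : E u = -log u := quantile_exp_one_sub hu
    have hq : ∀ n y, V n u ≤ y ↔ 1 - u ≤ (P n).real {ω | Z n ω ≤ y} := fun n y => by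
      rw [hV, ← hcdf]; exact quantile_le_iff _ (by linarith [hu.2]) (by linarith [hu.1]) y
    have hVt : Tendsto (fun n => V n u) atTop (𝓝 (E u)) := by
      rw [hEu]
      refine tendsto_order.2 ⟨fun y hy => ?_, fun y hy => ?_⟩
      · have hy' : max y (-log u / 2) < -log u := max_lt hy (by linarith)
        have hm0 : 0 < max y (-log u / 2) := lt_max_of_lt_right (by linarith)
        have h1 : 1 - exp (-max y (-log u / 2)) < 1 - u := by
          have := exp_lt_exp.2 (show log u < -max y (-log u / 2) by linarith)
          rw [exp_log hu.1] at this; linarith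
        filter_upwards [(h _ hm0).eventually_lt_const h1] with n hn
        refine (le_max_left _ (-log u / 2)).trans_lt (not_le.1 fun hcon => ?_)
        exact absurd ((hq n _).1 hcon) (not_le.2 hn)
      · set z := (-log u + y) / 2 with hz
        have hz0 : 0 < z := by rw [hz]; linarith
        have h1 : 1 - u < 1 - exp (-z) := by
          have := exp_lt_exp.2 (show -z < log u by rw [hz]; linarith)
          rw [exp_log hu.1] at this; linarith
        filter_upwards [(h z hz0).eventually_const_lt h1] with n hn
        exact ((hq n z).2 hn.le).trans_lt (by rw [hz]; linarith)
    have h2 := (hVt.div_const (E u)).sub_const 1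
    rwa [div_self (by rw [hEu]; exact hlog.ne'), sub_self] at h2
  refine ⟨fun n => unif.map fun u => (E u, V n u / E u - 1), fun n =>
    Measure.isProbabilityMeasure_map (hpair n), fun n => ?_, fun n => ?_, ?_⟩
  · rw [AEMeasurable.map_map_of_aemeasurable measurable_fst.aemeasurable (hpair n)]
    exact map_quantile_unif (expMeasure 1)
  · rw [AEMeasurable.map_map_of_aemeasurable (by fun_prop) (hpair n),
      ← map_quantile_unif ((P n).map (Z n))]
    refine Measure.map_congr ?_
    filter_upwards [ae_unif] with u hu
    have hlog : 0 < -log u := neg_pos.2 (log_neg hu.1 hu.2)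
    have hEu : E u ≠ 0 := by rw [show E u = -log u from quantile_exp_one_sub hu]; exact hlog.ne'
    simp only [Function.comp_apply, add_sub_cancel]
    rw [mul_div_cancel₀ _ hEu]
  · have hmeas := tendstoInMeasure_of_tendsto_ae (μ := unif) (f := fun n u => V n u / E u - 1)
      (g := fun _ => (0 : ℝ)) (fun n => (((hVm n).div hEm).sub_const 1).aestronglyMeasurable) (by
        filter_upwards [ae_unif] with u hu using hlim u hu)
    rw [tendstoInMeasure_iff_norm] at hmeas
    intro ε hε
    refine (hmeas ε hε).congr fun n => ?_
    rw [Measure.map_apply_of_aemeasurable (hpair n)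
      (measurableSet_le measurable_const measurable_snd.abs)]
    simp only [sub_zero, norm_eq_abs]; rfl

/-- Slutsky's lemma for an exponential limit, in multiplicative form. -/
lemma tendsto_real_le_of_log_div {Ω : ℕ → Type*} [∀ n, MeasurableSpace (Ω n)]
    {P : ∀ n, Measure (Ω n)} [∀ n, IsProbabilityMeasure (P n)] {Z W : ∀ n, Ω n → ℝ}
    (hpos : ∀ᶠ i : Σ n, Ω n in inProb P, 0 < Z i.1 i.2 ∧ 0 < W i.1 i.2)
    (hlog : Tendsto (fun i : Σ n, Ω n => log (Z i.1 i.2 / W i.1 i.2)) (inProb P) (𝓝 0))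
    (hW : ∀ x : ℝ, 0 < x → Tendsto (fun n => (P n).real {ω | W n ω ≤ x}) atTop (𝓝 (1 - exp (-x))))
    {x : ℝ} (hx : 0 < x) :
    Tendsto (fun n => (P n).real {ω | Z n ω ≤ x}) atTop (𝓝 (1 - exp (-x))) := by
  have hcont : Tendsto (fun η : ℝ => 1 - exp (-(x * exp η))) (𝓝 0) (𝓝 (1 - exp (-x))) := by
    have : Continuous fun η : ℝ => 1 - exp (-(x * exp η)) := by fun_prop
    simpa using this.tendsto 0
  have hcompare : ∀ η > (0 : ℝ), Tendsto (fun n => (P n).real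
      {ω | ¬ ((0 < Z n ω ∧ 0 < W n ω) ∧ |log (Z n ω / W n ω)| ≤ η)}) atTop (𝓝 0) := by
    intro η hη
    have h1 : ∀ᶠ i : Σ n, Ω n in inProb P, |log (Z i.1 i.2 / W i.1 i.2)| ≤ η := by
      filter_upwards [Metric.tendsto_nhds.1 hlog η hη] with i hi; simpa using hi.le
    have h2 := eventually_inProb_iff.1 (hpos.and h1)
    exact (ENNReal.tendsto_toReal_zero_iff fun n => measure_ne_top _ _).2 h2
  refine tendsto_order.2 ⟨fun y hy => ?_, fun y hy => ?_⟩
  · obtain ⟨r, hr, hball⟩ := Metric.eventually_nhds_iff.1 (hcont.eventually_const_lt hy)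
    have hη : 0 < r / 2 := half_pos hr
    have h1 := hball (y := -(r / 2)) (by rw [dist_eq, sub_zero, abs_neg, abs_of_pos hη]; linarith)
    have h2 := (hW (x * exp (-(r / 2))) (by positivity)).sub (hcompare _ hη)
    rw [sub_zero] at h2
    filter_upwards [h2.eventually_const_lt h1] with n hn
    refine hn.trans_le ?_
    rw [sub_le_iff_le_add]
    refine (measureReal_mono fun ω hω => ?_).trans (measureReal_union_le _ _)
    by_cases hg : (0 < Z n ω ∧ 0 < W n ω) ∧ |log (Z n ω / W n ω)| ≤ r / 2
    · left
      have h3 : Z n ω ≤ W n ω * exp (r / 2) := by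
        rw [← div_le_iff₀' hg.1.2, ← log_le_iff_le_exp (div_pos hg.1.1 hg.1.2)]
        exact (abs_le.1 hg.2).2
      have h4 : W n ω ≤ x * exp (-(r / 2)) := hω
      show Z n ω ≤ x
      calc Z n ω ≤ x * exp (-(r / 2)) * exp (r / 2) :=
            h3.trans (mul_le_mul_of_nonneg_right h4 (exp_pos _).le)
        _ = x := by rw [mul_assoc, ← exp_add]; simp
    · right; exact hg
  · obtain ⟨r, hr, hball⟩ := Metric.eventually_nhds_iff.1 (hcont.eventually_lt_const hy)
    have hη : 0 < r / 2 := half_pos hr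
    have h1 := hball (y := r / 2) (by rw [dist_eq, sub_zero, abs_of_pos hη]; linarith)
    have h2 := (hW (x * exp (r / 2)) (by positivity)).add (hcompare _ hη)
    rw [add_zero] at h2
    filter_upwards [h2.eventually_lt_const h1] with n hn
    refine lt_of_le_of_lt ?_ hn
    refine (measureReal_mono fun ω hω => ?_).trans (measureReal_union_le _ _)
    by_cases hg : (0 < Z n ω ∧ 0 < W n ω) ∧ |log (Z n ω / W n ω)| ≤ r / 2
    · left
      have h3 : W n ω * exp (-(r / 2)) ≤ Z n ω := by
        rw [← le_div_iff₀' hg.1.2, ← le_log_iff_exp_le (div_pos hg.1.1 hg.1.2)]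
        exact (abs_le.1 hg.2).1
      have h4 : Z n ω ≤ x := hω
      show W n ω ≤ x * exp (r / 2)
      calc W n ω = W n ω * exp (-(r / 2)) * exp (r / 2) := by rw [mul_assoc, ← exp_add]; simp
        _ ≤ x * exp (r / 2) := mul_le_mul_of_nonneg_right (h3.trans h4) (exp_pos _).le
    · right; exact hg

/-! ### Light truncation -/

/-- The law of `n` independent uniform variables conditioned on the event that the quantile
transform of each of them is at most `T`. -/
def truncUnifPi (μ : Measure ℝ) (T : ℝ) (n : ℕ) : Measure (Fin n → ℝ) :=
  Measure.pi fun _ => cond unif (Ici (1 - cdf μ T))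

section Truncation

variable (μ : Measure ℝ) [IsProbabilityMeasure μ] {T : ℝ}

lemma preimage_quantile_ae_eq (T : ℝ) :
    (fun v => quantile μ (1 - v)) ⁻¹' Iic T =ᵐ[unif] Ici (1 - cdf μ T) := by
  filter_upwards [ae_unif] with v hv
  refine propext ?_
  show quantile μ (1 - v) ≤ T ↔ 1 - cdf μ T ≤ v
  rw [quantile_le_iff μ (by linarith [hv.2]) (by linarith [hv.1])]
  constructor <;> intro h <;> linarith

lemma unif_Ici_eq (T : ℝ) : unif (Ici (1 - cdf μ T)) = μ (Iic T) := by
  conv_rhs => rw [← map_quantile_unif μ]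
  rw [Measure.map_apply_of_aemeasurable (measurable_quantile_one_sub μ) measurableSet_Iic]
  exact (measure_congr (preimage_quantile_ae_eq μ T)).symm

lemma measure_Iic_eq (T : ℝ) : μ (Iic T) = ofReal (cdf μ T) := (ofReal_cdf μ T).symm

lemma isProbabilityMeasure_cond_unif (hT : 0 < cdf μ T) :
    IsProbabilityMeasure (cond unif (Ici (1 - cdf μ T))) := by
  refine cond_isProbabilityMeasure ?_; rw [unif_Ici_eq, measure_Iic_eq]; simpa using hT

lemma isProbabilityMeasure_truncUnifPi (hT : 0 < cdf μ T) (n : ℕ) :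
    IsProbabilityMeasure (truncUnifPi μ T n) := by
  have := isProbabilityMeasure_cond_unif μ hT
  unfold truncUnifPi; infer_instance

lemma map_quantile_cond_unif :
    (cond unif (Ici (1 - cdf μ T))).map (fun v => quantile μ (1 - v)) = truncLaw μ T := by
  have hm := measurable_quantile_one_sub μ
  rw [ProbabilityTheory.cond, truncLaw, ProbabilityTheory.cond, Measure.map_smul, unif_Ici_eq,
    ← Measure.restrict_congr_set (preimage_quantile_ae_eq μ T),
    ← Measure.restrict_map_of_aemeasurable hm measurableSet_Iic, map_quantile_unif]

lemma aemeasurable_qSample (n : ℕ) :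
    AEMeasurable (qSample μ) (truncUnifPi μ T n) := by
  refine aemeasurable_pi_lambda _ fun l => ?_
  exact ((measurable_quantile_one_sub μ).mono_ac cond_absolutelyContinuous).comp_quasiMeasurePreserving
    (Measure.quasiMeasurePreserving_eval _ l)

lemma map_qSample_truncUnifPi (n : ℕ) :
    (truncUnifPi μ T n).map (qSample μ) = Measure.pi fun _ : Fin n => truncLaw μ T := by
  have h := Measure.pi_map_pi (μ := fun _ : Fin n => cond unif (Ici (1 - cdf μ T)))
    (f := fun _ v => quantile μ (1 - v))
    (fun _ => (measurable_quantile_one_sub μ).mono_ac cond_absolutelyContinuous)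
  simp only [map_quantile_cond_unif] at h; exact h

/-- Conditioning `n` variables on events of probability `F_Y(T)` multiplies the density by at most
`F_Y(T) ^ (-n) = (1 + D_T) ^ n`. -/
lemma truncUnifPi_le (hT : 0 < cdf μ T) (n : ℕ) :
    truncUnifPi μ T n ≤ ofReal ((1 + truncOdds μ T) ^ n) • unifPi n := by
  set S := Ici (1 - cdf μ T) with hS
  have hc : (unif S)⁻¹ = ofReal (1 + truncOdds μ T) := by
    rw [hS, unif_Ici_eq, measure_Iic_eq, ← ENNReal.ofReal_inv_of_pos hT, truncOdds]
    congr 1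
    field_simp; ring
  have h1 : truncUnifPi μ T n
      = ofReal ((1 + truncOdds μ T) ^ n) • (unifPi n).restrict (Set.univ.pi fun _ => S) := by
    refine Measure.pi_eq fun s hs => ?_
    rw [Measure.smul_apply, Measure.restrict_apply (MeasurableSet.univ_pi hs), ← Set.pi_inter_distrib,
      unifPi, Measure.pi_pi]
    simp only [ProbabilityTheory.cond, Measure.smul_apply, smul_eq_mul, ← hS, hc]
    rw [Finset.prod_mul_distrib, Finset.prod_const, Finset.card_univ, Fintype.card_fin,
      ENNReal.ofReal_pow (by
        have := cdf_le_one μ T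
        have : 0 ≤ truncOdds μ T := div_nonneg (by linarith) hT.le; linarith)]
    congr 1
    exact Finset.prod_congr rfl fun i _ => (Measure.restrict_apply (hs i)).symm
  rw [h1]
  intro s
  exact mul_le_mul_right (Measure.restrict_le_self s) _

end Truncation

lemma tendsto_ofReal_pow (μ : Measure ℝ) (hT : ∀ n, 0 < cdf μ (T n))
    (hD : Tendsto (fun n : ℕ => n * truncOdds μ (T n)) atTop (𝓝 0)) :
    Tendsto (fun n => ofReal ((1 + truncOdds μ (T n)) ^ n)) atTop (𝓝 1) := by
  have h0 : ∀ n, 0 ≤ truncOdds μ (T n) := fun n =>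
    div_nonneg (by linarith [cdf_le_one μ (T n)]) (hT n).le
  have h1 : Tendsto (fun n : ℕ => exp (n * truncOdds μ (T n))) atTop (𝓝 1) := by
    simpa [Function.comp_def] using (continuous_exp.tendsto 0).comp hD
  have h2 : Tendsto (fun n : ℕ => (1 + truncOdds μ (T n)) ^ n) atTop (𝓝 1) := by
    refine tendsto_of_tendsto_of_tendsto_of_le_of_le tendsto_const_nhds h1
      (fun n => one_le_pow₀ (by linarith [h0 n])) fun n => ?_
    show (1 + truncOdds μ (T n)) ^ n ≤ exp (n * truncOdds μ (T n))
    rw [exp_nat_mul]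
    exact pow_le_pow_left₀ (by linarith [h0 n]) (by linarith [add_one_le_exp (truncOdds μ (T n))]) n
  simpa using ENNReal.tendsto_ofReal h2

/-- Limits of probabilities under the uniform law carry over to a law dominated up to constants
tending to one. -/
lemma tendsto_real_of_le {Ω : ℕ → Type*} [∀ n, MeasurableSpace (Ω n)] {P Q : ∀ n, Measure (Ω n)}
    [∀ n, IsProbabilityMeasure (P n)] [∀ n, IsProbabilityMeasure (Q n)] {c : ℕ → ENNReal}
    (hc : Tendsto c atTop (𝓝 1)) (h : ∀ n, P n ≤ c n • Q n) {S : ∀ n, Set (Ω n)}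
    (hS : ∀ n, MeasurableSet (S n)) {p : ℝ} (hp : Tendsto (fun n => (Q n).real (S n)) atTop (𝓝 p)) :
    Tendsto (fun n => (P n).real (S n)) atTop (𝓝 p) := by
  have hcr : Tendsto (fun n => (c n).toReal) atTop (𝓝 1) := by
    simpa [Function.comp_def] using (ENNReal.tendsto_toReal ENNReal.one_ne_top).comp hc
  have hle : ∀ᶠ n in atTop, ∀ R : Set (Ω n), (P n).real R ≤ (c n).toReal * (Q n).real R := by
    filter_upwards [hc.eventually_lt_const ENNReal.one_lt_two] with n hn R
    have h1 := ENNReal.toReal_mono (by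
      rw [Measure.smul_apply, smul_eq_mul]
      exact ENNReal.mul_ne_top (hn.trans ENNReal.ofNat_lt_top).ne (measure_ne_top _ _)) (h n R)
    rwa [Measure.smul_apply, smul_eq_mul, ENNReal.toReal_mul] at h1
  have hup := hcr.mul hp
  have hlow := (hcr.mul (hp.const_sub 1)).const_sub 1
  rw [one_mul] at hup hlow
  rw [sub_sub_cancel] at hlow
  refine tendsto_of_tendsto_of_tendsto_of_le_of_le' hlow hup ?_ (hle.mono fun n hn => hn _)
  filter_upwards [hle] with n hn
  have h1 := hn (S n)ᶜ
  rw [probReal_compl_eq_one_sub (hS n), probReal_compl_eq_one_sub (hS n)] at h1; linarith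

/-- The smallest of `n` uniform variables, multiplied by `n`, is asymptotically exponential. -/
lemma tendsto_unifPi_orderStat_one {x : ℝ} (hx : 0 < x) :
    Tendsto (fun n => (unifPi n).real {v | n * orderStat v 1 ≤ x}) atTop (𝓝 (1 - exp (-x))) := by
  have h1 := (tendsto_one_add_div_pow_exp (-x)).const_sub 1
  refine h1.congr' ?_
  filter_upwards [eventually_ge_atTop 1, tendsto_natCast_atTop_atTop.eventually_ge_atTop x] with n hn hxn
  have hm : MeasurableSet {v : Fin n → ℝ | x < n * orderStat v 1} :=
    measurableSet_lt measurable_const ((measurable_orderStat 1).const_mul _)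
  have h2 := probReal_compl_eq_one_sub (μ := unifPi n) hm
  rw [unifPi_orderStat_one_gt hn hx.le hxn] at h2
  rw [neg_div, ← sub_eq_add_neg, ← h2]
  congr 1
  ext v; simp

lemma ScaledRoot.congr {k : ℕ} {h h' : ℕ → ℝ} {θ σ : ℝ} (hk : 1 ≤ k)
    (heq : ∀ j ∈ Icc 1 k, h j = h' j) (hr : ScaledRoot k h θ σ) : ScaledRoot k h' θ σ := by
  have h1 := heq 1 (mem_Icc.2 ⟨le_rfl, hk⟩)
  have hlog : avgLog k h' θ = avgLog k h θ := avg_congr fun j hj => by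
    rw [heq j (mem_Icc_one hj)]
  have hinv : avgInv k h' θ = avgInv k h θ := avg_congr fun j hj => by
    rw [heq j (mem_Icc_one hj)]
  exact ⟨hr.ne_zero, hr.scale_pos, h1 ▸ hr.arg_pos, by rw [hlog, ← h1]; exact hr.eq_log,
    by rw [hinv, ← h1]; exact hr.eq_inv⟩

/-! ### The limit law of the test statistic -/

/-- Being a sequence of pseudo maximum likelihood estimators depends on the samples only through
their laws. -/
lemma IsPseudoMLE.of_law {Ω Ω' : ℕ → Type*} [∀ n, MeasurableSpace (Ω n)]
    [∀ n, MeasurableSpace (Ω' n)] {P : ∀ n, Measure (Ω n)} {P' : ∀ n, Measure (Ω' n)}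
    {X : ∀ n, Ω n → Fin n → ℝ} {X' : ∀ n, Ω' n → Fin n → ℝ}
    (hlaw : ∀ n, ∀ B : Set (Fin n → ℝ), MeasurableSet B → P n {ω | X n ω ∈ B} = P' n {ω | X' n ω ∈ B})
    {a : ℝ → ℝ} {ξ : ℝ} {ξh τh : ∀ n, (Fin n → ℝ) → ℝ}
    (h : IsPseudoMLE P X k a ξ ξh τh) : IsPseudoMLE P' X' k a ξ ξh τh := by
  have hsmall : ∀ {g : ∀ n, (Fin n → ℝ) → ℝ}, (∀ n, Measurable (g n)) →
      SmallInProb P (fun n ω => g n (X n ω)) → SmallInProb P' (fun n ω => g n (X' n ω)) := by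
    intro g hg hs ε hε
    exact (hs ε hε).congr fun n =>
      hlaw n {x | ε ≤ |g n x|} (measurableSet_le measurable_const (hg n).abs)
  exact ⟨h.measurable_xi, h.measurable_tau, h.root.congr fun n => hlaw n _
      (measurableSet_isLikelihoodRoot (k n) (h.measurable_xi n) (h.measurable_tau n)),
    hsmall (g := fun n x => ξh n x - ξ) (fun n => (h.measurable_xi n).sub_const ξ) h.consistent_xi,
    hsmall (g := fun n x => ξh n x / τh n x / a ((n : ℝ) / k n) - 1)
      (fun n => (((h.measurable_xi n).div (h.measurable_tau n)).div_const _).sub_const 1)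
      h.consistent_sigma⟩

lemma eventually_root_of_isPseudoMLE {Ω : ℕ → Type*} [∀ n, MeasurableSpace (Ω n)]
    {P : ∀ n, Measure (Ω n)} [∀ n, IsProbabilityMeasure (P n)] {X : ∀ n, Ω n → Fin n → ℝ}
    (hX : ∀ n, AEMeasurable (X n) (P n)) {a : ℝ → ℝ} {ξ : ℝ}
    {ξh τh : ∀ n, (Fin n → ℝ) → ℝ} (h : IsPseudoMLE P X k a ξ ξh τh) :
    ∀ᶠ i : Σ n, Ω n in inProb P,
      IsLikelihoodRoot (X i.1 i.2) (k i.1) (ξh i.1 (X i.1 i.2)) (τh i.1 (X i.1 i.2)) := by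
  refine eventually_inProb_iff.2 ?_
  have h1 := ENNReal.Tendsto.sub (tendsto_const_nhds (x := (1 : ENNReal))) h.root
    (Or.inl ENNReal.one_ne_top)
  rw [tsub_self] at h1
  refine h1.congr fun n => ?_
  exact (prob_compl_eq_one_sub₀ ((hX n).nullMeasurable (measurableSet_isLikelihoodRoot (k n)
    (h.measurable_xi n) (h.measurable_tau n)))).symm

lemma TailArray.filter_mono {ι : Type*} {F 𝓖 : Filter ι} {k : ι → ℕ} {y : ι → ℕ → ℝ}
    (h : TailArray F k y) (hle : 𝓖 ≤ F) : TailArray 𝓖 k y := h.comp (tendsto_id'.2 hle)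

/-- Along any family of samples that has the profile of a tail array, a consistent root has a test
statistic asymptotic to the first entry of the array. -/
lemma tendsto_log_testStat_div {ι : Type*} {F : Filter ι} {n k : ι → ℕ} {y : ι → ℕ → ℝ}
    {x : ∀ i, Fin (n i) → ℝ} {α xi tau : ι → ℝ} (hy : TailArray F k y) {ξ : ℝ} (hξ : -1 / 2 < ξ)
    (hα : ∀ᶠ i in F, 0 < α i)
    (hexc : ∀ᶠ i in F, ∀ j ∈ Icc 1 (k i), exc ξ (k i) (y i) j = sExceed (x i) (k i) (α i) j)
    (hroot : ∀ᶠ i in F, IsLikelihoodRoot (x i) (k i) (xi i) (tau i))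
    (hxi : Tendsto xi F (𝓝 ξ)) (hsigma : Tendsto (fun i => xi i / tau i / α i) F (𝓝 1)) :
    (∀ᶠ i in F, 0 < testStat (x i) (k i) (xi i) (tau i)) ∧
      Tendsto (fun i => log (testStat (x i) (k i) (xi i) (tau i) / y i 1)) F (𝓝 0) := by
  have hS : ∀ᶠ i in F, ScaledRoot (k i) (sExceed (x i) (k i) (α i)) (tau i * α i)
      (xi i / tau i / α i) := by
    filter_upwards [hroot, hα, hy.tendsto_k.eventually_ge_atTop 1] with i h1 h2 h3
    exact ((isLikelihoodRoot_iff h3 h2).1 h1).1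
  have hS' : ∀ᶠ i in F, ScaledRoot (k i) (exc ξ (k i) (y i)) (tau i * α i) (xi i / tau i / α i) := by
    filter_upwards [hS, hexc, hy.tendsto_k.eventually_ge_atTop 1] with i h1 h2 h3
    exact h1.congr h3 fun j hj => (h2 j hj).symm
  have hθ : Tendsto (fun i => tau i * α i) F (𝓝 ξ) := by
    have h1 : Tendsto (fun i => xi i / (xi i / tau i / α i)) F (𝓝 (ξ / 1)) :=
      hxi.div hsigma one_ne_zero
    rw [div_one] at h1
    refine h1.congr' ?_
    filter_upwards [hS, hα] with i h2 h3
    have h4 : tau i ≠ 0 := by intro h0; exact h2.ne_zero (by rw [h0, zero_mul])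
    have h5 : xi i ≠ 0 := by intro h0; have := h2.scale_pos; simp [h0] at this
    field_simp
  have hlev := hy.tendsto_level_sub_log hξ hθ hsigma hS'
  have hpos : ∀ᶠ i in F, 0 < testStat (x i) (k i) (xi i) (tau i) := by
    filter_upwards [hS, hα, hy.tendsto_k.eventually_ge_atTop 1] with i h1 h2 h3
    rw [testStat_eq h2 h1]; positivity
  refine ⟨hpos, ?_⟩
  have hneg := hlev.neg
  rw [neg_zero] at hneg
  refine hneg.congr' ?_
  filter_upwards [hS, hα, hexc, hy.pos, hy.tendsto_k.eventually_ge_atTop 1] with i h1 h2 h3 h4 h5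
  have hk0 : (0 : ℝ) < k i := mod_cast h5
  have m1 : 1 ∈ Icc 1 (k i) := mem_Icc.2 ⟨le_rfl, h5⟩
  rw [testStat_eq h2 h1, h3 1 m1, log_div (mul_pos hk0 (exp_pos _)).ne' (h4 1 m1).ne',
    log_mul hk0.ne' (exp_pos _).ne', log_exp, log_div hk0.ne' (h4 1 m1).ne']
  ring

/-- The limit law of the test statistic for samples obtained by the quantile transform. -/
theorem tendsto_testStat_qSample
    (hξ : -1 / 2 < ξ) (hρ : ρ ≤ 0) (hU : SecondOrder (tailQuantile μ) a A ξ ρ)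
    (hk : Tendsto k atTop atTop)
    (hkn : Tendsto (fun n : ℕ => (k n : ℝ) / n) atTop (𝓝 0))
    (hA : Tendsto (fun n : ℕ => sqrt (k n) * A (n / k n)) atTop (𝓝 l))
    (hT : ∀ n, 0 < cdf μ (T n))
    (hD : Tendsto (fun n : ℕ => n * truncOdds μ (T n)) atTop (𝓝 0))
    {ξh τh : ∀ n, (Fin n → ℝ) → ℝ}
    (hm : IsPseudoMLE (fun n => truncUnifPi μ (T n) n) (fun _ => qSample μ) k a ξ ξh τh)
    {x : ℝ} (hx : 0 < x) :
    Tendsto (fun n => (truncUnifPi μ (T n) n).real {v | testStat (qSample μ v) (k n)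
      (ξh n (qSample μ v)) (τh n (qSample μ v)) ≤ x}) atTop (𝓝 (1 - exp (-x))) := by
  have hprob := fun n => isProbabilityMeasure_truncUnifPi μ (hT n) n
  have hc := tendsto_ofReal_pow μ hT hD
  have hdom := fun n => truncUnifPi_le μ (hT n) n
  have hle : inProb (fun n => truncUnifPi μ (T n) n) ≤ inProb unifPi := inProb_mono hc hdom
  obtain ⟨g1, g2, g3⟩ := tailArray_qSample hξ hρ hU hk hkn hA
  have hy := g1.filter_mono hle
  have ha : ∀ᶠ i : Sample in inProb (fun n => truncUnifPi μ (T n) n),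
      0 < a ((i.1 : ℝ) / k i.1) :=
    tendsto_fst_inProb.eventually ((tendsto_div_atTop hk hkn).eventually hU.pos_a)
  have hroot := eventually_root_of_isPseudoMLE (fun n => aemeasurable_qSample μ n) hm
  have hxi : Tendsto (fun i : Sample => ξh i.1 (qSample μ i.2))
      (inProb fun n => truncUnifPi μ (T n) n) (𝓝 ξ) := by
    have := (smallInProb_iff.1 hm.consistent_xi).add_const ξ; simpa using this
  have hsigma : Tendsto (fun i : Sample => ξh i.1 (qSample μ i.2)
      / τh i.1 (qSample μ i.2) / a ((i.1 : ℝ) / k i.1))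
      (inProb fun n => truncUnifPi μ (T n) n) (𝓝 1) := by
    have := (smallInProb_iff.1 hm.consistent_sigma).add_const 1; simpa using this
  obtain ⟨f1, f2⟩ := tendsto_log_testStat_div (x := fun i : Sample => qSample μ i.2)
    hy hξ ha (g2.filter_mono hle) hroot hxi hsigma
  have hae : ∀ᶠ i : Sample in inProb (fun n => truncUnifPi μ (T n) n),
      0 < (i.1 : ℝ) * orderStat i.2 1 := by
    refine Eventually.filter_mono hle ?_
    filter_upwards [eventually_inProb_of_ae ae_unifPi (p := fun i : Sample => ∀ l, i.2 l ∈ Ioo (0 : ℝ) 1),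
      tendsto_fst_inProb.eventually_ge_atTop 1] with i h1 h2
    have h3 : (0 : ℝ) < i.1 := mod_cast h2
    exact mul_pos h3 (orderStat_mem_of_forall h1 le_rfl h2).1
  refine tendsto_real_le_of_log_div (P := fun n => truncUnifPi μ (T n) n)
    (Z := fun n v => testStat (qSample μ v) (k n)
      (ξh n (qSample μ v)) (τh n (qSample μ v)))
    (W := fun n v => (n : ℝ) * orderStat v 1) (f1.and hae) ?_ (fun z hz => ?_) hx
  · have hsum := f2.add (g3.mono_left hle)
    rw [add_zero] at hsum
    refine hsum.congr' ?_
    filter_upwards [f1, hae, hy.pos, hy.tendsto_k.eventually_ge_atTop 1] with i h1 h2 h3 h4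
    have h5 := h3 1 (mem_Icc.2 ⟨le_rfl, h4⟩)
    rw [log_div h1.ne' h5.ne', log_div h5.ne' h2.ne', log_div h1.ne' h2.ne']; ring
  · exact tendsto_real_of_le hc hdom (fun n => measurableSet_le
      ((measurable_orderStat 1).const_mul _) measurable_const) (tendsto_unifPi_orderStat_one hz)

/-! ### Existence of the estimators -/

section

variable {k : ℕ} {h h' : ℕ → ℝ}

lemma avgLogQuot_congr (heq : ∀ j ∈ Icc 1 k, h j = h' j) (θ : ℝ) :
    avgLogQuot k h θ = avgLogQuot k h' θ := avg_congr fun j hj => by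
  rw [heq j (mem_Icc_one hj)]

lemma logQuotOne_congr (hk : 1 ≤ k) (heq : ∀ j ∈ Icc 1 k, h j = h' j) (θ : ℝ) :
    logQuotOne h θ = logQuotOne h' θ := by
  rw [logQuotOne, logQuotOne, heq 1 (mem_Icc.2 ⟨le_rfl, hk⟩)]

lemma rootLevel_congr (hk : 1 ≤ k) (heq : ∀ j ∈ Icc 1 k, h j = h' j) (θ : ℝ) :
    rootLevel k h θ = rootLevel k h' θ := by
  rw [rootLevel, rootLevel, avgLogQuot_congr heq, logQuotOne_congr hk heq]

lemma rootScale_congr (hk : 1 ≤ k) (heq : ∀ j ∈ Icc 1 k, h j = h' j) (θ : ℝ) :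
    rootScale k h θ = rootScale k h' θ := by
  rw [rootScale, rootScale, rootLevel_congr hk heq, logQuotOne_congr hk heq]

lemma rootFun_congr (hk : 1 ≤ k) (heq : ∀ j ∈ Icc 1 k, h j = h' j) (θ : ℝ) :
    rootFun k h θ = rootFun k h' θ := by
  rw [rootFun, rootFun, rootLevel_congr hk heq, rootScale_congr hk heq,
    logQuotOne_congr hk heq]
  congr 1
  refine avg_congr fun j hj => ?_
  rw [heq j (mem_Icc_one hj)]

lemma RootDomain.congr (hk : 1 ≤ k) (heq : ∀ j ∈ Icc 1 k, h j = h' j) {θ : ℝ} (hd : RootDomain k h θ) : RootDomain k h' θ := by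
  have e := logQuotOne_congr hk heq θ
  exact ⟨fun j hj => heq j hj ▸ hd.arg_pos j hj, by rw [← e, ← avgLogQuot_congr heq]; exact hd.ratio_mem,
    e ▸ hd.log_pos, by rw [← rootScale_congr hk heq]; exact hd.shape_pos⟩

end

/-- A zero of the reduced equation away from `θ = 0` gives a solution of the likelihood equations. -/
lemma isLikelihoodRoot_of_rootFun_eq_zero {n k : ℕ} (hk : 2 ≤ k) {x : Fin n → ℝ} {α θ : ℝ} (hα : 0 < α)
    (hθ : θ ≠ 0) (hd : RootDomain k (sExceed x k α) θ) (h0 : rootFun k (sExceed x k α) θ = 0) :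
    IsLikelihoodRoot x k (rootScale k (sExceed x k α) θ * θ) (θ / α) := by
  refine (isLikelihoodRoot_iff (by omega) hα).2 ?_
  have e1 : θ / α * α = θ := div_mul_cancel₀ _ hα.ne'
  have e2 : rootScale k (sExceed x k α) θ * θ / (θ / α) / α = rootScale k (sExceed x k α) θ := by
    field_simp
  rw [e1, e2]
  exact ⟨hd.scaledRoot hk hθ h0, hd.arg_pos⟩

/-- Consistent roots exist for samples obtained by the quantile transform. -/
theorem exists_isPseudoMLE_qSample
    (hξ : -1 / 2 < ξ) (hρ : ρ ≤ 0) (hU : SecondOrder (tailQuantile μ) a A ξ ρ)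
    (hk : Tendsto k atTop atTop)
    (hkn : Tendsto (fun n : ℕ => (k n : ℝ) / n) atTop (𝓝 0))
    (hA : Tendsto (fun n : ℕ => sqrt (k n) * A (n / k n)) atTop (𝓝 l))
    (hT : ∀ n, 0 < cdf μ (T n))
    (hD : Tendsto (fun n : ℕ => n * truncOdds μ (T n)) atTop (𝓝 0))
    (hne : ξ = 0 → ∀ᶠ i : Sample in inProb unifPi,
      rootFun (k i.1) (sExceed (qSample μ i.2) (k i.1) (a (i.1 / k i.1))) 0 ≠ 0) :
    ∃ ξh τh : ∀ n, (Fin n → ℝ) → ℝ,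
      IsPseudoMLE (fun n => truncUnifPi μ (T n) n) (fun _ => qSample μ) k a ξ ξh τh := by
  have hprob := fun n => isProbabilityMeasure_truncUnifPi μ (hT n) n
  have hle : inProb (fun n => truncUnifPi μ (T n) n) ≤ inProb unifPi :=
    inProb_mono (tendsto_ofReal_pow μ hT hD) fun n => truncUnifPi_le μ (hT n) n
  obtain ⟨c, hc, hc2⟩ := exists_between (max_lt (show -ξ < 1 / 2 by linarith) one_half_pos)
  have hc0 : 0 < c := (le_max_right _ _).trans_lt hc
  set α : ℕ → ℝ := fun n => a ((n : ℝ) / k n)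
  set H : ∀ n, (Fin n → ℝ) → ℕ → ℝ := fun n x => sExceed x (k n) (α n)
  set κ : ℕ → ℝ := fun n => (k n : ℝ) ^ (-c)
  have hHm : ∀ n j, Measurable fun x => H n x j := fun n j =>
    (measurable_exceed (k n) j).div_const _
  -- the root, as a measurable function of the sample
  have hsel : ∀ n : ℕ, ∃ s : (Fin n → ℝ) → ℝ, Measurable s ∧ (1 ≤ k n → ∀ x,
      ContinuousOn (rootFun (k n) (H n x)) (Set.Icc (ξ - κ n) (ξ + κ n)) →
      0 < rootFun (k n) (H n x) (ξ - κ n) → rootFun (k n) (H n x) (ξ + κ n) < 0 →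
      s x ∈ Set.Icc (ξ - κ n) (ξ + κ n) ∧ rootFun (k n) (H n x) (s x) = 0) := by
    intro n
    by_cases h1 : 1 ≤ k n
    · have hp : 0 < κ n := rpow_pos_of_pos (mod_cast h1) _
      obtain ⟨s, hs, hs2⟩ := exists_measurable_zero (fun x θ => rootFun (k n) (H n x) θ)
        (fun θ => measurable_rootFun _ (hHm n) measurable_const)
        (show ξ - κ n < ξ + κ n by linarith)
      exact ⟨s, hs, fun _ x => hs2 x⟩
    · exact ⟨fun _ => 0, measurable_const, fun h => absurd h h1⟩
  choose s hs hs2 using hsel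
  set R : ∀ n, (Fin n → ℝ) → ℝ := fun n x => rootScale (k n) (H n x) (s n x)
  have hRm : ∀ n, Measurable (R n) := fun n =>
    measurable_rootScale _ (hHm n) (hs n)
  obtain ⟨g1, g2, -⟩ := tailArray_qSample hξ hρ hU hk hkn hA
  obtain ⟨b1, b2, b3⟩ := g1.sign_change hξ hc hc2
  set S : Sample → ℝ := fun i => s i.1 (qSample μ i.2)
  set V : Sample → ℝ := fun i => R i.1 (qSample μ i.2)
  have hkP : Tendsto (fun i : Sample => k i.1) (inProb unifPi) atTop :=
    hk.comp tendsto_fst_inProb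
  have hα0 : ∀ᶠ i : Sample in inProb unifPi, 0 < α i.1 :=
    tendsto_fst_inProb.eventually ((tendsto_div_atTop hk hkn).eventually hU.pos_a)
  -- with probability tending to one the selected value is a root close to `ξ`
  have hgood : ∀ᶠ i : Sample in inProb unifPi,
      |S i - ξ| ≤ κ i.1 ∧
      RootDomain (k i.1) (H i.1 (qSample μ i.2))
        (S i) ∧
      rootFun (k i.1) (H i.1 (qSample μ i.2))
        (S i) = 0 := by
    filter_upwards [g2, b1, b3, hkP.eventually_ge_atTop 1] with i h1 h2 h3 h4
    have hdom : ∀ θ, |θ - ξ| ≤ κ i.1 →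
        RootDomain (k i.1) (H i.1 (qSample μ i.2)) θ := fun θ hθ =>
      (h2 θ hθ).congr h4 h1
    have hIcc : ∀ θ, θ ∈ Set.Icc (ξ - κ i.1) (ξ + κ i.1) →
        |θ - ξ| ≤ κ i.1 := fun θ hθ =>
      abs_le.2 ⟨by linarith [hθ.1], by linarith [hθ.2]⟩
    rw [rootFun_congr h4 h1, rootFun_congr h4 h1] at h3
    obtain ⟨f1, f2⟩ := hs2 i.1 h4 (qSample μ i.2)
      (continuousOn_rootFun h4 fun θ hθ => hdom θ (hIcc θ hθ)) h3.1 h3.2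
    exact ⟨hIcc _ f1, hdom _ (hIcc _ f1), f2⟩
  have hst : Tendsto (fun i : Sample => S i) (inProb unifPi) (𝓝 ξ) := by
    rw [tendsto_iff_norm_sub_tendsto_zero]
    exact squeeze_zero' (Eventually.of_forall fun i => norm_nonneg _) (hgood.mono fun i hi => hi.1)
      (tendsto_rpow_neg_of_tendsto hkP (by linarith))
  have hRt : Tendsto (fun i : Sample => V i) (inProb unifPi) (𝓝 1) := by
    refine Metric.tendsto_nhds.2 fun ε hε => ?_
    filter_upwards [b2 (ε / 2) (half_pos hε), hgood, g2, hkP.eventually_ge_atTop 1] with i h1 h2 h3 h4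
    have h5 := h1 _ h2.1
    rw [rootScale_congr h4 h3] at h5
    rw [dist_eq]
    exact h5.trans_lt (half_lt_self hε)
  have hs0 : ∀ᶠ i : Sample in inProb unifPi, S i ≠ 0 := by
    by_cases h0 : ξ = 0
    · filter_upwards [hne h0, hgood] with i h1 h2 h3
      rw [h3] at h2
      exact h1 h2.2.2
    · exact hst.eventually_ne h0
  have hsig : ∀ᶠ i : Sample in inProb unifPi, V i
      = V i * S i
        / (S i / α i.1) / α i.1 := by
    filter_upwards [hs0, hα0] with i h1 h2; field_simp
  have hξm : ∀ n, Measurable fun x : Fin n → ℝ => R n x * s n x := fun n => (hRm n).mul (hs n)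
  have hτm : ∀ n, Measurable fun x : Fin n → ℝ => s n x / α n := fun n => (hs n).div_const _
  refine ⟨fun n x => R n x * s n x, fun n x => s n x / α n, hξm, hτm, ?_, ?_, ?_⟩
  · have hroot : ∀ᶠ i : Sample in inProb (fun n => truncUnifPi μ (T n) n),
        IsLikelihoodRoot (qSample μ i.2) (k i.1)
          (V i * S i)
          (S i / α i.1) := by
      refine Eventually.filter_mono hle ?_
      filter_upwards [hgood, hs0, hα0, hkP.eventually_ge_atTop 2] with i h1 h2 h3 h4
      exact isLikelihoodRoot_of_rootFun_eq_zero h4 h3 h2 h1.2.1 h1.2.2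
    have h1 := ENNReal.Tendsto.sub (tendsto_const_nhds (x := (1 : ENNReal)))
      (eventually_inProb_iff.1 hroot) (Or.inl ENNReal.one_ne_top)
    rw [tsub_zero] at h1
    refine h1.congr fun n => ?_
    have hnull := (aemeasurable_qSample (T := T n) μ n).nullMeasurable
      (measurableSet_isLikelihoodRoot (k n) (hξm n) (hτm n))
    have h2 := prob_compl_eq_one_sub₀ hnull.compl
    rw [compl_compl] at h2; exact h2.symm
  · refine smallInProb_iff.2 (Tendsto.mono_left ?_ hle)
    have := (hRt.mul hst).sub_const ξ
    simpa using this
  · refine smallInProb_iff.2 (Tendsto.mono_left ?_ hle)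
    have := (hRt.congr' hsig).sub_const 1
    simpa using this

/-! ### Degenerate roots for vanishing extreme value index -/

lemma orderStat_update_eq {n : ℕ} (x : Fin n → ℝ) (i : Fin n) {z z' b : ℝ} (hz : b < z) (hz' : b < z')
    {m : ℕ} (h1 : 1 ≤ m) (h2 : m ≤ n) (hle : orderStat (update x i z) m ≤ b)
    (hle' : orderStat (update x i z') m ≤ b) :
    orderStat (update x i z) m = orderStat (update x i z') m := by
  have hcount : ∀ {u w : ℝ}, b < u → b < w → ∀ y ≤ b,
      (Finset.univ.filter fun l => update x i u l ≤ y)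
        = Finset.univ.filter fun l => update x i w l ≤ y := by
    intro u w hu hw y hy
    ext l
    simp only [Finset.mem_filter, Finset.mem_univ, true_and]
    by_cases hl : l = i
    · subst hl
      simp only [Function.update_self]
      constructor <;> intro h <;> linarith
    · simp only [Function.update_of_ne hl]
  refine le_antisymm ((orderStat_le_iff _ h1 h2 _).2 ?_) ((orderStat_le_iff _ h1 h2 _).2 ?_)
  · rw [hcount hz hz' _ hle']; exact (orderStat_le_iff _ h1 h2 _).1 le_rfl
  · rw [hcount hz' hz _ hle]; exact (orderStat_le_iff _ h1 h2 _).1 le_rfl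

lemma orderStat_last_update_le {n : ℕ} (hn : 1 ≤ n) (x : Fin n → ℝ) (i : Fin n) {z z' b : ℝ} (hz : z ≤ b)
    (hlt : b < orderStat (update x i z) n) :
    orderStat (update x i z) n ≤ orderStat (update x i z') n := by
  obtain ⟨l, hl⟩ := exists_eq_orderStat (update x i z) hn le_rfl
  have hli : l ≠ i := by rintro rfl; rw [Function.update_self] at hl; linarith
  rw [← hl, Function.update_of_ne hli, ← Function.update_of_ne hli z' x]
  exact le_orderStat_last _ l

lemma avg_eq_sum_sExceed {n k : ℕ} (hk : 2 ≤ k) (hkn : k < n) (x : Fin n → ℝ) (α : ℝ) {f : ℝ → ℝ}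
    (hf : f 0 = 0) : ((k : ℝ) - 1) * avg k (fun j => f (sExceed x k α j))
      = ∑ l, f (max (x l - orderStat x (n - k)) 0 / α) - f (sExceed x k α 1) := by
  have hk' : (k : ℝ) - 1 ≠ 0 := by
    have : (2 : ℝ) ≤ k := mod_cast hk
    linarith
  have h1 := sum_exceed hkn x (f := fun e => f (e / α)) (by simpa using hf)
  have h2 : Icc 1 k = insert 1 (Icc 2 k) := by ext j; simp only [mem_Icc, Finset.mem_insert]; omega
  rw [h2, Finset.sum_insert (by simp)] at h1
  rw [avg, ← mul_assoc, mul_one_div_cancel hk', one_mul, ← h1]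
  simp only [sExceed]; ring

/-- A sample for which the reduced equation degenerates, in a normalized configuration: the
threshold lies below `b₁` and the maximum above `b₂`, with `b₂` close to the threshold. -/
structure DegenerateSample (L₀ b₁ b₂ α : ℝ) {n : ℕ} (k : ℕ) (x : Fin n → ℝ) : Prop where
  zero : rootFun k (sExceed x k α) 0 = 0
  ratio_mem : avgLogQuot k (sExceed x k α) 0 / logQuotOne (sExceed x k α) 0
    ∈ Ioc 0 (levelRatio 1)
  log_pos : 0 < logQuotOne (sExceed x k α) 0
  level_ge : L₀ ≤ rootLevel k (sExceed x k α) 0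
  avg_near : |avg k (sExceed x k α) - 1| ≤ 1 / 10
  le_left : orderStat x (n - k) ≤ b₁
  lt_right : b₂ < orderStat x n
  close : (b₂ - orderStat x (n - k)) / α ≤ 16 / 10

lemma DegenerateSample.rootDomain {L₀ b₁ b₂ α : ℝ} {n k : ℕ} {x : Fin n → ℝ}
    (h : DegenerateSample L₀ b₁ b₂ α k x) : RootDomain k (sExceed x k α) 0 :=
  ⟨fun j _ => by simp, h.ratio_mem, h.log_pos, by simp⟩

/-- Moving a single observation inside `(b₁, b₂]` destroys the degeneracy, since it changes the first
two empirical moments of the exceedances in a way that the equation does not allow. -/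
lemma exists_degenerateSample_update_injective : ∃ L₀ : ℝ, ∀ (b₁ b₂ α : ℝ) (n k : ℕ) (x : Fin n → ℝ)
    (i : Fin n) (z z' : ℝ), 0 < α → 2 ≤ k → k < n → z ∈ Ioc b₁ b₂ → z' ∈ Ioc b₁ b₂ →
    DegenerateSample L₀ b₁ b₂ α k (update x i z) →
    DegenerateSample L₀ b₁ b₂ α k (update x i z') → z = z' := by
  obtain ⟨L₀, -, hL⟩ := exists_rootFun_zero_dichotomy
  refine ⟨L₀, fun b₁ b₂ α n k x i z z' hα hk hkn hz hz' hd hd' => ?_⟩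
  set X := update x i z with hX
  set X' := update x i z' with hX'
  have hc : orderStat X (n - k) = orderStat X' (n - k) :=
    orderStat_update_eq x i hz.1 hz'.1 (by omega) (by omega) hd.le_left hd'.le_left
  have hmax : orderStat X n = orderStat X' n :=
    le_antisymm (orderStat_last_update_le (by omega) x i hz.2 hd.lt_right)
      (orderStat_last_update_le (by omega) x i hz'.2 hd'.lt_right)
  set c := orderStat X (n - k)
  have h1 : sExceed X k α 1 = sExceed X' k α 1 := by
    rw [sExceed, sExceed, exceed, exceed, show n - 1 + 1 = n by omega, hmax, ← hc]
  have hsum : ∀ {f : ℝ → ℝ}, f 0 = 0 → ((k : ℝ) - 1) * (avg k (fun j => f (sExceed X k α j))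
      - avg k (fun j => f (sExceed X' k α j))) = f ((z - c) / α) - f ((z' - c) / α) := by
    intro f hf
    rw [mul_sub, avg_eq_sum_sExceed hk hkn X α hf, avg_eq_sum_sExceed hk hkn X' α hf, ← h1, ← hc]
    rw [sub_sub_sub_cancel_right, ← Finset.sum_sub_distrib, Finset.sum_eq_single i]
    · rw [hX, hX', Function.update_self, Function.update_self,
        max_eq_left (by linarith [hz.1, hd.le_left]), max_eq_left (by linarith [hz'.1, hd.le_left])]
    · intro l _ hl; rw [hX, hX', Function.update_of_ne hl, Function.update_of_ne hl, sub_self]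
    · intro h; exact absurd (Finset.mem_univ i) h
  have hdich := hL k (sExceed X k α) (sExceed X' k α) ((z - c) / α) ((z' - c) / α) hk h1
    hd.rootDomain hd'.rootDomain hd.level_ge hd'.level_ge hd.zero hd'.zero hd.avg_near hd'.avg_near
    (hsum (f := fun e => e) rfl) (hsum (f := fun e => e ^ 2) (by norm_num))
  have hle : ∀ w ≤ b₂, (w - c) / α ≤ 16 / 10 := fun w hw =>
    (div_le_div_of_nonneg_right (sub_le_sub_right hw c) hα.le).trans hd.close
  rcases hdich with h | h
  · rw [div_left_inj' hα.ne'] at h; linarith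
  · linarith [hle z hz.2, hle z' hz'.2]

lemma measurableSet_degenerateSample (L₀ b₁ b₂ α : ℝ) (n k : ℕ) :
    MeasurableSet {x : Fin n → ℝ | DegenerateSample L₀ b₁ b₂ α k x} := by
  have hh : ∀ j, Measurable fun x : Fin n → ℝ => sExceed x k α j := fun j =>
    (measurable_exceed k j).div_const _
  have h0 : Measurable fun _ : Fin n → ℝ => (0 : ℝ) := measurable_const
  have ho := fun i => measurable_orderStat (n := n) i
  rw [show {x : Fin n → ℝ | DegenerateSample L₀ b₁ b₂ α k x}
      = {x | _ ∧ _ ∧ _ ∧ _ ∧ _ ∧ _ ∧ _ ∧ _} from Set.ext fun x =>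
    ⟨fun h => ⟨h.1, h.2, h.3, h.4, h.5, h.6, h.7, h.8⟩,
      fun ⟨g1, g2, g3, g4, g5, g6, g7, g8⟩ => ⟨g1, g2, g3, g4, g5, g6, g7, g8⟩⟩]
  exact (measurableSet_eq_fun (measurable_rootFun k hh h0) h0).inter
    (((measurable_avgLogQuot k hh h0).div (measurable_logQuotOne hh h0) measurableSet_Ioc).inter
    ((measurableSet_lt h0 (measurable_logQuotOne hh h0)).inter
    ((measurableSet_le measurable_const (measurable_rootLevel k hh h0)).inter
    ((measurableSet_le ((measurable_avg k hh).sub_const 1).abs measurable_const).inter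
    ((measurableSet_le (ho _) measurable_const).inter ((measurableSet_lt measurable_const (ho _)).inter
    (measurableSet_le (((ho _).const_sub _).div_const _) measurable_const)))))))

/-- A bound on all one-dimensional sections of a set bounds its product measure. -/
lemma pi_le_of_forall_update {n : ℕ} {B : Set (Fin n → ℝ)}
    (hB : MeasurableSet B) (i : Fin n) {C : ENNReal} (h : ∀ x, μ {z | update x i z ∈ B} ≤ C) :
    Measure.pi (fun _ : Fin n => μ) B ≤ C := by
  have h1 := lintegral_le_of_lmarginal_le (μ := fun _ : Fin n => μ) {i}
    (f := B.indicator 1) (g := fun _ => C) (measurable_one.indicator hB) measurable_const (by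
      rw [lmarginal_singleton, lmarginal_singleton]
      intro x
      have h2 : (fun z => B.indicator (1 : (Fin n → ℝ) → ENNReal) (update x i z))
          = {z | update x i z ∈ B}.indicator 1 := rfl
      have h3 : MeasurableSet {z | update x i z ∈ B} := measurable_update x hB
      simp only [h2, lintegral_indicator_one h3, lintegral_const, measure_univ, mul_one]; exact h x)
  rwa [lintegral_indicator_one hB, lintegral_const, measure_univ, mul_one] at h1

/-- Double counting: many observations in a window, each of which could be moved there only to
finitely few other positions, make a degenerate sample improbable. -/
lemma pi_degenerateSample_le {L₀ : ℝ} (hL : ∀ (b₁ b₂ α : ℝ) (n k : ℕ) (x : Fin n → ℝ)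
    (i : Fin n) (z z' : ℝ), 0 < α → 2 ≤ k → k < n → z ∈ Ioc b₁ b₂ → z' ∈ Ioc b₁ b₂ →
    DegenerateSample L₀ b₁ b₂ α k (update x i z) →
    DegenerateSample L₀ b₁ b₂ α k (update x i z') → z = z')
    {n k : ℕ} {b₁ b₂ α N : ℝ} {C : ENNReal} (hα : 0 < α)
    (hk : 2 ≤ k) (hkn : k < n) (hatom : ∀ x₀ ∈ Ioc b₁ b₂, μ {x₀} ≤ C) :
    ofReal N * Measure.pi (fun _ : Fin n => μ) {x | DegenerateSample L₀ b₁ b₂ α k x ∧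
      N ≤ ∑ i, (Ioc b₁ b₂).indicator (fun _ => (1 : ℝ)) (x i)} ≤ n * C := by
  set D := {x : Fin n → ℝ | DegenerateSample L₀ b₁ b₂ α k x}
  have hDm : MeasurableSet D := measurableSet_degenerateSample L₀ b₁ b₂ α n k
  set B : Fin n → Set (Fin n → ℝ) := fun i => D ∩ {x | x i ∈ Ioc b₁ b₂}
  have hBm : ∀ i, MeasurableSet (B i) := fun i => hDm.inter (measurable_pi_apply i measurableSet_Ioc)
  set Z := {x : Fin n → ℝ | DegenerateSample L₀ b₁ b₂ α k x ∧
      N ≤ ∑ i, (Ioc b₁ b₂).indicator (fun _ => (1 : ℝ)) (x i)} with hZ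
  have hcm : Measurable fun x : Fin n → ℝ => ∑ i, (Ioc b₁ b₂).indicator (fun _ => (1 : ℝ)) (x i) :=
    Finset.measurable_sum _ fun i _ =>
      (measurable_const.indicator measurableSet_Ioc).comp (measurable_pi_apply i)
  have hZm : MeasurableSet Z := hDm.inter (measurableSet_le measurable_const hcm)
  have hsec : ∀ i, Measure.pi (fun _ : Fin n => μ) (B i) ≤ C := by
    intro i
    refine pi_le_of_forall_update (hBm i) i fun x => ?_
    rcases Set.eq_empty_or_nonempty {z | update x i z ∈ B i} with he | ⟨z, hz⟩
    · rw [he]; simp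
    · have hz2 : update x i z i ∈ Ioc b₁ b₂ := hz.2
      rw [Function.update_self] at hz2
      refine (measure_mono fun z' hz' => ?_).trans (hatom z hz2)
      have hz3 : update x i z' i ∈ Ioc b₁ b₂ := hz'.2
      rw [Function.update_self] at hz3
      exact (hL b₁ b₂ α n k x i z z' hα hk hkn hz2 hz3 hz.1 hz'.1).symm
  calc ofReal N * Measure.pi (fun _ : Fin n => μ) Z
      = ∫⁻ x, Z.indicator (fun _ => ofReal N) x ∂Measure.pi fun _ : Fin n => μ := by
        rw [lintegral_indicator_const hZm]
    _ ≤ ∫⁻ x, ∑ i, (B i).indicator 1 x ∂Measure.pi fun _ : Fin n => μ := by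
        refine lintegral_mono fun x => ?_
        by_cases hx : x ∈ Z
        · rw [Set.indicator_of_mem hx]
          refine (ENNReal.ofReal_le_ofReal hx.2).trans ?_
          rw [ENNReal.ofReal_sum_of_nonneg fun i _ => Set.indicator_nonneg (fun _ _ => zero_le_one) _]
          refine Finset.sum_le_sum fun i _ => ?_
          by_cases hi : x i ∈ Ioc b₁ b₂
          · rw [Set.indicator_of_mem hi, Set.indicator_of_mem (show x ∈ B i from ⟨hx.1, hi⟩)]; simp
          · rw [Set.indicator_of_notMem hi]; simp
        · rw [Set.indicator_of_notMem hx]; exact zero_le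
    _ = ∑ i, Measure.pi (fun _ : Fin n => μ) (B i) := by
        rw [lintegral_finsetSum _ fun i _ => measurable_one.indicator (hBm i)]
        exact Finset.sum_congr rfl fun i _ => lintegral_indicator_one (hBm i)
    _ ≤ ∑ _i : Fin n, C := Finset.sum_le_sum fun i _ => hsec i
    _ = n * C := by simp

lemma SecondOrder.tendsto_increment
    (hU : SecondOrder (tailQuantile μ) a A ξ ρ) (hρ : ρ ≤ 0) {x : ℝ} (hx : 1 / 2 ≤ x) :
    Tendsto (fun t => (tailQuantile μ (t * x) - tailQuantile μ t) / a t) atTop (𝓝 (kFun ξ x)) := by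
  obtain ⟨C, t₀, hC⟩ := hU.exists_bound hρ one_pos
  rw [tendsto_iff_norm_sub_tendsto_zero]
  have h1 : Tendsto (fun t => C * |A t| * x ^ (max ξ 0 + 1)) atTop (𝓝 0) := by
    simpa using (hU.tendsto_A.abs.const_mul C).mul_const (x ^ (max ξ 0 + 1))
  refine squeeze_zero' (Eventually.of_forall fun t => norm_nonneg _) ?_ h1
  filter_upwards [eventually_ge_atTop t₀] with t ht using hC t ht x hx

lemma SecondOrder.eventually_tailQuantile_lt
    (hU : SecondOrder (tailQuantile μ) a A ξ ρ) (hρ : ρ ≤ 0) {x y : ℝ} (hx : 1 / 2 ≤ x)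
    (hxy : x < y) : ∀ᶠ t in atTop, tailQuantile μ (t * x) < tailQuantile μ (t * y) := by
  have h1 := (hU.tendsto_increment hρ (hx.trans hxy.le)).sub (hU.tendsto_increment hρ hx)
  have h2 : 0 < kFun ξ y - kFun ξ x := sub_pos.2 (kFun_strictMonoOn ξ
    (Set.mem_Ioi.2 (by linarith)) (Set.mem_Ioi.2 (by linarith)) hxy)
  filter_upwards [h1.eventually_const_lt h2, hU.pos_a] with t h3 h4
  rw [← sub_div, sub_sub_sub_cancel_right, lt_div_iff₀ h4, zero_mul] at h3; linarith

/-- Atoms in an intermediate window of the upper tail are small. -/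
lemma SecondOrder.exists_atom_le
    (hU : SecondOrder (tailQuantile μ) a A 0 ρ) (hρ : ρ ≤ 0) :
    ∃ C : ℝ, ∀ᶠ t in atTop, ∀ x₀ ∈ Ioc (tailQuantile μ (t * 2)) (tailQuantile μ (t * 4)),
      μ {x₀} ≤ ofReal (C * |A t| / t) := by
  obtain ⟨C, t₀, hC⟩ := hU.exists_bound hρ one_pos
  refine ⟨8 * |C|, ?_⟩
  filter_upwards [eventually_ge_atTop t₀, eventually_ge_atTop 1,
    hU.eventually_tailQuantile_lt hρ (show (1 : ℝ) / 2 ≤ 4 by norm_num) (show (4 : ℝ) < 8 by norm_num)]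
    with t h1 h2 h3 x₀ hx₀
  have ht0 : 0 < t := by linarith
  set V := {v : ℝ | v ∈ Ioo (0 : ℝ) 1 ∧ quantile μ (1 - v) = x₀}
  have hμ : μ {x₀} ≤ volume V := by
    conv_lhs => rw [← map_quantile_unif μ]
    rw [Measure.map_apply_of_aemeasurable (measurable_quantile_one_sub μ) (measurableSet_singleton x₀),
      unif, Measure.restrict_apply' measurableSet_Ioo]
    exact measure_mono fun v hv => ⟨hv.2, hv.1⟩
  refine hμ.trans (volume_le_diam V |>.trans ?_)
  -- points with the same quantile have, in the scale `t`, almost the same logarithm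
  have hz : ∀ v ∈ V, 2 < 1 / (t * v) ∧ 1 / (t * v) < 8 ∧
      |(x₀ - tailQuantile μ t) / a t - log (1 / (t * v))| ≤ |C| * |A t| * 8 := by
    rintro v ⟨hv, hvx⟩
    have hv0 := hv.1
    have hval : tailQuantile μ (t * (1 / (t * v))) = x₀ := by
      rw [tailQuantile, ← hvx]; congr 2; field_simp
    have hinv : t * (1 / (t * v)) = 1 / v := by field_simp
    have h1v : 1 < 1 / v := (one_lt_div hv0).2 hv.2
    have g1 : 2 < 1 / (t * v) := by
      by_contra hcon
      have := tailQuantile_mono μ (u := t * (1 / (t * v))) (v := t * 2) (by rw [hinv]; exact h1v)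
        (mul_le_mul_of_nonneg_left (not_lt.1 hcon) ht0.le)
      rw [hval] at this
      linarith [hx₀.1]
    have g2 : 1 / (t * v) < 8 := by
      by_contra hcon
      have := tailQuantile_mono μ (u := t * 8) (v := t * (1 / (t * v))) (by linarith)
        (mul_le_mul_of_nonneg_left (not_lt.1 hcon) ht0.le)
      rw [hval] at this
      linarith [hx₀.2]
    refine ⟨g1, g2, ?_⟩
    have g3 := hC t h1 (1 / (t * v)) (by linarith)
    rw [hval, max_self, zero_add, rpow_one] at g3
    have e : kFun 0 (1 / (t * v)) = log (1 / (t * v)) := if_pos rfl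
    rw [e] at g3
    have g4 : C * |A t| ≤ |C| * |A t| := mul_le_mul_of_nonneg_right (le_abs_self C) (abs_nonneg _)
    have g5 : 0 ≤ |C| * |A t| := by positivity
    nlinarith
  have hdist : ∀ u ∈ V, ∀ v ∈ V, u ≤ v → v - u ≤ 8 * |C| * |A t| / t := by
    intro u hu v hv huv
    obtain ⟨_, _, e1⟩ := hz u hu
    obtain ⟨e2, _, e3⟩ := hz v hv
    have hu0 := hu.1.1
    have hv0 := hv.1.1
    have g1 : log (v / u) ≤ 16 * (|C| * |A t|) := by
      have f1 := abs_le.1 e1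
      have f2 := abs_le.1 e3
      have f3 : log (v / u) = log (1 / (t * u)) - log (1 / (t * v)) := by
        rw [← log_div (by positivity) (by positivity)]; congr 1; field_simp
      linarith
    have g2 := one_sub_inv_le_log_of_pos (div_pos hv0 hu0)
    have g3 : v ≤ 1 / (2 * t) := by
      rw [lt_div_iff₀ (by positivity)] at e2; rw [le_div_iff₀ (by positivity)]; linarith
    have g4 : v - u = v * (1 - (v / u)⁻¹) := by field_simp
    have g5 : 0 ≤ 16 * (|C| * |A t|) := by positivity
    calc v - u ≤ v * (16 * (|C| * |A t|)) := by
          rw [g4]; exact mul_le_mul_of_nonneg_left (g2.trans g1) hv0.le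
      _ ≤ 1 / (2 * t) * (16 * (|C| * |A t|)) := mul_le_mul_of_nonneg_right g3 g5
      _ = _ := by field_simp; ring
  refine Metric.ediam_le fun u hu v hv => ?_
  rw [edist_dist, dist_eq]
  refine ENNReal.ofReal_le_ofReal ?_
  rcases le_total u v with h | h
  · rw [abs_sub_comm, abs_of_nonneg (sub_nonneg.2 h)]; exact hdist u hu v hv h
  · rw [abs_of_nonneg (sub_nonneg.2 h)]; exact hdist v hv u hu h

lemma map_qSample_unifPi (μ : Measure ℝ) [IsProbabilityMeasure μ] (n : ℕ) :
    (unifPi n).map (qSample μ) = Measure.pi fun _ : Fin n => μ := by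
  have h := Measure.pi_map_pi (μ := fun _ : Fin n => unif) (f := fun _ v => quantile μ (1 - v))
    (fun _ => measurable_quantile_one_sub μ)
  simp only [map_quantile_unif] at h; exact h

lemma aemeasurable_qSample_unifPi (μ : Measure ℝ) [IsProbabilityMeasure μ] (n : ℕ) :
    AEMeasurable (qSample μ) (unifPi n) :=
  aemeasurable_pi_lambda _ fun l => (measurable_quantile_one_sub μ).comp_quasiMeasurePreserving
    (Measure.quasiMeasurePreserving_eval _ l)

/-- The number of uniform points between two deterministic levels of order `k / n`. -/
lemma UniformTail.eventually_count
    (hu : UniformTail (inProb unifPi) (fun i => k i.1) (fun i j => i.1 * orderStat i.2 j))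
    (hkn : ∀ᶠ n in atTop, k n + 1 ≤ n) :
    ∀ᶠ i : Sample in inProb unifPi, (k i.1 : ℝ) / 24
      ≤ countLe i.2 (k i.1 / (3 * i.1)) - countLe i.2 (k i.1 / (4 * i.1)) := by
  filter_upwards [hu.close (1 / 4) (by norm_num),
    eventually_mul_rpow_le hu.tendsto_k (show (3 / 4 : ℝ) < 1 by norm_num) 400,
    hu.tendsto_k.eventually_ge_atTop 200, tendsto_fst_inProb.eventually hkn] with i h1 h2 h3 h4
  set K := k i.1
  have hn0 : (0 : ℝ) < i.1 := mod_cast (by omega : 0 < i.1)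
  have hK200 : (200 : ℝ) ≤ K := mod_cast h3
  have hK0 : (0 : ℝ) < K := by linarith
  rw [rpow_one] at h2
  have hclose : ∀ j, 1 ≤ j → j ≤ K → |i.1 * orderStat i.2 j - j| ≤ K / 200 := by
    intro j hj1 hj2
    refine (h1 j (mem_Icc.2 ⟨hj1, by omega⟩)).trans ?_
    have g1 : sqrt j ≤ (K : ℝ) ^ (1 / 2 : ℝ) := by
      rw [← sqrt_eq_rpow]; exact sqrt_le_sqrt (mod_cast hj2)
    have g2 : (K : ℝ) ^ (1 / 4 : ℝ) * (K : ℝ) ^ (1 / 2 : ℝ) = (K : ℝ) ^ (3 / 4 : ℝ) := by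
      rw [← rpow_add hK0]; norm_num
    have g3 := mul_le_mul_of_nonneg_left g1 (rpow_nonneg hK0.le (1 / 4))
    rw [g2] at g3
    linarith
  set j₁ := 26 * K / 100 + 1
  set j₂ := 32 * K / 100
  have e1 : (26 * K : ℝ) ≤ 100 * j₁ := mod_cast (by omega : 26 * K ≤ 100 * j₁)
  have e2 : (100 * j₁ : ℝ) ≤ 26 * K + 100 := mod_cast (by omega : 100 * j₁ ≤ 26 * K + 100)
  have e3 : (100 * j₂ : ℝ) ≤ 32 * K := mod_cast (by omega : 100 * j₂ ≤ 32 * K)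
  have e4 : (32 * K : ℝ) ≤ 100 * j₂ + 100 := mod_cast (by omega : 32 * K ≤ 100 * j₂ + 100)
  have c1 := (abs_le.1 (hclose j₁ (by omega) (by omega))).1
  have c2 := (abs_le.1 (hclose j₂ (by omega) (by omega))).2
  have f1 : ¬ orderStat i.2 j₁ ≤ K / (4 * i.1) := by
    rw [not_le, div_lt_iff₀ (by positivity)]; linarith
  have f2 : orderStat i.2 j₂ ≤ K / (3 * i.1) := by rw [le_div_iff₀ (by positivity)]; linarith
  rw [orderStat_le_iff_countLe _ (by omega) (by omega), not_le] at f1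
  rw [orderStat_le_iff_countLe _ (by omega) (by omega)] at f2; linarith

set_option maxHeartbeats 400000 in
/-- For vanishing extreme value index, `θ = 0` is with probability tending to one not a root of the
reduced equation. -/
theorem eventually_rootFun_zero_ne
    (hρ : ρ ≤ 0) (hU : SecondOrder (tailQuantile μ) a A 0 ρ)
    (hk : Tendsto k atTop atTop)
    (hkn : Tendsto (fun n : ℕ => (k n : ℝ) / n) atTop (𝓝 0))
    (hA : Tendsto (fun n : ℕ => sqrt (k n) * A (n / k n)) atTop (𝓝 l)) :
    ∀ᶠ i : Sample in inProb unifPi,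
      rootFun (k i.1) (sExceed (qSample μ i.2) (k i.1) (a (i.1 / k i.1))) 0 ≠ 0 := by
  obtain ⟨L₀, hL⟩ := exists_degenerateSample_update_injective
  have hsucc := eventually_succ_le hkn
  have ht := tendsto_div_atTop hk hkn
  have hu := uniformTail_unifPi hk hsucc
  have hfst : Tendsto (fun i : Sample => i.1) (inProb unifPi) atTop := tendsto_fst_inProb
  set t : ℕ → ℝ := fun n => (n : ℝ) / k n with htdef
  set b₁ : ℕ → ℝ := fun n => tailQuantile μ (t n * 2) with hb1
  set b₂ : ℕ → ℝ := fun n => tailQuantile μ (t n * 4)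
  set Z : ∀ n, Set (Fin n → ℝ) := fun n => {x | DegenerateSample L₀ (b₁ n) (b₂ n) (a (t n)) (k n) x ∧
      (k n : ℝ) / 24 ≤ ∑ i, (Ioc (b₁ n) (b₂ n)).indicator (fun _ => (1 : ℝ)) (x i)} with hZ
  have hrare : ∀ᶠ i : Sample in inProb unifPi, qSample μ i.2 ∉ Z i.1 := by
    obtain ⟨C, hC⟩ := hU.exists_atom_le hρ
    obtain ⟨C₁, hC₁⟩ := exists_abs_le_of_tendsto_sqrt_mul hk hA
    have hlim : Tendsto (fun n => ofReal (24 * (|C| * |C₁|) * (k n : ℝ) ^ (-1 / 2 : ℝ))) atTop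
        (𝓝 0) := by
      have := (tendsto_rpow_neg_of_tendsto hk (b := -1 / 2) (by norm_num)).const_mul
        (24 * (|C| * |C₁|))
      rw [mul_zero] at this
      simpa using ENNReal.tendsto_ofReal this
    refine eventually_inProb_of_le hlim ?_
    filter_upwards [ht.eventually hC, hC₁, hsucc, hk.eventually_ge_atTop 2, ht.eventually hU.pos_a]
      with n h1 h2 h3 h4 h5
    have hn0 : (0 : ℝ) < n := mod_cast (by omega : 0 < n)
    simp only [not_not]
    have g1 : unifPi n {v | qSample μ v ∈ Z n} ≤ Measure.pi (fun _ : Fin n => μ) (Z n) := by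
      rw [← map_qSample_unifPi]
      exact Measure.le_map_apply (aemeasurable_qSample_unifPi μ n) _
    refine g1.trans ?_
    have g2 := pi_degenerateSample_le hL (N := (k n : ℝ) / 24) (α := a (t n)) h5 h4
      (show k n < n by omega) h1
    have hK : ofReal ((k n : ℝ) / 24) ≠ 0 := by
      rw [Ne, ENNReal.ofReal_eq_zero, not_le]; positivity
    have g3 : Measure.pi (fun _ : Fin n => μ) (Z n)
        ≤ n * ofReal (C * |A (t n)| / t n) / ofReal ((k n : ℝ) / 24) := by
      rw [ENNReal.le_div_iff_mul_le (Or.inl hK) (Or.inl ENNReal.ofReal_ne_top), mul_comm]; exact g2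
    refine g3.trans ?_
    rw [← ENNReal.ofReal_natCast, ← ENNReal.ofReal_mul hn0.le,
      ← ENNReal.ofReal_div_of_pos (by positivity)]
    refine ENNReal.ofReal_le_ofReal ?_
    have e : (n : ℝ) * (C * |A (t n)| / t n) / (k n / 24) = 24 * (C * |A (t n)|) := by
      rw [htdef]; field_simp
    rw [e]
    have g4 : C * |A (t n)| ≤ |C| * (|C₁| * (k n : ℝ) ^ (-1 / 2 : ℝ)) :=
      mul_le_mul (le_abs_self C) (h2.trans (mul_le_mul_of_nonneg_right (le_abs_self C₁) (by positivity)))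
        (abs_nonneg _) (abs_nonneg _)
    linarith
  -- outside an event of small probability, a degenerate root puts the sample into `Z`
  obtain ⟨g1, g2, -⟩ := tailArray_qSample (by norm_num) hρ hU hk hkn hA
  obtain ⟨z1, z2, z3⟩ := g1.limits_at_zero
  have hgap : Tendsto (fun n => (tailQuantile μ (t n * 4) - tailQuantile μ (t n * (10 / 11))) / a (t n))
      atTop (𝓝 (log 4 - log (10 / 11))) := by
    have h1 := ((hU.tendsto_increment hρ (show (1 : ℝ) / 2 ≤ 4 by norm_num)).sub
      (hU.tendsto_increment hρ (show (1 : ℝ) / 2 ≤ 10 / 11 by norm_num))).comp ht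
    have e : ∀ x, kFun 0 x = log x := fun x => if_pos rfl
    rw [e, e] at h1
    refine h1.congr fun n => ?_
    simp only [Function.comp_apply]
    rw [← sub_div, sub_sub_sub_cancel_right]
  have hlog : log 4 - log (10 / 11) < 16 / 10 := by
    have e1 : log 4 = 2 * log 2 := by rw [show (4 : ℝ) = 2 ^ 2 by norm_num, log_pow]; norm_num
    have e2 : log (10 / 11) = -log (11 / 10) := by rw [← log_inv]; norm_num
    have := log_le_sub_one_of_pos (show (0 : ℝ) < 11 / 10 by norm_num)
    linarith [log_two_lt_d9]
  have hclosek := hu.abs_last_sub_le (show (0 : ℝ) < 1 / 11 by norm_num)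
  have h34 : ∀ᶠ n in atTop, tailQuantile μ (t n * 2) < tailQuantile μ (t n * 3) :=
    ht.eventually (hU.eventually_tailQuantile_lt hρ (by norm_num) (by norm_num))
  have hdet : ∀ᶠ i : Sample in inProb unifPi, (k i.1 + 1 ≤ i.1 ∧ 22 ≤ k i.1 ∧ 0 < a (t i.1) ∧ 2 ≤ t i.1)
      ∧ (b₂ i.1 - tailQuantile μ (t i.1 * (10 / 11))) / a (t i.1) ≤ 16 / 10 ∧
      tailQuantile μ (t i.1 * 2) < tailQuantile μ (t i.1 * 3) :=
    hfst.eventually ((hsucc.and ((hk.eventually_ge_atTop 22).and ((ht.eventually hU.pos_a).and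
      (ht.eventually_ge_atTop 2)))).and ((hgap.eventually_le_const hlog).and h34))
  filter_upwards [hrare, g2, z1, z2.eventually_ge_atTop L₀,
    (tendsto_iff_norm_sub_tendsto_zero.1 z3).eventually_le_const (show (0 : ℝ) < 1 / 10 by norm_num),
    (g1.tendsto_exc_one le_rfl).eventually_gt_atTop (16 / 10), hclosek, hdet,
    eventually_inProb_of_ae ae_unifPi (p := fun i : Sample => ∀ l, i.2 l ∈ Ioo (0 : ℝ) 1),
    hu.eventually_count hsucc]
    with i hr he q1 q2 q3 q4 q5 ⟨⟨d1, d2, d3, d4⟩, d5, d6⟩ hv hcount h0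
  have hK0 : (0 : ℝ) < k i.1 := mod_cast (by omega : 0 < k i.1)
  have hn0 : (0 : ℝ) < i.1 := mod_cast (by omega : 0 < i.1)
  have hk1 : 1 ≤ k i.1 := by omega
  have hdom := q1.congr hk1 he
  rw [rootLevel_congr hk1 he] at q2
  have havg := avg_congr (k := k i.1) fun j hj => he j (mem_Icc_one hj)
  rw [havg, norm_eq_abs] at q3
  rw [he 1 (mem_Icc.2 ⟨le_rfl, hk1⟩)] at q4
  -- the threshold
  have hthr : orderStat (qSample μ i.2) (i.1 - k i.1)
      = quantile μ (1 - orderStat i.2 (k i.1 + 1)) := by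
    rw [← orderStat_qSample μ hv (by omega) d1]
    congr 1; omega
  have hvk := orderStat_mem_of_forall hv (show 1 ≤ k i.1 + 1 by omega) d1
  have q6 := abs_le.1 q5
  have hinv : ∀ c : ℝ, 0 < c → 1 / (t i.1 * c) = k i.1 / (c * i.1) := fun c hc => by
    rw [htdef]; field_simp
  have hc1 : ∀ c : ℝ, 1 ≤ c → 1 / (t i.1 * c) < 1 := fun c hc => by
    rw [div_lt_one (by positivity)]; nlinarith
  have hthr1 : orderStat (qSample μ i.2) (i.1 - k i.1) ≤ b₁ i.1 := by
    rw [hthr, hb1]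
    refine quantile_mono μ (by linarith [hvk.2]) ?_ (by
      have : 0 < 1 / (t i.1 * 2) := by positivity
      linarith)
    have : 1 / (t i.1 * 2) ≤ orderStat i.2 (k i.1 + 1) := by
      rw [hinv 2 (by norm_num), div_le_iff₀ (by positivity)]; linarith
    linarith
  have hthr2 : tailQuantile μ (t i.1 * (10 / 11)) ≤ orderStat (qSample μ i.2) (i.1 - k i.1) := by
    rw [hthr]
    have h10 : orderStat i.2 (k i.1 + 1) ≤ 1 / (t i.1 * (10 / 11)) := by
      rw [hinv _ (by norm_num), le_div_iff₀ (by positivity)]; linarith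
    refine quantile_mono μ ?_ (by linarith) (by linarith [hvk.1])
    have : 1 / (t i.1 * (10 / 11)) < 1 := by rw [div_lt_one (by positivity)]; linarith
    linarith
  have hclose : (b₂ i.1 - orderStat (qSample μ i.2) (i.1 - k i.1)) / a (t i.1) ≤ 16 / 10 :=
    (div_le_div_of_nonneg_right (sub_le_sub_left hthr2 _) d3.le).trans d5
  have hmax : b₂ i.1 < orderStat (qSample μ i.2) i.1 := by
    have h5 : 16 / 10 < exceed (qSample μ i.2) (k i.1) 1 / a (t i.1) := q4
    rw [exceed, show i.1 - 1 + 1 = i.1 by omega] at h5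
    have h6 := (div_lt_div_iff_of_pos_right d3).1 (hclose.trans_lt h5); linarith
  refine hr ⟨⟨h0, hdom.ratio_mem, hdom.log_pos, q2, q3, hthr1, hmax, hclose⟩, hcount.trans ?_⟩
  -- uniform points between the two levels give observations in the window
  rw [countLe, countLe, ← Finset.sum_sub_distrib]
  refine Finset.sum_le_sum fun l _ => ?_
  have hvl := hv l
  simp only [Set.indicator_apply, Set.mem_Iic, Set.mem_Ioc]
  by_cases hw : i.2 l ≤ k i.1 / (3 * i.1)
  · by_cases hw2 : i.2 l ≤ k i.1 / (4 * i.1)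
    · rw [if_pos hw, if_pos hw2, sub_self]; split_ifs <;> norm_num
    · rw [if_pos hw, if_neg hw2, if_pos, sub_zero]
      rw [← hinv 3 (by norm_num)] at hw
      rw [← hinv 4 (by norm_num)] at hw2
      have p3 : 0 < 1 / (t i.1 * 4) := by positivity
      exact ⟨d6.trans_le (quantile_mono μ (by linarith [hc1 3 (by norm_num)]) (by linarith)
        (by linarith [hvl.1])), quantile_mono μ (by linarith [hvl.2]) (by linarith) (by linarith)⟩
  · rw [if_neg hw]
    have p1 : (0 : ℝ) ≤ if i.2 l ≤ k i.1 / (4 * i.1) then 1 else 0 := by split_ifs <;> norm_num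
    have p2 : (0 : ℝ) ≤ if b₁ i.1 < qSample μ i.2 l ∧ qSample μ i.2 l ≤ b₂ i.1
        then 1 else 0 := by split_ifs <;> norm_num
    linarith


end

end TruncPOT


theorem theorem3
    (μ : Measure ℝ) [IsProbabilityMeasure μ] (ξ ρ : ℝ) (a A : ℝ → ℝ)
    (hξ : -1 / 2 < ξ) (hρ : ρ ≤ 0)
    (hU : TruncPOT.SecondOrder (TruncPOT.tailQuantile μ) a A ξ ρ)
    (k : ℕ → ℕ) (hk : Tendsto k atTop atTop)
    (hkn : Tendsto (fun n : ℕ => (k n : ℝ) / (n : ℝ)) atTop (𝓝 0))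
    (l : ℝ)
    (hA : Tendsto (fun n : ℕ => Real.sqrt (k n : ℝ) * A ((n : ℝ) / (k n : ℝ))) atTop (𝓝 l))
    (T : ℕ → ℝ) (hT : ∀ n, 0 < cdf μ (T n))
    (hD : Tendsto (fun n : ℕ => (n : ℝ) * TruncPOT.truncOdds μ (T n)) atTop (𝓝 0))
    {Ω : ℕ → Type*} [∀ n, MeasurableSpace (Ω n)] (P : ∀ n, Measure (Ω n))
    [∀ n, IsProbabilityMeasure (P n)] (X : ∀ n, Fin n → Ω n → ℝ)
    (hXm : ∀ n i, Measurable (X n i))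
    (hXi : ∀ n, iIndepFun (X n) (P n))
    (hXl : ∀ n i, (P n).map (X n i) = TruncPOT.truncLaw μ (T n)) :
    (∃ ξh τh : ∀ n, (Fin n → ℝ) → ℝ,
      TruncPOT.IsPseudoMLE P (fun n ω i => X n i ω) k a ξ ξh τh) ∧
    (∀ ξh τh : ∀ n, (Fin n → ℝ) → ℝ,
      TruncPOT.IsPseudoMLE P (fun n ω i => X n i ω) k a ξ ξh τh →
      TruncPOT.EqInLawExpOneAddSmall P
        (fun n ω => TruncPOT.testStat (fun i => X n i ω) (k n)
          (ξh n (fun i => X n i ω)) (τh n (fun i => X n i ω)))) := by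
  have hXv : ∀ n, Measurable fun ω i => X n i ω := fun n => measurable_pi_lambda _ (hXm n)
  -- the samples have the law of quantile transforms of conditioned uniform samples
  have hlaw : ∀ n, ∀ B : Set (Fin n → ℝ), MeasurableSet B → P n {ω | (fun i => X n i ω) ∈ B}
      = TruncPOT.truncUnifPi μ (T n) n {v | TruncPOT.qSample μ v ∈ B} := by
    intro n B hB
    have h1 := (iIndepFun_iff_map_fun_eq_pi_map fun i => (hXm n i).aemeasurable).1 (hXi n)
    simp only [hXl] at h1
    rw [← TruncPOT.map_qSample_truncUnifPi μ n] at h1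
    have h2 := congrArg (fun m => m B) h1
    simp only [Measure.map_apply (hXv n) hB, Measure.map_apply_of_aemeasurable
      (TruncPOT.aemeasurable_qSample μ n) hB] at h2
    exact h2
  refine ⟨?_, fun ξh τh hm => ?_⟩
  · obtain ⟨ξh, τh, h⟩ := TruncPOT.exists_isPseudoMLE_qSample hξ hρ hU hk hkn hA hT hD
      fun h0 => by subst h0; exact TruncPOT.eventually_rootFun_zero_ne hρ hU hk hkn hA
    exact ⟨ξh, τh, h.of_law fun n B hB => (hlaw n B hB).symm⟩
  · have htest : ∀ n, Measurable fun x : Fin n → ℝ => TruncPOT.testStat x (k n) (ξh n x) (τh n x) :=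
      fun n => TruncPOT.measurable_testStat (k n) (hm.measurable_xi n) (hm.measurable_tau n)
    refine TruncPOT.eqInLawExpOneAddSmall_of_tendsto (fun n => (htest n).comp (hXv n)) fun x hx => ?_
    refine (TruncPOT.tendsto_testStat_qSample hξ hρ hU hk hkn hA hT hD
      (hm.of_law hlaw) hx).congr fun n => ?_
    exact congrArg ENNReal.toReal (hlaw n _ (measurableSet_le (htest n) measurable_const)).symm
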